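/- Let $p$ be a prime and, for $n\ge 1$, let $\Gamma=\mathrm{Sp}_n(\mathbb Z)$ and $\mathrm S=\mathrm{GSp}_n^+(\mathbb Q)=\{M\in M_{2n}(\mathbb Q) : {}^tMJ_nM=\mu(M)J_n,\ \mu(M)>0\}$. The Hecke ring of $(\Gamma,\mathrm S)$ consists of the finite integral combinations $\sum_i a_i(\Gamma g_i)$ of cosets in $\Gamma\backslash \mathrm S$ that are invariant under right multiplication by $\Gamma$, with the product $\sum_i a_i(\Gamma g_i)\cdot\sum_j b_j(\Gamma h_j)=\sum_{i,j}a_ib_j(\Gamma g_ih_j)$; a double coset $(M)=\Gamma M\Gamma$ is identified with the sum of the cosets $\Gamma g\subset\Gamma M\Gamma$. For $a\ge 1$ put $$\mathbf T(a)=\sum (\mathrm{diag}(d_1,\dots,d_n;e_1,\dots,e_n)),$$ the sum over all positive integers $d_i,e_i$ with $d_i\mid d_{i+1}$, $d_n\mid e_n$, $e_{i+1}\mid e_i$, $d_ie_i=a$. Put $$\mathbf T_i(p^2)=(\mathrm{diag}(\underbrace{1,\dots,1}_{n-i},\underbrace{p,\dots,p}_{i};\underbrace{p^2,\dots,p^2}_{n-i},\underbrace{p,\dots,p}_{i}))\quad(1\le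 i\le n),\qquad [\mathbf p]_n=(pE_{2n})=\mathbf T_n(p^2),$$ and $\mathcal L_{\mathbb Z}=\mathbb Z[\mathbf T(p),\mathbf T_1(p^2),\dots,\mathbf T_n(p^2)]$. The spherical map $\Omega:\mathcal L_{\mathbb Z}\to\mathbb Q[x_0,x_1,\dots,x_n]$ is the additive map $\sum_j a_j(\Gamma M_j)\mapsto\sum_j a_j\,x_0^{\delta_j}\prod_{i=1}^n(x_ip^{-i})^{d_{ij}}$, where the representatives are chosen as $M_j=\begin{pmatrix}p^{\delta_j}\,{}^tD_j^{-1}&B_j\\0&D_j\end{pmatrix}$ with $D_j$ upper triangular with diagonal $p^{d_{1j}},\dots,p^{d_{nj}}$. It is applied to polynomials in $v$ over $\mathcal L_{\mathbb Z}$ coefficientwise. Let $n=3$. Then $\mathbf T(p^\delta)\in\mathcal L_{\mathbb Z}$ for all $\delta\ge 0$, and there is exactly one polynomial $\mathbf Q_3(v)\in\mathcal L_{\mathbb Z}[v]$ with $$\Omega(\mathbf Q_3(v))=\prod_{I\subseteq\{1,2,3\}}\Bigl(1-x_0\prod_{i\in I}x_i\,v\Bigr).$$ Its constant term is $1$, and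 $$\mathbf R_3(v)=\sum_{\delta=0}^\infty\mathbf T(p^\delta)v^\delta=\frac{\mathbf P_3(v)}{\mathbf Q_3(v)}$$ (that is, $\mathbf R_3\mathbf Q_3=\mathbf Q_3\mathbf R_3=\mathbf P_3$), where $\mathbf P_3(v)\in\mathcal L_{\mathbb Z}[v]$ is the polynomial of degree $6$ $$\begin{aligned}\mathbf P_3(v)=1&-p^2\bigl(\mathbf T_2(p^2)+(p^2-p+1)(p^2+p+1)[\mathbf p]_3\bigr)v^2+(p+1)p^4\,\mathbf T(p)[\mathbf p]_3v^3\\&-p^7[\mathbf p]_3\bigl(\mathbf T_2(p^2)+(p^2-p+1)(p^2+p+1)[\mathbf p]_3\bigr)v^4+p^{15}[\mathbf p]_3^3v^6 .\end{aligned}$$ Moreover $$\begin{aligned}\Omega(\mathbf P_3(v))=1&-\Bigl(\tfrac{sym_{2,1,1}}{p}+\tfrac{(p^2+p+1)sym_{1,1,1}}{p^2}+\tfrac{sym_{1,1,0}}{p}\Bigr)x_0^2v^2\\&+\tfrac{p+1}{p^2}\bigl(sym_{2,2,2}+sym_{2,2,1}+sym_{2,1,1}+sym_{1,1,1}\bigr)x_0^3v^3\\&-\Bigl(\tfrac{sym_{3,2,2}}{p^2}+\tfrac{(p^2+p+1)sym_{2,2,2}}{p^3}+\tfrac{sym_{2,2,1}}{p^2}\Bigr)x_0^4v^4+\tfrac{sym_{3,3,3}}{p^3}x_0^6v^6,\end{aligned}$$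 where $sym_{i,j,k}$ is the sum of the distinct monomials obtained from $x_1^ix_2^jx_3^k$ by permuting $x_1,x_2,x_3$. -/

import Mathlib

namespace SymplecticHecke

open Matrix

noncomputable section

section AbstractHeckeRing

variable {G : Type*} [Group G] (Γ : Subgroup G)

/-- The set `Γ \ G` of the cosets `Γ g`. -/
abbrev Cosets : Type _ := Quotient (QuotientGroup.rightRel Γ)

/-- The coset `Γ g`. -/
def coset (g : G) : Cosets Γ := Quotient.mk _ g

variable {Γ}

theorem coset_eq_iff {g h : G} : coset Γ g = coset Γ h ↔ h * g⁻¹ ∈ Γ := by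
  unfold coset
  rw [Quotient.eq, QuotientGroup.rightRel_apply]

/-- Right translation `Γ g ↦ Γ g h` on `Γ \ G`. -/
def translate (h : G) : Cosets Γ → Cosets Γ :=
  Quotient.lift (fun g => coset Γ (g * h)) fun a b hab => by
    change QuotientGroup.rightRel Γ a b at hab
    rw [QuotientGroup.rightRel_apply] at hab
    rw [coset_eq_iff]
    simpa [mul_assoc] using hab

theorem translate_coset (h g : G) : translate h (coset Γ g) = coset Γ (g * h) := rfl

theorem translate_comp (h k : G) :
    (translate k : Cosets Γ → Cosets Γ) ∘ translate h = translate (h * k) := by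
  funext c
  induction c using Quotient.inductionOn with
  | _ g => exact congrArg (coset Γ) (mul_assoc g h k)

theorem translate_one : (translate 1 : Cosets Γ → Cosets Γ) = id := by
  funext c
  induction c using Quotient.inductionOn with
  | _ g => exact congrArg (coset Γ) (mul_one g)

variable (Γ)

/-- The finite integral combinations `t = ∑ aᵢ (Γ gᵢ)` of cosets with `t γ = t` for all
`γ ∈ Γ`, where `t h = ∑ aᵢ (Γ gᵢ h)`. -/
def invariants : AddSubgroup (Cosets Γ →₀ ℤ) where
  carrier := {t | ∀ γ ∈ Γ, Finsupp.mapDomain (translate γ) t = t}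
  zero_mem' := fun _ _ => Finsupp.mapDomain_zero
  add_mem' := fun ha hb γ hγ => by rw [Finsupp.mapDomain_add, ha γ hγ, hb γ hγ]
  neg_mem' := fun {a} ha γ hγ => by
    have h := (Finsupp.mapDomain.addMonoidHom (M := ℤ) (translate (Γ := Γ) γ)).map_neg a
    exact h.trans (congrArg Neg.neg (ha γ hγ))

/-- The Hecke ring (over `ℤ`) of `Γ` in `G`: the `Γ`-invariant combinations of cosets `Γ g`, with
the product `(∑ aᵢ (Γ gᵢ)) (∑ bⱼ (Γ hⱼ)) = ∑ aᵢ bⱼ (Γ gᵢ hⱼ)`. -/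
def HeckeRing : Type _ := invariants Γ

instance : AddCommGroup (HeckeRing Γ) := inferInstanceAs (AddCommGroup (invariants Γ))

namespace HeckeRing

variable {Γ}

/-- The underlying combination of cosets `Γ g`. -/
def toCosets (t : HeckeRing Γ) : Cosets Γ →₀ ℤ := t.1

theorem toCosets_add (t s : HeckeRing Γ) : (t + s).toCosets = t.toCosets + s.toCosets := rfl

theorem ext {t s : HeckeRing Γ} (h : t.toCosets = s.toCosets) : t = s := Subtype.ext h

/-- `t · (Γ h) = ∑ aᵢ (Γ gᵢ h)`, which depends only on the coset `Γ h` as `t` is invariant. -/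
def actCoset (t : HeckeRing Γ) : Cosets Γ → (Cosets Γ →₀ ℤ) :=
  Quotient.lift (fun h => Finsupp.mapDomain (translate h) t.toCosets) fun a b hab => by
    change QuotientGroup.rightRel Γ a b at hab
    rw [QuotientGroup.rightRel_apply] at hab
    have h : Finsupp.mapDomain (translate (b * a⁻¹)) t.toCosets = t.toCosets := t.2 _ hab
    change Finsupp.mapDomain (translate a) t.toCosets = Finsupp.mapDomain (translate b) t.toCosets
    conv_lhs => rw [← h]
    rw [← Finsupp.mapDomain_comp, translate_comp]
    simp

theorem actCoset_coset (t : HeckeRing Γ) (h : G) :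
    t.actCoset (coset Γ h) = Finsupp.mapDomain (translate h) t.toCosets := rfl

/-- `t · (∑ bⱼ (Γ hⱼ)) = ∑ bⱼ (t · (Γ hⱼ))`. -/
def act (t : HeckeRing Γ) : (Cosets Γ →₀ ℤ) →ₗ[ℤ] (Cosets Γ →₀ ℤ) :=
  Finsupp.linearCombination ℤ t.actCoset

theorem act_single (t : HeckeRing Γ) (h : G) (b : ℤ) :
    t.act (Finsupp.single (coset Γ h) b) = b • Finsupp.mapDomain (translate h) t.toCosets := by
  rw [act, Finsupp.linearCombination_single, actCoset_coset]

theorem mapDomain_act (t : HeckeRing Γ) (h : G) (s : Cosets Γ →₀ ℤ) :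
    Finsupp.mapDomain (translate h) (t.act s) =
      t.act (Finsupp.mapDomain (translate h) s) := by
  induction s using Finsupp.induction_linear with
  | zero => simp
  | add f g hf hg => rw [map_add, Finsupp.mapDomain_add, Finsupp.mapDomain_add, map_add, hf, hg]
  | single c b =>
    induction c using Quotient.inductionOn with
    | _ g =>
      change Finsupp.mapDomain (translate h) (t.act (Finsupp.single (coset Γ g) b)) =
        t.act (Finsupp.mapDomain (translate h) (Finsupp.single (coset Γ g) b))
      rw [Finsupp.mapDomain_single, translate_coset, act_single, act_single,
        Finsupp.mapDomain_smul, ← Finsupp.mapDomain_comp, translate_comp]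

instance : Mul (HeckeRing Γ) :=
  ⟨fun t s => ⟨t.act s.toCosets, fun γ hγ => by
    rw [mapDomain_act]
    exact congrArg t.act (s.2 γ hγ)⟩⟩

instance : One (HeckeRing Γ) :=
  ⟨⟨Finsupp.single (coset Γ 1) 1, fun γ hγ => by
    rw [Finsupp.mapDomain_single, translate_coset, coset_eq_iff.2]
    simpa using hγ⟩⟩

theorem toCosets_mul (t s : HeckeRing Γ) : (t * s).toCosets = t.act s.toCosets := rfl

theorem toCosets_one : (1 : HeckeRing Γ).toCosets = Finsupp.single (coset Γ 1) 1 := rfl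

theorem act_mul (t s : HeckeRing Γ) (u : Cosets Γ →₀ ℤ) :
    (t * s).act u = t.act (s.act u) := by
  induction u using Finsupp.induction_linear with
  | zero => simp
  | add f g hf hg => simp only [map_add, hf, hg]
  | single c b =>
    induction c using Quotient.inductionOn with
    | _ g =>
      change (t * s).act (Finsupp.single (coset Γ g) b) =
        t.act (s.act (Finsupp.single (coset Γ g) b))
      rw [act_single, act_single, map_smul, toCosets_mul, mapDomain_act]

theorem act_add (t s : HeckeRing Γ) (u : Cosets Γ →₀ ℤ) :
    (t + s).act u = t.act u + s.act u := by
  induction u using Finsupp.induction_linear with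
  | zero => simp
  | add f g hf hg => simp only [map_add, hf, hg]; abel
  | single c b =>
    induction c using Quotient.inductionOn with
    | _ g =>
      change (t + s).act (Finsupp.single (coset Γ g) b) =
        t.act (Finsupp.single (coset Γ g) b) + s.act (Finsupp.single (coset Γ g) b)
      rw [act_single, act_single, act_single, toCosets_add, Finsupp.mapDomain_add, smul_add]

theorem act_one (u : Cosets Γ →₀ ℤ) : (1 : HeckeRing Γ).act u = u := by
  induction u using Finsupp.induction_linear with
  | zero => simp
  | add f g hf hg => simp only [map_add, hf, hg]
  | single c b =>
    induction c using Quotient.inductionOn with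
    | _ g =>
      change (1 : HeckeRing Γ).act (Finsupp.single (coset Γ g) b) = Finsupp.single (coset Γ g) b
      rw [act_single, toCosets_one, Finsupp.mapDomain_single, translate_coset]
      simp

instance : Ring (HeckeRing Γ) :=
  { (inferInstance : AddCommGroup (HeckeRing Γ)) with
    mul := (· * ·)
    one := 1
    mul_assoc := fun t s u => ext (act_mul t s u.toCosets)
    one_mul := fun t => ext (act_one t.toCosets)
    mul_one := fun t => ext (by
      rw [toCosets_mul, toCosets_one, act_single, translate_one, Finsupp.mapDomain_id, one_smul])
    left_distrib := fun t s u => ext (by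
      rw [toCosets_mul, toCosets_add, toCosets_add, map_add, toCosets_mul, toCosets_mul])
    right_distrib := fun t s u => ext (act_add t s u.toCosets)
    zero_mul := fun t => by
      have h : (0 : HeckeRing Γ).act t.toCosets + (0 : HeckeRing Γ).act t.toCosets =
          (0 : HeckeRing Γ).act t.toCosets := by rw [← act_add, add_zero]
      exact ext (add_eq_left.1 h)
    mul_zero := fun t => ext (map_zero t.act) }

end HeckeRing

/-- The cosets `Γ h` contained in the double coset `Γ g Γ`. -/
def cosetsIn (g : G) : Set (Cosets Γ) := {c | ∃ γ ∈ Γ, c = coset Γ (g * γ)}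

/-- The double coset `(g) = Γ g Γ` as an element of the Hecke ring: the sum of the (finitely many)
cosets that it contains. -/
def doubleCoset (g : G) (hg : (cosetsIn Γ g).Finite) : HeckeRing Γ :=
  ⟨∑ c ∈ hg.toFinset, Finsupp.single c 1, fun γ hγ => by
    rw [Finsupp.mapDomain_finsetSum]
    simp only [Finsupp.mapDomain_single]
    refine Finset.sum_bij (fun c _ => translate γ c) ?_ ?_ ?_ (fun _ _ => rfl)
    · intro c hc
      obtain ⟨γ', hγ', rfl⟩ := hg.mem_toFinset.1 hc
      exact hg.mem_toFinset.2 ⟨γ' * γ, Γ.mul_mem hγ' hγ, congrArg (coset Γ) (mul_assoc _ _ _)⟩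
    · intro c _ c' _ h
      have := congrArg (translate γ⁻¹) h
      have e := translate_comp (Γ := Γ) γ γ⁻¹
      rw [mul_inv_cancel, translate_one] at e
      simpa only [← Function.comp_apply (f := translate γ⁻¹), e, id] using this
    · intro c hc
      obtain ⟨γ', hγ', rfl⟩ := hg.mem_toFinset.1 hc
      refine ⟨coset Γ (g * (γ' * γ⁻¹)), hg.mem_toFinset.2
        ⟨γ' * γ⁻¹, Γ.mul_mem hγ' (Γ.inv_mem hγ), rfl⟩, ?_⟩
      rw [translate_coset]
      congr 1
      group⟩

end AbstractHeckeRing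

section Symplectic

variable {n : ℕ}

/-- `ᵗM J M = μ J`, i.e. `M` is a symplectic similitude with multiplier `μ`. -/
def IsSimilitude (M : Matrix (Fin n ⊕ Fin n) (Fin n ⊕ Fin n) ℚ) (μ : ℚ) : Prop :=
  Mᵀ * J (Fin n) ℚ * M = μ • J (Fin n) ℚ

theorem IsSimilitude.mul {M N : Matrix (Fin n ⊕ Fin n) (Fin n ⊕ Fin n) ℚ} {μ ν : ℚ}
    (hM : IsSimilitude M μ) (hN : IsSimilitude N ν) : IsSimilitude (M * N) (μ * ν) := by
  unfold IsSimilitude at *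
  rw [transpose_mul]
  calc _ = Nᵀ * (Mᵀ * J (Fin n) ℚ * M) * N := by simp only [Matrix.mul_assoc]
    _ = _ := by rw [hM, Matrix.mul_smul, Matrix.smul_mul, hN, smul_smul]

theorem IsSimilitude.inv {M N : Matrix (Fin n ⊕ Fin n) (Fin n ⊕ Fin n) ℚ} {μ : ℚ}
    (hM : IsSimilitude M μ) (hμ : μ ≠ 0) (h1 : M * N = 1) : IsSimilitude N μ⁻¹ := by
  unfold IsSimilitude at *
  have h2 : Nᵀ * Mᵀ = 1 := by rw [← transpose_mul, h1, transpose_one]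
  have h3 : μ • (Nᵀ * J (Fin n) ℚ * N) = J (Fin n) ℚ := by
    calc _ = Nᵀ * (μ • J (Fin n) ℚ) * N := by rw [Matrix.mul_smul, Matrix.smul_mul]
      _ = (Nᵀ * Mᵀ) * J (Fin n) ℚ * (M * N) := by rw [← hM]; simp only [Matrix.mul_assoc]
      _ = _ := by rw [h1, h2, Matrix.one_mul, Matrix.mul_one]
  calc _ = μ⁻¹ • μ • (Nᵀ * J (Fin n) ℚ * N) := by
        rw [smul_smul, inv_mul_cancel₀ hμ, one_smul]
    _ = _ := by rw [h3]

variable (n)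

/-- The group `GSpₙ⁺(ℚ)` of the rational matrices `M` of size `2n` with `ᵗM J M = μ J` for some
`μ > 0`. -/
def GSp : Subgroup (GL (Fin n ⊕ Fin n) ℚ) where
  carrier := {M | ∃ μ : ℚ, 0 < μ ∧ IsSimilitude M.val μ}
  one_mem' := ⟨1, one_pos, by simp [IsSimilitude]⟩
  mul_mem' := by
    rintro a b ⟨μ, hμ, ha⟩ ⟨ν, hν, hb⟩
    exact ⟨μ * ν, mul_pos hμ hν, ha.mul hb⟩
  inv_mem' := by
    rintro a ⟨μ, hμ, ha⟩
    exact ⟨μ⁻¹, inv_pos.2 hμ, ha.inv hμ.ne' (by rw [← GeneralLinearGroup.coe_mul]; simp)⟩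

variable {n}

/-- The matrix of an element of `GSpₙ⁺(ℚ)`. -/
def mat (M : GSp n) : Matrix (Fin n ⊕ Fin n) (Fin n ⊕ Fin n) ℚ := M.1.val

theorem mat_mul (M N : GSp n) : mat (M * N) = mat M * mat N := rfl

theorem mat_one : mat (1 : GSp n) = 1 := rfl

theorem mat_mul_inv (M : GSp n) : mat M * mat M⁻¹ = 1 := by
  rw [← mat_mul, mul_inv_cancel, mat_one]

variable (n)

/-- The Siegel modular group `Spₙ(ℤ)`, as a subgroup of `GSpₙ⁺(ℚ)`. -/
def Sp : Subgroup (GSp n) where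
  carrier := {M | ∃ A ∈ symplecticGroup (Fin n) ℤ, A.map (Int.castRingHom ℚ) = mat M}
  one_mem' := ⟨1, one_mem _, by simp [mat_one]⟩
  mul_mem' := by
    rintro a b ⟨A, hA, ha⟩ ⟨B, hB, hb⟩
    exact ⟨A * B, mul_mem hA hB, by rw [Matrix.map_mul, ha, hb, mat_mul]⟩
  inv_mem' := by
    rintro a ⟨A, hA, ha⟩
    let A' : symplecticGroup (Fin n) ℤ := ⟨A, hA⟩
    refine ⟨(A'⁻¹ : symplecticGroup (Fin n) ℤ), (A'⁻¹).2, ?_⟩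
    have h1 : ((A'⁻¹ : symplecticGroup (Fin n) ℤ) : Matrix _ _ ℤ) * A = 1 :=
      congrArg Subtype.val (inv_mul_cancel A')
    have h2 := congrArg (fun X => X.map (Int.castRingHom ℚ)) h1
    simp only [Matrix.map_mul, ha] at h2
    rw [Matrix.map_one _ (map_zero _) (map_one _)] at h2
    calc _ = _ * (mat a * mat a⁻¹) := by rw [mat_mul_inv, Matrix.mul_one]
      _ = mat a⁻¹ := by rw [← Matrix.mul_assoc, h2, Matrix.one_mul]

variable {n}

theorem mem_Sp_iff (M : GSp n) : M ∈ Sp n ↔ IsSimilitude (mat M) 1 ∧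
    ∃ A : Matrix (Fin n ⊕ Fin n) (Fin n ⊕ Fin n) ℤ, A.map (Int.castRingHom ℚ) = mat M := by
  have key (A : Matrix (Fin n ⊕ Fin n) (Fin n ⊕ Fin n) ℤ) :
      A ∈ symplecticGroup (Fin n) ℤ ↔ IsSimilitude (A.map (Int.castRingHom ℚ)) 1 := by
    rw [SymplecticGroup.mem_iff', IsSimilitude, one_smul, ← transpose_map,
      ← map_J (Fin n) (Int.castRingHom ℚ), ← Matrix.map_mul, ← Matrix.map_mul]
    exact ((Matrix.map_injective (RingHom.injective_int (Int.castRingHom ℚ))).eq_iff).symm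
  constructor
  · rintro ⟨A, hA, h⟩
    exact ⟨h ▸ (key A).1 hA, A, h⟩
  · rintro ⟨h1, A, h⟩
    exact ⟨A, (key A).2 (h ▸ h1), h⟩

theorem finite_cosetsIn (g : GSp n) : (cosetsIn (Sp n) g).Finite := by
  have hclear (X : Matrix (Fin n ⊕ Fin n) (Fin n ⊕ Fin n) ℚ) : ∃ a : ℕ, a ≠ 0 ∧
      ∃ Y : Matrix (Fin n ⊕ Fin n) (Fin n ⊕ Fin n) ℤ,
        Y.map (Int.castRingHom ℚ) = (a : ℚ) • X := by
    refine ⟨X.den, X.den_ne_zero, X.num, ?_⟩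
    ext i j
    have h := congrFun (congrFun (Matrix.inv_denom_smul_num X) i) j
    simp only [Matrix.smul_apply, Matrix.map_apply, smul_eq_mul] at h ⊢
    rw [← h]
    have : (X.den : ℚ) ≠ 0 := by exact_mod_cast X.den_ne_zero
    simp
    field_simp
  obtain ⟨a, ha, U, hU⟩ := hclear (mat g)
  obtain ⟨b, hb, V, hV⟩ := hclear (mat g⁻¹)
  have hN : NeZero (a * b) := ⟨Nat.mul_ne_zero ha hb⟩
  choose γ hγ hc using fun c : cosetsIn (Sp n) g => c.2
  choose A hA using fun c => ((mem_Sp_iff (γ c)).1 (hγ c)).2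
  choose B hB using fun c => ((mem_Sp_iff (γ c)⁻¹).1 ((Sp n).inv_mem (hγ c))).2
  rw [← Set.finite_coe_iff]
  refine Finite.of_injective (fun c => (A c).map (Int.castRingHom (ZMod (a * b)))) ?_
  intro c c' h
  refine Subtype.ext ?_
  rw [hc c, hc c', coset_eq_iff, mem_Sp_iff]
  have hm : mat (g * γ c' * (g * γ c)⁻¹) = mat g * mat (γ c') * (mat (γ c)⁻¹ * mat g⁻¹) := by
    rw [_root_.mul_inv_rev]; rfl
  rw [hm]
  constructor
  · obtain ⟨μ, hμ, hg⟩ := g.2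
    have h1 := ((mem_Sp_iff _).1 (hγ c')).1
    have h2 := ((mem_Sp_iff _).1 ((Sp n).inv_mem (hγ c))).1
    have h3 : IsSimilitude (mat g⁻¹) μ⁻¹ :=
      IsSimilitude.inv (M := mat g) hg hμ.ne' (mat_mul_inv g)
    have h4 := (IsSimilitude.mul (M := mat g) hg h1).mul (h2.mul h3)
    rwa [mul_one, one_mul, mul_inv_cancel₀ hμ.ne'] at h4
  · have hdvd (i j) : ∃ y : ℤ, A c' i j = A c i j + (a * b : ℕ) * y := by
      have hij := congrFun (congrFun h i) j
      simp only [Matrix.map_apply, eq_intCast] at hij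
      obtain ⟨y, hy⟩ := (ZMod.intCast_eq_intCast_iff_dvd_sub _ _ _).1 hij
      exact ⟨y, by linarith⟩
    choose Y hY using hdvd
    have hY' : mat (γ c') = mat (γ c) +
        ((a : ℚ) * b) • (Matrix.of Y).map (Int.castRingHom ℚ) := by
      rw [← hA, ← hA]
      ext i j
      simp [hY]
    refine ⟨1 + U * Matrix.of Y * B c * V, ?_⟩
    rw [Matrix.map_add _ (map_add _), Matrix.map_one _ (map_zero _) (map_one _), Matrix.map_mul,
      Matrix.map_mul, Matrix.map_mul, hU, hV, hB, hY', Matrix.mul_add, Matrix.add_mul]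
    congr 1
    · rw [Matrix.mul_assoc, ← Matrix.mul_assoc (mat (γ c)), mat_mul_inv, Matrix.one_mul,
        mat_mul_inv]
    · simp only [Matrix.smul_mul, Matrix.mul_smul, smul_smul, Matrix.mul_assoc, mul_comm]

/-- The element `diag(d₁, …, dₙ; e₁, …, eₙ)` of `GSpₙ⁺(ℚ)`, where `dᵢ eᵢ = a` for all `i`. -/
def diag (d e : Fin n → ℕ) (a : ℕ) (ha : a ≠ 0) (h : ∀ i, d i * e i = a) : GSp n :=
  ⟨GeneralLinearGroup.mkOfDetNeZero
    (Matrix.diagonal (Sum.elim (fun i => (d i : ℚ)) (fun i => (e i : ℚ)))) (by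
      have h0 (i) : d i ≠ 0 ∧ e i ≠ 0 := by
        rw [← mul_ne_zero_iff, h i]; exact ha
      simp [Matrix.det_diagonal, Finset.prod_eq_zero_iff, h0]), (a : ℚ),
    by positivity, by
      have h' (i) : (d i : ℚ) * e i = a := by exact_mod_cast h i
      change Matrix.transpose _ * J (Fin n) ℚ * _ = _
      ext (i | i) (j | j) <;>
        simp [GeneralLinearGroup.mkOfDetNeZero, J, Matrix.diagonal_mul, Matrix.mul_diagonal,
          Matrix.one_apply]
      · split_ifs with hij
        · rw [← hij]; exact h' i
        · rfl
      · split_ifs with hij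
        · rw [← hij, mul_comm]; exact h' i
        · rfl⟩

/-- The Hecke operator `T(d₁, …, dₙ; e₁, …, eₙ)`: the double coset of `diag(d; e)` modulo
`Spₙ(ℤ)`. -/
def heckeDiag (d e : Fin n → ℕ) (a : ℕ) (ha : a ≠ 0) (h : ∀ i, d i * e i = a) :
    HeckeRing (Sp n) :=
  doubleCoset (Sp n) (diag d e a ha h) (finite_cosetsIn _)

variable (n)

/-- The pairs `(d, e)` of `n`-tuples of positive integers with `dᵢ ∣ dᵢ₊₁`, `dₙ ∣ eₙ`, `eᵢ₊₁ ∣ eᵢ`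
and `dᵢ eᵢ = a`. -/
def elementaryDivisors (a : ℕ) : Finset ((Fin n → ℕ) × (Fin n → ℕ)) :=
  {x ∈ Fintype.piFinset (fun _ => a.divisors) ×ˢ Fintype.piFinset (fun _ => a.divisors) |
    (∀ i, x.1 i * x.2 i = a) ∧
    (∀ i j : Fin n, (i : ℕ) + 1 = j → x.1 i ∣ x.1 j ∧ x.2 j ∣ x.2 i) ∧
    (∀ i : Fin n, (i : ℕ) + 1 = n → x.1 i ∣ x.2 i)}

/-- The Hecke operator `T(a) = ∑ T(d; e)`, over the elementary divisors `(d, e)` with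
`dᵢ eᵢ = a`. -/
def heckeT (a : ℕ) (ha : a ≠ 0) : HeckeRing (Sp n) :=
  ∑ x ∈ (elementaryDivisors n a).attach,
    heckeDiag x.1.1 x.1.2 a ha (Finset.mem_filter.1 x.2).2.1

variable (p : ℕ) [hp : Fact p.Prime]

/-- The Hecke operator `Tᵢ(p²) = T(1, …, 1, p, …, p; p², …, p², p, …, p)`, with `n - i` entries `1`,
`i` entries `p`, `n - i` entries `p²` and `i` entries `p`, for `i ≤ n`. -/
def heckeTi (i : ℕ) : HeckeRing (Sp n) :=
  heckeDiag (fun j : Fin n => if (j : ℕ) < n - i then 1 else p)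
    (fun j : Fin n => if (j : ℕ) < n - i then p ^ 2 else p) (p ^ 2)
    (pow_ne_zero 2 hp.out.ne_zero) (fun j => by split_ifs <;> ring)

/-- The double coset `[p]ₙ` of the scalar matrix `p E₂ₙ`. -/
def heckeScalar : HeckeRing (Sp n) :=
  heckeDiag (fun _ : Fin n => p) (fun _ => p) (p ^ 2)
    (pow_ne_zero 2 hp.out.ne_zero) (fun _ => (sq p).symm)

theorem heckeTi_self : heckeTi n p n = heckeScalar n p := by
  simp only [heckeTi, heckeScalar, Nat.sub_self, Nat.not_lt_zero, if_false]

/-- The ring `L_ℤ = ℤ[T(p), T₁(p²), …, Tₙ(p²)]`. -/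
def LZ : Subring (HeckeRing (Sp n)) :=
  Subring.closure ({heckeT n p hp.out.ne_zero} ∪
    {t | ∃ i : ℕ, 1 ≤ i ∧ i ≤ n ∧ t = heckeTi n p i})

/-- The generating series `R(v) = ∑ T(p^δ) v^δ`. -/
def heckeSeries : PowerSeries (HeckeRing (Sp n)) :=
  PowerSeries.mk fun δ => heckeT n (p ^ δ) (pow_ne_zero δ hp.out.ne_zero)

variable {n}

/-- `M` is block triangular, `M = (A B; 0 D)` with multiplier `p ^ δ` (so that
`A = p ^ δ (ᵗD)⁻¹`), and `D` is upper triangular with the diagonal `p ^ d₁, …, p ^ dₙ`. -/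
def IsTriangular (M : GSp n) (δ : ℕ) (d : Fin n → ℕ) : Prop :=
  IsSimilitude (mat M) ((p : ℚ) ^ δ) ∧
    ∃ A B D : Matrix (Fin n) (Fin n) ℚ, mat M = Matrix.fromBlocks A B 0 D ∧
      D.BlockTriangular id ∧ ∀ i, D i i = (p : ℚ) ^ d i

open Classical in
/-- The spherical map on cosets: if `Spₙ(ℤ) M` contains a triangular matrix with the exponents
`δ, d₁, …, dₙ` (which depend only on the coset, and exist if `M` is integral and its multiplier is
a power of `p`), then its image is `x₀ ^ δ ∏ᵢ (xᵢ p ^ (-i)) ^ dᵢ`. -/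
def cosetOmega (c : Cosets (Sp n)) : MvPolynomial (Fin (n + 1)) ℚ :=
  if h : ∃ e : ℕ × (Fin n → ℕ), ∃ M : GSp n, coset (Sp n) M = c ∧ IsTriangular p M e.1 e.2 then
    MvPolynomial.X 0 ^ h.choose.1 *
      ∏ i : Fin n, (MvPolynomial.C (((p : ℚ) ^ ((i : ℕ) + 1))⁻¹) * MvPolynomial.X i.succ) ^
        h.choose.2 i
  else 0

variable {p}

/-- The spherical map `Ω : L_ℤ → ℚ[x₀, …, xₙ]`, `∑ aⱼ (Γ Mⱼ) ↦ ∑ aⱼ Ω(Γ Mⱼ)`. -/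
def Omega (t : LZ n p) : MvPolynomial (Fin (n + 1)) ℚ :=
  t.1.toCosets.sum fun c a => (a : ℚ) • cosetOmega p c

open Polynomial in
/-- The spherical map applied to the coefficients of a polynomial in `v`. -/
def OmegaPoly (F : (LZ n p)[X]) : (MvPolynomial (Fin (n + 1)) ℚ)[X] :=
  F.sum fun j t => Polynomial.monomial j (Omega t)

variable (n) in
open Polynomial in
/-- The spinor polynomial `∏ (1 - x₀ x_{i₁} ⋯ x_{iₖ} v)` over the subsets `{i₁, …, iₖ}` of
`{1, …, n}`. -/
def spinor : (MvPolynomial (Fin (n + 1)) ℚ)[X] :=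
  ∏ s : Finset (Fin n),
    (1 - C (MvPolynomial.X 0 * ∏ i ∈ s, MvPolynomial.X i.succ) * X)

/-- The monomial symmetric polynomial `sym_{i,j,k}` in `x₁, x₂, x₃`: the sum of the distinct
monomials obtained from `x₁ ^ i x₂ ^ j x₃ ^ k` by permuting the variables. -/
def sym (i j k : ℕ) : MvPolynomial (Fin 4) ℚ :=
  ∑ m ∈ Finset.univ.image (fun σ : Equiv.Perm (Fin 3) => ![i, j, k] ∘ σ),
    ∏ l : Fin 3, MvPolynomial.X l.succ ^ m l

variable (p)

/-- `T(p)` for `n = 3`, as an element of `L_ℤ`. -/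
def T₀ : LZ 3 p := ⟨heckeT 3 p hp.out.ne_zero, Subring.subset_closure (Or.inl rfl)⟩

/-- `T₂(p²)` for `n = 3`, as an element of `L_ℤ`. -/
def T₂ : LZ 3 p :=
  ⟨heckeTi 3 p 2, Subring.subset_closure (Or.inr ⟨2, by norm_num, by norm_num, rfl⟩)⟩

/-- `[p]₃ = T₃(p²)`, as an element of `L_ℤ`. -/
def scalar₃ : LZ 3 p :=
  ⟨heckeScalar 3 p, Subring.subset_closure
    (Or.inr ⟨3, by norm_num, le_rfl, (heckeTi_self 3 p).symm⟩)⟩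

open Polynomial in
/-- The numerator of the Hecke series, as a polynomial in `v` over `L_ℤ`. -/
def P₃ : (LZ 3 p)[X] :=
  1 - C ((p : LZ 3 p) ^ 2 *
        (T₂ p + ((p : LZ 3 p) ^ 2 - p + 1) * ((p : LZ 3 p) ^ 2 + p + 1) * scalar₃ p)) * X ^ 2
    + C (((p : LZ 3 p) + 1) * (p : LZ 3 p) ^ 4 * T₀ p * scalar₃ p) * X ^ 3
    - C ((p : LZ 3 p) ^ 7 * scalar₃ p *
        (T₂ p + ((p : LZ 3 p) ^ 2 - p + 1) * ((p : LZ 3 p) ^ 2 + p + 1) * scalar₃ p)) * X ^ 4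
    + C ((p : LZ 3 p) ^ 15 * scalar₃ p ^ 3) * X ^ 6

open Polynomial in
/-- The numerator of the Hecke series in terms of the variables `x₀, x₁, x₂, x₃`. -/
def sphericalP₃ : (MvPolynomial (Fin 4) ℚ)[X] :=
  let x₀ : MvPolynomial (Fin 4) ℚ := MvPolynomial.X 0
  let q : ℚ := p
  1 - C (((1 / q) • sym 2 1 1 + ((q ^ 2 + q + 1) / q ^ 2) • sym 1 1 1 + (1 / q) • sym 1 1 0)
        * x₀ ^ 2) * X ^ 2
    + C (((q + 1) / q ^ 2) • (sym 2 2 2 + sym 2 2 1 + sym 2 1 1 + sym 1 1 1) * x₀ ^ 3) * X ^ 3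
    - C (((1 / q ^ 2) • sym 3 2 2 + ((q ^ 2 + q + 1) / q ^ 3) • sym 2 2 2
        + (1 / q ^ 2) • sym 2 2 1) * x₀ ^ 4) * X ^ 4
    + C ((1 / q ^ 3) • sym 3 3 3 * x₀ ^ 6) * X ^ 6

end Symplectic

end

end SymplecticHecke

open SymplecticHecke Polynomial

/-! The spherical map turns an identity in the Hecke ring into one between polynomials. Every
integral coset with multiplier a power of `p` has a triangular representative. Diagonal exponents
add up under multiplication of triangular matrices, so the spherical map is a ring homomorphism on
the elements supported on such cosets (`spOmega`). It is injective: the diagonal exponents of a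
triangular matrix dominate its elementary divisors, so the matrix of coefficients is triangular with
positive diagonal (`eq_zero_of_omegaLin_eq_zero`). Hence it suffices to prove `Ω(R) · spinor =
sphericalP₃` and `Ω(P₃) = sphericalP₃` over the commutative ring `ℚ[x₀, …, x₃]`; the uniqueness of
`Q` is injectivity again.

For the first identity, `Γ (A B; 0 D) ↦ GL₃(ℤ) D` factors the spherical map through the Hecke ring
of `GL₃`, up to the power `x₀ ^ δ` (`omegaLin_eq`). The operator `T(p ^ δ)` contains all integral
matrices with multiplier `p ^ δ`. So its image has at `diag(p ^ x, p ^ y, p ^ z)`, `0 ≤ x ≤ y ≤ z ≤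
δ`, the number `p ^ (3x + 2y + z)` of admissible `B` modulo `D` as coefficient (`diagCoeff_pushT`).
The elementary symmetric polynomials `e_k` are the images of multiples of the elementary double
cosets, and products with these are given by a Pieri rule (`coeffHom_elemHecke_mul`). Normalized by
`p ^ (δ - 2 (x + y + z))`, the coefficients become `p ^ (x + δ - z)`, which is geometric in `x` and
in `δ - z`. The spinor polynomial in `y = x₀ v` is `(1 - y)(1 - e₃ y) ∏ (1 - xᵢ y) ∏ (1 - xᵢ xⱼ y)`;
multiplying by these groups of factors in turn telescopes the series down to finitely many
coefficients, in degrees `0, 2, 3, 4, 6` (`normCoeff_reducedTotal`).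

For the second identity, `T₂(p²) + [p]₃` is the sum of the cosets with multiplier `p²` whose
reduction modulo `p` has rank at most one. Its image in the Hecke ring of `GL₃` is found by
counting, the main case being the `p ^ 3` symmetric `3 × 3` matrices of rank at most one over the
field with `p` elements (`card_filter_one_one_one`).

For the existence of `Q`, the symmetry `I ↦ Iᶜ` of the spinor polynomial leaves only the coefficient
of `v²` to be lifted, the others being polynomials in it and in the images of `T(p)`, `T₂(p²)`,
`[p]₃`. It is read off from the `v²` term of `R Q = P`, once `T(p²)` is known to lie in `L_ℤ`; this
follows from the decomposition of `T(p)²` (`exists_heckeTInt_two`). Since `Q` has constant term `1`,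
the relation `R Q = P` is finally a recursion placing every `T(p ^ δ)` in `L_ℤ`. -/

namespace SymplecticHecke

open Matrix HeckeRing

set_option linter.unusedSectionVars false

noncomputable section

/-! ### Coefficients, supports and multiplicative weights in an abstract Hecke ring. -/

section AbstractHecke

variable {G : Type*} [Group G] {Γ : Subgroup G}

theorem coset_surjective (c : Cosets Γ) : ∃ g, coset Γ g = c := Quotient.exists_rep c

theorem coset_mul_left {γ : G} (hγ : γ ∈ Γ) (g : G) : coset Γ (γ * g) = coset Γ g := by
  rw [coset_eq_iff, _root_.mul_inv_rev, mul_inv_cancel_left]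
  exact Γ.inv_mem hγ

theorem coset_eq_coset_iff_exists {g h : G} :
    coset Γ g = coset Γ h ↔ ∃ γ ∈ Γ, h = γ * g := by
  rw [coset_eq_iff]
  exact ⟨fun H => ⟨_, H, by group⟩, by rintro ⟨γ, hγ, rfl⟩; simpa using hγ⟩

theorem translate_injective (h : G) :
    Function.Injective (translate h : Cosets Γ → Cosets Γ) := by
  intro c c' e
  have k := congrFun (translate_comp (Γ := Γ) h h⁻¹)
  simp only [mul_inv_cancel, translate_one, Function.comp_apply, id] at k
  rw [← k c, ← k c', e]

namespace HeckeRing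

/-- The underlying combination of cosets, as an additive map. -/
def toCosetsHom (Γ : Subgroup G) : HeckeRing Γ →+ (Cosets Γ →₀ ℤ) where
  toFun := toCosets
  map_zero' := rfl
  map_add' := toCosets_add

/-- The coefficient of the coset `Γ g`, as an additive map. -/
def coeffHom (g : G) : HeckeRing Γ →+ ℤ :=
  (Finsupp.applyAddHom (coset Γ g)).comp (toCosetsHom Γ)

theorem coeffHom_apply (g : G) (t : HeckeRing Γ) :
    coeffHom g t = t.toCosets (coset Γ g) := rfl

theorem coeffHom_eq_of_coset_eq {g h : G} (e : coset Γ g = coset Γ h) (t : HeckeRing Γ) :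
    coeffHom g t = coeffHom h t := by
  rw [coeffHom_apply, coeffHom_apply, e]

theorem ext_coeff {t s : HeckeRing Γ} (h : ∀ g, coeffHom g t = coeffHom g s) : t = s := by
  refine ext (Finsupp.ext fun c => ?_)
  obtain ⟨g, rfl⟩ := coset_surjective c
  exact h g

/-- This is the invariance of `t` under right translation, read at one coset; translation is
injective, so no coefficients merge. Together with `coeffHom_mul_left` it shows that a coefficient
depends only on the double coset, which is why diagonal matrices suffice later. -/
theorem coeffHom_mul_right (t : HeckeRing Γ) (g : G) {γ : G} (hγ : γ ∈ Γ) :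
    coeffHom (g * γ) t = coeffHom g t := by
  have h : Finsupp.mapDomain (translate γ) t.toCosets = t.toCosets := t.2 γ hγ
  conv_lhs => rw [coeffHom_apply, ← h, ← translate_coset]
  exact Finsupp.mapDomain_apply (translate_injective γ) _ _

theorem coeffHom_mul_left (t : HeckeRing Γ) (g : G) {γ : G} (hγ : γ ∈ Γ) :
    coeffHom (γ * g) t = coeffHom g t :=
  coeffHom_eq_of_coset_eq (coset_mul_left hγ g) t

theorem coeffHom_one (g : G) [Decidable (g ∈ Γ)] :
    coeffHom g (1 : HeckeRing Γ) = if g ∈ Γ then 1 else 0 := by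
  classical
  rw [coeffHom_apply, toCosets_one, Finsupp.single_apply]
  simp only [coset_eq_iff, inv_one, mul_one]

/-- The coefficients of a product. -/
theorem coeffHom_mul (t s : HeckeRing Γ) (g : G) (r : Cosets Γ → G)
    (hr : ∀ c ∈ s.toCosets.support, coset Γ (r c) = c) :
    coeffHom g (t * s) = ∑ c ∈ s.toCosets.support, s.toCosets c * coeffHom (g * (r c)⁻¹) t := by
  rw [coeffHom_apply, toCosets_mul, act, Finsupp.linearCombination_apply, Finsupp.sum,
    Finsupp.finsetSum_apply]
  refine Finset.sum_congr rfl fun c hc => ?_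
  rw [Finsupp.smul_apply, smul_eq_mul]
  congr 1
  conv_lhs => rw [← hr c hc, actCoset_coset]
  have : coset Γ g = translate (r c) (coset Γ (g * (r c)⁻¹)) := by
    rw [translate_coset, inv_mul_cancel_right]
  rw [this, Finsupp.mapDomain_apply (translate_injective _), coeffHom_apply]

/-- The element of the Hecke ring attached to a finite set of cosets which is invariant
under right translation by `Γ`. -/
def ofSet (s : Set (Cosets Γ)) (hs : s.Finite)
    (h : ∀ γ ∈ Γ, ∀ c, translate γ c ∈ s ↔ c ∈ s) : HeckeRing Γ :=
  ⟨∑ c ∈ hs.toFinset, Finsupp.single c 1, fun γ hγ => by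
    rw [Finsupp.mapDomain_finsetSum]
    simp only [Finsupp.mapDomain_single]
    refine Finset.sum_bij (fun c _ => translate γ c) ?_ ?_ ?_ (fun _ _ => rfl)
    · intro c hc
      rw [Set.Finite.mem_toFinset] at hc ⊢
      exact (h γ hγ c).2 hc
    · intro c _ c' _ e
      exact translate_injective γ e
    · intro c hc
      rw [Set.Finite.mem_toFinset] at hc
      refine ⟨translate γ⁻¹ c, ?_, ?_⟩
      · rw [Set.Finite.mem_toFinset]
        exact (h γ⁻¹ (Γ.inv_mem hγ) c).2 hc
      · have k := congrFun (translate_comp (Γ := Γ) γ⁻¹ γ) c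
        simpa only [inv_mul_cancel, translate_one, Function.comp_apply, id] using k⟩

open Classical in
theorem toCosets_ofSet_apply (s : Set (Cosets Γ)) (hs : s.Finite)
    (h : ∀ γ ∈ Γ, ∀ c, translate γ c ∈ s ↔ c ∈ s) (c : Cosets Γ) :
    (ofSet s hs h).toCosets c = if c ∈ s then 1 else 0 := by
  change (∑ c ∈ hs.toFinset, Finsupp.single c 1 : Cosets Γ →₀ ℤ) c = _
  rw [Finsupp.finsetSum_apply]
  simp [Finsupp.single_apply]

open Classical in
theorem toCosets_doubleCoset_apply (g : G) (hg : (cosetsIn Γ g).Finite) (c : Cosets Γ) :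
    (doubleCoset Γ g hg).toCosets c = if c ∈ cosetsIn Γ g then 1 else 0 := by
  change (∑ c ∈ hg.toFinset, Finsupp.single c 1 : Cosets Γ →₀ ℤ) c = _
  rw [Finsupp.finsetSum_apply]
  simp [Finsupp.single_apply]

theorem coset_mem_cosetsIn {g h : G} :
    coset Γ h ∈ cosetsIn Γ g ↔ ∃ γ ∈ Γ, ∃ γ' ∈ Γ, h = γ * g * γ' := by
  constructor
  · rintro ⟨γ', hγ', e⟩
    obtain ⟨γ, hγ, e⟩ := coset_eq_coset_iff_exists.1 e.symm
    exact ⟨γ, hγ, γ', hγ', by rw [e, mul_assoc]⟩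
  · rintro ⟨γ, hγ, γ', hγ', rfl⟩
    exact ⟨γ', hγ', by rw [mul_assoc, coset_mul_left hγ]⟩

end HeckeRing

/-- The linear extension to combinations of cosets of a function on cosets. -/
def weightSum {R : Type*} [CommRing R] (w : Cosets Γ → R) :
    (Cosets Γ →₀ ℤ) →ₗ[ℤ] R :=
  Finsupp.linearCombination ℤ w

/-- A combination of cosets all of which have a representative in `B`. -/
def SupportedOn (B : Set G) (t : Cosets Γ →₀ ℤ) : Prop :=
  ∀ c, t c ≠ 0 → ∃ g ∈ B, coset Γ g = c

theorem SupportedOn.add {B : Set G} {t s : Cosets Γ →₀ ℤ} (ht : SupportedOn B t)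
    (hs : SupportedOn B s) : SupportedOn B (t + s) := by
  intro c hc
  by_cases h : t c = 0
  · exact hs c fun h' => hc (by simp [h, h'])
  · exact ht c h

theorem SupportedOn.neg {B : Set G} {t : Cosets Γ →₀ ℤ} (ht : SupportedOn B t) :
    SupportedOn B (-t) := fun c hc => ht c (by simpa using hc)

theorem SupportedOn.mono {B B' : Set G} (h : B ⊆ B') {t : Cosets Γ →₀ ℤ}
    (ht : SupportedOn B t) : SupportedOn B' t := fun c hc => by
  obtain ⟨g, hg, e⟩ := ht c hc
  exact ⟨g, h hg, e⟩

/-- A nonzero coefficient of the product at `Γ g` requires a coset `Γ h` of `s` for which `Γ g h⁻¹`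
occurs in `t`; if `k ∈ B` represents the latter, `k h` represents `Γ g`. -/
theorem SupportedOn.mul {B B' B'' : Set G} (hB : ∀ g ∈ B, ∀ h ∈ B', g * h ∈ B'')
    {t s : HeckeRing Γ}
    (ht : SupportedOn B t.toCosets) (hs : SupportedOn B' s.toCosets) :
    SupportedOn B'' (t * s).toCosets := by
  intro c hc
  choose! r hr using hs
  obtain ⟨g, rfl⟩ := coset_surjective c
  rw [← HeckeRing.coeffHom_apply, HeckeRing.coeffHom_mul t s g r
    (fun c hc => (hr c (Finsupp.mem_support_iff.1 hc)).2)] at hc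
  obtain ⟨c, hc, h⟩ := Finset.exists_ne_zero_of_sum_ne_zero hc
  obtain ⟨k, hk, e⟩ := ht _ (right_ne_zero_of_mul h)
  refine ⟨k * r c, hB k hk _ (hr c (Finsupp.mem_support_iff.1 hc)).1, ?_⟩
  rw [← translate_coset, e, translate_coset, inv_mul_cancel_right]

theorem weightSum_one {R : Type*} [CommRing R] (w : Cosets Γ → R) (h : w (coset Γ 1) = 1) :
    weightSum w (1 : HeckeRing Γ).toCosets = 1 := by
  rw [HeckeRing.toCosets_one, weightSum, Finsupp.linearCombination_single, h, one_smul]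

/-- If the weight is multiplicative on a set of representatives, then its linear extension is
multiplicative on the Hecke ring. -/
theorem weightSum_mul {R : Type*} [CommRing R] (w : Cosets Γ → R) (B : Set G)
    (hw : ∀ g ∈ B, ∀ h ∈ B, w (coset Γ (g * h)) = w (coset Γ g) * w (coset Γ h))
    {t s : HeckeRing Γ} (ht : SupportedOn B t.toCosets) (hs : SupportedOn B s.toCosets) :
    weightSum w (t * s).toCosets = weightSum w t.toCosets * weightSum w s.toCosets := by
  rw [HeckeRing.toCosets_mul, HeckeRing.act, weightSum,
    Finsupp.linearCombination_apply ℤ (v := t.actCoset), Finsupp.sum, map_sum,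
    Finsupp.linearCombination_apply ℤ (v := w) s.toCosets, Finsupp.sum,
    Finset.mul_sum]
  refine Finset.sum_congr rfl fun c hc => ?_
  -- The action of `t` on a coset does not depend on the representative, so one in `B` may be taken,
  -- and multiplicativity of `w` applies term by term.
  obtain ⟨h, hh, rfl⟩ := hs c (Finsupp.mem_support_iff.1 hc)
  rw [map_smul, HeckeRing.actCoset_coset, Finsupp.linearCombination_mapDomain, mul_smul_comm]
  congr 1
  rw [Finsupp.linearCombination_apply, Finsupp.linearCombination_apply, Finsupp.sum, Finsupp.sum,
    Finset.sum_mul]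
  refine Finset.sum_congr rfl fun c' hc' => ?_
  obtain ⟨g, hg, rfl⟩ := ht c' (Finsupp.mem_support_iff.1 hc')
  rw [Function.comp_apply, translate_coset, hw g hg h hh, smul_mul_assoc]

end AbstractHecke

end

noncomputable section

/-! ### Hermite and Smith normal forms of integral matrices. -/

section IntegralMatrices

variable {n : ℕ}

/-- The block diagonal matrix `diag(a, X)`. -/
def scalarSum (a : ℤ) (X : Matrix (Fin n) (Fin n) ℤ) : Matrix (Fin (n + 1)) (Fin (n + 1)) ℤ :=
  Matrix.of (Fin.cons (Fin.cons a 0) fun i => Fin.cons 0 (X i))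

@[simp] theorem scalarSum_zero_zero (a : ℤ) (X : Matrix (Fin n) (Fin n) ℤ) :
    scalarSum a X 0 0 = a := rfl

@[simp] theorem scalarSum_zero_succ (a : ℤ) (X : Matrix (Fin n) (Fin n) ℤ) (j : Fin n) :
    scalarSum a X 0 j.succ = 0 := rfl

@[simp] theorem scalarSum_succ_zero (a : ℤ) (X : Matrix (Fin n) (Fin n) ℤ) (i : Fin n) :
    scalarSum a X i.succ 0 = 0 := rfl

@[simp] theorem scalarSum_succ_succ (a : ℤ) (X : Matrix (Fin n) (Fin n) ℤ) (i j : Fin n) :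
    scalarSum a X i.succ j.succ = X i j := rfl

theorem scalarSum_mul (a b : ℤ) (X Y : Matrix (Fin n) (Fin n) ℤ) :
    scalarSum a X * scalarSum b Y = scalarSum (a * b) (X * Y) := by
  ext i j
  refine Fin.cases ?_ (fun i => ?_) i <;> refine Fin.cases ?_ (fun j => ?_) j <;>
    simp [Matrix.mul_apply, Fin.sum_univ_succ]

theorem scalarSum_one : scalarSum 1 (1 : Matrix (Fin n) (Fin n) ℤ) = 1 := by
  ext i j
  refine Fin.cases ?_ (fun i => ?_) i <;> refine Fin.cases ?_ (fun j => ?_) j <;>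
    simp [Matrix.one_apply, Fin.succ_ne_zero, (Fin.succ_ne_zero _).symm]

/-- The unimodular matrix `diag(a, U)`. -/
def unitSum (a : ℤˣ) (U : GL (Fin n) ℤ) : GL (Fin (n + 1)) ℤ where
  val := scalarSum a U.val
  inv := scalarSum (a⁻¹ : ℤˣ) (U⁻¹ : GL (Fin n) ℤ).val
  val_inv := by rw [scalarSum_mul, Units.mul_inv, Units.mul_inv, scalarSum_one]
  inv_val := by rw [scalarSum_mul, Units.inv_mul, Units.inv_mul, scalarSum_one]

theorem exists_mulVec_eq_update (x : Fin n → ℤ) {i j : Fin n} (hij : i ≠ j) (c : ℤ) :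
    ∃ U : GL (Fin n) ℤ, U.val *ᵥ x = Function.update x i (x i + c * x j) := by
  refine ⟨GeneralLinearGroup.mk'' (transvection i j c)
    (by rw [det_transvection_of_ne i j hij]; exact isUnit_one), ?_⟩
  change transvection i j c *ᵥ x = _
  rw [transvection, add_mulVec, one_mulVec]
  ext k
  rw [Pi.add_apply, single_mulVec]
  by_cases h : k = i
  · subst h; simp
  · simp [h]

/-- The orbits of integral vectors under unimodular matrices contain multiples of the first
basis vector. -/
theorem exists_mulVec_eq_single (x : Fin (n + 1) → ℤ) :
    ∃ (U : GL (Fin (n + 1)) ℤ) (g : ℤ), U.val *ᵥ x = Pi.single 0 g := by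
  induction hN : ∑ i, (x i).natAbs using Nat.strong_induction_on generalizing x with
  | _ N ih =>
  by_cases h : ∃ i j, i ≠ j ∧ x i ≠ 0 ∧ x j ≠ 0 ∧ (x j).natAbs ≤ (x i).natAbs
  · obtain ⟨i, j, hij, hi, hj, hle⟩ := h
    -- Euclid's algorithm by single additions: the sign of `x i * x j` decides between subtracting
    -- and adding the smaller entry, and the sum of the absolute values drops.
    obtain ⟨c, hc⟩ : ∃ c : ℤ, (x i + c * x j).natAbs < (x i).natAbs := by
      by_cases hs : 0 < x i * x j
      · refine ⟨-1, ?_⟩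
        rcases pos_and_pos_or_neg_and_neg_of_mul_pos hs with h | h <;> omega
      · refine ⟨1, ?_⟩
        have hs' : x i * x j < 0 := lt_of_le_of_ne (not_lt.1 hs) (mul_ne_zero hi hj)
        rcases mul_neg_iff.1 hs' with h | h <;> omega
    obtain ⟨U, hU⟩ := exists_mulVec_eq_update x hij c
    have hlt : ∑ k, ((U.val *ᵥ x) k).natAbs < N := by
      rw [← hN, hU]
      refine Finset.sum_lt_sum (fun k _ => ?_) ⟨i, Finset.mem_univ _, by simpa using hc⟩
      by_cases hk : k = i
      · subst hk; simpa using hc.le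
      · simp [hk]
    obtain ⟨V, g, hV⟩ := ih _ hlt _ rfl
    exact ⟨V * U, g, by rw [Units.val_mul, ← mulVec_mulVec, hV]⟩
  · have h' : ∀ i j, i ≠ j → x i = 0 ∨ x j = 0 := by
      intro i j hij
      by_contra! hc
      rcases le_total (x j).natAbs (x i).natAbs with hle | hle
      · exact h ⟨i, j, hij, hc.1, hc.2, hle⟩
      · exact h ⟨j, i, hij.symm, hc.2, hc.1, hle⟩
    by_cases h0 : ∃ k, k ≠ 0 ∧ x k ≠ 0
    · obtain ⟨k, hk, hxk⟩ := h0
      have hz : ∀ i, i ≠ k → x i = 0 := fun i hi => (h' i k hi).resolve_right hxk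
      -- The only nonzero entry sits at `k ≠ 0`: it is copied to the place `0` and then cancelled at
      -- `k`.
      obtain ⟨U, hU⟩ := exists_mulVec_eq_update x hk.symm 1
      obtain ⟨V, hV⟩ := exists_mulVec_eq_update (U.val *ᵥ x) hk (-1)
      refine ⟨V * U, x k, ?_⟩
      rw [Units.val_mul, ← mulVec_mulVec, hV, hU]
      ext i
      by_cases hi : i = k
      · subst hi; simp [hk, hz 0 hk.symm]
      · by_cases hi0 : i = 0
        · subst hi0; simp [hk.symm, hz 0 hk.symm]
        · simp [hi, hi0, hz i hi]
    · push Not at h0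
      refine ⟨1, x 0, ?_⟩
      rw [Units.val_one, one_mulVec]
      ext i
      by_cases hi : i = 0
      · subst hi; simp
      · simp [hi, h0 i hi]

/-- The Hermite form of a nonsingular integral matrix. -/
theorem exists_hermite (D : Matrix (Fin n) (Fin n) ℤ) (hD : D.det ≠ 0) :
    ∃ U : GL (Fin n) ℤ, (U.val * D).BlockTriangular id ∧ ∀ i, 0 < (U.val * D) i i := by
  induction n with
  | zero => exact ⟨1, fun i => i.elim0, fun i => i.elim0⟩
  | succ n ih =>
    obtain ⟨U, g, hU⟩ := exists_mulVec_eq_single fun i => D i 0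
    have hcol (i) : (U.val * D) i 0 = Pi.single (M := fun _ => ℤ) 0 g i := by
      rw [← hU]; rfl
    have hdet : (U.val * D).det ≠ 0 := by
      rw [det_mul]
      exact mul_ne_zero ((isUnit_iff_isUnit_det _).1 U.isUnit).ne_zero hD
    -- The first column is cleared below the pivot, so `hdet` says that the pivot `g` and the
    -- complementary minor are both nonzero.
    rw [det_succ_column_zero, Fin.sum_univ_succ] at hdet
    simp only [hcol, Pi.single_eq_same, Pi.single_eq_of_ne (Fin.succ_ne_zero _), mul_zero,
      zero_mul, Finset.sum_const_zero, add_zero, Fin.val_zero, pow_zero, one_mul] at hdet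
    have hg : g ≠ 0 := left_ne_zero_of_mul hdet
    obtain ⟨V, hV, hpos⟩ := ih ((U.val * D).submatrix Fin.succ Fin.succ)
      (by simpa [Fin.succAbove_zero] using right_ne_zero_of_mul hdet)
    obtain ⟨a, ha⟩ : ∃ a : ℤˣ, 0 < (a : ℤ) * g := by
      rcases lt_or_gt_of_ne hg with h | h
      · exact ⟨-1, by simpa using h⟩
      · exact ⟨1, by simpa using h⟩
    have h0 (j) : (scalarSum a V.val * (U.val * D)) 0 j = a * (U.val * D) 0 j := by
      rw [Matrix.mul_apply, Fin.sum_univ_succ]; simp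
    have h1 (i j) : (scalarSum a V.val * (U.val * D)) (Fin.succ i) (Fin.succ j) =
        (V.val * (U.val * D).submatrix Fin.succ Fin.succ) i j := by
      rw [Matrix.mul_apply, Fin.sum_univ_succ]; simp [Matrix.mul_apply]
    have h2 (i) : (scalarSum a V.val * (U.val * D)) (Fin.succ i) 0 = 0 := by
      rw [Matrix.mul_apply, Fin.sum_univ_succ]; simp [hcol]
    refine ⟨unitSum a V * U, ?_, ?_⟩
    · rw [Units.val_mul, Matrix.mul_assoc]
      change (scalarSum a V.val * (U.val * D)).BlockTriangular id
      intro i j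
      refine Fin.cases (fun h => absurd h (Fin.not_lt_zero _)) (fun i => ?_) i
      refine Fin.cases (fun _ => h2 i) (fun j hij => ?_) j
      rw [h1]
      exact hV (Fin.succ_lt_succ_iff.1 hij)
    · rw [Units.val_mul, Matrix.mul_assoc]
      change ∀ i, 0 < (scalarSum a V.val * (U.val * D)) i i
      intro i
      refine Fin.cases ?_ (fun i => ?_) i
      · rw [h0, hcol]; simpa using ha
      · rw [h1]; exact hpos i

/-- Over `ℤ` the matrix `A` has no inverse, but `A (B A - c) = 0`, and the adjugate turns this into
`det A • (B A - c) = 0` with `det A ≠ 0`. -/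
theorem mul_eq_smul_one_comm {m : Type*} [Fintype m] [DecidableEq m] {A B : Matrix m m ℤ}
    {c : ℤ} (hc : c ≠ 0) (h : A * B = c • 1) : B * A = c • 1 := by
  have hdet : A.det ≠ 0 := by
    intro h0
    have := congrArg det h
    rw [det_mul, h0, zero_mul, det_smul, det_one, mul_one] at this
    exact pow_ne_zero _ hc this.symm
  have h1 : A * (B * A - c • 1) = 0 := by
    rw [Matrix.mul_sub, ← Matrix.mul_assoc, h, Matrix.smul_mul, Matrix.one_mul,
      Matrix.mul_smul, Matrix.mul_one, sub_self]
  have h2 : A.det • (B * A - c • 1) = 0 := by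
    have := congrArg (A.adjugate * ·) h1
    simpa only [← Matrix.mul_assoc, adjugate_mul, Matrix.smul_mul, Matrix.one_mul,
      Matrix.mul_zero] using this
  exact sub_eq_zero.1 ((smul_eq_zero.1 h2).resolve_left hdet)

/-- A matrix dividing `p ^ K` is a power of `p` times a matrix which does not vanish modulo
`p`. -/
theorem exists_eq_pow_smul {m : Type*} [Fintype m] [DecidableEq m] [Nonempty m] (p : ℕ)
    [hp : Fact p.Prime] {D D' : Matrix m m ℤ} {K : ℕ} (h : D * D' = (p : ℤ) ^ K • 1) :
    ∃ (k : ℕ) (E : Matrix m m ℤ), k ≤ K ∧ D = (p : ℤ) ^ k • E ∧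
      E * D' = (p : ℤ) ^ (K - k) • 1 ∧ ∃ i j, ¬ (p : ℤ) ∣ E i j := by
  classical
  have hp0 : (p : ℤ) ≠ 0 := by exact_mod_cast hp.out.ne_zero
  have hbound (k : ℕ) (hk : ∀ i j, (p : ℤ) ^ k ∣ D i j) : k ≤ K := by
    obtain ⟨i⟩ := ‹Nonempty m›
    have h1 : (p : ℤ) ^ k ∣ (p : ℤ) ^ K := by
      have := congrFun (congrFun h i) i
      rw [Matrix.smul_apply, one_apply_eq, smul_eq_mul, mul_one] at this
      rw [← this, Matrix.mul_apply]
      exact Finset.dvd_sum fun j _ => Dvd.dvd.mul_right (hk i j) _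
    have h2 : p ^ k ∣ p ^ K := by exact_mod_cast h1
    exact (Nat.pow_dvd_pow_iff_le_right hp.out.one_lt).1 h2
  -- By `hbound` the admissible exponents are at most `K`, so the search up to `K` finds the true
  -- maximum; maximality gives the entry prime to `p`.
  let k := Nat.findGreatest (fun k => ∀ i j, (p : ℤ) ^ k ∣ D i j) K
  have hk : ∀ i j, (p : ℤ) ^ k ∣ D i j :=
    Nat.findGreatest_spec (P := fun k => ∀ i j, (p : ℤ) ^ k ∣ D i j) (Nat.zero_le K) (by simp)
  have hkK : k ≤ K := Nat.findGreatest_le K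
  choose E hE using hk
  have hDE : D = (p : ℤ) ^ k • Matrix.of E := by
    ext i j; rw [hE i j]; rfl
  refine ⟨k, Matrix.of E, hkK, hDE, ?_, ?_⟩
  · rw [hDE, Matrix.smul_mul, ← Nat.add_sub_cancel' hkK, pow_add, mul_smul] at h
    exact smul_right_injective _ (pow_ne_zero k hp0) h
  · by_contra! hall
    have : k + 1 ≤ k := by
      have hP : ∀ i j, (p : ℤ) ^ (k + 1) ∣ D i j := fun i j => by
        rw [hE i j, pow_succ]; exact mul_dvd_mul_left _ (hall i j)
      exact Nat.le_findGreatest (hbound _ hP) hP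
    omega

/-- A vector in the orbit of a multiple of a basis vector is primitive if it is a column of a
divisor of a power of `p` which does not vanish modulo `p`. -/
theorem isUnit_of_column {m : Type*} [Fintype m] [DecidableEq m] (p : ℕ) [hp : Fact p.Prime]
    {E D' V : Matrix m m ℤ} {K : ℕ} (h : D' * E = (p : ℤ) ^ K • 1) {i₀ j i : m}
    (hE : ¬ (p : ℤ) ∣ E i j) {g : ℤ} (hV : E.col j = V *ᵥ Pi.single i₀ g) : IsUnit g := by
  have hcol (k) : g ∣ E k j := by
    have := congrFun hV k
    rw [Matrix.mulVec_single] at this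
    exact ⟨V k i₀, this.trans (mul_comm _ _)⟩
  have hdvd : g ∣ (p : ℤ) ^ K := by
    have := congrFun (congrFun h j) j
    rw [Matrix.smul_apply, one_apply_eq, smul_eq_mul, mul_one] at this
    rw [← this, Matrix.mul_apply]
    exact Finset.dvd_sum fun k _ => Dvd.dvd.mul_left (hcol k) _
  obtain ⟨k, -, hk⟩ := (dvd_prime_pow (Nat.prime_iff_prime_int.1 hp.out) K).1 hdvd
  rcases Nat.eq_zero_or_pos k with rfl | hpos
  · rw [pow_zero] at hk
    exact associated_one_iff_isUnit.1 hk
  · exact absurd (((dvd_pow_self (p : ℤ) hpos.ne').trans hk.symm.dvd).trans (hcol i)) hE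

/-- The Smith normal form of a divisor of a power of `p`. -/
theorem exists_smith (p : ℕ) [hp : Fact p.Prime] (D D' : Matrix (Fin n) (Fin n) ℤ) (K : ℕ)
    (h : D * D' = (p : ℤ) ^ K • 1) :
    ∃ (U V : GL (Fin n) ℤ) (a : Fin n → ℕ), Monotone a ∧
      U.val * D * V.val = diagonal fun i => (p : ℤ) ^ a i := by
  have hp0 : (p : ℤ) ≠ 0 := by exact_mod_cast hp.out.ne_zero
  induction n generalizing K with
  | zero => exact ⟨1, 1, fun i => i.elim0, fun i => i.elim0, by ext i; exact i.elim0⟩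
  | succ n ih =>
    obtain ⟨k, E, -, hDE, hE, i, j, hij⟩ := exists_eq_pow_smul p h
    generalize K - k = K' at hE
    -- The column `j` has an entry prime to `p`, while its content `g` divides a power of `p`; hence
    -- `g` is a unit.
    obtain ⟨U, g, hU⟩ := exists_mulVec_eq_single (E.col j)
    have hg : IsUnit g := by
      refine isUnit_of_column p (mul_eq_smul_one_comm (pow_ne_zero _ hp0) hE) hij
        (V := (U⁻¹ : GL (Fin (n + 1)) ℤ).val) (i₀ := 0) ?_
      rw [← hU, mulVec_mulVec, Units.inv_mul, one_mulVec]
    obtain ⟨a, rfl⟩ := hg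
    let P : GL (Fin (n + 1)) ℤ := GeneralLinearGroup.mk'' ((Equiv.swap 0 j).permMatrix ℤ)
      (by rw [det_permutation]; exact (Equiv.Perm.sign (Equiv.swap 0 j)).isUnit.map
            (Int.castRingHom ℤ))
    let E₁ := (unitSum a⁻¹ 1 * U).val * E * P.val
    have hE₁ (i) : E₁ i 0 = Pi.single (M := fun _ => ℤ) 0 1 i := by
      have h1 : E₁ i 0 = ((unitSum a⁻¹ 1 * U).val * E) i j := by
        change ((unitSum a⁻¹ 1 * U).val * E * (Equiv.swap 0 j).permMatrix ℤ :
          Matrix (Fin (n + 1)) (Fin (n + 1)) ℤ) i 0 = _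
        rw [Equiv.Perm.permMatrix, PEquiv.mul_toMatrix_toPEquiv]
        simp
      have h2 (i) : (U.val * E) i j = Pi.single (M := fun _ => ℤ) 0 (a : ℤ) i := by
        rw [← hU]; rfl
      rw [h1, Units.val_mul, Matrix.mul_assoc]
      change (scalarSum (a⁻¹ : ℤˣ) (1 : Matrix (Fin n) (Fin n) ℤ) * (U.val * E) :
        Matrix (Fin (n + 1)) (Fin (n + 1)) ℤ) i j = _
      rw [Matrix.mul_apply, Fin.sum_univ_succ]
      refine Fin.cases ?_ (fun i => ?_) i
      · simp [h2]
      · simp [h2]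
    -- The first column of `E₁` is now the first basis vector, and `W` clears the first row by
    -- column operations.
    let W : Matrix (Fin (n + 1)) (Fin (n + 1)) ℤ :=
      Matrix.of (Fin.cons (Fin.cons 1 fun l => -E₁ 0 l.succ) fun i => (1 : Matrix _ _ ℤ) i.succ)
    have hW : W.det = 1 := by
      rw [det_of_isUpperTriangular]
      · rw [Fin.prod_univ_succ]; simp [W]
      · intro i l
        refine Fin.cases (fun h => absurd h (Fin.not_lt_zero _)) (fun i hl => ?_) i
        exact one_apply_ne (ne_of_gt hl)
    let V : GL (Fin (n + 1)) ℤ := GeneralLinearGroup.mk'' W (by rw [hW]; exact isUnit_one)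
    have hE₂ : E₁ * W = scalarSum 1 (E₁.submatrix Fin.succ Fin.succ) := by
      ext i l
      rw [Matrix.mul_apply, Fin.sum_univ_succ, hE₁]
      refine Fin.cases ?_ (fun i => ?_) i <;> refine Fin.cases ?_ (fun l => ?_) l <;>
        simp [W, Matrix.one_apply, Fin.succ_ne_zero]
    -- The relation with the complementary factor is carried along because the induction hypothesis
    -- needs the remaining block to divide `p ^ K'`.
    have hEF : scalarSum 1 (E₁.submatrix Fin.succ Fin.succ) *
        ((P * V)⁻¹.val * D' * (unitSum a⁻¹ 1 * U)⁻¹.val) = (p : ℤ) ^ K' • 1 := by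
      rw [← hE₂]
      change (unitSum a⁻¹ 1 * U).val * E * P.val * V.val * _ = _
      calc _ = (unitSum a⁻¹ 1 * U).val * (E * ((P * V).val * (P * V)⁻¹.val) * D') *
            (unitSum a⁻¹ 1 * U)⁻¹.val := by
            rw [Units.val_mul P V]; simp only [Matrix.mul_assoc]
        _ = _ := by
          rw [Units.mul_inv, Matrix.mul_one, hE, Matrix.mul_smul, Matrix.mul_one,
            Matrix.smul_mul, Units.mul_inv]
    obtain ⟨U', V', b, hb, hUV⟩ := ih (E₁.submatrix Fin.succ Fin.succ)
      (((P * V)⁻¹.val * D' * (unitSum a⁻¹ 1 * U)⁻¹.val).submatrix Fin.succ Fin.succ) K' (by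
        ext i l
        have := congrFun (congrFun hEF i.succ) l.succ
        rw [Matrix.mul_apply, Fin.sum_univ_succ] at this
        simpa [Matrix.mul_apply, Matrix.one_apply] using this)
    refine ⟨unitSum 1 U' * (unitSum a⁻¹ 1 * U), P * V * unitSum 1 V', Fin.cons k fun i => k + b i,
      ?_, ?_⟩
    · intro i l
      refine Fin.cases ?_ (fun i => ?_) i <;> refine Fin.cases ?_ (fun l => ?_) l
      · simp
      · simp
      · intro h; exact absurd h (not_le.2 (Fin.succ_pos i))
      · intro h
        simpa using hb (Fin.succ_le_succ_iff.1 h)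
    · have : (unitSum 1 U' * (unitSum a⁻¹ 1 * U)).val * E * (P * V * unitSum 1 V').val =
          scalarSum 1 (diagonal fun i => (p : ℤ) ^ b i) := by
        calc _ = scalarSum 1 U'.val * (E₁ * W) * scalarSum 1 V'.val := by
              simp only [Units.val_mul, Matrix.mul_assoc, E₁]; rfl
          _ = _ := by rw [hE₂, scalarSum_mul, scalarSum_mul, hUV]; simp
      rw [hDE, Matrix.mul_smul, Matrix.smul_mul, this]
      ext i l
      refine Fin.cases ?_ (fun i => ?_) i <;> refine Fin.cases ?_ (fun l => ?_) l <;>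
        simp [Matrix.diagonal_apply, pow_add, Fin.succ_ne_zero, (Fin.succ_ne_zero _).symm]

end IntegralMatrices

end

noncomputable section

/-! ### Block triangular form and elementary divisors of integral symplectic similitudes. -/

section IntegralSimilitudes

variable {n : ℕ}

/-- `M` is an integral symplectic similitude with multiplier `μ`. -/
def IsIntSimilitude (M : Matrix (Fin n ⊕ Fin n) (Fin n ⊕ Fin n) ℤ) (μ : ℤ) : Prop :=
  Mᵀ * J (Fin n) ℤ * M = μ • J (Fin n) ℤ

variable {M N : Matrix (Fin n ⊕ Fin n) (Fin n ⊕ Fin n) ℤ} {μ ν : ℤ}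

theorem isIntSimilitude_one_iff : IsIntSimilitude M 1 ↔ M ∈ symplecticGroup (Fin n) ℤ := by
  rw [IsIntSimilitude, one_smul, SymplecticGroup.mem_iff']

theorem IsIntSimilitude.mul (hM : IsIntSimilitude M μ) (hN : IsIntSimilitude N ν) :
    IsIntSimilitude (M * N) (μ * ν) := by
  unfold IsIntSimilitude at *
  rw [transpose_mul]
  calc _ = Nᵀ * (Mᵀ * J (Fin n) ℤ * M) * N := by simp only [Matrix.mul_assoc]
    _ = _ := by rw [hM, Matrix.mul_smul, Matrix.smul_mul, hN, smul_smul]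

theorem IsIntSimilitude.mul_of_mem (hM : M ∈ symplecticGroup (Fin n) ℤ)
    (hN : IsIntSimilitude N ν) : IsIntSimilitude (M * N) ν := by
  simpa using (isIntSimilitude_one_iff.2 hM).mul hN

theorem IsIntSimilitude.mul_mem (hM : IsIntSimilitude M μ)
    (hN : N ∈ symplecticGroup (Fin n) ℤ) : IsIntSimilitude (M * N) μ := by
  simpa using hM.mul (isIntSimilitude_one_iff.2 hN)

/-- `-J ᵗM J` is the adjoint of `M` for the symplectic form. So `M` divides its multiplier, which
makes `exists_eq_pow_smul` applicable when `μ` is a power of `p`. -/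
theorem IsIntSimilitude.dual_mul (h : IsIntSimilitude M μ) :
    -J (Fin n) ℤ * Mᵀ * J (Fin n) ℤ * M = μ • 1 := by
  unfold IsIntSimilitude at h
  rw [Matrix.mul_assoc (-J (Fin n) ℤ), Matrix.mul_assoc (-J (Fin n) ℤ), h, Matrix.mul_smul,
    Matrix.neg_mul, J_squared, neg_neg]

theorem IsIntSimilitude.mul_dual (h : IsIntSimilitude M μ) (hμ : μ ≠ 0) :
    M * (-J (Fin n) ℤ * Mᵀ * J (Fin n) ℤ) = μ • 1 :=
  mul_eq_smul_one_comm hμ h.dual_mul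

theorem IsIntSimilitude.transpose (h : IsIntSimilitude M μ) (hμ : μ ≠ 0) :
    IsIntSimilitude Mᵀ μ := by
  unfold IsIntSimilitude
  have h1 := congrArg (· * J (Fin n) ℤ) (h.mul_dual hμ)
  simp only [Matrix.neg_mul, Matrix.mul_neg, Matrix.mul_assoc, J_squared, Matrix.mul_one,
    neg_neg, Matrix.smul_mul, Matrix.one_mul] at h1
  rw [transpose_transpose, Matrix.mul_assoc, h1]

/-- The entries of `ᵗM J M` are the symplectic pairings of the columns of `M`. -/
theorem isIntSimilitude_iff :
    IsIntSimilitude M μ ↔ ∀ i j, ∑ k, (M (Sum.inr k) i * M (Sum.inl k) j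
      - M (Sum.inl k) i * M (Sum.inr k) j) = μ * J (Fin n) ℤ i j := by
  rw [IsIntSimilitude, ← Matrix.ext_iff]
  refine forall_congr' fun i => forall_congr' fun j => ?_
  have : (Mᵀ * J (Fin n) ℤ * M) i j = ∑ k, (M (Sum.inr k) i * M (Sum.inl k) j
      - M (Sum.inl k) i * M (Sum.inr k) j) := by
    rw [Matrix.mul_apply, Fintype.sum_sum_type, ← Finset.sum_add_distrib]
    refine Finset.sum_congr rfl fun k _ => ?_
    simp [Matrix.mul_apply, J, Matrix.one_apply, Matrix.neg_apply]
    ring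
  rw [this, Matrix.smul_apply, smul_eq_mul]

theorem fromBlocks_diag_mem {U V : Matrix (Fin n) (Fin n) ℤ} (h : Uᵀ * V = 1) :
    fromBlocks U 0 0 V ∈ symplecticGroup (Fin n) ℤ := by
  have h' : Vᵀ * U = 1 := by simpa using congrArg Matrix.transpose h
  rw [SymplecticGroup.mem_iff', J, fromBlocks_transpose, fromBlocks_multiply, fromBlocks_multiply]
  simp [h, h']

theorem fromBlocks_unipotent_mem {S : Matrix (Fin n) (Fin n) ℤ} (h : Sᵀ = S) :
    fromBlocks 1 S 0 1 ∈ symplecticGroup (Fin n) ℤ := by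
  rw [SymplecticGroup.mem_iff', J, fromBlocks_transpose, fromBlocks_multiply, fromBlocks_multiply]
  simp [h]

theorem fromBlocks_diagonal_mem {a b c d : Fin n → ℤ} (h : ∀ i, a i * d i - b i * c i = 1) :
    fromBlocks (diagonal a) (diagonal b) (diagonal c) (diagonal d) ∈
      symplecticGroup (Fin n) ℤ := by
  have h1 : (fun i => c i * b i + -(a i * d i)) = fun _ => -1 :=
    funext fun i => by linear_combination -h i
  have h2 : (fun i => d i * a i + -(b i * c i)) = fun _ => 1 :=
    funext fun i => by linear_combination h i
  have h3 : (fun i => c i * a i + -(a i * c i)) = 0 := funext fun i => by simp [mul_comm]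
  have h4 : (fun i => d i * b i + -(b i * d i)) = 0 := funext fun i => by simp [mul_comm]
  rw [SymplecticGroup.mem_iff', J, fromBlocks_transpose, fromBlocks_multiply, fromBlocks_multiply]
  simp [h1, h2, h3, h4]
  ext i j
  simp [diagonal_apply, Matrix.one_apply]
  split_ifs <;> rfl

/-- The lower row is `(-y, x)` divided by the greatest common divisor, and Bézout coefficients
complete it to determinant one. -/
theorem exists_sl2 (x y : ℤ) : ∃ a b c d : ℤ, a * d - b * c = 1 ∧ c * x + d * y = 0 := by
  by_cases h : x = 0 ∧ y = 0
  · exact ⟨1, 0, 0, 1, by simp [h.1, h.2]⟩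
  · have hg : 0 < Int.gcd x y := Int.gcd_pos_iff.2 (by tauto)
    obtain ⟨g, x', y', hg', hc, hx, hy⟩ := Int.exists_gcd_one' hg
    obtain ⟨u, v, huv⟩ := Int.isCoprime_iff_gcd_eq_one.2 hc
    exact ⟨u, v, -y', x', by linarith, by rw [hx, hy]; ring⟩

/-- Every integral vector is equivalent modulo `Sp` to a multiple of the first basis vector. -/
theorem exists_symplectic_mulVec_eq_single (v : Fin (n + 1) ⊕ Fin (n + 1) → ℤ) :
    ∃ (γ : symplecticGroup (Fin (n + 1)) ℤ) (g : ℤ),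
      γ.val *ᵥ v = Pi.single (Sum.inl 0) g := by
  -- An element of `SL₂(ℤ)` in each coordinate plane kills the lower half of the vector; the upper
  -- half is then moved by a Levi element.
  choose a b c d h1 h2 using fun i => exists_sl2 (v (Sum.inl i)) (v (Sum.inr i))
  let x : Fin (n + 1) → ℤ := fun i => a i * v (Sum.inl i) + b i * v (Sum.inr i)
  obtain ⟨U, g, hU⟩ := exists_mulVec_eq_single x
  refine ⟨⟨fromBlocks U.val 0 0 (U⁻¹).valᵀ, fromBlocks_diag_mem ?_⟩ *
    ⟨_, fromBlocks_diagonal_mem h1⟩, g, ?_⟩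
  swap
  · rw [← transpose_mul, Units.inv_mul, transpose_one]
  · rw [Submonoid.coe_mul, ← mulVec_mulVec]
    have hv : fromBlocks (diagonal a) (diagonal b) (diagonal c) (diagonal d) *ᵥ v =
        Sum.elim x 0 := by
      rw [fromBlocks_mulVec]
      congr 1
      · ext i; simp [mulVec_diagonal, x]
      · ext i; simpa [mulVec_diagonal] using h2 i
    rw [hv, fromBlocks_mulVec]
    ext (i | i)
    · simp [hU, Pi.single_apply]
    · simp

/-- The hypothesis expresses that `v` is primitive; the remaining sign is absorbed by `-1 ∈ Sp`. -/
theorem exists_symplectic_mulVec_eq_single_one {v : Fin (n + 1) ⊕ Fin (n + 1) → ℤ}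
    (hv : ∀ (γ : symplecticGroup (Fin (n + 1)) ℤ) (g : ℤ),
      γ.val *ᵥ v = Pi.single (Sum.inl 0) g → IsUnit g) :
    ∃ γ : symplecticGroup (Fin (n + 1)) ℤ, γ.val *ᵥ v = Pi.single (Sum.inl 0) 1 := by
  obtain ⟨γ, g, h⟩ := exists_symplectic_mulVec_eq_single v
  rcases Int.isUnit_iff.1 (hv γ g h) with rfl | rfl
  · exact ⟨γ, h⟩
  · refine ⟨⟨-γ.val, SymplecticGroup.neg_mem γ.2⟩, ?_⟩
    rw [Matrix.neg_mulVec, h, ← Pi.single_neg, neg_neg]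

/-- The orthogonal sum of a plane, with the matrix `(a b; c d)`, and of `X`. -/
def planeSum (a b c d : ℤ) (X : Matrix (Fin n ⊕ Fin n) (Fin n ⊕ Fin n) ℤ) :
    Matrix (Fin (n + 1) ⊕ Fin (n + 1)) (Fin (n + 1) ⊕ Fin (n + 1)) ℤ :=
  fromBlocks (scalarSum a X.toBlocks₁₁) (scalarSum b X.toBlocks₁₂)
    (scalarSum c X.toBlocks₂₁) (scalarSum d X.toBlocks₂₂)

theorem scalarSum_add (a b : ℤ) (X Y : Matrix (Fin n) (Fin n) ℤ) :
    scalarSum a X + scalarSum b Y = scalarSum (a + b) (X + Y) := by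
  ext i j
  refine Fin.cases ?_ (fun i => ?_) i <;> refine Fin.cases ?_ (fun j => ?_) j <;> simp

theorem scalarSum_smul (a b : ℤ) (X : Matrix (Fin n) (Fin n) ℤ) :
    b • scalarSum a X = scalarSum (b * a) (b • X) := by
  ext i j
  refine Fin.cases ?_ (fun i => ?_) i <;> refine Fin.cases ?_ (fun j => ?_) j <;>
    simp [-zsmul_eq_mul]

theorem scalarSum_transpose (a : ℤ) (X : Matrix (Fin n) (Fin n) ℤ) :
    (scalarSum a X)ᵀ = scalarSum a Xᵀ := by
  ext i j
  refine Fin.cases ?_ (fun i => ?_) i <;> refine Fin.cases ?_ (fun j => ?_) j <;> simp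

theorem scalarSum_injective {a b : ℤ} {X Y : Matrix (Fin n) (Fin n) ℤ}
    (h : scalarSum a X = scalarSum b Y) : X = Y := by
  ext i j
  exact congrFun (congrFun h i.succ) j.succ

theorem planeSum_mul (a b c d a' b' c' d' : ℤ)
    (X Y : Matrix (Fin n ⊕ Fin n) (Fin n ⊕ Fin n) ℤ) :
    planeSum a b c d X * planeSum a' b' c' d' Y =
      planeSum (a * a' + b * c') (a * b' + b * d') (c * a' + d * c') (c * b' + d * d')
        (X * Y) := by
  rw [planeSum, planeSum, planeSum, fromBlocks_multiply]
  simp only [scalarSum_mul, scalarSum_add]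
  conv_rhs => rw [← fromBlocks_toBlocks X, ← fromBlocks_toBlocks Y, fromBlocks_multiply]
  simp

theorem planeSum_transpose (a b c d : ℤ) (X : Matrix (Fin n ⊕ Fin n) (Fin n ⊕ Fin n) ℤ) :
    (planeSum a b c d X)ᵀ = planeSum a c b d Xᵀ := by
  rw [planeSum, planeSum, fromBlocks_transpose]
  simp only [scalarSum_transpose]
  rfl

theorem planeSum_smul (a b c d e : ℤ) (X : Matrix (Fin n ⊕ Fin n) (Fin n ⊕ Fin n) ℤ) :
    e • planeSum a b c d X = planeSum (e * a) (e * b) (e * c) (e * d) (e • X) := by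
  rw [planeSum, planeSum, fromBlocks_smul]
  simp only [scalarSum_smul]
  rfl

theorem planeSum_J : planeSum 0 (-1) 1 0 (J (Fin n) ℤ) = J (Fin (n + 1)) ℤ := by
  have h0 : scalarSum 0 (0 : Matrix (Fin n) (Fin n) ℤ) = 0 := by
    simpa using (scalarSum_smul (n := n) 0 0 0).symm
  have h1 : scalarSum (-1) (-1 : Matrix (Fin n) (Fin n) ℤ) = -1 := by
    have := scalarSum_smul (n := n) 1 (-1) 1
    rw [scalarSum_one] at this
    simpa using this.symm
  rw [planeSum, J, J]
  simp [h0, h1, scalarSum_one]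

theorem planeSum_injective {a b c d a' b' c' d' : ℤ}
    {X Y : Matrix (Fin n ⊕ Fin n) (Fin n ⊕ Fin n) ℤ}
    (h : planeSum a b c d X = planeSum a' b' c' d' Y) : X = Y := by
  obtain ⟨h1, h2, h3, h4⟩ := fromBlocks_inj.1 h
  rw [← fromBlocks_toBlocks X, ← fromBlocks_toBlocks Y, scalarSum_injective h1,
    scalarSum_injective h2, scalarSum_injective h3, scalarSum_injective h4]

theorem isIntSimilitude_of_planeSum {a d : ℤ} (h : IsIntSimilitude (planeSum a 0 0 d M) μ) :
    IsIntSimilitude M μ := by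
  unfold IsIntSimilitude at h
  rw [← planeSum_J, planeSum_transpose, planeSum_mul, planeSum_mul, planeSum_smul] at h
  exact planeSum_injective h

/-- The symplectic matrix `1 ⊕ γ ⊕ 1`. -/
def stabilize (γ : symplecticGroup (Fin n) ℤ) : symplecticGroup (Fin (n + 1)) ℤ :=
  ⟨planeSum 1 0 0 1 γ.val, by
    rw [SymplecticGroup.mem_iff', ← planeSum_J, planeSum_transpose, planeSum_mul, planeSum_mul,
      SymplecticGroup.mem_iff'.1 γ.2]
    simp⟩

/-- The pairing of the first column, a multiple of the first basis vector, with column `j` involves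
only the entry of that column in the dual row `inr 0`, and the multiplier prescribes its value. -/
theorem row_of_column {M : Matrix (Fin (n + 1) ⊕ Fin (n + 1)) (Fin (n + 1) ⊕ Fin (n + 1)) ℤ}
    (h : IsIntSimilitude M μ) {g : ℤ}
    (hg : ∀ i, M i (Sum.inl 0) = Pi.single (M := fun _ => ℤ) (Sum.inl 0) g i) (j) :
    g * M (Sum.inr 0) j = -(μ * J (Fin (n + 1)) ℤ (Sum.inl 0) j) := by
  rw [← isIntSimilitude_iff.1 h, Fin.sum_univ_succ]
  simp [hg]

/-- With the row `inr 0` vanishing on the remaining columns, the first plane contributes nothing to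
their pairings. -/
theorem isIntSimilitude_submatrix
    {M : Matrix (Fin (n + 1) ⊕ Fin (n + 1)) (Fin (n + 1) ⊕ Fin (n + 1)) ℤ}
    (h : IsIntSimilitude M μ) (h0 : ∀ j : Fin n, M (Sum.inr 0) (Sum.inl j.succ) = 0)
    (h1 : ∀ j : Fin n, M (Sum.inr 0) (Sum.inr j.succ) = 0) :
    IsIntSimilitude (M.submatrix (Sum.map Fin.succ Fin.succ) (Sum.map Fin.succ Fin.succ)) μ := by
  rw [isIntSimilitude_iff] at h ⊢
  have hs (j : Fin n ⊕ Fin n) : M (Sum.inr 0) (Sum.map Fin.succ Fin.succ j) = 0 := by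
    rcases j with j | j
    exacts [h0 j, h1 j]
  intro i j
  have := h (Sum.map Fin.succ Fin.succ i) (Sum.map Fin.succ Fin.succ j)
  rw [Fin.sum_univ_succ, hs, hs] at this
  have hJ : J (Fin (n + 1)) ℤ (Sum.map Fin.succ Fin.succ i) (Sum.map Fin.succ Fin.succ j) =
      J (Fin n) ℤ i j := by
    rcases i with i | i <;> rcases j with j | j <;> simp [J, Matrix.one_apply]
  rw [hJ] at this
  simpa using this

/-- Every integral similitude is equivalent modulo `Sp` to a block triangular one. -/
theorem exists_blockTriangular (hμ : μ ≠ 0) (h : IsIntSimilitude M μ) :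
    ∃ γ : symplecticGroup (Fin n) ℤ, (γ.val * M).toBlocks₂₁ = 0 := by
  induction n with
  | zero => exact ⟨1, by ext i; exact i.elim0⟩
  | succ n ih =>
    obtain ⟨γ, g, hγ⟩ := exists_symplectic_mulVec_eq_single (M.col (Sum.inl 0))
    have hcol (i) : (γ.val * M) i (Sum.inl 0) = Pi.single (M := fun _ => ℤ) (Sum.inl 0) g i := by
      rw [← hγ]; rfl
    have hM : IsIntSimilitude (γ.val * M) μ := h.mul_of_mem γ.2
    have hrow := row_of_column hM hcol
    have hg : g ≠ 0 := by
      rintro rfl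
      have := hrow (Sum.inr 0)
      simp [J] at this
      exact hμ this.symm
    have h0 (j) : (γ.val * M) (Sum.inr 0) (Sum.inl j) = 0 := by
      have := hrow (Sum.inl j)
      simpa [J, hg] using this
    have h1 (j : Fin n) : (γ.val * M) (Sum.inr 0) (Sum.inr j.succ) = 0 := by
      have := hrow (Sum.inr j.succ)
      simpa [J, hg, Matrix.one_apply, (Fin.succ_ne_zero j).symm] using this
    obtain ⟨γ', hγ'⟩ := ih (isIntSimilitude_submatrix hM (fun j => h0 _) h1)
    refine ⟨stabilize γ' * γ, ?_⟩
    ext i j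
    have e : (toBlocks₂₁ ((stabilize γ' * γ).val * M)) i j =
        (planeSum 1 0 0 1 γ'.val * (γ.val * M)) (Sum.inr i) (Sum.inl j) := by
      rw [Submonoid.coe_mul, Matrix.mul_assoc]; rfl
    rw [e, Matrix.mul_apply, Fintype.sum_sum_type, Fin.sum_univ_succ, Fin.sum_univ_succ]
    refine Fin.cases ?_ (fun i => ?_) i
    · simp [planeSum, h0]
    · refine Fin.cases ?_ (fun j => ?_) j
      · simp [planeSum, hcol]
      · have := congrFun (congrFun hγ' i) j
        simp only [toBlocks₂₁, Matrix.of_apply, Matrix.mul_apply, Fintype.sum_sum_type,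
          submatrix_apply, Sum.map_inl, Sum.map_inr, Matrix.zero_apply] at this
        simpa [planeSum, toBlocks₂₁, toBlocks₂₂, Matrix.mul_apply] using this

/-- An integral similitude whose first row and column are those of the unit matrix splits off a
plane. -/
theorem eq_planeSum {M : Matrix (Fin (n + 1) ⊕ Fin (n + 1)) (Fin (n + 1) ⊕ Fin (n + 1)) ℤ}
    (hμ : μ ≠ 0) (h : IsIntSimilitude M μ)
    (hcol : ∀ i, M i (Sum.inl 0) = Pi.single (M := fun _ => ℤ) (Sum.inl 0) 1 i)
    (hrow : ∀ i, M (Sum.inl 0) i = Pi.single (M := fun _ => ℤ) (Sum.inl 0) 1 i) :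
    M = planeSum 1 0 0 μ
      (M.submatrix (Sum.map Fin.succ Fin.succ) (Sum.map Fin.succ Fin.succ)) := by
  have h1 (j) : M (Sum.inr 0) j = -(μ * J (Fin (n + 1)) ℤ (Sum.inl 0) j) := by
    rw [← row_of_column h hcol, one_mul]
  have h2 (j) : M j (Sum.inr 0) = -(μ * J (Fin (n + 1)) ℤ (Sum.inl 0) j) := by
    rw [← row_of_column (h.transpose hμ) (fun i => by rw [transpose_apply, hrow]), one_mul,
      transpose_apply]
  ext (i | i) (j | j) <;> refine Fin.cases ?_ (fun i => ?_) i <;>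
    refine Fin.cases ?_ (fun j => ?_) j <;>
    simp [planeSum, hcol, hrow, h1, h2, J, toBlocks₁₁, toBlocks₁₂, toBlocks₂₁,
      toBlocks₂₂, (Fin.succ_ne_zero _).symm]

/-- The elements of `GL` with first row `(1, -r)` and the other rows those of the unit matrix. -/
theorem exists_gl_row (r : Fin n → ℤ) : ∃ W : GL (Fin (n + 1)) ℤ, (∀ i, W.val i 0 =
    Pi.single (M := fun _ => ℤ) 0 1 i) ∧
      (Fin.cons 1 r : Fin (n + 1) → ℤ) ᵥ* W.val = Pi.single 0 1 := by
  let W : Matrix (Fin (n + 1)) (Fin (n + 1)) ℤ :=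
    Matrix.of (Fin.cons (Fin.cons 1 fun l => -r l) fun i => (1 : Matrix _ _ ℤ) i.succ)
  have hW : W.det = 1 := by
    rw [det_of_isUpperTriangular]
    · rw [Fin.prod_univ_succ]; simp [W]
    · intro i l
      refine Fin.cases (fun h => absurd h (Fin.not_lt_zero _)) (fun i hl => ?_) i
      exact one_apply_ne (ne_of_gt hl)
  refine ⟨GeneralLinearGroup.mk'' W (by rw [hW]; exact isUnit_one), ?_, ?_⟩
  · intro i
    change W i 0 = _
    refine Fin.cases ?_ (fun i => ?_) i <;> simp [W]
  · change (Fin.cons 1 r : Fin (n + 1) → ℤ) ᵥ* W = _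
    ext j
    rw [vecMul, dotProduct, Fin.sum_univ_succ]
    refine Fin.cases ?_ (fun j => ?_) j <;>
      simp [W, Matrix.one_apply, Fin.succ_ne_zero]

/-- The symplectic elementary divisors of an integral similitude whose multiplier is a power of
`p`. -/
theorem exists_symplectic_smith (p : ℕ) [hp : Fact p.Prime] {δ : ℕ}
    (h : IsIntSimilitude M ((p : ℤ) ^ δ)) :
    ∃ (γ γ' : symplecticGroup (Fin n) ℤ) (a : Fin n → ℕ), Monotone a ∧ (∀ i, 2 * a i ≤ δ) ∧
      γ.val * M * γ'.val = diagonal (Sum.elim (fun i => (p : ℤ) ^ a i)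
        fun i => (p : ℤ) ^ (δ - a i)) := by
  have hp0 : (p : ℤ) ≠ 0 := by exact_mod_cast hp.out.ne_zero
  induction n generalizing δ with
  | zero => exact ⟨1, 1, fun i => i.elim0, fun i => i.elim0, fun i => i.elim0, by
      ext (i | i) <;> exact i.elim0⟩
  | succ n ih =>
    obtain ⟨k, E, -, hME, hE, i, j, hij⟩ :=
      exists_eq_pow_smul p (h.mul_dual (pow_ne_zero _ hp0))
    -- The form is quadratic in `M`, so taking `p ^ k` out of `M` takes `p ^ (2k)` out of the
    -- multiplier; this is where `2 a₁ ≤ δ` comes from.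
    have hk : 2 * k ≤ δ := by
      have h1 := congrFun (congrFun h (Sum.inr 0)) (Sum.inl 0)
      rw [hME, transpose_smul, Matrix.smul_mul, Matrix.smul_mul, Matrix.mul_smul, smul_smul,
        ← pow_add, ← two_mul] at h1
      have h2 : (p : ℤ) ^ (2 * k) ∣ (p : ℤ) ^ δ := by
        rw [Matrix.smul_apply, Matrix.smul_apply, smul_eq_mul, smul_eq_mul] at h1
        simp only [J, fromBlocks_apply₂₁, one_apply_eq, mul_one] at h1
        exact ⟨_, h1.symm⟩
      exact (Nat.pow_dvd_pow_iff_le_right hp.out.one_lt).1 (by exact_mod_cast h2)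
    obtain ⟨δ, rfl⟩ := Nat.exists_eq_add_of_le hk
    have hEs : IsIntSimilitude E ((p : ℤ) ^ δ) := by
      unfold IsIntSimilitude at h
      rw [hME, transpose_smul, Matrix.smul_mul, Matrix.smul_mul, Matrix.mul_smul, smul_smul,
        ← pow_add, ← two_mul, pow_add, mul_smul] at h
      exact smul_right_injective _ (pow_ne_zero _ hp0) h
    generalize hK : 2 * k + δ - k = K at hE
    -- Column `j` of `E` is primitive. Multiplication by `γ` on the left makes it the first basis
    -- vector, and `κ⁻¹` on the right brings it to the first place.
    obtain ⟨γ, hγ⟩ : ∃ γ : symplecticGroup (Fin (n + 1)) ℤ,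
        γ.val *ᵥ E.col j = Pi.single (Sum.inl 0) 1 := by
      refine exists_symplectic_mulVec_eq_single_one fun γ g e => ?_
      refine isUnit_of_column p (mul_eq_smul_one_comm (pow_ne_zero _ hp0) hE) hij
        (V := (γ⁻¹).val) (i₀ := Sum.inl 0) ?_
      rw [← e, mulVec_mulVec, ← Submonoid.coe_mul, inv_mul_cancel, Submonoid.coe_one, one_mulVec]
    obtain ⟨κ, hκ⟩ : ∃ κ : symplecticGroup (Fin (n + 1)) ℤ,
        κ.val *ᵥ Pi.single j 1 = Pi.single (Sum.inl 0) 1 := by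
      refine exists_symplectic_mulVec_eq_single_one fun γ g e => ?_
      have : Pi.single j 1 = (γ⁻¹).val *ᵥ Pi.single (Sum.inl 0) g := by
        rw [← e, mulVec_mulVec, ← Submonoid.coe_mul, inv_mul_cancel, Submonoid.coe_one,
          one_mulVec]
      have := congrFun this j
      rw [mulVec_single] at this
      refine isUnit_of_dvd_one ⟨(γ⁻¹).val j (Sum.inl 0), ?_⟩
      simpa [mul_comm] using this
    have hκ' : (κ⁻¹).val *ᵥ Pi.single (Sum.inl 0) 1 = Pi.single j 1 := by
      rw [← hκ, mulVec_mulVec, ← Submonoid.coe_mul, inv_mul_cancel, Submonoid.coe_one,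
          one_mulVec]
    -- the first column
    obtain ⟨E₁, hE₁⟩ : ∃ E₁, E₁ = γ.val * E * (κ⁻¹).val := ⟨_, rfl⟩
    have hcol : E₁ *ᵥ Pi.single (Sum.inl 0) 1 = Pi.single (Sum.inl 0) 1 := by
      rw [hE₁, ← mulVec_mulVec, hκ', ← mulVec_mulVec, mulVec_single_one, hγ]
    have hcol' (i) : E₁ i (Sum.inl 0) = Pi.single (M := fun _ => ℤ) (Sum.inl 0) 1 i := by
      rw [← hcol, mulVec_single_one]; rfl
    -- the first row
    obtain ⟨W, hW0, hW⟩ := exists_gl_row fun l : Fin n => E₁ (Sum.inl 0) (Sum.inl l.succ)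
    let κ₁ : symplecticGroup (Fin (n + 1)) ℤ := ⟨fromBlocks W.val 0 0 (W⁻¹).valᵀ,
      fromBlocks_diag_mem (by rw [← transpose_mul, Units.inv_mul, transpose_one])⟩
    have hr (l : Fin (n + 1)) : (E₁ * κ₁.val) (Sum.inl 0) (Sum.inl l) =
        Pi.single (M := fun _ => ℤ) 0 1 l := by
      rw [← hW]
      simp [κ₁, Matrix.mul_apply, Fin.sum_univ_succ, vecMul, dotProduct, hcol']
    -- After `κ₁` the upper half of the first row is that of the unit matrix. A symmetric `S` with
    -- first row `-y` therefore cancels the other half, and `κ₂` fixes the first column.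
    let y : Fin (n + 1) → ℤ := fun l => (E₁ * κ₁.val) (Sum.inl 0) (Sum.inr l)
    let S : Matrix (Fin (n + 1)) (Fin (n + 1)) ℤ := Matrix.of fun l m =>
      if l = 0 then -y m else if m = 0 then -y l else 0
    let κ₂ : symplecticGroup (Fin (n + 1)) ℤ := ⟨fromBlocks 1 S 0 1,
      fromBlocks_unipotent_mem (by
        ext l m
        by_cases hl : l = 0 <;> by_cases hm : m = 0 <;> simp [S, hl, hm])⟩
    obtain ⟨E₂, hE₂⟩ : ∃ E₂, E₂ = E₁ * κ₁.val * κ₂.val := ⟨_, rfl⟩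
    have hcol₂ (i) : E₂ i (Sum.inl 0) = Pi.single (M := fun _ => ℤ) (Sum.inl 0) 1 i := by
      have e1 : κ₂.val *ᵥ Pi.single (Sum.inl 0) 1 = Pi.single (Sum.inl 0) 1 := by
        rw [mulVec_single_one]
        ext (l | l) <;> simp [κ₂, Matrix.one_apply, Pi.single_apply]
      have e2 : κ₁.val *ᵥ Pi.single (Sum.inl 0) 1 = Pi.single (Sum.inl 0) 1 := by
        rw [mulVec_single_one]
        ext (l | l) <;> simp [κ₁, hW0, Pi.single_apply]
      have e3 : E₂ *ᵥ Pi.single (Sum.inl 0) 1 = Pi.single (Sum.inl 0) 1 := by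
        rw [hE₂, ← mulVec_mulVec, e1, ← mulVec_mulVec, e2, hcol]
      rw [← e3, mulVec_single_one]; rfl
    have hrow₂ (i) : E₂ (Sum.inl 0) i = Pi.single (M := fun _ => ℤ) (Sum.inl 0) 1 i := by
      rw [hE₂, Matrix.mul_apply, Fintype.sum_sum_type]
      simp only [hr]
      rcases i with l | l
      · simp [κ₂, Matrix.one_apply, Pi.single_apply]
      · simp only [κ₂, fromBlocks_apply₁₂, fromBlocks_apply₂₂]
        rw [Finset.sum_eq_single 0 (by intro b _ hb; simp [hb]) (by simp),
          Finset.sum_eq_single l (by intro b _ hb; simp [hb]) (by simp)]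
        simp [S, y]
    have hE₂s : IsIntSimilitude E₂ ((p : ℤ) ^ δ) := by
      rw [hE₂, hE₁]
      exact (((hEs.mul_of_mem γ.2).mul_mem (κ⁻¹).2).mul_mem κ₁.2).mul_mem κ₂.2
    have hsplit := eq_planeSum (pow_ne_zero _ hp0) hE₂s hcol₂ hrow₂
    generalize E₂.submatrix (Sum.map Fin.succ Fin.succ) (Sum.map Fin.succ Fin.succ) = X at hsplit
    obtain ⟨α, β, b, hb, hb2, hαβ⟩ := ih (isIntSimilitude_of_planeSum (hsplit ▸ hE₂s))
    refine ⟨stabilize α * γ, κ⁻¹ * κ₁ * κ₂ * stabilize β, Fin.cons k fun i => k + b i,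
      ?_, ?_, ?_⟩
    · intro i l
      refine Fin.cases ?_ (fun i => ?_) i <;> refine Fin.cases ?_ (fun l => ?_) l
      · simp
      · simp
      · intro h; exact absurd h (not_le.2 (Fin.succ_pos i))
      · intro h
        simpa using hb (Fin.succ_le_succ_iff.1 h)
    · intro i
      refine Fin.cases ?_ (fun i => ?_) i
      · simp
      · have := hb2 i
        simp only [Fin.cons_succ]
        omega
    · have : (stabilize α * γ).val * E * (κ⁻¹ * κ₁ * κ₂ * stabilize β).val =
          planeSum 1 0 0 ((p : ℤ) ^ δ) (diagonal (Sum.elim (fun i => (p : ℤ) ^ b i)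
            fun i => (p : ℤ) ^ (δ - b i))) := by
        calc _ = planeSum 1 0 0 1 α.val * E₂ * planeSum 1 0 0 1 β.val := by
              rw [hE₂, hE₁]
              simp only [Submonoid.coe_mul, Matrix.mul_assoc]; rfl
          _ = _ := by rw [hsplit, planeSum_mul, planeSum_mul, hαβ]; simp
      rw [hME, Matrix.mul_smul, Matrix.smul_mul, this, planeSum_smul]
      have hδ : 2 * k + δ - k = k + δ := by omega
      have hδ' (i) : 2 * k + δ - (k + b i) = k + (δ - b i) := by
        have := hb2 i
        omega
      ext (i | i) (l | l) <;> refine Fin.cases ?_ (fun i => ?_) i <;>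
        refine Fin.cases ?_ (fun l => ?_) l <;>
        simp [planeSum, Matrix.diagonal_apply, pow_add, (Fin.succ_ne_zero _).symm, toBlocks₁₁,
          toBlocks₁₂, toBlocks₂₁, toBlocks₂₂, hδ, hδ', -zsmul_eq_mul]

end IntegralSimilitudes

end

noncomputable section

/-! ### Rational matrices with integral entries, minors and triangular factors. -/

section RationalMatrices

variable {m : Type*} [Fintype m] [DecidableEq m]

/-- A rational matrix with integral entries. -/
def IsInt (M : Matrix m m ℚ) : Prop :=
  ∃ A : Matrix m m ℤ, A.map (Int.castRingHom ℚ) = M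

theorem isInt_iff {M : Matrix m m ℚ} : IsInt M ↔ ∀ i j, ∃ a : ℤ, (a : ℚ) = M i j := by
  constructor
  · rintro ⟨A, rfl⟩ i j
    exact ⟨A i j, rfl⟩
  · intro h
    choose A hA using h
    exact ⟨Matrix.of A, by ext i j; exact hA i j⟩

theorem IsInt.mul {M N : Matrix m m ℚ} (hM : IsInt M) (hN : IsInt N) : IsInt (M * N) := by
  obtain ⟨A, rfl⟩ := hM
  obtain ⟨B, rfl⟩ := hN
  exact ⟨A * B, Matrix.map_mul⟩

theorem isInt_zero : IsInt (0 : Matrix m m ℚ) := ⟨0, Matrix.map_zero _ (map_zero _)⟩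

theorem IsInt.transpose {M : Matrix m m ℚ} (hM : IsInt M) : IsInt Mᵀ := by
  obtain ⟨A, rfl⟩ := hM
  exact ⟨Aᵀ, (transpose_map).symm⟩

theorem isInt_fromBlocks {A B C D : Matrix m m ℚ} :
    IsInt (fromBlocks A B C D) ↔ IsInt A ∧ IsInt B ∧ IsInt C ∧ IsInt D := by
  constructor
  · intro h
    rw [isInt_iff] at h
    simp only [isInt_iff]
    exact ⟨fun i j => h (Sum.inl i) (Sum.inl j), fun i j => h (Sum.inl i) (Sum.inr j),
      fun i j => h (Sum.inr i) (Sum.inl j), fun i j => h (Sum.inr i) (Sum.inr j)⟩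
  · rintro ⟨⟨A, rfl⟩, ⟨B, rfl⟩, ⟨C, rfl⟩, ⟨D, rfl⟩⟩
    exact ⟨fromBlocks A B C D, fromBlocks_map _ _ _ _ _⟩

theorem map_intCast_injective {A B : Matrix m m ℤ}
    (h : A.map (Int.castRingHom ℚ) = B.map (Int.castRingHom ℚ)) : A = B :=
  Matrix.map_injective (RingHom.injective_int (Int.castRingHom ℚ)) h

theorem isUnit_of_isInt_inv {D E : Matrix m m ℚ} (hD : IsInt D) (hE : IsInt E) (h : D * E = 1) :
    ∃ U : GL m ℤ, U.val.map (Int.castRingHom ℚ) = D := by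
  obtain ⟨A, rfl⟩ := hD
  obtain ⟨B, rfl⟩ := hE
  have hAB : A * B = 1 := map_intCast_injective (by
    rw [Matrix.map_mul, h, Matrix.map_one _ (map_zero _) (map_one _)])
  exact ⟨⟨A, B, hAB, mul_eq_one_comm.1 hAB⟩, rfl⟩

variable {k : ℕ}

/-- The minors of a product are divisible by a common divisor of those of the right factor. -/
theorem dvd_minor_mul_left {c : ℤ} {N : Matrix m m ℤ}
    (h : ∀ f g : Fin k → m, c ∣ (N.submatrix f g).det) (M : Matrix m m ℤ) (f g : Fin k → m) :
    c ∣ ((M * N).submatrix f g).det := by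
  have e : (M * N).submatrix f g =
      Matrix.of fun i => ∑ l, M (f i) l • (N.submatrix id g) l := by
    ext i j
    simp [Matrix.mul_apply]
  have : ((M * N).submatrix f g).det =
      ∑ r : Fin k → m, (∏ i, M (f i) (r i)) * (N.submatrix r g).det := by
    rw [e]
    change (detRowAlternating.toMultilinearMap :
      MultilinearMap ℤ (fun _ : Fin k => Fin k → ℤ) ℤ)
        (fun i => ∑ l, M (f i) l • (N.submatrix id g) l) = _
    -- Expansion by multilinearity in the rows: the Cauchy–Binet formula before grouping, with all
    -- maps `r`, injective or not.
    rw [MultilinearMap.map_sum]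
    refine Finset.sum_congr rfl fun r _ => ?_
    rw [MultilinearMap.map_smul_univ]
    rfl
  rw [this]
  exact Finset.dvd_sum fun r _ => Dvd.dvd.mul_left (h r g) _

theorem dvd_minor_mul_right {c : ℤ} {N : Matrix m m ℤ}
    (h : ∀ f g : Fin k → m, c ∣ (N.submatrix f g).det) (M : Matrix m m ℤ) (f g : Fin k → m) :
    c ∣ ((N * M).submatrix f g).det := by
  have h' : ∀ f g : Fin k → m, c ∣ (Nᵀ.submatrix f g).det := fun f g => by
    rw [← transpose_submatrix, det_transpose]; exact h g f
  have := dvd_minor_mul_left h' Mᵀ g f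
  rwa [← transpose_mul, ← transpose_submatrix, det_transpose] at this

/-- A minor of `diag(ε)` with rows `f` is `∏ ε (f i)` times a minor of the unit matrix. A repeated
index in `f` gives two equal rows, so only injective `f` have to be tested. -/
theorem dvd_minor_diagonal {c : ℤ} {ε : m → ℤ}
    (h : ∀ f : Fin k → m, Function.Injective f → c ∣ ∏ i, ε (f i)) (f g : Fin k → m) :
    c ∣ ((diagonal ε).submatrix f g).det := by
  have e : (diagonal ε).submatrix f g =
      diagonal (ε ∘ f) * (1 : Matrix m m ℤ).submatrix f g := by
    ext i j
    rw [diagonal_mul, submatrix_apply, submatrix_apply, diagonal_apply, one_apply]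
    simp
  by_cases hf : Function.Injective f
  · rw [e, det_mul, det_diagonal]
    exact Dvd.dvd.mul_right (h f hf) _
  · simp only [Function.Injective, not_forall] at hf
    obtain ⟨i, j, hij, hne⟩ := hf
    rw [det_zero_of_row_eq hne (by ext l; simp [hij])]
    exact dvd_zero c

/-- A left factor of an upper triangular matrix by a nonsingular upper triangular one is upper
triangular. -/
theorem triangular_of_mul {n : ℕ} {X D T : Matrix (Fin n) (Fin n) ℚ} (h : X * D = T)
    (hD : D.BlockTriangular id) (hD0 : ∀ i, D i i ≠ 0) (hT : T.BlockTriangular id) :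
    X.BlockTriangular id ∧ ∀ i, X i i * D i i = T i i := by
  have hdet : IsUnit D.det := by
    rw [det_of_isUpperTriangular hD]
    exact (Finset.prod_ne_zero_iff.2 fun i _ => hD0 i).isUnit
  have hX : X = T * D⁻¹ := by rw [← h, mul_nonsing_inv_cancel_right _ _ hdet]
  have hXt : X.BlockTriangular id := by
    have : Invertible D := invertibleOfIsUnitDet D hdet
    rw [hX]
    exact hT.mul (blockTriangular_inv_of_blockTriangular hD)
  refine ⟨hXt, fun i => ?_⟩
  rw [← h, Matrix.mul_apply, Finset.sum_eq_single i]
  · intro j _ hj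
    rcases lt_or_gt_of_ne hj with h | h
    · rw [hXt h, zero_mul]
    · rw [hD h, mul_zero]
  · simp

end RationalMatrices

/-! ### Integral elements of `GSp` and their diagonal representatives. -/

section Similitudes

variable {n : ℕ}

theorem IsSimilitude.det_ne_zero {M : Matrix (Fin n ⊕ Fin n) (Fin n ⊕ Fin n) ℚ} {μ : ℚ}
    (hμ : μ ≠ 0) (h : IsSimilitude M μ) : M.det ≠ 0 := by
  intro h0
  have := congrArg det h
  rw [det_mul, h0, mul_zero, det_smul] at this
  exact mul_ne_zero (pow_ne_zero _ hμ) (isUnit_det_J (Fin n) ℚ).ne_zero this.symm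

/-- The element of `GSp` with a given matrix. -/
def ofMatrix (M : Matrix (Fin n ⊕ Fin n) (Fin n ⊕ Fin n) ℚ) (μ : ℚ) (hμ : 0 < μ)
    (h : IsSimilitude M μ) : GSp n :=
  ⟨GeneralLinearGroup.mkOfDetNeZero M (h.det_ne_zero hμ.ne'), μ, hμ, h⟩

theorem mat_injective : Function.Injective (mat : GSp n → _) := fun _ _ h =>
  Subtype.ext (Units.ext h)

theorem mat_diag (d e : Fin n → ℕ) (a : ℕ) (ha : a ≠ 0) (h : ∀ i, d i * e i = a) :
    mat (diag d e a ha h) =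
      diagonal (Sum.elim (fun i => (d i : ℚ)) (fun i => (e i : ℚ))) := rfl

theorem isSimilitude_diag (d e : Fin n → ℕ) (a : ℕ) (ha : a ≠ 0) (h : ∀ i, d i * e i = a) :
    IsSimilitude (mat (diag d e a ha h)) a := by
  have h' (i) : (d i : ℚ) * e i = a := by exact_mod_cast h i
  rw [IsSimilitude, mat_diag]
  ext (i | i) (j | j) <;>
    simp [J, Matrix.diagonal_mul, Matrix.mul_diagonal, Matrix.one_apply]
  · split_ifs with hij
    · rw [← hij]; exact h' i
    · rfl
  · split_ifs with hij
    · rw [← hij, mul_comm]; exact h' i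
    · rfl

theorem isSimilitude_map {M : Matrix (Fin n ⊕ Fin n) (Fin n ⊕ Fin n) ℤ} {μ : ℤ} :
    IsSimilitude (M.map (Int.castRingHom ℚ)) μ ↔ IsIntSimilitude M μ := by
  rw [IsSimilitude, IsIntSimilitude, ← map_J (Fin n) (Int.castRingHom ℚ), ← transpose_map,
    ← Matrix.map_mul, ← Matrix.map_mul]
  have : (μ : ℚ) • (J (Fin n) ℤ).map (Int.castRingHom ℚ) =
      (μ • J (Fin n) ℤ).map (Int.castRingHom ℚ) := by
    ext i j; simp [-zsmul_eq_mul]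
  rw [this]
  exact ⟨fun h => map_intCast_injective h, fun h => by rw [h]⟩

/-- An integral symplectic matrix as an element of `GSp`. -/
def ofSymplectic (γ : symplecticGroup (Fin n) ℤ) : GSp n :=
  ofMatrix (γ.val.map (Int.castRingHom ℚ)) 1 one_pos (by
    have := isSimilitude_map.2 (isIntSimilitude_one_iff.2 γ.2)
    rwa [Int.cast_one] at this)

theorem ofSymplectic_mem (γ : symplecticGroup (Fin n) ℤ) : ofSymplectic γ ∈ Sp n :=
  ⟨γ.val, γ.2, rfl⟩

/-- In rank zero the condition is empty and every number is a multiplier, hence `NeZero n`. -/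
theorem isSimilitude_unique [NeZero n] {M : Matrix (Fin n ⊕ Fin n) (Fin n ⊕ Fin n) ℚ} {μ ν : ℚ}
    (h : IsSimilitude M μ) (h' : IsSimilitude M ν) : μ = ν := by
  have := congrFun (congrFun (h.symm.trans h') (Sum.inr 0)) (Sum.inl 0)
  simpa [J] using this

variable (p : ℕ) [hp : Fact p.Prime]

variable (n) in
/-- The integral elements of `GSp` with multiplier `p ^ δ`. -/
def integralSet (δ : ℕ) : Set (GSp n) :=
  {M | IsSimilitude (mat M) ((p : ℚ) ^ δ) ∧ IsInt (mat M)}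

variable {p}

theorem isInt_of_mem_Sp {γ : GSp n} (h : γ ∈ Sp n) : IsInt (mat γ) := ((mem_Sp_iff γ).1 h).2

theorem integralSet_mul {δ ε : ℕ} {M N : GSp n} (hM : M ∈ integralSet n p δ)
    (hN : N ∈ integralSet n p ε) : M * N ∈ integralSet n p (δ + ε) := by
  refine ⟨?_, hM.2.mul hN.2⟩
  rw [pow_add, mat_mul]
  exact hM.1.mul hN.1

theorem mem_integralSet_zero {γ : GSp n} : γ ∈ integralSet n p 0 ↔ γ ∈ Sp n := by
  rw [mem_Sp_iff, integralSet, Set.mem_ofPred_eq, pow_zero]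
  rfl

theorem mul_mem_integralSet {δ : ℕ} {γ M : GSp n} (hγ : γ ∈ Sp n) (hM : M ∈ integralSet n p δ) :
    γ * M ∈ integralSet n p δ := by
  simpa using integralSet_mul (mem_integralSet_zero.2 hγ) hM

theorem integralSet_mul_mem {δ : ℕ} {γ M : GSp n} (hγ : γ ∈ Sp n) (hM : M ∈ integralSet n p δ) :
    M * γ ∈ integralSet n p δ := by
  simpa using integralSet_mul hM (mem_integralSet_zero.2 hγ)

theorem integralSet_unique [NeZero n] {δ ε : ℕ} {M : GSp n} (h : M ∈ integralSet n p δ)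
    (h' : M ∈ integralSet n p ε) : δ = ε := by
  have := isSimilitude_unique h.1 h'.1
  exact Nat.pow_right_injective hp.out.two_le (by exact_mod_cast this)

variable (p) in
/-- The element `diag(p ^ a₁, …, p ^ aₙ; p ^ (δ - a₁), …, p ^ (δ - aₙ))` of `GSp`. -/
def powDiag (δ : ℕ) (a : Fin n → ℕ) (h : ∀ i, a i ≤ δ) : GSp n :=
  diag (fun i => p ^ a i) (fun i => p ^ (δ - a i)) (p ^ δ) (pow_ne_zero δ hp.out.ne_zero)
    fun i => by rw [← pow_add, Nat.add_sub_cancel' (h i)]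

theorem mat_powDiag (δ : ℕ) (a : Fin n → ℕ) (h : ∀ i, a i ≤ δ) :
    mat (powDiag p δ a h) = (diagonal (Sum.elim (fun i => (p : ℤ) ^ a i)
        fun i => (p : ℤ) ^ (δ - a i))).map (Int.castRingHom ℚ) := by
  rw [powDiag, mat_diag, diagonal_map (map_zero _)]
  congr 1
  ext (i | i) <;> simp

theorem diag_mem_integralSet {δ : ℕ} (d e : Fin n → ℕ) (ha : p ^ δ ≠ 0)
    (h : ∀ i, d i * e i = p ^ δ) : diag d e (p ^ δ) ha h ∈ integralSet n p δ := by
  constructor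
  · have := isSimilitude_diag d e (p ^ δ) ha h
    rwa [Nat.cast_pow] at this
  · refine ⟨diagonal (Sum.elim (fun i => (d i : ℤ)) (fun i => (e i : ℤ))), ?_⟩
    rw [mat_diag, diagonal_map (map_zero _)]
    congr 1
    ext (i | i) <;> simp

theorem powDiag_mem (δ : ℕ) (a : Fin n → ℕ) (h : ∀ i, a i ≤ δ) :
    powDiag p δ a h ∈ integralSet n p δ := diag_mem_integralSet _ _ _ _

/-- The symplectic elementary divisor theorem, transported to `GSp`. Since coefficients are constant
on double cosets, every computation with them reduces to the matrices `powDiag`. -/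
theorem exists_eq_mul_powDiag_mul {δ : ℕ} {M : GSp n} (hM : M ∈ integralSet n p δ) :
    ∃ γ ∈ Sp n, ∃ γ' ∈ Sp n, ∃ (a : Fin n → ℕ) (h : ∀ i, a i ≤ δ), Monotone a ∧
      (∀ i, 2 * a i ≤ δ) ∧ M = γ * powDiag p δ a h * γ' := by
  obtain ⟨hs, A, hA⟩ := hM
  have hA' : IsIntSimilitude A ((p : ℤ) ^ δ) := by
    rw [← isSimilitude_map, hA]; exact_mod_cast hs
  obtain ⟨γ, γ', a, ha, h2, e⟩ := exists_symplectic_smith p hA'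
  have hle (i) : a i ≤ δ := by have := h2 i; omega
  refine ⟨(ofSymplectic γ)⁻¹, inv_mem (ofSymplectic_mem γ), (ofSymplectic γ')⁻¹,
    inv_mem (ofSymplectic_mem γ'), a, hle, ha, h2, ?_⟩
  rw [eq_mul_inv_iff_mul_eq, eq_inv_mul_iff_mul_eq]
  apply mat_injective
  rw [mat_powDiag, ← e, Matrix.map_mul, Matrix.map_mul, hA, mat_mul, mat_mul, Matrix.mul_assoc]
  rfl

theorem exists_blockTriangular_rep {δ : ℕ} {M : GSp n} (hM : M ∈ integralSet n p δ) :
    ∃ γ ∈ Sp n, ∃ A B D, mat (γ * M) = fromBlocks A B 0 D := by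
  obtain ⟨hs, A, hA⟩ := hM
  have hA' : IsIntSimilitude A ((p : ℤ) ^ δ) := by
    rw [← isSimilitude_map, hA]; exact_mod_cast hs
  obtain ⟨γ, e⟩ := exists_blockTriangular
    (pow_ne_zero δ (by exact_mod_cast hp.out.ne_zero)) hA'
  refine ⟨ofSymplectic γ, ofSymplectic_mem γ, (mat (ofSymplectic γ * M)).toBlocks₁₁,
    (mat (ofSymplectic γ * M)).toBlocks₁₂, (mat (ofSymplectic γ * M)).toBlocks₂₂, ?_⟩
  have h0 : (mat (ofSymplectic γ * M)).toBlocks₂₁ = 0 := by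
    have : mat (ofSymplectic γ * M) = (γ.val * A).map (Int.castRingHom ℚ) := by
      rw [Matrix.map_mul, hA]; rfl
    rw [this]
    ext i j
    have := congrFun (congrFun e i) j
    simp only [toBlocks₂₁, Matrix.of_apply, Matrix.zero_apply] at this
    simp [toBlocks₂₁, this]
  conv_lhs => rw [← fromBlocks_toBlocks (mat (ofSymplectic γ * M)), h0]

/-- So `D` and the multiplier determine `A`, and the freedom in `B` is that of a symmetric matrix `B
D⁻¹`; this is what is counted in the fibres of `toGL`. -/
theorem isSimilitude_fromBlocks {A B D : Matrix (Fin n) (Fin n) ℚ} {μ : ℚ} :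
    IsSimilitude (fromBlocks A B 0 D) μ ↔ Aᵀ * D = μ • 1 ∧ Bᵀ * D = Dᵀ * B := by
  have h1 : (fromBlocks A B 0 D)ᵀ * J (Fin n) ℚ * fromBlocks A B 0 D =
      fromBlocks 0 (-(Aᵀ * D)) (Dᵀ * A) (Dᵀ * B - Bᵀ * D) := by
    rw [J, fromBlocks_transpose, fromBlocks_multiply, fromBlocks_multiply]
    simp [sub_eq_add_neg]
  rw [IsSimilitude, h1, J, fromBlocks_smul, fromBlocks_inj]
  simp only [smul_zero, true_and, smul_neg, neg_inj, sub_eq_zero]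
  constructor
  · rintro ⟨h, -, h'⟩
    exact ⟨h, h'.symm⟩
  · rintro ⟨h, h'⟩
    refine ⟨h, ?_, h'.symm⟩
    have := congrArg Matrix.transpose h
    simpa using this

end Similitudes

end

noncomputable section

theorem map_intCast_smul_one {m : Type*} [DecidableEq m] (c : ℤ) :
    ((c • 1 : Matrix m m ℤ)).map (Int.castRingHom ℚ) = (c : ℚ) • 1 := by
  ext i j
  rw [Matrix.map_apply, Matrix.smul_apply, Matrix.smul_apply, smul_eq_mul, smul_eq_mul, map_mul,
    one_apply, one_apply]
  split_ifs <;> simp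

/-! ### Unimodular cosets, Hermite exponents and the weights on the `GLₙ` side. -/

section GeneralLinear

variable (n : ℕ)

/-- The group of unimodular matrices, as a subgroup of `GL(ℚ)`. -/
def GLZ : Subgroup (GL (Fin n) ℚ) := (GeneralLinearGroup.map (Int.castRingHom ℚ)).range

variable {n}

theorem mem_GLZ_iff {g : GL (Fin n) ℚ} :
    g ∈ GLZ n ↔ IsInt g.val ∧ IsInt (g⁻¹ : GL (Fin n) ℚ).val := by
  constructor
  · rintro ⟨U, rfl⟩
    refine ⟨⟨U.val, rfl⟩, ?_⟩
    rw [← map_inv]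
    exact ⟨_, rfl⟩
  · rintro ⟨h, h'⟩
    obtain ⟨U, hU⟩ := isUnit_of_isInt_inv h h' (Units.mul_inv g)
    exact ⟨U, Units.ext hU⟩

theorem map_mem_GLZ (U : GL (Fin n) ℤ) :
    GeneralLinearGroup.map (Int.castRingHom ℚ) U ∈ GLZ n := ⟨U, rfl⟩

theorem val_map_intCast (U : GL (Fin n) ℤ) :
    (GeneralLinearGroup.map (Int.castRingHom ℚ) U).val = U.val.map (Int.castRingHom ℚ) := rfl

variable (p : ℕ) [hp : Fact p.Prime]

variable (n) in
/-- The integral matrices dividing a power of `p`. -/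
def glIntegral : Set (GL (Fin n) ℚ) :=
  {g | IsInt g.val ∧ ∃ K : ℕ, IsInt ((p : ℚ) ^ K • (g⁻¹ : GL (Fin n) ℚ).val)}

variable {p}

theorem glIntegral_mul {g h : GL (Fin n) ℚ} (hg : g ∈ glIntegral n p) (hh : h ∈ glIntegral n p) :
    g * h ∈ glIntegral n p := by
  obtain ⟨h1, K, h2⟩ := hg
  obtain ⟨h3, L, h4⟩ := hh
  refine ⟨h1.mul h3, K + L, ?_⟩
  rw [_root_.mul_inv_rev, Units.val_mul, pow_add, mul_comm, mul_smul, ← Matrix.mul_smul,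
    ← Matrix.smul_mul]
  exact h4.mul h2

theorem glIntegral_of_mem_GLZ {g : GL (Fin n) ℚ} (hg : g ∈ GLZ n) : g ∈ glIntegral n p :=
  ⟨(mem_GLZ_iff.1 hg).1, 0, by rw [pow_zero, one_smul]; exact (mem_GLZ_iff.1 hg).2⟩

theorem glIntegral_of_coset_eq {g h : GL (Fin n) ℚ} (e : coset (GLZ n) g = coset (GLZ n) h)
    (hg : g ∈ glIntegral n p) : h ∈ glIntegral n p := by
  obtain ⟨γ, hγ, rfl⟩ := coset_eq_coset_iff_exists.1 e
  exact glIntegral_mul (glIntegral_of_mem_GLZ hγ) hg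

variable (p) in
/-- An upper triangular matrix with the diagonal `p ^ d₁, …, p ^ dₙ`. -/
def IsTri (g : GL (Fin n) ℚ) (d : Fin n → ℕ) : Prop :=
  g.val.BlockTriangular id ∧ ∀ i, g.val i i = (p : ℚ) ^ d i

theorem IsTri.mul {g h : GL (Fin n) ℚ} {d e : Fin n → ℕ} (hg : IsTri p g d) (hh : IsTri p h e) :
    IsTri p (g * h) (d + e) := by
  refine ⟨hg.1.mul hh.1, fun i => ?_⟩
  rw [Units.val_mul, Matrix.mul_apply, Finset.sum_eq_single i, hg.2, hh.2, Pi.add_apply, pow_add]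
  · intro j _ hj
    rcases lt_or_gt_of_ne hj with h | h
    · rw [hg.1 h, zero_mul]
    · rw [hh.1 h, mul_zero]
  · simp

theorem isTri_one : IsTri p (1 : GL (Fin n) ℚ) 0 :=
  ⟨blockTriangular_one, fun i => by simp⟩

/-- The unimodular matrix connecting two triangular ones is itself triangular, and its integral
diagonal entries are the quotients `p ^ eᵢ / p ^ dᵢ`. -/
theorem IsTri.le_of_coset_eq {g h : GL (Fin n) ℚ} {d e : Fin n → ℕ} (hg : IsTri p g d)
    (hh : IsTri p h e) (H : coset (GLZ n) g = coset (GLZ n) h) (i : Fin n) : d i ≤ e i := by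
  obtain ⟨γ, hγ, rfl⟩ := coset_eq_coset_iff_exists.1 H
  have hp0 : (p : ℚ) ≠ 0 := by exact_mod_cast hp.out.ne_zero
  have h1 := (triangular_of_mul (X := γ.val) (D := g.val) rfl hg.1
    (fun i => by rw [hg.2]; exact pow_ne_zero _ hp0) hh.1).2 i
  obtain ⟨a, ha⟩ := isInt_iff.1 (mem_GLZ_iff.1 hγ).1 i i
  rw [← Units.val_mul, hh.2, hg.2, ← ha] at h1
  have h2 : a * (p : ℤ) ^ d i = (p : ℤ) ^ e i := by exact_mod_cast h1
  have h3 : (p : ℤ) ^ d i ∣ (p : ℤ) ^ e i := ⟨a, by rw [← h2, mul_comm]⟩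
  exact (Nat.pow_dvd_pow_iff_le_right hp.out.one_lt).1 (by exact_mod_cast h3)

theorem IsTri.unique {g h : GL (Fin n) ℚ} {d e : Fin n → ℕ} (hg : IsTri p g d)
    (hh : IsTri p h e) (H : coset (GLZ n) g = coset (GLZ n) h) : d = e :=
  funext fun i => le_antisymm (hg.le_of_coset_eq hh H i) (hh.le_of_coset_eq hg H.symm i)

/-- In the Hermite form the diagonal entries are positive, and they divide `p ^ K` because `p ^ K
g⁻¹` is integral and triangular factors multiply on the diagonal. -/
theorem exists_isTri {g : GL (Fin n) ℚ} (hg : g ∈ glIntegral n p) :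
    ∃ γ ∈ GLZ n, ∃ d, IsTri p (γ * g) d := by
  obtain ⟨⟨A, hA⟩, K, B, hB⟩ := hg
  have hp0 : (p : ℤ) ≠ 0 := by exact_mod_cast hp.out.ne_zero
  have hAB : B * A = (p : ℤ) ^ K • 1 := map_intCast_injective (by
    rw [Matrix.map_mul, hA, hB, Matrix.smul_mul, Units.inv_mul, map_intCast_smul_one,
      Int.cast_pow, Int.cast_natCast])
  have hdet : A.det ≠ 0 := by
    intro h0
    have := congrArg det hAB
    rw [det_mul, h0, mul_zero, det_smul, det_one, mul_one] at this
    exact pow_ne_zero _ (pow_ne_zero _ hp0) this.symm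
  obtain ⟨U, hU, hpos⟩ := exists_hermite A hdet
  have hval : (GeneralLinearGroup.map (Int.castRingHom ℚ) U * g).val =
      (U.val * A).map (Int.castRingHom ℚ) := by
    rw [Matrix.map_mul, hA]; rfl
  have htri : ((U.val * A).map (Int.castRingHom ℚ)).BlockTriangular id :=
    fun i j hij => by rw [Matrix.map_apply, hU hij, map_zero]
  have key (i) : ∃ d : ℕ, (U.val * A) i i = (p : ℤ) ^ d := by
    have h1 : (B * (U⁻¹ : GL (Fin n) ℤ).val) * (U.val * A) = (p : ℤ) ^ K • 1 := by
      rw [Matrix.mul_assoc, ← Matrix.mul_assoc _ U.val, Units.inv_mul, Matrix.one_mul, hAB]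
    have h2 : (B * (U⁻¹ : GL (Fin n) ℤ).val).map (Int.castRingHom ℚ) *
        (U.val * A).map (Int.castRingHom ℚ) = (p : ℚ) ^ K • 1 := by
      rw [← Matrix.map_mul, h1, map_intCast_smul_one, Int.cast_pow, Int.cast_natCast]
    have h3 := (triangular_of_mul h2 htri (fun i => by
      simpa using (hpos i).ne') (by
        intro i j hij
        simp only [id] at hij
        simp [hij.ne'])).2 i
    rw [Matrix.map_apply, Matrix.map_apply, Matrix.smul_apply, one_apply_eq, smul_eq_mul, mul_one,
      eq_intCast, eq_intCast] at h3
    have h4 : (U.val * A) i i ∣ (p : ℤ) ^ K := ⟨(B * (U⁻¹ : GL (Fin n) ℤ).val) i i, by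
      rw [mul_comm]; exact_mod_cast h3.symm⟩
    obtain ⟨d, -, hd⟩ := (dvd_prime_pow (Nat.prime_iff_prime_int.1 hp.out) K).1 h4
    exact ⟨d, Int.eq_of_associated_of_nonneg hd (hpos i).le (by positivity)⟩
  choose d hd using key
  refine ⟨_, map_mem_GLZ U, d, ?_, fun i => ?_⟩
  · rw [hval]; exact htri
  · rw [hval, Matrix.map_apply, hd]; simp

variable (p) in
open Classical in
/-- The monomial `∏ᵢ (xᵢ p ^ (-i)) ^ dᵢ` attached to the coset modulo `GLₙ(ℤ)` of an upper
triangular matrix with the diagonal `p ^ d₁, …, p ^ dₙ`. -/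
def glWeight (c : Cosets (GLZ n)) : MvPolynomial (Fin (n + 1)) ℚ :=
  if h : ∃ d : Fin n → ℕ, ∃ g, coset (GLZ n) g = c ∧ IsTri p g d then
    ∏ i : Fin n, (MvPolynomial.C (((p : ℚ) ^ ((i : ℕ) + 1))⁻¹) * MvPolynomial.X i.succ) ^
      h.choose i
  else 0

theorem glWeight_coset {g : GL (Fin n) ℚ} {d : Fin n → ℕ} (h : IsTri p g d) :
    glWeight p (coset (GLZ n) g) =
      ∏ i : Fin n, (MvPolynomial.C (((p : ℚ) ^ ((i : ℕ) + 1))⁻¹) * MvPolynomial.X i.succ) ^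
        d i := by
  have hex : ∃ d : Fin n → ℕ, ∃ g', coset (GLZ n) g' = coset (GLZ n) g ∧ IsTri p g' d :=
    ⟨d, g, rfl, h⟩
  obtain ⟨g', e, h'⟩ := hex.choose_spec
  rw [glWeight, dif_pos hex, h'.unique h e]

theorem glWeight_mul {g h : GL (Fin n) ℚ} {d e : Fin n → ℕ} (hg : IsTri p g d)
    (hh : IsTri p h e) : glWeight p (coset (GLZ n) (g * h)) =
      glWeight p (coset (GLZ n) g) * glWeight p (coset (GLZ n) h) := by
  rw [glWeight_coset (hg.mul hh), glWeight_coset hg, glWeight_coset hh,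
    ← Finset.prod_mul_distrib]
  simp only [Pi.add_apply, pow_add]

theorem supportedOn_isTri {t : Cosets (GLZ n) →₀ ℤ} (ht : SupportedOn (glIntegral n p) t) :
    SupportedOn {g | ∃ d, IsTri p g d} t := by
  intro c hc
  obtain ⟨g, hg, rfl⟩ := ht c hc
  obtain ⟨γ, hγ, h⟩ := exists_isTri hg
  exact ⟨γ * g, h, coset_mul_left hγ g⟩

theorem weightSum_glWeight_mul {t s : HeckeRing (GLZ n)}
    (ht : SupportedOn (glIntegral n p) t.toCosets)
    (hs : SupportedOn (glIntegral n p) s.toCosets) :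
    weightSum (glWeight p) (t * s).toCosets =
      weightSum (glWeight p) t.toCosets * weightSum (glWeight p) s.toCosets :=
  weightSum_mul _ {g | ∃ d, IsTri p g d}
    (by rintro g ⟨d, hd⟩ h ⟨e, he⟩; exact glWeight_mul hd he)
    (supportedOn_isTri ht) (supportedOn_isTri hs)

end GeneralLinear

/-! ### The Siegel parabolic subgroup and the factorization of the spherical map through `GLₙ`. -/

section Parabolic

variable {n : ℕ}

/-- A similitude with vanishing lower left block. -/
def IsBlockTri (M : GSp n) : Prop := ∃ A B D, mat M = fromBlocks A B 0 D

theorem IsBlockTri.mul {M N : GSp n} (hM : IsBlockTri M) (hN : IsBlockTri N) :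
    IsBlockTri (M * N) := by
  obtain ⟨A, B, D, h⟩ := hM
  obtain ⟨A', B', D', h'⟩ := hN
  refine ⟨A * A', A * B' + B * D', D * D', ?_⟩
  rw [mat_mul, h, h', fromBlocks_multiply]
  simp

theorem mat_inv {M : GSp n} {μ : ℚ} (hμ : μ ≠ 0) (h : IsSimilitude (mat M) μ) :
    mat M⁻¹ = μ⁻¹ • (-J (Fin n) ℚ * (mat M)ᵀ * J (Fin n) ℚ) := by
  have h1 : (-J (Fin n) ℚ * (mat M)ᵀ * J (Fin n) ℚ) * mat M = μ • 1 := by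
    unfold IsSimilitude at h
    rw [Matrix.mul_assoc (-J (Fin n) ℚ), Matrix.mul_assoc (-J (Fin n) ℚ), h, Matrix.mul_smul,
      Matrix.neg_mul, J_squared, neg_neg]
  calc mat M⁻¹ = (μ⁻¹ • (-J (Fin n) ℚ * (mat M)ᵀ * J (Fin n) ℚ) * mat M) * mat M⁻¹ := by
        rw [Matrix.smul_mul, h1, smul_smul, inv_mul_cancel₀ hμ, one_smul, Matrix.one_mul]
    _ = _ := by rw [Matrix.mul_assoc, mat_mul_inv, Matrix.mul_one]

theorem mat_inv_fromBlocks {M : GSp n} {μ : ℚ} (hμ : μ ≠ 0) (h : IsSimilitude (mat M) μ)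
    {A B D : Matrix (Fin n) (Fin n) ℚ} (hM : mat M = fromBlocks A B 0 D) :
    mat M⁻¹ = μ⁻¹ • fromBlocks Dᵀ (-Bᵀ) 0 Aᵀ := by
  rw [mat_inv hμ h, hM, J, fromBlocks_transpose, fromBlocks_neg, fromBlocks_multiply,
    fromBlocks_multiply]
  simp

theorem IsBlockTri.inv {M : GSp n} (hM : IsBlockTri M) : IsBlockTri M⁻¹ := by
  obtain ⟨A, B, D, h⟩ := hM
  obtain ⟨μ, hμ, hs⟩ := M.2
  exact ⟨_, _, _, by rw [mat_inv_fromBlocks hμ.ne' hs h, fromBlocks_smul, smul_zero]⟩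

open Classical in
/-- The lower right block of a similitude, as an invertible matrix. -/
def lowerBlock (M : GSp n) : GL (Fin n) ℚ :=
  if h : (mat M).toBlocks₂₂.det ≠ 0 then
    GeneralLinearGroup.mkOfDetNeZero (mat M).toBlocks₂₂ h
  else 1

theorem lowerBlock_val {M : GSp n} {A B D : Matrix (Fin n) (Fin n) ℚ}
    (h : mat M = fromBlocks A B 0 D) : (lowerBlock M).val = D := by
  have hD : (mat M).toBlocks₂₂.det ≠ 0 := by
    obtain ⟨μ, hμ, hs⟩ := M.2
    have := IsSimilitude.det_ne_zero (M := mat M) hμ.ne' hs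
    rw [h, det_fromBlocks_zero₂₁] at this
    rw [h, toBlocks_fromBlocks₂₂]
    exact right_ne_zero_of_mul this
  rw [lowerBlock, dif_pos hD]
  change (mat M).toBlocks₂₂ = D
  rw [h, toBlocks_fromBlocks₂₂]

theorem lowerBlock_mul {M N : GSp n} (hM : IsBlockTri M) (hN : IsBlockTri N) :
    lowerBlock (M * N) = lowerBlock M * lowerBlock N := by
  obtain ⟨A, B, D, h⟩ := hM
  obtain ⟨A', B', D', h'⟩ := hN
  have : mat (M * N) = fromBlocks (A * A') (A * B' + B * D') 0 (D * D') := by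
    rw [mat_mul, h, h', fromBlocks_multiply]; simp
  apply Units.ext
  rw [lowerBlock_val this, Units.val_mul, lowerBlock_val h, lowerBlock_val h']

theorem isBlockTri_one : IsBlockTri (1 : GSp n) := ⟨1, 0, 1, by rw [mat_one, fromBlocks_one]⟩

theorem lowerBlock_one : lowerBlock (1 : GSp n) = 1 :=
  Units.ext (lowerBlock_val (A := 1) (B := 0) (by
    rw [mat_one, Units.val_one, fromBlocks_one]))

theorem lowerBlock_inv {M : GSp n} (hM : IsBlockTri M) : lowerBlock M⁻¹ = (lowerBlock M)⁻¹ := by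
  rw [eq_inv_iff_mul_eq_one, ← lowerBlock_mul hM.inv hM, inv_mul_cancel, lowerBlock_one]

theorem isInt_lowerBlock {M : GSp n} (hM : IsBlockTri M) (h : IsInt (mat M)) :
    IsInt (lowerBlock M).val := by
  obtain ⟨A, B, D, e⟩ := hM
  rw [lowerBlock_val e]
  rw [e, isInt_fromBlocks] at h
  exact h.2.2.2

theorem lowerBlock_mem_GLZ {γ : GSp n} (hγ : γ ∈ Sp n) (h : IsBlockTri γ) :
    lowerBlock γ ∈ GLZ n := by
  rw [mem_GLZ_iff, ← lowerBlock_inv h]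
  exact ⟨isInt_lowerBlock h (isInt_of_mem_Sp hγ),
    isInt_lowerBlock h.inv (isInt_of_mem_Sp (inv_mem hγ))⟩

theorem coset_lowerBlock_eq {M N : GSp n} (hM : IsBlockTri M) (hN : IsBlockTri N)
    (h : coset (Sp n) M = coset (Sp n) N) :
    coset (GLZ n) (lowerBlock M) = coset (GLZ n) (lowerBlock N) := by
  rw [coset_eq_iff] at h ⊢
  rw [← lowerBlock_inv hM, ← lowerBlock_mul hN hM.inv]
  exact lowerBlock_mem_GLZ h (hN.mul hM.inv)

open Classical in
/-- The map `Γ (A B; 0 D) ↦ GLₙ(ℤ) D`. -/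
def toGL (c : Cosets (Sp n)) : Cosets (GLZ n) :=
  if h : ∃ M, IsBlockTri M ∧ coset (Sp n) M = c then coset (GLZ n) (lowerBlock h.choose)
  else coset (GLZ n) 1

theorem toGL_coset {M : GSp n} (hM : IsBlockTri M) :
    toGL (coset (Sp n) M) = coset (GLZ n) (lowerBlock M) := by
  have hex : ∃ N, IsBlockTri N ∧ coset (Sp n) N = coset (Sp n) M := ⟨M, hM, rfl⟩
  rw [toGL, dif_pos hex]
  exact coset_lowerBlock_eq hex.choose_spec.1 hM hex.choose_spec.2

/-- The Levi element `(ᵗU⁻¹ 0; 0 U)`. -/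
def levi (U : GL (Fin n) ℚ) : GSp n :=
  ofMatrix (fromBlocks (U⁻¹ : GL (Fin n) ℚ).valᵀ 0 0 U.val) 1 one_pos (by
    rw [isSimilitude_fromBlocks]
    simp)

theorem mat_levi (U : GL (Fin n) ℚ) :
    mat (levi U) = fromBlocks (U⁻¹ : GL (Fin n) ℚ).valᵀ 0 0 U.val := rfl

theorem isBlockTri_levi (U : GL (Fin n) ℚ) : IsBlockTri (levi U) := ⟨_, _, _, mat_levi U⟩

theorem lowerBlock_levi (U : GL (Fin n) ℚ) : lowerBlock (levi U) = U :=
  Units.ext (lowerBlock_val (mat_levi U))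

theorem levi_mem {U : GL (Fin n) ℚ} (hU : U ∈ GLZ n) : levi U ∈ Sp n := by
  rw [mem_Sp_iff]
  rw [mem_GLZ_iff] at hU
  refine ⟨?_, ?_⟩
  · rw [mat_levi, isSimilitude_fromBlocks]
    simp
  · rw [mat_levi]
    exact isInt_fromBlocks.2 ⟨hU.2.transpose, isInt_zero, isInt_zero, hU.1⟩

variable {p : ℕ} [hp : Fact p.Prime]

theorem lowerBlock_mem_glIntegral {δ : ℕ} {M : GSp n} (hM : M ∈ integralSet n p δ)
    (h : IsBlockTri M) : lowerBlock M ∈ glIntegral n p := by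
  refine ⟨isInt_lowerBlock h hM.2, δ, ?_⟩
  have hp0 : (p : ℚ) ^ δ ≠ 0 := pow_ne_zero _ (by exact_mod_cast hp.out.ne_zero)
  obtain ⟨A, B, D, e⟩ := h
  have e' : mat M⁻¹ =
      fromBlocks (((p : ℚ) ^ δ)⁻¹ • Dᵀ) (((p : ℚ) ^ δ)⁻¹ • -Bᵀ) 0 (((p : ℚ) ^ δ)⁻¹ • Aᵀ) := by
    rw [mat_inv_fromBlocks hp0 hM.1 e, fromBlocks_smul, smul_zero]
  rw [← lowerBlock_inv ⟨A, B, D, e⟩, lowerBlock_val e', smul_smul, mul_inv_cancel₀ hp0, one_smul]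
  have := hM.2
  rw [e, isInt_fromBlocks] at this
  exact this.1.transpose

theorem exists_isBlockTri {δ : ℕ} {M : GSp n} (hM : M ∈ integralSet n p δ) :
    ∃ γ ∈ Sp n, IsBlockTri (γ * M) ∧ ∃ d, IsTri p (lowerBlock (γ * M)) d := by
  obtain ⟨γ, hγ, A, B, D, e⟩ := exists_blockTriangular_rep hM
  have h1 : IsBlockTri (γ * M) := ⟨A, B, D, e⟩
  obtain ⟨U, hU, d, hd⟩ := exists_isTri (lowerBlock_mem_glIntegral (mul_mem_integralSet hγ hM) h1)
  refine ⟨levi U * γ, mul_mem (levi_mem hU) hγ, ?_, d, ?_⟩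
  · rw [mul_assoc]; exact (isBlockTri_levi U).mul h1
  · rwa [mul_assoc, lowerBlock_mul (isBlockTri_levi U) h1, lowerBlock_levi]

theorem isTriangular_iff {M : GSp n} {δ : ℕ} {d : Fin n → ℕ} :
    IsTriangular p M δ d ↔ IsSimilitude (mat M) ((p : ℚ) ^ δ) ∧ IsBlockTri M ∧
      IsTri p (lowerBlock M) d := by
  constructor
  · rintro ⟨h, A, B, D, e, h1, h2⟩
    refine ⟨h, ⟨A, B, D, e⟩, ?_⟩
    rw [IsTri, lowerBlock_val e]
    exact ⟨h1, h2⟩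
  · rintro ⟨h, ⟨A, B, D, e⟩, h1⟩
    rw [IsTri, lowerBlock_val e] at h1
    exact ⟨h, A, B, D, e, h1.1, h1.2⟩

theorem isSimilitude_of_coset_eq {M N : GSp n} (e : coset (Sp n) M = coset (Sp n) N) {μ : ℚ}
    (h : IsSimilitude (mat M) μ) : IsSimilitude (mat N) μ := by
  obtain ⟨γ, hγ, rfl⟩ := coset_eq_coset_iff_exists.1 e
  simpa [mat_mul] using ((mem_Sp_iff γ).1 hγ).1.mul h

/-- The exponents chosen in `cosetOmega` are forced: `d` by the uniqueness of the Hermite diagonal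
of the lower block, and `δ` by the uniqueness of the multiplier. -/
theorem cosetOmega_coset [NeZero n] {M : GSp n} {δ : ℕ} {d : Fin n → ℕ}
    (h : IsTriangular p M δ d) :
    cosetOmega p (coset (Sp n) M) = MvPolynomial.X 0 ^ δ *
      ∏ i : Fin n, (MvPolynomial.C (((p : ℚ) ^ ((i : ℕ) + 1))⁻¹) * MvPolynomial.X i.succ) ^
        d i := by
  have hex : ∃ e : ℕ × (Fin n → ℕ), ∃ N : GSp n, coset (Sp n) N = coset (Sp n) M ∧
      IsTriangular p N e.1 e.2 := ⟨(δ, d), M, rfl, h⟩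
  obtain ⟨N, e, h'⟩ := hex.choose_spec
  rw [isTriangular_iff] at h h'
  have h1 : hex.choose.2 = d := h'.2.2.unique h.2.2 (coset_lowerBlock_eq h'.2.1 h.2.1 e)
  have h2 : hex.choose.1 = δ := by
    have := isSimilitude_unique (isSimilitude_of_coset_eq e h'.1) h.1
    exact Nat.pow_right_injective hp.out.two_le (by exact_mod_cast this)
  rw [cosetOmega, dif_pos hex, h1, h2]

/-- The weight sees only the multiplier and the `GLₙ(ℤ)`-coset of `D`, so the block `B` enters later
only through a count. -/
theorem cosetOmega_eq [NeZero n] {M : GSp n} {δ : ℕ} (h : M ∈ integralSet n p δ) :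
    cosetOmega p (coset (Sp n) M) =
      MvPolynomial.X 0 ^ δ * glWeight p (toGL (coset (Sp n) M)) := by
  obtain ⟨γ, hγ, h1, d, hd⟩ := exists_isBlockTri h
  rw [← coset_mul_left hγ M, toGL_coset h1, glWeight_coset hd,
    cosetOmega_coset (isTriangular_iff.2 ⟨(mul_mem_integralSet hγ h).1, h1, hd⟩)]

variable (n p) in
/-- The integral elements of `GSp` whose multiplier is a power of `p`. -/
def integralUnion : Set (GSp n) := {M | ∃ δ, M ∈ integralSet n p δ}

/-- The spherical map on all combinations of cosets. -/
def omegaLin (p : ℕ) [Fact p.Prime] :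
    (Cosets (Sp n) →₀ ℤ) →ₗ[ℤ] MvPolynomial (Fin (n + 1)) ℚ := weightSum (cosetOmega p)

theorem Omega_eq (t : LZ n p) : Omega t = omegaLin p t.1.toCosets := by
  rw [Omega, omegaLin, weightSum, Finsupp.linearCombination_apply]
  refine Finsupp.sum_congr fun c _ => ?_
  exact Int.cast_smul_eq_zsmul ℚ _ _

/-- Products of triangular representatives are triangular and their exponents add, so the weight is
multiplicative on representatives and `weightSum_mul` applies. -/
theorem omegaLin_mul [NeZero n] {t s : HeckeRing (Sp n)}
    (ht : SupportedOn (integralUnion n p) t.toCosets)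
    (hs : SupportedOn (integralUnion n p) s.toCosets) :
    omegaLin p (t * s).toCosets = omegaLin p t.toCosets * omegaLin p s.toCosets := by
  have key {t : HeckeRing (Sp n)} (ht : SupportedOn (integralUnion n p) t.toCosets) :
      SupportedOn {M | ∃ δ d, IsTriangular p M δ d} t.toCosets := by
    intro c hc
    obtain ⟨M, ⟨δ, hM⟩, rfl⟩ := ht c hc
    obtain ⟨γ, hγ, h, d, hd⟩ := exists_isBlockTri hM
    exact ⟨γ * M, ⟨δ, d, isTriangular_iff.2 ⟨(mul_mem_integralSet hγ hM).1, h, hd⟩⟩,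
      coset_mul_left hγ M⟩
  refine weightSum_mul _ _ ?_ (key ht) (key hs)
  rintro M ⟨δ, d, h⟩ N ⟨ε, e, h'⟩
  have : IsTriangular p (M * N) (δ + ε) (d + e) := by
    rw [isTriangular_iff] at *
    refine ⟨?_, h.2.1.mul h'.2.1, ?_⟩
    · rw [pow_add]; exact h.1.mul h'.1
    · rw [lowerBlock_mul h.2.1 h'.2.1]; exact h.2.2.mul h'.2.2
  rw [cosetOmega_coset this, cosetOmega_coset h, cosetOmega_coset h', pow_add]
  simp only [Pi.add_apply, pow_add, Finset.prod_mul_distrib]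
  ring

theorem omegaLin_one [NeZero n] : omegaLin (n := n) p (1 : HeckeRing (Sp n)).toCosets = 1 := by
  refine weightSum_one _ ?_
  rw [cosetOmega_coset (δ := 0) (d := 0) (isTriangular_iff.2 ⟨?_, isBlockTri_one, ?_⟩)]
  · simp
  · simp [IsSimilitude, mat_one]
  · rw [lowerBlock_one]; exact isTri_one

end Parabolic

end

noncomputable section

/-! ### Elementary divisors against triangular exponents; injectivity of the spherical map. -/

section ElementaryDivisors

variable {p : ℕ} [hp : Fact p.Prime]

theorem intCast_prime_ne_zero : (p : ℤ) ≠ 0 := by exact_mod_cast hp.out.ne_zero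

theorem ratCast_prime_ne_zero : (p : ℚ) ≠ 0 := by exact_mod_cast hp.out.ne_zero

theorem pow_dvd_pow_iff_le {a b : ℕ} : (p : ℤ) ^ a ∣ (p : ℤ) ^ b ↔ a ≤ b := by
  rw [← Nat.pow_dvd_pow_iff_le_right hp.out.one_lt]
  exact_mod_cast Iff.rfl

/-- The sum of the smallest exponents of `diag(p ^ a; p ^ (δ - a))` bounds the sum of the same
number of other exponents from below. -/
theorem sum_le_sum_exponents {δ k : ℕ} {a : Fin 3 → ℕ} (ha : Monotone a) (h2 : ∀ i, 2 * a i ≤ δ)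
    (hk : k ≤ 3) {f : Fin k → Fin 3 ⊕ Fin 3} (hf : Function.Injective f) :
    ∑ i : Fin k, a (Fin.castLE hk i) ≤
      ∑ i, Sum.elim a (fun i => δ - a i) (f i) := by
  have h01 : a 0 ≤ a 1 := ha (by decide)
  have h12 : a 1 ≤ a 2 := ha (by decide)
  -- Only the places `inl 0` and `inl 1` may carry exponents below `a 2`, and an injective `f` uses
  -- each of them at most once.
  have key (s : Fin 3 ⊕ Fin 3) : (s = Sum.inl 0 ∧ Sum.elim a (fun i => δ - a i) s = a 0) ∨
      (s = Sum.inl 1 ∧ Sum.elim a (fun i => δ - a i) s = a 1) ∨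
      a 2 ≤ Sum.elim a (fun i => δ - a i) s := by
    rcases s with i | i
    · fin_cases i <;> simp
    · have := h2 0
      have := h2 1
      have := h2 2
      refine Or.inr (Or.inr ?_)
      fin_cases i <;> simp <;> omega
  interval_cases k
  · simp
  · have := key (f 0)
    simp only [Fin.sum_univ_one]
    change a 0 ≤ _
    omega
  · have hne : f 0 ≠ f 1 := hf.ne (by decide)
    simp only [Fin.sum_univ_two]
    change a 0 + a 1 ≤ _
    rcases key (f 0) with ⟨e, h⟩ | ⟨e, h⟩ | h <;> rcases key (f 1) with ⟨e', h'⟩ | ⟨e', h'⟩ | h' <;>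
      first
      | exact absurd (e.trans e'.symm) hne
      | omega
  · have hne : f 0 ≠ f 1 := hf.ne (by decide)
    have hne' : f 0 ≠ f 2 := hf.ne (by decide)
    have hne'' : f 1 ≠ f 2 := hf.ne (by decide)
    simp only [Fin.sum_univ_three]
    change a 0 + a 1 + a 2 ≤ _
    rcases key (f 0) with ⟨e, h⟩ | ⟨e, h⟩ | h <;> rcases key (f 1) with ⟨e', h'⟩ | ⟨e', h'⟩ | h' <;>
      rcases key (f 2) with ⟨e'', h''⟩ | ⟨e'', h''⟩ | h'' <;>
      first
      | exact absurd (e.trans e'.symm) hne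
      | exact absurd (e.trans e''.symm) hne'
      | exact absurd (e'.trans e''.symm) hne''
      | omega

/-- The divisibility of all minors of size `k` by a number survives multiplication by integral
matrices on both sides, so it may be checked on the diagonal representative. -/
theorem pow_dvd_minor {δ k : ℕ} {a : Fin 3 → ℕ} {h : ∀ i, a i ≤ δ} (ha : Monotone a)
    (h2 : ∀ i, 2 * a i ≤ δ) (hk : k ≤ 3) {γ γ' M : GSp 3} (hγ : γ ∈ Sp 3) (hγ' : γ' ∈ Sp 3)
    (e : M = γ * powDiag p δ a h * γ') {N : Matrix (Fin 3 ⊕ Fin 3) (Fin 3 ⊕ Fin 3) ℤ}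
    (hN : N.map (Int.castRingHom ℚ) = mat M) (f g : Fin k → Fin 3 ⊕ Fin 3) :
    (p : ℤ) ^ (∑ i : Fin k, a (Fin.castLE hk i)) ∣ (N.submatrix f g).det := by
  obtain ⟨A, hA⟩ := isInt_of_mem_Sp hγ
  obtain ⟨B, hB⟩ := isInt_of_mem_Sp hγ'
  have hN' : N = A * diagonal (Sum.elim (fun i => (p : ℤ) ^ a i)
      fun i => (p : ℤ) ^ (δ - a i)) * B := map_intCast_injective (by
    rw [hN, e, mat_mul, mat_mul, mat_powDiag, Matrix.map_mul, Matrix.map_mul, hA, hB])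
  rw [hN']
  refine dvd_minor_mul_right (dvd_minor_mul_left (dvd_minor_diagonal fun f hf => ?_) A) B f g
  have : ∏ i, Sum.elim (fun i => (p : ℤ) ^ a i) (fun i => (p : ℤ) ^ (δ - a i)) (f i) =
      (p : ℤ) ^ ∑ i, Sum.elim a (fun i => δ - a i) (f i) := by
    rw [← Finset.prod_pow_eq_pow_sum]
    refine Finset.prod_congr rfl fun i _ => ?_
    rcases f i with j | j <;> rfl
  rw [this]
  exact pow_dvd_pow _ (sum_le_sum_exponents ha h2 hk hf)

/-- The diagonal exponents of a triangular matrix dominate the elementary divisors. -/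
theorem sum_le_of_isTriangular {δ : ℕ} {a : Fin 3 → ℕ} {h : ∀ i, a i ≤ δ} (ha : Monotone a)
    (h2 : ∀ i, 2 * a i ≤ δ) {γ γ' M : GSp 3} (hγ : γ ∈ Sp 3) (hγ' : γ' ∈ Sp 3)
    (e : M = γ * powDiag p δ a h * γ') {d : Fin 3 → ℕ} (hM : IsTriangular p M δ d) :
    (∀ i, d i ≤ δ) ∧ ∀ k, ∀ hk : k ≤ 3, ∑ i : Fin k, a (Fin.castLE hk i) ≤
      ∑ i : Fin k, (δ - d (Fin.castLE hk i)) := by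
  have hInt : M ∈ integralSet 3 p δ := by
    rw [e]
    exact integralSet_mul_mem hγ' (mul_mem_integralSet hγ (powDiag_mem δ a h))
  obtain ⟨N, hN⟩ := hInt.2
  obtain ⟨hs, A, B, D, hABD, hD, hDd⟩ := hM
  rw [hABD, isSimilitude_fromBlocks] at hs
  -- `ᵗA = p ^ δ D⁻¹` is upper triangular, so `A` is lower triangular with diagonal `p ^ (δ - dᵢ)`.
  -- Its leading minors are pure powers of `p`, and these are compared with the divisors of all
  -- minors.
  have htri := triangular_of_mul hs.1 hD
    (fun i => by rw [hDd]; exact pow_ne_zero _ ratCast_prime_ne_zero) (by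
      intro i j hij
      simp only [id] at hij
      simp [hij.ne'])
  have hNA (i j) : ((N (Sum.inl i) (Sum.inl j) : ℤ) : ℚ) = A i j := by
    have := congrFun (congrFun hN (Sum.inl i)) (Sum.inl j)
    rw [hABD] at this
    exact this
  have hdiag (i) : N (Sum.inl i) (Sum.inl i) * (p : ℤ) ^ d i = (p : ℤ) ^ δ := by
    have := htri.2 i
    rw [hDd, transpose_apply, ← hNA, Matrix.smul_apply, one_apply_eq, smul_eq_mul, mul_one] at this
    exact_mod_cast this
  have hle (i) : d i ≤ δ := pow_dvd_pow_iff_le.1 ⟨_, (hdiag i).symm.trans (mul_comm _ _)⟩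
  refine ⟨hle, fun k hk => ?_⟩
  have hdiag' (i) : N (Sum.inl i) (Sum.inl i) = (p : ℤ) ^ (δ - d i) := by
    have := hdiag i
    rw [← Nat.sub_add_cancel (hle i), pow_add] at this
    simpa using mul_right_cancel₀ (pow_ne_zero _ intCast_prime_ne_zero) this
  have hdvd := pow_dvd_minor ha h2 hk hγ hγ' e hN (fun i => Sum.inl (Fin.castLE hk i))
    (fun i => Sum.inl (Fin.castLE hk i))
  rw [det_of_isLowerTriangular] at hdvd
  · simp only [submatrix_apply, hdiag'] at hdvd
    rwa [Finset.prod_pow_eq_pow_sum, pow_dvd_pow_iff_le] at hdvd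
  · intro i j hij
    have hlt : i < j := hij
    have := htri.1 (i := Fin.castLE hk j) (j := Fin.castLE hk i) hlt
    rw [transpose_apply, ← hNA] at this
    exact_mod_cast this

theorem isTriangular_powDiag (δ : ℕ) (a : Fin 3 → ℕ) (h : ∀ i, a i ≤ δ) :
    IsTriangular p (powDiag p δ a h) δ fun i => δ - a i := by
  refine ⟨(powDiag_mem δ a h).1, diagonal fun i => (p : ℚ) ^ a i, 0,
    diagonal fun i => (p : ℚ) ^ (δ - a i), ?_, blockTriangular_diagonal _, by simp⟩
  rw [mat_powDiag, diagonal_map (map_zero _), fromBlocks_diagonal]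
  congr 1
  ext (i | i) <;> simp

theorem partialSums_le {δ : ℕ} {a b : Fin 3 → ℕ} (hb : ∀ i, b i ≤ δ)
    (H : ∀ k, ∀ hk : k ≤ 3, ∑ i : Fin k, a (Fin.castLE hk i) ≤
      ∑ i : Fin k, (δ - (δ - b (Fin.castLE hk i)))) :
    a 0 ≤ b 0 ∧ a 0 + a 1 ≤ b 0 + b 1 ∧ a 0 + a 1 + a 2 ≤ b 0 + b 1 + b 2 := by
  have h1 := H 1 (by norm_num)
  have h2 := H 2 (by norm_num)
  have h3 := H 3 (by norm_num)
  simp only [fun i => Nat.sub_sub_self (hb i)] at h1 h2 h3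
  rw [Fin.sum_univ_one, Fin.sum_univ_one] at h1
  rw [Fin.sum_univ_two, Fin.sum_univ_two] at h2
  rw [Fin.sum_univ_three, Fin.sum_univ_three] at h3
  exact ⟨h1, h2, h3⟩

/-- The elementary divisors are unique. -/
theorem powDiag_unique {δ : ℕ} {a b : Fin 3 → ℕ} {ha : ∀ i, a i ≤ δ} {hb : ∀ i, b i ≤ δ}
    (ma : Monotone a) (mb : Monotone b) (a2 : ∀ i, 2 * a i ≤ δ) (b2 : ∀ i, 2 * b i ≤ δ)
    {γ γ' : GSp 3} (hγ : γ ∈ Sp 3) (hγ' : γ' ∈ Sp 3)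
    (e : powDiag p δ b hb = γ * powDiag p δ a ha * γ') : b = a := by
  have e' : powDiag p δ a ha = γ⁻¹ * powDiag p δ b hb * γ'⁻¹ := by rw [e]; group
  have h1 := partialSums_le hb
    (sum_le_of_isTriangular ma a2 hγ hγ' e (isTriangular_powDiag δ b hb)).2
  have h2 := partialSums_le ha
    (sum_le_of_isTriangular mb b2 (inv_mem hγ) (inv_mem hγ') e' (isTriangular_powDiag δ a ha)).2
  ext i
  fin_cases i
  · change b 0 = a 0; omega
  · change b 1 = a 1; omega
  · change b 2 = a 2; omega

variable (p) in
/-- The double coset of `diag(p ^ a; p ^ (δ - a))`. -/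
def heckePow (δ : ℕ) (a : Fin 3 → ℕ) (h : ∀ i, a i ≤ δ) : HeckeRing (Sp 3) :=
  doubleCoset (Sp 3) (powDiag p δ a h) (finite_cosetsIn _)

theorem coeffHom_heckePow {δ : ℕ} {a b : Fin 3 → ℕ} {ha : ∀ i, a i ≤ δ} {hb : ∀ i, b i ≤ δ}
    (ma : Monotone a) (mb : Monotone b) (a2 : ∀ i, 2 * a i ≤ δ) (b2 : ∀ i, 2 * b i ≤ δ) :
    coeffHom (powDiag p δ b hb) (heckePow p δ a ha) = if b = a then 1 else 0 := by
  classical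
  rw [coeffHom_apply, heckePow, toCosets_doubleCoset_apply]
  refine if_congr ?_ rfl rfl
  rw [coset_mem_cosetsIn]
  constructor
  · rintro ⟨γ, hγ, γ', hγ', e⟩
    exact powDiag_unique ma mb a2 b2 hγ hγ' e
  · rintro rfl
    exact ⟨1, one_mem _, 1, one_mem _, by simp⟩

theorem coeffHom_doubleCoset_of_notMem {δ : ℕ} {D M : GSp 3} (hD : D ∈ integralSet 3 p δ)
    (hM : M ∉ integralSet 3 p δ) :
    coeffHom M (doubleCoset (Sp 3) D (finite_cosetsIn _)) = 0 := by
  classical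
  rw [coeffHom_apply, toCosets_doubleCoset_apply, if_neg]
  rw [coset_mem_cosetsIn]
  rintro ⟨γ, hγ, γ', hγ', rfl⟩
  exact hM (integralSet_mul_mem hγ' (mul_mem_integralSet hγ hD))

theorem mem_elementaryDivisors_iff {δ : ℕ} {x : (Fin 3 → ℕ) × (Fin 3 → ℕ)} :
    x ∈ elementaryDivisors 3 (p ^ δ) ↔ ∃ a : Fin 3 → ℕ, Monotone a ∧ (∀ i, 2 * a i ≤ δ) ∧
      x = (fun i => p ^ a i, fun i => p ^ (δ - a i)) := by
  have hdiv {a b : ℕ} : p ^ a ∣ p ^ b ↔ a ≤ b := Nat.pow_dvd_pow_iff_le_right hp.out.one_lt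
  rw [elementaryDivisors, Finset.mem_filter]
  constructor
  · rintro ⟨-, h1, h2, h3⟩
    have h4 (i) : ∃ k ≤ δ, x.1 i = p ^ k := (Nat.dvd_prime_pow hp.out).1 ⟨_, (h1 i).symm⟩
    choose a ha hxa using h4
    have h5 (i) : x.2 i = p ^ (δ - a i) := by
      have := h1 i
      rw [hxa, ← Nat.add_sub_cancel' (ha i), pow_add] at this
      simpa using Nat.eq_of_mul_eq_mul_left (pow_pos hp.out.pos _) this
    have h01 := (h2 0 1 rfl).1
    have h12 := (h2 1 2 rfl).1
    have h22 := h3 2 rfl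
    rw [hxa, hxa, hdiv] at h01 h12
    rw [hxa, h5, hdiv] at h22
    have hδ := ha 2
    refine ⟨a, ?_, ?_, Prod.ext (funext hxa) (funext h5)⟩
    · rw [Fin.monotone_iff_le_succ]
      intro i
      fin_cases i
      exacts [h01, h12]
    · intro i
      fin_cases i <;> simp <;> omega
  · rintro ⟨a, ma, a2, rfl⟩
    have hle (i) : a i ≤ δ := by have := a2 i; omega
    refine ⟨?_, ?_, ?_, ?_⟩
    · simp only [Finset.mem_product, Fintype.mem_piFinset, Nat.mem_divisors]
      exact ⟨fun i => ⟨hdiv.2 (hle i), pow_ne_zero _ hp.out.ne_zero⟩,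
        fun i => ⟨hdiv.2 (Nat.sub_le _ _), pow_ne_zero _ hp.out.ne_zero⟩⟩
    · intro i
      change p ^ a i * p ^ (δ - a i) = _
      rw [← pow_add, Nat.add_sub_cancel' (hle i)]
    · intro i j hij
      have hm : a i ≤ a j := ma (by rw [Fin.le_def]; omega)
      exact ⟨hdiv.2 hm, hdiv.2 (by omega)⟩
    · intro i hi
      have := a2 i
      exact hdiv.2 (by omega)

open Classical in
/-- The Hecke operator `T(p ^ δ)` is the sum of all integral cosets with multiplier `p ^ δ`. -/
theorem coeffHom_heckeT (δ : ℕ) (h0 : p ^ δ ≠ 0) (M : GSp 3) :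
    coeffHom M (heckeT 3 (p ^ δ) h0) = if M ∈ integralSet 3 p δ then 1 else 0 := by
  rw [heckeT, map_sum]
  split_ifs with hM
  · obtain ⟨γ, hγ, γ', hγ', a, ha, ma, a2, e⟩ := exists_eq_mul_powDiag_mul hM
    let x : {x // x ∈ elementaryDivisors 3 (p ^ δ)} :=
      ⟨_, mem_elementaryDivisors_iff.2 ⟨a, ma, a2, rfl⟩⟩
    have hMd (t : HeckeRing (Sp 3)) : coeffHom M t = coeffHom (powDiag p δ a ha) t := by
      rw [e, coeffHom_mul_right _ _ hγ', coeffHom_mul_left _ _ hγ]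
    rw [Finset.sum_eq_single x]
    · rw [hMd]
      change coeffHom (powDiag p δ a ha) (heckePow p δ a ha) = 1
      rw [coeffHom_heckePow ma ma a2 a2, if_pos rfl]
    · rintro ⟨y, hy⟩ - hne
      obtain ⟨b, mb, b2, rfl⟩ := mem_elementaryDivisors_iff.1 hy
      rw [hMd]
      have hb (i) : b i ≤ δ := by have := b2 i; omega
      change coeffHom (powDiag p δ a ha) (heckePow p δ b hb) = 0
      rw [coeffHom_heckePow mb ma b2 a2, if_neg]
      rintro rfl
      exact hne rfl
    · intro h; exact absurd (Finset.mem_attach _ _) h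
  · refine Finset.sum_eq_zero fun x _ => ?_
    exact coeffHom_doubleCoset_of_notMem (diag_mem_integralSet _ _ _ _) hM

theorem cosetOmega_eq_monomial {M : GSp 3} {δ : ℕ} {d : Fin 3 → ℕ} (h : IsTriangular p M δ d) :
    cosetOmega p (coset (Sp 3) M) =
      MvPolynomial.monomial (Finsupp.equivFunOnFinite.symm (Fin.cons δ d))
        (∏ i : Fin 3, (((p : ℚ) ^ ((i : ℕ) + 1))⁻¹) ^ d i) := by
  rw [cosetOmega_coset h, MvPolynomial.monomial_eq, Finsupp.prod_fintype _ _ (by simp)]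
  simp only [mul_pow, Finset.prod_mul_distrib, ← map_pow, ← map_prod,
    Finsupp.equivFunOnFinite_symm_apply_apply]
  rw [Fin.prod_univ_succ (n := 3)]
  simp only [Fin.cons_zero, Fin.cons_succ]
  ring

/-- Integral elements of the Hecke ring are determined by their coefficients at the diagonal
matrices. -/
theorem eq_zero_of_coeffHom_powDiag {t : HeckeRing (Sp 3)}
    (ht : SupportedOn (integralUnion 3 p) t.toCosets)
    (h : ∀ δ a (ha : ∀ i, a i ≤ δ), Monotone a → (∀ i, 2 * a i ≤ δ) →
      coeffHom (powDiag p δ a ha) t = 0) : t = 0 := by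
  refine ext_coeff fun M => ?_
  rw [map_zero]
  by_contra hne
  obtain ⟨N, ⟨δ, hN⟩, e⟩ := ht _ hne
  rw [coeffHom_eq_of_coset_eq e.symm] at hne
  obtain ⟨γ, hγ, γ', hγ', a, ha, ma, a2, e⟩ := exists_eq_mul_powDiag_mul hN
  rw [e, coeffHom_mul_right _ _ hγ', coeffHom_mul_left _ _ hγ] at hne
  exact hne (h δ a ha ma a2)

/-- The spherical map is injective. -/
theorem eq_zero_of_omegaLin_eq_zero {t : HeckeRing (Sp 3)}
    (ht : SupportedOn (integralUnion 3 p) t.toCosets) (h0 : omegaLin p t.toCosets = 0) :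
    t = 0 := by
  refine eq_zero_of_coeffHom_powDiag ht fun δ a ha ma a2 => ?_
  -- The quantity is the sum of the three partial sums of `a`, so it decreases strictly along the
  -- dominance order.
  induction hσ : 3 * a 0 + 2 * a 1 + a 2 using Nat.strong_induction_on generalizing a with
  | _ N ih =>
  by_contra hne
  -- This is the monomial of the coset of `powDiag p δ a` itself; its coefficient in the spherical
  -- image is examined.
  let e : Fin 4 →₀ ℕ := Finsupp.equivFunOnFinite.symm (Fin.cons δ fun i => δ - a i)
  let κ : Cosets (Sp 3) → ℚ := fun c => MvPolynomial.coeff e (cosetOmega p c)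
  have hκ : ∑ c ∈ t.toCosets.support, (t.toCosets c : ℚ) * κ c = 0 := by
    have := congrArg (MvPolynomial.coeff e) h0
    rw [omegaLin, weightSum, Finsupp.linearCombination_apply, Finsupp.sum,
      MvPolynomial.coeff_sum, MvPolynomial.coeff_zero] at this
    rw [← this]
    refine Finset.sum_congr rfl fun c _ => ?_
    rw [← Int.cast_smul_eq_zsmul ℚ, MvPolynomial.coeff_smul, smul_eq_mul]
  have key (c) (hc : c ∈ t.toCosets.support) : 0 ≤ κ c ∧
      (κ c ≠ 0 → t.toCosets c = coeffHom (powDiag p δ a ha) t) := by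
    obtain ⟨M, ⟨δ', hM⟩, rfl⟩ := ht c (Finsupp.mem_support_iff.1 hc)
    obtain ⟨γ, hγ, hb, d, hd⟩ := exists_isBlockTri hM
    have hM' := mul_mem_integralSet hγ hM
    rw [← coset_mul_left hγ M] at hc ⊢
    generalize γ * M = M at *
    have htri : IsTriangular p M δ' d := isTriangular_iff.2 ⟨hM'.1, hb, hd⟩
    change 0 ≤ MvPolynomial.coeff e (cosetOmega p (coset (Sp 3) M)) ∧
      (MvPolynomial.coeff e (cosetOmega p (coset (Sp 3) M)) ≠ 0 → _)
    rw [cosetOmega_eq_monomial htri, MvPolynomial.coeff_monomial]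
    split_ifs with heq
    · refine ⟨by positivity, fun _ => ?_⟩
      have heq' := Finsupp.equivFunOnFinite.symm.injective heq
      obtain ⟨rfl, rfl⟩ := Fin.cons_inj.1 heq'
      obtain ⟨γ, hγ, γ', hγ', b, hb, mb, b2, e⟩ := exists_eq_mul_powDiag_mul hM'
      -- A coset contributing to the monomial has elementary divisors `b` with partial sums at most
      -- those of `a`; if `b ≠ a`, its coefficient in `t` is zero by induction.
      have hs := partialSums_le ha (sum_le_of_isTriangular mb b2 hγ hγ' e htri).2
      have hcb : t.toCosets (coset (Sp 3) M) = coeffHom (powDiag p δ' b hb) t := by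
        rw [← coeffHom_apply, e, coeffHom_mul_right _ _ hγ', coeffHom_mul_left _ _ hγ]
      have hba : b = a := by
        by_contra hba
        have hlt : 3 * b 0 + 2 * b 1 + b 2 < N := by
          by_contra hge
          apply hba
          ext i
          fin_cases i
          · change b 0 = a 0; omega
          · change b 1 = a 1; omega
          · change b 2 = a 2; omega
        have := ih _ hlt b hb mb b2 rfl
        rw [← hcb] at this
        exact Finsupp.mem_support_iff.1 hc this
      subst hba
      exact hcb
    · exact ⟨le_rfl, fun h => absurd rfl h⟩
  have hsum : (coeffHom (powDiag p δ a ha) t : ℚ) * ∑ c ∈ t.toCosets.support, κ c = 0 := by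
    rw [← hκ, Finset.mul_sum]
    refine Finset.sum_congr rfl fun c hc => ?_
    by_cases hc0 : κ c = 0
    · rw [hc0, mul_zero, mul_zero]
    · rw [(key c hc).2 hc0]
  -- All contributing cosets carry the same coefficient of `t`. Their weights are nonnegative and
  -- the diagonal coset has a positive one, so nothing can cancel.
  have hpos : 0 < ∑ c ∈ t.toCosets.support, κ c := by
    refine Finset.sum_pos' (fun c hc => (key c hc).1) ⟨coset (Sp 3) (powDiag p δ a ha), ?_, ?_⟩
    · exact Finsupp.mem_support_iff.2 hne
    · change 0 < MvPolynomial.coeff e (cosetOmega p (coset (Sp 3) (powDiag p δ a ha)))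
      rw [cosetOmega_eq_monomial (isTriangular_powDiag δ a ha), MvPolynomial.coeff_monomial,
        if_pos rfl]
      have : 0 < (p : ℚ) := by exact_mod_cast hp.out.pos
      positivity
  exact mul_ne_zero (by exact_mod_cast hne) hpos.ne' hsum

end ElementaryDivisors

end

noncomputable section

/-! ### The image of symplectic Hecke operators in the Hecke ring of `GLₙ`. -/

section PushForward

variable {n p : ℕ} [hp : Fact p.Prime]

/-- Right multiplication by a Levi element multiplies `D` by `U`. Thus invariance under the Levi
part of `Sp` becomes invariance under `GLₙ(ℤ)`, and the image lies again in a Hecke ring. -/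
theorem translate_toGL {c : Cosets (Sp n)} (hc : ∃ M ∈ integralUnion n p, coset (Sp n) M = c)
    (U : GL (Fin n) ℚ) : translate U (toGL c) = toGL (translate (levi U) c) := by
  obtain ⟨M, ⟨δ, hM⟩, rfl⟩ := hc
  obtain ⟨γ, hγ, hb, -⟩ := exists_isBlockTri hM
  rw [← coset_mul_left hγ M, translate_coset, toGL_coset hb,
    toGL_coset (hb.mul (isBlockTri_levi U)),
    translate_coset, lowerBlock_mul hb (isBlockTri_levi U), lowerBlock_levi]

/-- The image of an integral element of the symplectic Hecke ring in the Hecke ring of `GLₙ`. -/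
def pushGL (p : ℕ) [Fact p.Prime] (t : HeckeRing (Sp n))
    (ht : SupportedOn (integralUnion n p) t.toCosets) : HeckeRing (GLZ n) :=
  ⟨Finsupp.mapDomain toGL t.toCosets, fun U hU => by
    have h : Finsupp.mapDomain (translate (levi U)) t.toCosets = t.toCosets :=
      t.2 _ (levi_mem hU)
    conv_rhs => rw [← h]
    rw [← Finsupp.mapDomain_comp, ← Finsupp.mapDomain_comp]
    exact Finsupp.mapDomain_congr fun c hc =>
      translate_toGL (ht c (Finsupp.mem_support_iff.1 hc)) U⟩

theorem toCosets_pushGL (t : HeckeRing (Sp n))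
    (ht : SupportedOn (integralUnion n p) t.toCosets) :
    (pushGL p t ht).toCosets = Finsupp.mapDomain toGL t.toCosets := rfl

theorem omegaLin_eq [NeZero n] {δ : ℕ} {t : HeckeRing (Sp n)}
    (ht : SupportedOn (integralUnion n p) t.toCosets)
    (hδ : SupportedOn (integralSet n p δ) t.toCosets) :
    omegaLin p t.toCosets =
      MvPolynomial.X 0 ^ δ * weightSum (glWeight p) (pushGL p t ht).toCosets := by
  rw [toCosets_pushGL, omegaLin, weightSum, weightSum, Finsupp.linearCombination_mapDomain,
    Finsupp.linearCombination_apply, Finsupp.linearCombination_apply, Finsupp.sum, Finsupp.sum,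
    Finset.mul_sum]
  refine Finset.sum_congr rfl fun c hc => ?_
  obtain ⟨M, hM, rfl⟩ := hδ c (Finsupp.mem_support_iff.1 hc)
  rw [cosetOmega_eq hM, mul_smul_comm, Function.comp_apply]

theorem supportedOn_pushGL (t : HeckeRing (Sp n))
    (ht : SupportedOn (integralUnion n p) t.toCosets) :
    SupportedOn (glIntegral n p) (pushGL p t ht).toCosets := by
  classical
  intro c hc
  rw [toCosets_pushGL] at hc
  obtain ⟨b, hb, rfl⟩ :=
    Finset.mem_image.1 (Finsupp.mapDomain_support (Finsupp.mem_support_iff.2 hc))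
  obtain ⟨M, ⟨δ, hM⟩, rfl⟩ := ht b (Finsupp.mem_support_iff.1 hb)
  obtain ⟨γ, hγ, hb, -⟩ := exists_isBlockTri hM
  exact ⟨_, lowerBlock_mem_glIntegral (mul_mem_integralSet hγ hM) hb, by
    rw [← toGL_coset hb, coset_mul_left hγ]⟩

end PushForward

/-! ### Counting the blocks `B` above a diagonal `D`. -/

section Fibers

variable {p : ℕ} [hp : Fact p.Prime]

variable (p) in
/-- The matrix `diag(p ^ a₁, …, p ^ aₙ)`. -/
def glDiag {n : ℕ} (a : Fin n → ℤ) : GL (Fin n) ℚ :=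
  GeneralLinearGroup.mkOfDetNeZero (diagonal fun i => (p : ℚ) ^ a i) (by
    rw [det_diagonal]
    exact Finset.prod_ne_zero_iff.2 fun i _ => zpow_ne_zero _ ratCast_prime_ne_zero)

theorem glDiag_val {n : ℕ} (a : Fin n → ℤ) :
    (glDiag p a).val = diagonal fun i => (p : ℚ) ^ a i := rfl

/-- The bounds for the entries of `B` modulo `D = diag(p ^ a₁, p ^ a₂, p ^ a₃)`. -/
def boxExponent (a : Fin 3 → ℕ) : Fin 6 → ℕ := ![a 0, a 0, a 0, a 1, a 1, a 2]

variable (p) in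
/-- Representatives of the matrices `B` modulo `D = diag(p ^ a₁, p ^ a₂, p ^ a₃)`. -/
def box (a : Fin 3 → ℕ) : Finset (Fin 6 → ℕ) :=
  Fintype.piFinset fun k => Finset.range (p ^ boxExponent a k)

theorem card_box (a : Fin 3 → ℕ) : (box p a).card = p ^ (3 * a 0 + 2 * a 1 + a 2) := by
  rw [box, Fintype.card_piFinset]
  simp only [Finset.card_range]
  rw [Finset.prod_pow_eq_pow_sum, Fin.sum_univ_six]
  simp only [boxExponent]
  congr 1
  simp
  ring

variable (p) in
/-- The integral matrix `B` with `B D⁻¹` symmetric, where `D = diag(p ^ a₁, p ^ a₂, p ^ a₃)`, with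
given entries on and below the diagonal. -/
def boxMatrix (a : Fin 3 → ℕ) (s : Fin 6 → ℕ) : Matrix (Fin 3) (Fin 3) ℤ :=
  !![(s 0 : ℤ), s 1 * p ^ (a 1 - a 0), s 2 * p ^ (a 2 - a 0);
     s 1, s 3, s 4 * p ^ (a 2 - a 1);
     s 2, s 4, s 5]

variable (p) in
/-- The integral matrix `(p ^ δ D⁻¹, B; 0, D)`. -/
def fiberIntMatrix (δ : ℕ) (a : Fin 3 → ℕ) (s : Fin 6 → ℕ) :
    Matrix (Fin 3 ⊕ Fin 3) (Fin 3 ⊕ Fin 3) ℤ :=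
  fromBlocks (diagonal fun i => (p : ℤ) ^ (δ - a i)) (boxMatrix p a s) 0
    (diagonal fun i => (p : ℤ) ^ a i)

theorem fiberIntMatrix_map (δ : ℕ) (a : Fin 3 → ℕ) (s : Fin 6 → ℕ) :
    (fiberIntMatrix p δ a s).map (Int.castRingHom ℚ) =
      fromBlocks (diagonal fun i => (p : ℚ) ^ (δ - a i))
        ((boxMatrix p a s).map (Int.castRingHom ℚ)) 0 (diagonal fun i => (p : ℚ) ^ a i) := by
  rw [fiberIntMatrix, fromBlocks_map, diagonal_map (map_zero _), diagonal_map (map_zero _),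
    Matrix.map_zero _ (map_zero _)]
  simp

theorem isIntSimilitude_fiberIntMatrix {δ : ℕ} {a : Fin 3 → ℕ} (h : ∀ i, a i ≤ δ)
    (ma : Monotone a) (s : Fin 6 → ℕ) :
    IsIntSimilitude (fiberIntMatrix p δ a s) ((p : ℤ) ^ δ) := by
  have h01 : (p : ℚ) ^ (a 1 - a 0) * p ^ a 0 = p ^ a 1 := by
    rw [← pow_add, Nat.sub_add_cancel (ma (by decide))]
  have h02 : (p : ℚ) ^ (a 2 - a 0) * p ^ a 0 = p ^ a 2 := by
    rw [← pow_add, Nat.sub_add_cancel (ma (by decide))]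
  have h12 : (p : ℚ) ^ (a 2 - a 1) * p ^ a 1 = p ^ a 2 := by
    rw [← pow_add, Nat.sub_add_cancel (ma (by decide))]
  rw [← isSimilitude_map, fiberIntMatrix_map, isSimilitude_fromBlocks]
  constructor
  · rw [diagonal_transpose, diagonal_mul_diagonal, Int.cast_pow, Int.cast_natCast,
      ← diagonal_one, ← diagonal_smul]
    congr 1
    ext i
    simp [← pow_add, Nat.sub_add_cancel (h i)]
  · ext i j
    rw [diagonal_transpose, Matrix.mul_diagonal, Matrix.diagonal_mul]
    fin_cases i <;> fin_cases j <;> simp [boxMatrix] <;>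
      first
      | ring1
      | linear_combination (s 1 : ℚ) * h01
      | linear_combination -(s 1 : ℚ) * h01
      | linear_combination (s 2 : ℚ) * h02
      | linear_combination -(s 2 : ℚ) * h02
      | linear_combination (s 4 : ℚ) * h12
      | linear_combination -(s 4 : ℚ) * h12

variable (p) in
/-- The element `(p ^ δ D⁻¹, B; 0, D)` of `GSp`. -/
def fiberMatrix (δ : ℕ) (a : Fin 3 → ℕ) (h : ∀ i, a i ≤ δ) (ma : Monotone a) (s : Fin 6 → ℕ) :
    GSp 3 :=
  ofMatrix ((fiberIntMatrix p δ a s).map (Int.castRingHom ℚ)) ((p : ℚ) ^ δ)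
    (pow_pos (by exact_mod_cast hp.out.pos) δ) (by
      have := isSimilitude_map.2 (isIntSimilitude_fiberIntMatrix (p := p) h ma s)
      rwa [Int.cast_pow, Int.cast_natCast] at this)

variable {δ : ℕ} {a : Fin 3 → ℕ} {h : ∀ i, a i ≤ δ} {ma : Monotone a}

theorem mat_fiberMatrix (s : Fin 6 → ℕ) :
    mat (fiberMatrix p δ a h ma s) = (fiberIntMatrix p δ a s).map (Int.castRingHom ℚ) := rfl

theorem fiberMatrix_mem (s : Fin 6 → ℕ) : fiberMatrix p δ a h ma s ∈ integralSet 3 p δ := by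
  refine ⟨?_, ⟨_, rfl⟩⟩
  have := isSimilitude_map.2 (isIntSimilitude_fiberIntMatrix (p := p) h ma s)
  rwa [Int.cast_pow, Int.cast_natCast] at this

theorem isBlockTri_fiberMatrix (s : Fin 6 → ℕ) : IsBlockTri (fiberMatrix p δ a h ma s) :=
  ⟨_, _, _, by rw [mat_fiberMatrix, fiberIntMatrix_map]⟩

theorem lowerBlock_fiberMatrix (s : Fin 6 → ℕ) :
    lowerBlock (fiberMatrix p δ a h ma s) = glDiag p fun i => (a i : ℤ) := by
  apply Units.ext
  rw [lowerBlock_val (by rw [mat_fiberMatrix, fiberIntMatrix_map]), glDiag_val]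
  simp

/-- A `γ` between two such matrices has upper left block `1`, as the blocks `A` agree. Hence `B' = B
+ T D`, and the lower entries are congruent modulo the power of `p` of their column; both being
reduced, they coincide. -/
theorem coset_fiberMatrix_injOn :
    Set.InjOn (fun s => coset (Sp 3) (fiberMatrix p δ a h ma s)) (box p a) := by
  intro s hs s' hs' e
  have hp0 := ratCast_prime_ne_zero (p := p)
  obtain ⟨γ, hγ, e⟩ := coset_eq_coset_iff_exists.1 e
  obtain ⟨N, hN⟩ := isInt_of_mem_Sp hγ
  have e1 : fiberIntMatrix p δ a s' = N * fiberIntMatrix p δ a s := map_intCast_injective (by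
    rw [Matrix.map_mul, hN, ← mat_fiberMatrix (h := h) (ma := ma),
      ← mat_fiberMatrix (h := h) (ma := ma), e, mat_mul])
  rw [← fromBlocks_toBlocks N, fiberIntMatrix, fiberIntMatrix, fromBlocks_multiply,
    fromBlocks_inj] at e1
  obtain ⟨e11, e12, -, -⟩ := e1
  have hN1 : N.toBlocks₁₁ = 1 := by
    ext i j
    have := congrFun (congrFun e11 i) j
    rw [Matrix.add_apply, Matrix.mul_diagonal, Matrix.mul_zero, Matrix.zero_apply, add_zero] at this
    have hne : (p : ℤ) ^ (δ - a j) ≠ 0 := pow_ne_zero _ intCast_prime_ne_zero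
    refine mul_right_cancel₀ hne (this.symm.trans ?_)
    by_cases hij : i = j
    · subst hij; simp
    · simp [hij]
  rw [hN1, Matrix.one_mul] at e12
  have key (k) (hk : ∃ c : ℤ, (s' k : ℤ) = s k + c * p ^ boxExponent a k) : s k = s' k := by
    obtain ⟨c, hc⟩ := hk
    have h1 : s k < p ^ boxExponent a k := Finset.mem_range.1 (Fintype.mem_piFinset.1 hs k)
    have h2 : s' k < p ^ boxExponent a k := Finset.mem_range.1 (Fintype.mem_piFinset.1 hs' k)
    have h3 : (s k : ℤ) ≡ s' k [ZMOD (p ^ boxExponent a k : ℕ)] := by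
      rw [Int.modEq_iff_dvd]
      exact ⟨c, by rw [hc]; push_cast; ring⟩
    exact Nat.ModEq.eq_of_lt_of_lt (Int.natCast_modEq_iff.1 h3) h1 h2
  have hB (i j) := congrFun (congrFun e12 i) j
  simp only [Matrix.add_apply, Matrix.mul_diagonal] at hB
  ext k
  apply key
  fin_cases k
  · exact ⟨_, hB 0 0⟩
  · exact ⟨_, hB 1 0⟩
  · exact ⟨_, hB 2 0⟩
  · exact ⟨_, hB 1 1⟩
  · exact ⟨_, hB 2 1⟩
  · exact ⟨_, hB 2 2⟩

/-- The block `A = p ^ δ ᵗD⁻¹` has to be integral. -/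
theorem le_of_lowerBlock {M : GSp 3} (hM : M ∈ integralSet 3 p δ) (hb : IsBlockTri M)
    (e : lowerBlock M = glDiag p fun i => (a i : ℤ)) (i : Fin 3) : a i ≤ δ := by
  obtain ⟨A, B, D, hABD⟩ := hb
  have hD : D = diagonal fun i => (p : ℚ) ^ a i := by
    rw [← lowerBlock_val hABD, e, glDiag_val]; simp
  have hInt := hM.2
  have hs := hM.1
  rw [hABD, isInt_fromBlocks] at hInt
  rw [hABD, isSimilitude_fromBlocks, hD] at hs
  obtain ⟨x, hx⟩ := isInt_iff.1 hInt.1 i i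
  have := congrFun (congrFun hs.1 i) i
  rw [Matrix.mul_diagonal, transpose_apply, ← hx, Matrix.smul_apply, one_apply_eq, smul_eq_mul,
    mul_one] at this
  have h2 : x * (p : ℤ) ^ a i = (p : ℤ) ^ δ := by exact_mod_cast this
  exact pow_dvd_pow_iff_le.1 ⟨x, by rw [← h2, mul_comm]⟩

variable (h ma) in
-- Symmetry of `B D⁻¹` gives `b_ij = b_ji p ^ (a_j - a_i)` for `i ≤ j`, so the entries on and below
-- the diagonal determine `B`; these are reduced modulo the columns of `D`.
theorem exists_fiberMatrix {M : GSp 3} (hM : M ∈ integralSet 3 p δ) (hb : IsBlockTri M)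
    (e : lowerBlock M = glDiag p fun i => (a i : ℤ)) :
    ∃ s ∈ box p a, coset (Sp 3) (fiberMatrix p δ a h ma s) = coset (Sp 3) M := by
  obtain ⟨A, B, D, hABD⟩ := hb
  have hD : D = diagonal fun i => (p : ℚ) ^ a i := by
    rw [← lowerBlock_val hABD, e, glDiag_val]; simp
  have hInt := hM.2
  have hs := hM.1
  rw [hABD, isInt_fromBlocks] at hInt
  rw [hABD, isSimilitude_fromBlocks, hD] at hs
  have hp0 := ratCast_prime_ne_zero (p := p)
  have hA : A = diagonal fun i => (p : ℚ) ^ (δ - a i) := by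
    ext i j
    have := congrFun (congrFun hs.1 j) i
    rw [Matrix.mul_diagonal, transpose_apply, Matrix.smul_apply, smul_eq_mul] at this
    refine mul_right_cancel₀ (pow_ne_zero (a i) hp0) (this.trans ?_)
    by_cases hij : i = j
    · subst hij; simp [← pow_add, Nat.sub_add_cancel (h i)]
    · simp [hij, Ne.symm hij]
  obtain ⟨B, rfl⟩ := hInt.2.1
  have hsymm (i j) : B j i * (p : ℤ) ^ a j = (p : ℤ) ^ a i * B i j := by
    have := congrFun (congrFun hs.2 i) j
    rw [diagonal_transpose, Matrix.mul_diagonal, Matrix.diagonal_mul, transpose_apply] at this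
    simp only [Matrix.map_apply, eq_intCast] at this
    exact_mod_cast this
  have hoff (i j) (hij : i ≤ j) : B i j = B j i * (p : ℤ) ^ (a j - a i) := by
    have := hsymm i j
    rw [← Nat.sub_add_cancel (ma hij), pow_add] at this
    refine mul_left_cancel₀ (pow_ne_zero (a i) intCast_prime_ne_zero) (this.symm.trans ?_)
    ring
  let r : Fin 6 → Fin 3 := ![0, 1, 2, 1, 2, 2]
  let c : Fin 6 → Fin 3 := ![0, 0, 0, 1, 1, 2]
  have hc (k) : boxExponent a k = a (c k) := by fin_cases k <;> rfl
  have hpos (k : Fin 6) : (0 : ℤ) < (p : ℤ) ^ a (c k) := pow_pos (by exact_mod_cast hp.out.pos) _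
  let s : Fin 6 → ℕ := fun k => (B (r k) (c k) % (p : ℤ) ^ a (c k)).toNat
  let q : Fin 6 → ℤ := fun k => B (r k) (c k) / (p : ℤ) ^ a (c k)
  have hsq (k) : (s k : ℤ) = B (r k) (c k) - q k * (p : ℤ) ^ a (c k) := by
    have := Int.emod_add_mul_ediv (B (r k) (c k)) ((p : ℤ) ^ a (c k))
    rw [Int.toNat_of_nonneg (Int.emod_nonneg _ (hpos k).ne')]
    simp only [q]
    linarith
  -- The quotients form a symmetric matrix, so the reduction `B + T D` is left multiplication by the
  -- element `(1 T; 0 1)` of `Sp`.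
  let T : Matrix (Fin 3) (Fin 3) ℤ :=
    !![-q 0, -q 1, -q 2; -q 1, -q 3, -q 4; -q 2, -q 4, -q 5]
  have hT : Tᵀ = T := by ext i j; fin_cases i <;> fin_cases j <;> rfl
  refine ⟨s, ?_, ?_⟩
  · rw [box, Fintype.mem_piFinset]
    intro k
    rw [Finset.mem_range, hc]
    zify
    rw [Int.toNat_of_nonneg (Int.emod_nonneg _ (hpos k).ne')]
    exact Int.emod_lt_of_pos _ (hpos k)
  · refine (coset_eq_coset_iff_exists.2 ⟨_, ofSymplectic_mem
      ⟨_, fromBlocks_unipotent_mem hT⟩, ?_⟩).symm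
    apply mat_injective
    rw [mat_fiberMatrix, mat_mul, hABD]
    change _ = (fromBlocks 1 T 0 1).map (Int.castRingHom ℚ) * _
    rw [fiberIntMatrix_map, fromBlocks_map, fromBlocks_multiply, hA, hD,
      Matrix.map_one _ (map_zero _) (map_one _), Matrix.map_zero _ (map_zero _)]
    have h01 := ma (show (0 : Fin 3) ≤ 1 by decide)
    have h02 := ma (show (0 : Fin 3) ≤ 2 by decide)
    have h12 := ma (show (1 : Fin 3) ≤ 2 by decide)
    have key : boxMatrix p a s = B + T * diagonal fun i => (p : ℤ) ^ a i := by
      have e01 : (p : ℤ) ^ a 1 = (p : ℤ) ^ (a 1 - a 0) * p ^ a 0 := by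
        rw [← pow_add, Nat.sub_add_cancel h01]
      have e02 : (p : ℤ) ^ a 2 = (p : ℤ) ^ (a 2 - a 0) * p ^ a 0 := by
        rw [← pow_add, Nat.sub_add_cancel h02]
      have e12 : (p : ℤ) ^ a 2 = (p : ℤ) ^ (a 2 - a 1) * p ^ a 1 := by
        rw [← pow_add, Nat.sub_add_cancel h12]
      have s0 : (s 0 : ℤ) = B 0 0 - q 0 * (p : ℤ) ^ a 0 := hsq 0
      have s1 : (s 1 : ℤ) = B 1 0 - q 1 * (p : ℤ) ^ a 0 := hsq 1
      have s2 : (s 2 : ℤ) = B 2 0 - q 2 * (p : ℤ) ^ a 0 := hsq 2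
      have s3 : (s 3 : ℤ) = B 1 1 - q 3 * (p : ℤ) ^ a 1 := hsq 3
      have s4 : (s 4 : ℤ) = B 2 1 - q 4 * (p : ℤ) ^ a 1 := hsq 4
      have s5 : (s 5 : ℤ) = B 2 2 - q 5 * (p : ℤ) ^ a 2 := hsq 5
      have b01 := hoff 0 1 (by decide)
      have b02 := hoff 0 2 (by decide)
      have b12 := hoff 1 2 (by decide)
      ext i j
      rw [Matrix.add_apply, Matrix.mul_diagonal]
      fin_cases i <;> fin_cases j
      · change (s 0 : ℤ) = B 0 0 + -q 0 * p ^ a 0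
        rw [s0]; ring
      · change (s 1 : ℤ) * p ^ (a 1 - a 0) = B 0 1 + -q 1 * p ^ a 1
        rw [s1, b01, e01]; ring
      · change (s 2 : ℤ) * p ^ (a 2 - a 0) = B 0 2 + -q 2 * p ^ a 2
        rw [s2, b02, e02]; ring
      · change (s 1 : ℤ) = B 1 0 + -q 1 * p ^ a 0
        rw [s1]; ring
      · change (s 3 : ℤ) = B 1 1 + -q 3 * p ^ a 1
        rw [s3]; ring
      · change (s 4 : ℤ) * p ^ (a 2 - a 1) = B 1 2 + -q 4 * p ^ a 2
        rw [s4, b12, e12]; ring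
      · change (s 2 : ℤ) = B 2 0 + -q 2 * p ^ a 0
        rw [s2]; ring
      · change (s 4 : ℤ) = B 2 1 + -q 4 * p ^ a 1
        rw [s4]; ring
      · change (s 5 : ℤ) = B 2 2 + -q 5 * p ^ a 2
        rw [s5]; ring
    rw [key, Matrix.map_add _ (map_add _), Matrix.map_mul, diagonal_map (map_zero _)]
    simp

theorem exists_lowerBlock_eq {M : GSp 3} (hM : M ∈ integralSet 3 p δ) {D : GL (Fin 3) ℚ}
    (e : toGL (coset (Sp 3) M) = coset (GLZ 3) D) :
    ∃ γ ∈ Sp 3, IsBlockTri (γ * M) ∧ lowerBlock (γ * M) = D := by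
  obtain ⟨γ, hγ, hb, -⟩ := exists_isBlockTri hM
  rw [← coset_mul_left hγ, toGL_coset hb] at e
  obtain ⟨U, hU, rfl⟩ := coset_eq_coset_iff_exists.1 e
  refine ⟨levi U * γ, mul_mem (levi_mem hU) hγ, ?_, ?_⟩
  · rw [mul_assoc]; exact (isBlockTri_levi U).mul hb
  · rw [mul_assoc, lowerBlock_mul (isBlockTri_levi U) hb, lowerBlock_levi]

open Classical in
theorem coeffHom_pushGL (t : HeckeRing (Sp 3))
    (ht : SupportedOn (integralUnion 3 p) t.toCosets) (D : GL (Fin 3) ℚ) :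
    coeffHom D (pushGL p t ht) = ∑ c ∈ t.toCosets.support with toGL c = coset (GLZ 3) D,
      t.toCosets c := by
  rw [coeffHom_apply, toCosets_pushGL, Finsupp.mapDomain, Finsupp.sum, Finsupp.finsetSum_apply,
    Finset.sum_filter]
  exact Finset.sum_congr rfl fun c _ => Finsupp.single_apply

open Classical in
/-- The coefficients of the image in the Hecke ring of `GL₃` of the sum of the cosets in a set of
integral matrices. -/
theorem coeffHom_pushGL_glDiag {𝒮 : Set (GSp 3)} (h𝒮 : 𝒮 ⊆ integralSet 3 p δ)
    {t : HeckeRing (Sp 3)} (htc : ∀ M, coeffHom M t = if M ∈ 𝒮 then 1 else 0)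
    (ht : SupportedOn (integralUnion 3 p) t.toCosets) (h : ∀ i, a i ≤ δ) (ma : Monotone a) :
    coeffHom (glDiag p fun i => (a i : ℤ)) (pushGL p t ht) =
      ((box p a).filter fun s => fiberMatrix p δ a h ma s ∈ 𝒮).card := by
  have hsupp (M) : coset (Sp 3) M ∈ t.toCosets.support ↔ M ∈ 𝒮 := by
    rw [Finsupp.mem_support_iff, ← coeffHom_apply, htc]
    split_ifs with hM <;> simp [hM]
  rw [coeffHom_pushGL]
  have h1 : ∀ c ∈ t.toCosets.support.filter
      (fun c => toGL c = coset (GLZ 3) (glDiag p fun i => (a i : ℤ))), t.toCosets c = 1 := by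
    intro c hc
    obtain ⟨M, rfl⟩ := coset_surjective c
    rw [← coeffHom_apply, htc, if_pos ((hsupp M).1 (Finset.mem_filter.1 hc).1)]
  rw [Finset.sum_congr rfl h1, Finset.sum_const, nsmul_eq_mul, mul_one, Nat.cast_inj]
  symm
  refine Finset.card_bij (fun s _ => coset (Sp 3) (fiberMatrix p δ a h ma s)) ?_ ?_ ?_
  · intro s hs
    rw [Finset.mem_filter] at hs ⊢
    exact ⟨(hsupp _).2 hs.2, by
      rw [toGL_coset (isBlockTri_fiberMatrix s), lowerBlock_fiberMatrix]⟩
  · intro s hs s' hs' e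
    exact coset_fiberMatrix_injOn (Finset.mem_filter.1 hs).1 (Finset.mem_filter.1 hs').1 e
  · intro c hc
    obtain ⟨M, rfl⟩ := coset_surjective c
    rw [Finset.mem_filter, hsupp] at hc
    have hM := h𝒮 hc.1
    obtain ⟨γ, hγ, hb, e⟩ := exists_lowerBlock_eq hM hc.2
    obtain ⟨s, hs, e'⟩ := exists_fiberMatrix h ma (mul_mem_integralSet hγ hM) hb e
    rw [coset_mul_left hγ] at e'
    refine ⟨s, Finset.mem_filter.2 ⟨hs, ?_⟩, e'⟩
    rw [← hsupp, e', hsupp]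
    exact hc.1

theorem coeffHom_pushGL_glDiag_eq_zero {t : HeckeRing (Sp 3)}
    (hδ : SupportedOn (integralSet 3 p δ) t.toCosets)
    (ht : SupportedOn (integralUnion 3 p) t.toCosets) (ha : ¬ ∀ i, a i ≤ δ) :
    coeffHom (glDiag p fun i => (a i : ℤ)) (pushGL p t ht) = 0 := by
  classical
  rw [coeffHom_pushGL, Finset.filter_eq_empty_iff.2, Finset.sum_empty]
  intro c hc e
  obtain ⟨M, hM, rfl⟩ := hδ c (Finsupp.mem_support_iff.1 hc)
  obtain ⟨γ, hγ, hb, e⟩ := exists_lowerBlock_eq hM e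
  exact ha (le_of_lowerBlock (mul_mem_integralSet hγ hM) hb e)

end Fibers

end

noncomputable section

/-! ### Hecke elements attached to biinvariant sets, and products with them. -/

section Biinvariant

variable {G : Type*} [Group G] {Γ : Subgroup G}

/-- A subset of `G` with `Γ X Γ = X`. -/
def IsBiinvariant (Γ : Subgroup G) (X : Set G) : Prop :=
  ∀ γ ∈ Γ, ∀ g, (γ * g ∈ X ↔ g ∈ X) ∧ (g * γ ∈ X ↔ g ∈ X)

theorem IsBiinvariant.coset_mem_image {X : Set G} (hX : IsBiinvariant Γ X) (g : G) :
    coset Γ g ∈ coset Γ '' X ↔ g ∈ X := by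
  constructor
  · rintro ⟨h, hh, e⟩
    obtain ⟨γ, hγ, rfl⟩ := coset_eq_coset_iff_exists.1 e
    exact ((hX γ hγ h).1).2 hh
  · exact fun h => ⟨g, h, rfl⟩

/-- The sum of the cosets contained in a set `X` with `Γ X Γ = X`. -/
def ofBiinvariant {X : Set G} (hX : IsBiinvariant Γ X) (hfin : (coset Γ '' X).Finite) :
    HeckeRing Γ :=
  ofSet (coset Γ '' X) hfin fun γ hγ c => by
    obtain ⟨g, rfl⟩ := coset_surjective c
    rw [translate_coset, hX.coset_mem_image, hX.coset_mem_image]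
    exact (hX γ hγ g).2

variable {X : Set G} {hX : IsBiinvariant Γ X} {hfin : (coset Γ '' X).Finite}

open Classical in
theorem coeffHom_ofBiinvariant (g : G) :
    coeffHom g (ofBiinvariant hX hfin) = if g ∈ X then 1 else 0 := by
  rw [coeffHom_apply, ofBiinvariant, toCosets_ofSet_apply]
  exact if_congr (hX.coset_mem_image g) rfl rfl

theorem supportedOn_ofBiinvariant : SupportedOn X (ofBiinvariant hX hfin).toCosets := by
  classical
  intro c hc
  rw [ofBiinvariant, toCosets_ofSet_apply] at hc
  by_contra h
  have h' : c ∉ coset Γ '' X := h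
  rw [if_neg h'] at hc
  exact hc rfl

variable {ι : Type*} [Fintype ι]

theorem finite_of_range_eq {r : ι → G} (h : Set.range (coset Γ ∘ r) = coset Γ '' X) :
    (coset Γ '' X).Finite := h ▸ Set.finite_range _

theorem weightSum_ofBiinvariant {R : Type*} [CommRing R] (w : Cosets Γ → R) {r : ι → G}
    (hinj : Function.Injective (coset Γ ∘ r)) (h : Set.range (coset Γ ∘ r) = coset Γ '' X) :
    weightSum w (ofBiinvariant hX hfin).toCosets = ∑ i, w (coset Γ (r i)) := by
  classical
  have e : (ofBiinvariant hX hfin).toCosets = ∑ i, Finsupp.single (coset Γ (r i)) 1 := by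
    ext c
    rw [ofBiinvariant, toCosets_ofSet_apply, Finsupp.finsetSum_apply, ← h]
    simp only [Finsupp.single_apply]
    by_cases hc : c ∈ Set.range (coset Γ ∘ r)
    · obtain ⟨i, rfl⟩ := hc
      rw [if_pos ⟨i, rfl⟩, Finset.sum_eq_single i]
      · simp
      · intro j _ hj
        exact if_neg fun e => hj (hinj e)
      · simp
    · rw [if_neg hc, Finset.sum_eq_zero]
      intro i _
      exact if_neg fun e => hc ⟨i, e⟩
  rw [e, map_sum]
  simp [weightSum]

/-- The coefficients of the product with the sum of the cosets contained in `X`, in terms of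
representatives of the inverse of `X`. -/
theorem coeffHom_ofBiinvariant_mul (s : HeckeRing Γ) {k : ι → G}
    (hinj : Function.Injective (coset Γ ∘ k)) (hk : ∀ i, (k i)⁻¹ ∈ X)
    (hex : ∀ g, g⁻¹ ∈ X → ∃ i, coset Γ g = coset Γ (k i)) (D : G) :
    coeffHom D (ofBiinvariant hX hfin * s) = ∑ i, coeffHom (k i * D) s := by
  classical
  choose r hr using coset_surjective (Γ := Γ)
  rw [coeffHom_mul _ s D r fun c _ => hr c]
  have hinj' : Function.Injective fun i => coset Γ (k i * D) := by
    intro i j e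
    simp only [← translate_coset] at e
    exact hinj (translate_injective D e)
  -- `D (r c)⁻¹` lies in `X` exactly when `c` is one of the cosets `Γ kᵢ D`, and then for a single
  -- `i`.
  have h1 (c) : s.toCosets c * coeffHom (D * (r c)⁻¹) (ofBiinvariant hX hfin) =
      ∑ i, if coset Γ (k i * D) = c then s.toCosets c else 0 := by
    rw [coeffHom_ofBiinvariant]
    split_ifs with hmem
    · obtain ⟨i, hi⟩ := hex (r c * D⁻¹) (by simpa using hmem)
      have hi' : coset Γ (k i * D) = c := by
        rw [← translate_coset, ← hi, translate_coset, inv_mul_cancel_right, hr]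
      rw [Finset.sum_eq_single i]
      · rw [if_pos hi', mul_one]
      · intro j _ hj
        exact if_neg fun e => hj (hinj' (e.trans hi'.symm))
      · simp
    · rw [mul_zero, Finset.sum_eq_zero]
      intro i _
      refine if_neg fun e => hmem ?_
      rw [← hr c] at e
      obtain ⟨γ, hγ, e⟩ := coset_eq_coset_iff_exists.1 e
      rw [e]
      have : D * (γ * (k i * D))⁻¹ = (k i)⁻¹ * γ⁻¹ := by group
      rw [this]
      exact ((hX _ (inv_mem hγ) _).2).2 (hk i)
  simp only [h1]
  rw [Finset.sum_comm]
  refine Finset.sum_congr rfl fun i _ => ?_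
  rw [Finset.sum_ite_eq, coeffHom_apply]
  split_ifs with hc
  · rfl
  · exact (Finsupp.notMem_support_iff.1 hc).symm

end Biinvariant

/-! ### Coefficients at diagonal matrices in the Hecke ring of `GLₙ`. -/

section DiagonalCoefficients

variable {p : ℕ} [hp : Fact p.Prime] {n : ℕ}

theorem glDiag_mul (a b : Fin n → ℤ) : glDiag p a * glDiag p b = glDiag p (a + b) := by
  apply Units.ext
  rw [Units.val_mul, glDiag_val, glDiag_val, glDiag_val, diagonal_mul_diagonal]
  simp only [Pi.add_apply, zpow_add₀ ratCast_prime_ne_zero]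

theorem glDiag_zero : glDiag p (0 : Fin n → ℤ) = 1 := by
  apply Units.ext
  rw [glDiag_val]
  simp

theorem glDiag_inv (a : Fin n → ℤ) : (glDiag p a)⁻¹ = glDiag p (-a) := by
  rw [inv_eq_iff_mul_eq_one, glDiag_mul, add_neg_cancel, glDiag_zero]

theorem glDiag_const_comm (c : ℤ) (g : GL (Fin n) ℚ) :
    glDiag p (fun _ => c) * g = g * glDiag p fun _ => c := by
  apply Units.ext
  rw [Units.val_mul, Units.val_mul, glDiag_val]
  ext i j
  rw [Matrix.diagonal_mul, Matrix.mul_diagonal, mul_comm]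

/-- Permutation matrices are unimodular, so they do not change the double coset of a diagonal
matrix. -/
theorem coeffHom_glDiag_perm (s : HeckeRing (GLZ n)) (a : Fin n → ℤ) (σ : Equiv.Perm (Fin n)) :
    coeffHom (glDiag p (a ∘ σ)) s = coeffHom (glDiag p a) s := by
  let P : GL (Fin n) ℤ := GeneralLinearGroup.mk'' (σ.permMatrix ℤ)
    (by rw [det_permutation]; exact (Equiv.Perm.sign σ).isUnit.map (Int.castRingHom ℤ))
  have hP : GeneralLinearGroup.map (Int.castRingHom ℚ) P * glDiag p a =
      glDiag p (a ∘ σ) * GeneralLinearGroup.map (Int.castRingHom ℚ) P := by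
    apply Units.ext
    rw [Units.val_mul, Units.val_mul, glDiag_val, glDiag_val, val_map_intCast]
    change (σ.permMatrix ℤ).map _ * _ = _ * (σ.permMatrix ℤ).map _
    ext i j
    rw [Matrix.mul_diagonal, Matrix.diagonal_mul, Matrix.map_apply]
    simp only [Equiv.Perm.permMatrix, PEquiv.toMatrix_apply, Equiv.toPEquiv_apply,
      Option.mem_some_iff, Function.comp_apply]
    by_cases h : σ i = j
    · subst h; simp
    · simp [h]
  rw [← coeffHom_mul_right s (glDiag p (a ∘ σ)) (map_mem_GLZ P), ← hP,
    coeffHom_mul_left _ _ (map_mem_GLZ P)]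

theorem coeffHom_glDiag_of_neg {s : HeckeRing (GLZ n)}
    (hs : SupportedOn (glIntegral n p) s.toCosets) {a : Fin n → ℤ} {i : Fin n} (hi : a i < 0) :
    coeffHom (glDiag p a) s = 0 := by
  by_contra hne
  obtain ⟨g, hg, e⟩ := hs _ hne
  have := (glIntegral_of_coset_eq e hg).1
  obtain ⟨x, hx⟩ := isInt_iff.1 this i i
  rw [glDiag_val, diagonal_apply_eq] at hx
  have hp1 : (1 : ℚ) < p := by exact_mod_cast hp.out.one_lt
  have h1 : ((p : ℚ)) ^ a i < 1 := zpow_lt_one_of_neg₀ hp1 hi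
  have h0 : 0 < ((p : ℚ)) ^ a i := zpow_pos (by positivity) _
  rw [← hx] at h0 h1
  have h0' : 0 < x := by exact_mod_cast h0
  have h1' : x < 1 := by exact_mod_cast h1
  omega

/-- By the Smith normal form every double coset in `glIntegral` contains a diagonal matrix with
increasing exponents. -/
theorem eq_of_coeffHom_glDiag {t s : HeckeRing (GLZ n)}
    (ht : SupportedOn (glIntegral n p) t.toCosets) (hs : SupportedOn (glIntegral n p) s.toCosets)
    (h : ∀ a : Fin n → ℕ, Monotone a →
      coeffHom (glDiag p fun i => (a i : ℤ)) t = coeffHom (glDiag p fun i => (a i : ℤ)) s) :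
    t = s := by
  refine ext_coeff fun g => ?_
  by_cases hg : g ∈ glIntegral n p
  · obtain ⟨⟨A, hA⟩, K, B, hB⟩ := hg
    have hAB : A * B = (p : ℤ) ^ K • 1 := map_intCast_injective (by
      rw [Matrix.map_mul, hA, hB, Matrix.mul_smul, Units.mul_inv, map_intCast_smul_one,
        Int.cast_pow, Int.cast_natCast])
    obtain ⟨U, V, a, ma, e⟩ := exists_smith p A B K hAB
    have key : GeneralLinearGroup.map (Int.castRingHom ℚ) U * g *
        GeneralLinearGroup.map (Int.castRingHom ℚ) V = glDiag p fun i => (a i : ℤ) := by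
      apply Units.ext
      have := congrArg (fun X => X.map (Int.castRingHom ℚ)) e
      simp only [Matrix.map_mul, hA] at this
      refine this.trans ?_
      rw [diagonal_map (map_zero _), glDiag_val]
      simp
    have := h a ma
    rwa [← key, coeffHom_mul_right _ _ (map_mem_GLZ V), coeffHom_mul_left _ _ (map_mem_GLZ U),
      coeffHom_mul_right _ _ (map_mem_GLZ V), coeffHom_mul_left _ _ (map_mem_GLZ U)] at this
  · have key {t : HeckeRing (GLZ n)} (ht : SupportedOn (glIntegral n p) t.toCosets) :
        coeffHom g t = 0 := by
      by_contra hne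
      obtain ⟨g', hg', e⟩ := ht _ hne
      exact hg (glIntegral_of_coset_eq e hg')
    rw [key ht, key hs]

end DiagonalCoefficients

/-! ### Reduced Hermite forms of size three. -/

section Hermite

variable {p : ℕ} [hp : Fact p.Prime]

variable (p) in
/-- The matrix `(p ^ d₁ x y; 0 p ^ d₂ z; 0 0 p ^ d₃)`. -/
def hermMatrix (d : Fin 3 → ℕ) (x y z : ℤ) : Matrix (Fin 3) (Fin 3) ℤ :=
  !![(p : ℤ) ^ d 0, x, y; 0, (p : ℤ) ^ d 1, z; 0, 0, (p : ℤ) ^ d 2]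

theorem det_hermMatrix (d : Fin 3 → ℕ) (x y z : ℤ) :
    (hermMatrix p d x y z).det = (p : ℤ) ^ (d 0 + d 1 + d 2) := by
  rw [hermMatrix, det_fin_three]
  simp
  ring

variable (p) in
/-- The matrix `(p ^ d₁ x y; 0 p ^ d₂ z; 0 0 p ^ d₃)` as an element of `GL₃(ℚ)`. -/
def herm (d : Fin 3 → ℕ) (x y z : ℤ) : GL (Fin 3) ℚ :=
  GeneralLinearGroup.mkOfDetNeZero ((hermMatrix p d x y z).map (Int.castRingHom ℚ)) (by
    rw [← RingHom.mapMatrix_apply, ← RingHom.map_det, det_hermMatrix, map_pow]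
    exact pow_ne_zero _ (by simpa using hp.out.ne_zero))

theorem herm_val (d : Fin 3 → ℕ) (x y z : ℤ) :
    (herm p d x y z).val = (hermMatrix p d x y z).map (Int.castRingHom ℚ) := rfl

theorem isTri_herm (d : Fin 3 → ℕ) (x y z : ℤ) : IsTri p (herm p d x y z) d := by
  constructor
  · intro i j hij
    rw [herm_val]
    fin_cases i <;> fin_cases j <;> simp [hermMatrix] at hij ⊢
  · intro i
    rw [herm_val]
    fin_cases i <;> simp [hermMatrix]

/-- The effect of a unipotent row operation on the entries above the diagonal. -/
theorem coset_herm_eq {d : Fin 3 → ℕ} {x y z x' y' z' : ℤ} (u v w : ℤ)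
    (hx : x' = x + u * p ^ d 1) (hz : z' = z + w * p ^ d 2)
    (hy : y' = y + u * z + v * p ^ d 2) :
    coset (GLZ 3) (herm p d x y z) = coset (GLZ 3) (herm p d x' y' z') := by
  let U : GL (Fin 3) ℤ := GeneralLinearGroup.mk'' !![1, u, v; 0, 1, w; 0, 0, 1]
    (by simp [det_fin_three])
  refine coset_eq_coset_iff_exists.2 ⟨_, map_mem_GLZ U, ?_⟩
  apply Units.ext
  rw [Units.val_mul, herm_val, herm_val, val_map_intCast, ← Matrix.map_mul]
  congr 1
  change _ = !![1, u, v; 0, 1, w; 0, 0, 1] * _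
  rw [hermMatrix, hermMatrix, hx, hy, hz]
  ext i j
  fin_cases i <;> fin_cases j <;> simp [Matrix.mul_apply, Fin.sum_univ_three]

theorem exists_herm {g : GL (Fin 3) ℚ} (hg : g ∈ glIntegral 3 p) :
    ∃ d, ∃ x y z : ℕ, x < p ^ d 1 ∧ y < p ^ d 2 ∧ z < p ^ d 2 ∧
      coset (GLZ 3) g = coset (GLZ 3) (herm p d x y z) := by
  obtain ⟨γ, hγ, d, htri, hd⟩ := exists_isTri hg
  obtain ⟨A, hA⟩ := (glIntegral_mul (glIntegral_of_mem_GLZ hγ) hg).1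
  have hA' : A = hermMatrix p d (A 0 1) (A 0 2) (A 1 2) := by
    have hentry (i j) : ((A i j : ℤ) : ℚ) = (γ * g).val i j := congrFun (congrFun hA i) j
    have h0 (i j) (hij : j < i) : A i j = 0 := by
      have := hentry i j
      rw [htri hij] at this
      exact_mod_cast this
    have h1 (i) : A i i = (p : ℤ) ^ d i := by
      have := hentry i i
      rw [hd] at this
      exact_mod_cast this
    ext i j
    fin_cases i <;> fin_cases j
    · exact h1 0
    · rfl
    · rfl
    · exact h0 1 0 (by decide)
    · exact h1 1
    · rfl
    · exact h0 2 0 (by decide)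
    · exact h0 2 1 (by decide)
    · exact h1 2
  have e : γ * g = herm p d (A 0 1) (A 0 2) (A 1 2) := by
    apply Units.ext
    rw [herm_val, ← hA', hA]
  have hpos (k : ℕ) : (0 : ℤ) < (p : ℤ) ^ k := pow_pos (by exact_mod_cast hp.out.pos) _
  have hred (x : ℤ) (k : ℕ) : ∃ (x' : ℕ) (q : ℤ), x' < p ^ k ∧ (x' : ℤ) = x + q * p ^ k := by
    refine ⟨(x % (p : ℤ) ^ k).toNat, -(x / (p : ℤ) ^ k), ?_, ?_⟩
    · zify
      rw [Int.toNat_of_nonneg (Int.emod_nonneg _ (hpos k).ne')]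
      exact Int.emod_lt_of_pos _ (hpos k)
    · rw [Int.toNat_of_nonneg (Int.emod_nonneg _ (hpos k).ne')]
      have := Int.emod_add_mul_ediv x ((p : ℤ) ^ k)
      linarith
  obtain ⟨x, u, hx, ex⟩ := hred (A 0 1) (d 1)
  obtain ⟨z, w, hz, ez⟩ := hred (A 1 2) (d 2)
  -- The row operation reducing `x` changes the corner entry by `u` times the entry `z`, so the
  -- corner is reduced last.
  obtain ⟨y, v, hy, ey⟩ := hred (A 0 2 + u * A 1 2) (d 2)
  refine ⟨d, x, y, z, hx, hy, hz, ?_⟩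
  rw [← coset_mul_left hγ g, e]
  exact coset_herm_eq u v w ex ez ey

theorem herm_unique {d d' : Fin 3 → ℕ} {x y z x' y' z' : ℕ} (hx : x < p ^ d 1)
    (hy : y < p ^ d 2) (hz : z < p ^ d 2) (hx' : x' < p ^ d' 1) (hy' : y' < p ^ d' 2)
    (hz' : z' < p ^ d' 2)
    (e : coset (GLZ 3) (herm p d x y z) = coset (GLZ 3) (herm p d' x' y' z')) :
    d = d' ∧ x = x' ∧ y = y' ∧ z = z' := by
  obtain rfl := (isTri_herm d x y z).unique (isTri_herm d' x' y' z') e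
  refine ⟨rfl, ?_⟩
  obtain ⟨γ, hγ, e⟩ := coset_eq_coset_iff_exists.1 e
  obtain ⟨N, hN⟩ := (mem_GLZ_iff.1 hγ).1
  have e1 : hermMatrix p d x' y' z' = N * hermMatrix p d x y z := map_intCast_injective (by
    rw [Matrix.map_mul, hN, ← herm_val, ← herm_val, e, Units.val_mul])
  have hp0 (k : ℕ) : (p : ℤ) ^ k ≠ 0 := pow_ne_zero _ intCast_prime_ne_zero
  have key (i j) := congrFun (congrFun e1 i) j
  simp only [Matrix.mul_apply, Fin.sum_univ_three] at key
  have k00 : (p : ℤ) ^ d 0 = N 0 0 * p ^ d 0 := by simpa [hermMatrix] using key 0 0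
  have k01 : (x' : ℤ) = N 0 0 * x + N 0 1 * p ^ d 1 := by simpa [hermMatrix] using key 0 1
  have k02 : (y' : ℤ) = N 0 0 * y + N 0 1 * z + N 0 2 * p ^ d 2 := by
    simpa [hermMatrix] using key 0 2
  have k10 : N 1 0 = 0 := by simpa [hermMatrix, hp.out.ne_zero] using key 1 0
  have k11 : (p : ℤ) ^ d 1 = N 1 0 * x + N 1 1 * p ^ d 1 := by simpa [hermMatrix] using key 1 1
  have k12 : (z' : ℤ) = N 1 0 * y + N 1 1 * z + N 1 2 * p ^ d 2 := by
    simpa [hermMatrix] using key 1 2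
  have n00 : N 0 0 = 1 := mul_right_cancel₀ (hp0 _) (k00.symm.trans (one_mul _).symm)
  rw [k10, zero_mul, zero_add] at k11 k12
  have n11 : N 1 1 = 1 := mul_right_cancel₀ (hp0 _) (k11.symm.trans (one_mul _).symm)
  rw [n00, one_mul] at k01 k02
  rw [n11, one_mul] at k12
  have hmod {b b' k : ℕ} {c : ℤ} (hb : b < p ^ k) (hb' : b' < p ^ k)
      (h : (b' : ℤ) = b + c * p ^ k) : b = b' := by
    have h3 : (b : ℤ) ≡ b' [ZMOD (p ^ k : ℕ)] := by
      rw [Int.modEq_iff_dvd]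
      exact ⟨c, by rw [h]; push_cast; ring⟩
    exact Nat.ModEq.eq_of_lt_of_lt (Int.natCast_modEq_iff.1 h3) hb hb'
  have ex := hmod hx hx' k01
  have ez := hmod hz hz' k12
  have n01 : N 0 1 = 0 := by
    rw [ex] at k01
    have : N 0 1 * (p : ℤ) ^ d 1 = 0 := by linarith
    exact (mul_eq_zero.1 this).resolve_right (hp0 _)
  rw [n01, zero_mul, add_zero] at k02
  exact ⟨ex, hmod hy hy' k02, ez⟩

/-- Right multiplication by a diagonal matrix with increasing exponents diagonalizes a Hermite
form whose off-diagonal entries stand in rows with diagonal entry `1`. -/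
theorem coeffHom_herm_mul_glDiag (s : HeckeRing (GLZ 3)) {d : Fin 3 → ℕ} {x y z : ℤ}
    (hx : x = 0 ∨ d 0 = 0) (hy : y = 0 ∨ d 0 = 0) (hz : z = 0 ∨ d 1 = 0) {a : Fin 3 → ℤ}
    (ha : Monotone a) :
    coeffHom (herm p d x y z * glDiag p a) s =
      coeffHom (glDiag p fun i => (d i : ℤ) + a i) s := by
  have h01 : 0 ≤ a 1 - a 0 := sub_nonneg.2 (ha (by decide))
  have h02 : 0 ≤ a 2 - a 0 := sub_nonneg.2 (ha (by decide))
  have h12 : 0 ≤ a 2 - a 1 := sub_nonneg.2 (ha (by decide))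
  let V : GL (Fin 3) ℤ := GeneralLinearGroup.mk''
    !![1, x * p ^ (a 1 - a 0).toNat, y * p ^ (a 2 - a 0).toNat;
       0, 1, z * p ^ (a 2 - a 1).toNat; 0, 0, 1] (by simp [det_fin_three])
  have hp0 := ratCast_prime_ne_zero (p := p)
  have hpow {b c : ℤ} (h : 0 ≤ c - b) : (p : ℚ) ^ b * (p : ℚ) ^ (c - b).toNat = (p : ℚ) ^ c := by
    rw [← zpow_natCast, Int.toNat_of_nonneg h, ← zpow_add₀ hp0]
    congr 1; ring
  have key : herm p d x y z * glDiag p a =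
      glDiag p (fun i => (d i : ℤ) + a i) * GeneralLinearGroup.map (Int.castRingHom ℚ) V := by
    apply Units.ext
    rw [Units.val_mul, Units.val_mul, herm_val, glDiag_val, glDiag_val, val_map_intCast]
    change _ = diagonal _ * (!![1, x * p ^ (a 1 - a 0).toNat, y * p ^ (a 2 - a 0).toNat;
       0, 1, z * p ^ (a 2 - a 1).toNat; 0, 0, 1] : Matrix _ _ ℤ).map _
    ext i j
    rw [Matrix.mul_diagonal, Matrix.diagonal_mul, zpow_add₀ hp0, zpow_natCast]
    fin_cases i <;> fin_cases j <;> simp [hermMatrix]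
    · rcases hx with hx | hx
      · simp [hx]
      · rw [hx, ← hpow h01]; ring
    · rcases hy with hy | hy
      · simp [hy]
      · rw [hy, ← hpow h02]; ring
    · rcases hz with hz | hz
      · simp [hz]
      · rw [hz, ← hpow h12]; ring
  rw [key, coeffHom_mul_right _ _ (map_mem_GLZ V)]

end Hermite

end

noncomputable section

/-! ### The elementary double cosets of `GL₃` and the Pieri rule. -/

section Pieri

variable {p : ℕ} [hp : Fact p.Prime]

variable (p) in
/-- The integral matrices `g` of size `3` with `p g⁻¹` integral and `|det g| = p ^ k`. -/
def elemSet (k : ℕ) : Set (GL (Fin 3) ℚ) :=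
  {g | IsInt g.val ∧ IsInt ((p : ℚ) • (g⁻¹ : GL (Fin 3) ℚ).val) ∧ |g.val.det| = (p : ℚ) ^ k}

theorem elemSet_subset (k : ℕ) : elemSet p k ⊆ glIntegral 3 p :=
  fun _ h => ⟨h.1, 1, by rw [pow_one]; exact h.2.1⟩

theorem abs_det_of_mem_GLZ {n : ℕ} {γ : GL (Fin n) ℚ} (hγ : γ ∈ GLZ n) : |γ.val.det| = 1 := by
  obtain ⟨U, rfl⟩ := hγ
  rw [val_map_intCast, ← RingHom.mapMatrix_apply, ← RingHom.map_det, eq_intCast, ← Int.cast_abs,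
    Int.isUnit_iff_abs_eq.1 ((Matrix.isUnit_iff_isUnit_det _).1 U.isUnit), Int.cast_one]

theorem elemSet_mul_left {k : ℕ} {γ g : GL (Fin 3) ℚ} (hγ : γ ∈ GLZ 3) (hg : g ∈ elemSet p k) :
    γ * g ∈ elemSet p k := by
  refine ⟨(mem_GLZ_iff.1 hγ).1.mul hg.1, ?_, ?_⟩
  · rw [_root_.mul_inv_rev, Units.val_mul, ← Matrix.smul_mul]
    exact hg.2.1.mul (mem_GLZ_iff.1 hγ).2
  · rw [Units.val_mul, det_mul, abs_mul, abs_det_of_mem_GLZ hγ, one_mul, hg.2.2]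

theorem elemSet_mul_right {k : ℕ} {γ g : GL (Fin 3) ℚ} (hγ : γ ∈ GLZ 3) (hg : g ∈ elemSet p k) :
    g * γ ∈ elemSet p k := by
  refine ⟨hg.1.mul (mem_GLZ_iff.1 hγ).1, ?_, ?_⟩
  · rw [_root_.mul_inv_rev, Units.val_mul, ← Matrix.mul_smul]
    exact (mem_GLZ_iff.1 hγ).2.mul hg.2.1
  · rw [Units.val_mul, det_mul, abs_mul, abs_det_of_mem_GLZ hγ, mul_one, hg.2.2]

theorem isBiinvariant_elemSet (k : ℕ) : IsBiinvariant (GLZ 3) (elemSet p k) := by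
  intro γ hγ g
  constructor
  · exact ⟨fun h => by simpa using elemSet_mul_left (inv_mem hγ) h, elemSet_mul_left hγ⟩
  · exact ⟨fun h => by simpa using elemSet_mul_right (inv_mem hγ) h, elemSet_mul_right hγ⟩

theorem glDiag_const_val {n : ℕ} (c : ℤ) :
    (glDiag p fun _ : Fin n => c).val = ((p : ℚ) ^ c) • 1 := by
  rw [glDiag_val, smul_one_eq_diagonal]

/-- `g ↦ p g⁻¹` interchanges the elementary sets of complementary size; hence the inverses needed in
`coeffHom_ofBiinvariant_mul` are again Hermite forms, up to the scalar `p⁻¹`. -/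
theorem mul_inv_mem_elemSet {k l : ℕ} (hkl : k + l = 3) {g : GL (Fin 3) ℚ}
    (hg : g ∈ elemSet p k) : glDiag p (fun _ => 1) * g⁻¹ ∈ elemSet p l := by
  have hp0 := ratCast_prime_ne_zero (p := p)
  refine ⟨?_, ?_, ?_⟩
  · rw [Units.val_mul, glDiag_const_val, Matrix.smul_mul, Matrix.one_mul, zpow_one]
    exact hg.2.1
  · rw [_root_.mul_inv_rev, inv_inv, glDiag_inv, Units.val_mul]
    have : (-fun _ : Fin 3 => (1 : ℤ)) = fun _ => -1 := rfl
    rw [this, glDiag_const_val, Matrix.mul_smul, Matrix.mul_one, smul_smul, _root_.zpow_neg_one,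
      mul_inv_cancel₀ hp0, one_smul]
    exact hg.1
  · have h1 : |(g⁻¹ : GL (Fin 3) ℚ).val.det| * (p : ℚ) ^ k = 1 := by
      rw [← hg.2.2, ← abs_mul, ← det_mul, Units.inv_mul, det_one, abs_one]
    have h2 : (p : ℚ) ^ l * p ^ k = p ^ 3 := by rw [← pow_add, add_comm, hkl]
    rw [Units.val_mul, glDiag_const_val, det_mul, det_smul, det_one, mul_one, abs_mul, zpow_one,
      Fintype.card_fin, abs_of_nonneg (by positivity)]
    refine mul_right_cancel₀ (pow_ne_zero k hp0) ?_
    rw [mul_assoc, h1, mul_one, h2]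

variable (p) in
/-- The Hermite forms of the elements of `elemSet p k`: the exponents on the diagonal and the
entries above it. -/
def ElemIndex (k : ℕ) : Type :=
  Σ d : {d : Fin 3 → Fin 2 // (d 0 : ℕ) + d 1 + d 2 = k},
    Fin (p ^ ((d.1 1 : ℕ) * (1 - d.1 0))) × Fin (p ^ ((d.1 2 : ℕ) * (1 - d.1 0))) ×
      Fin (p ^ ((d.1 2 : ℕ) * (1 - d.1 1)))

instance (k : ℕ) : Fintype (ElemIndex p k) := by unfold ElemIndex; infer_instance

/-- The representatives of the cosets in `elemSet p k`. -/
def elemRep {k : ℕ} (i : ElemIndex p k) : GL (Fin 3) ℚ :=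
  herm p (fun j => i.1.1 j) (i.2.1 : ℕ) (i.2.2.1 : ℕ) (i.2.2.2 : ℕ)

/-- An entry above the diagonal is free only if its row has diagonal entry `1` and its column has
`p`. In particular `x` needs `d₁ = 1` and `z` needs `d₁ = 0`, counting from zero, so one of them
vanishes. -/
theorem ElemIndex.entries {k : ℕ} (i : ElemIndex p k) :
    ((i.2.1 : ℕ) = 0 ∨ (i.1.1 0 : ℕ) = 0) ∧ ((i.2.2.1 : ℕ) = 0 ∨ (i.1.1 0 : ℕ) = 0) ∧
      ((i.2.2.2 : ℕ) = 0 ∨ (i.1.1 1 : ℕ) = 0) ∧ ((i.2.1 : ℕ) = 0 ∨ (i.2.2.2 : ℕ) = 0) := by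
  obtain ⟨⟨d, hd⟩, ⟨x, hx⟩, ⟨y, hy⟩, ⟨z, hz⟩⟩ := i
  simp only at hx hy hz ⊢
  have h0 : (d 0 : ℕ) = 0 ∨ (d 0 : ℕ) = 1 := by omega
  have h1 : (d 1 : ℕ) = 0 ∨ (d 1 : ℕ) = 1 := by omega
  rcases h0 with h0 | h0 <;> rcases h1 with h1 | h1 <;> rw [h0] at hx hy <;> rw [h1] at hx hz <;>
    simp at hx hy hz <;> simp [*]

theorem ElemIndex.lt {k : ℕ} (i : ElemIndex p k) :
    (i.2.1 : ℕ) < p ^ (i.1.1 1 : ℕ) ∧ (i.2.2.1 : ℕ) < p ^ (i.1.1 2 : ℕ) ∧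
      (i.2.2.2 : ℕ) < p ^ (i.1.1 2 : ℕ) := by
  have h {a b : ℕ} : p ^ (a * (1 - b)) ≤ p ^ a :=
    Nat.pow_le_pow_right hp.out.pos (by
      calc a * (1 - b) ≤ a * 1 := Nat.mul_le_mul_left _ (by omega)
        _ = a := mul_one a)
  exact ⟨i.2.1.2.trans_le h, i.2.2.1.2.trans_le h, i.2.2.2.2.trans_le h⟩

theorem det_herm (d : Fin 3 → ℕ) (x y z : ℤ) :
    (herm p d x y z).val.det = (p : ℚ) ^ (d 0 + d 1 + d 2) := by
  rw [herm_val, ← RingHom.mapMatrix_apply, ← RingHom.map_det, det_hermMatrix]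
  simp

theorem elemRep_mem {k : ℕ} (i : ElemIndex p k) : elemRep i ∈ elemSet p k := by
  obtain ⟨e1, e2, e3, e4⟩ := i.entries
  rw [elemRep]
  generalize hx : ((i.2.1 : ℕ) : ℤ) = x
  generalize hy : ((i.2.2.1 : ℕ) : ℤ) = y
  generalize hz : ((i.2.2.2 : ℕ) : ℤ) = z
  refine ⟨⟨_, rfl⟩, ?_, ?_⟩
  · let d : Fin 3 → ℕ := fun j => i.1.1 j
    have hd (j) : (p : ℤ) ^ (1 - d j) * (p : ℤ) ^ d j = p := by
      rw [← pow_add, Nat.sub_add_cancel (Nat.le_of_lt_succ (i.1.1 j).2), pow_one]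
    -- This is `p g⁻¹` written out; the mixed term of its corner entry is absent because `x z = 0`.
    let N : Matrix (Fin 3) (Fin 3) ℤ := !![(p : ℤ) ^ (1 - d 0), -(x * p ^ (1 - d 1)),
      -(y * p ^ (1 - d 2)); 0, p ^ (1 - d 1), -(z * p ^ (1 - d 2)); 0, 0, p ^ (1 - d 2)]
    have h1 : x = 0 ∨ d 0 = 0 := e1.imp_left fun h => by rw [← hx, h, Nat.cast_zero]
    have h2 : y = 0 ∨ d 0 = 0 := e2.imp_left fun h => by rw [← hy, h, Nat.cast_zero]
    have h3 : z = 0 ∨ d 1 = 0 := e3.imp_left fun h => by rw [← hz, h, Nat.cast_zero]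
    have h4 : x * z = 0 := by
      rw [← hx, ← hz]
      rcases e4 with e | e <;> rw [e] <;> simp
    have g1 : x * (p : ℤ) ^ (1 - d 0) = x * p := by
      rcases h1 with h | h <;> rw [h] <;> simp
    have g2 : y * (p : ℤ) ^ (1 - d 0) = y * p := by
      rcases h2 with h | h <;> rw [h] <;> simp
    have g3 : z * (p : ℤ) ^ (1 - d 1) = z * p := by
      rcases h3 with h | h <;> rw [h] <;> simp
    have hN : N * hermMatrix p d x y z = (p : ℤ) • 1 := by
      ext a b
      rw [Matrix.mul_apply, Fin.sum_univ_three]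
      fin_cases a <;> fin_cases b <;> simp [N, hermMatrix, -zsmul_eq_mul]
      · exact hd 0
      · linear_combination g1 - x * hd 1
      · linear_combination g2 - y * hd 2 - (p : ℤ) ^ (1 - d 1) * h4
      · exact hd 1
      · linear_combination g3 - z * hd 2
      · exact hd 2
    refine ⟨N, ?_⟩
    have hN' := congrArg (fun X => X.map (Int.castRingHom ℚ)) hN
    simp only [Matrix.map_mul, map_intCast_smul_one, Int.cast_natCast] at hN'
    rw [← herm_val] at hN'
    calc N.map (Int.castRingHom ℚ) = N.map (Int.castRingHom ℚ) * (herm p d x y z).val *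
          ((herm p d x y z)⁻¹ : GL (Fin 3) ℚ).val := by
            rw [Matrix.mul_assoc, Units.mul_inv, Matrix.mul_one]
      _ = _ := by rw [hN', Matrix.smul_mul, Matrix.one_mul]
  · rw [det_herm, abs_of_nonneg (by positivity), i.1.2]

theorem coset_elemRep_injective (k : ℕ) :
    Function.Injective (coset (GLZ 3) ∘ elemRep (p := p) (k := k)) := by
  intro i j e
  have hi := i.lt
  have hj := j.lt
  obtain ⟨hd, hx, hy, hz⟩ := herm_unique hi.1 hi.2.1 hi.2.2 hj.1 hj.2.1 hj.2.2 e
  obtain ⟨⟨d, hd1⟩, x, y, z⟩ := i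
  obtain ⟨⟨d', hd2⟩, x', y', z'⟩ := j
  have hdd : d = d' := by
    ext l
    exact congrFun hd l
  subst hdd
  obtain rfl : x = x' := Fin.ext hx
  obtain rfl : y = y' := Fin.ext hy
  obtain rfl : z = z' := Fin.ext hz
  rfl

/-- Integrality of `N = p g⁻¹` for a Hermite form bounds the diagonal exponents by one. It also
forces every reduced entry in a row with diagonal entry `p` to be divisible by `p`, hence zero. -/
theorem exists_elemRep {k : ℕ} {g : GL (Fin 3) ℚ} (hg : g ∈ elemSet p k) :
    ∃ i : ElemIndex p k, coset (GLZ 3) g = coset (GLZ 3) (elemRep i) := by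
  obtain ⟨d, x, y, z, hx, hy, hz, e⟩ := exists_herm (elemSet_subset k hg)
  obtain ⟨γ, hγ, e'⟩ := coset_eq_coset_iff_exists.1 e
  have hh : herm p d x y z ∈ elemSet p k := e' ▸ elemSet_mul_left hγ hg
  have hpp : 1 < p := hp.out.one_lt
  have hp0 := intCast_prime_ne_zero (p := p)
  have hsum : d 0 + d 1 + d 2 = k := by
    have := hh.2.2
    rw [det_herm, abs_of_nonneg (by positivity)] at this
    exact Nat.pow_right_injective hp.out.two_le (by exact_mod_cast this)
  obtain ⟨N, hN⟩ := hh.2.1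
  have hN' : N * hermMatrix p d x y z = (p : ℤ) • 1 := map_intCast_injective (by
    rw [Matrix.map_mul, hN, map_intCast_smul_one, ← herm_val, Matrix.smul_mul, Units.inv_mul,
      Int.cast_natCast])
  have key (a b) := congrFun (congrFun hN' a) b
  simp only [Matrix.mul_apply, Fin.sum_univ_three, Matrix.smul_apply, smul_eq_mul] at key
  have k00 : N 0 0 * (p : ℤ) ^ d 0 = p := by simpa [hermMatrix] using key 0 0
  have k01 : N 0 0 * x + N 0 1 * p ^ d 1 = 0 := by simpa [hermMatrix] using key 0 1
  have k02 : N 0 0 * y + N 0 1 * z + N 0 2 * p ^ d 2 = 0 := by simpa [hermMatrix] using key 0 2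
  have k10 : N 1 0 = 0 := by simpa [hermMatrix, hp.out.ne_zero] using key 1 0
  have k11 : N 1 1 * (p : ℤ) ^ d 1 = p := by simpa [hermMatrix, k10] using key 1 1
  have k12 : N 1 1 * z + N 1 2 * p ^ d 2 = 0 := by simpa [hermMatrix, k10] using key 1 2
  have k20 : N 2 0 = 0 := by simpa [hermMatrix, hp.out.ne_zero] using key 2 0
  have k21 : N 2 1 = 0 := by simpa [hermMatrix, hp.out.ne_zero, k20] using key 2 1
  have k22 : N 2 2 * (p : ℤ) ^ d 2 = p := by simpa [hermMatrix, k20, k21] using key 2 2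
  have hle {m : ℤ} {e : ℕ} (h : m * (p : ℤ) ^ e = p) : e < 2 := by
    have h' : (p : ℤ) ^ e ∣ (p : ℤ) ^ 1 := ⟨m, by rw [pow_one, mul_comm]; exact h.symm⟩
    have := pow_dvd_pow_iff_le.1 h'
    omega
  have h0 := hle k00
  have h1 := hle k11
  have h2 := hle k22
  have hdvd {x : ℕ} (hx : x < p) (h : (p : ℤ) ∣ x) : x = 0 :=
    Nat.eq_zero_of_dvd_of_lt (by exact_mod_cast h) hx
  have n0 (h : d 0 = 1) : N 0 0 = 1 := by
    rw [h, pow_one] at k00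
    exact mul_right_cancel₀ hp0 (k00.trans (one_mul _).symm)
  have n1 (h : d 1 = 1) : N 1 1 = 1 := by
    rw [h, pow_one] at k11
    exact mul_right_cancel₀ hp0 (k11.trans (one_mul _).symm)
  have hx0 (h : d 0 = 1) : x = 0 := by
    have : d 1 = 0 ∨ d 1 = 1 := by omega
    rcases this with h' | h'
    · rw [h', pow_zero] at hx
      omega
    · rw [n0 h, h', one_mul, pow_one] at k01
      rw [h', pow_one] at hx
      exact hdvd hx ⟨-N 0 1, by linarith⟩
  have hz0 (h : d 1 = 1) : z = 0 := by
    have : d 2 = 0 ∨ d 2 = 1 := by omega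
    rcases this with h' | h'
    · rw [h', pow_zero] at hz
      omega
    · rw [n1 h, h', one_mul, pow_one] at k12
      rw [h', pow_one] at hz
      exact hdvd hz ⟨-N 1 2, by linarith⟩
  have hy0 (h : d 0 = 1) : y = 0 := by
    have : d 2 = 0 ∨ d 2 = 1 := by omega
    rcases this with h' | h'
    · rw [h', pow_zero] at hy
      omega
    · rw [hx0 h, Nat.cast_zero, mul_zero, zero_add] at k01
      have : N 0 1 = 0 := (mul_eq_zero.1 k01).resolve_right (pow_ne_zero _ hp0)
      rw [n0 h, h', one_mul, pow_one, this, zero_mul, add_zero] at k02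
      rw [h', pow_one] at hy
      exact hdvd hy ⟨-N 0 2, by linarith⟩
  have hlt {b c w : ℕ} (hb : b < 2) (hw : w < p ^ c) (h : b = 1 → w = 0) :
      w < p ^ (c * (1 - b)) := by
    have : b = 0 ∨ b = 1 := by omega
    rcases this with h' | h'
    · rw [h', Nat.sub_zero, mul_one]
      exact hw
    · rw [h h']
      exact pow_pos hp.out.pos _
  have hd2 (j) : d j < 2 := by fin_cases j <;> assumption
  exact ⟨⟨⟨fun j => ⟨d j, hd2 j⟩, hsum⟩, ⟨x, hlt h0 hx hx0⟩, ⟨y, hlt h0 hy hy0⟩,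
    ⟨z, hlt h1 hz hz0⟩⟩, e⟩

theorem range_elemRep (k : ℕ) :
    Set.range (coset (GLZ 3) ∘ elemRep (p := p) (k := k)) = coset (GLZ 3) '' elemSet p k := by
  ext c
  constructor
  · rintro ⟨i, rfl⟩
    exact ⟨_, elemRep_mem i, rfl⟩
  · rintro ⟨g, hg, rfl⟩
    obtain ⟨i, e⟩ := exists_elemRep hg
    exact ⟨i, e.symm⟩

variable (p) in
/-- The sum of the cosets contained in `elemSet p k`. -/
def elemHecke (k : ℕ) : HeckeRing (GLZ 3) :=
  ofBiinvariant (isBiinvariant_elemSet (p := p) k) (finite_of_range_eq (range_elemRep k))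

theorem supportedOn_elemHecke (k : ℕ) :
    SupportedOn (glIntegral 3 p) (elemHecke p k).toCosets :=
  supportedOn_ofBiinvariant.mono (elemSet_subset k)

/-- The exponent of `p` in the number of Hermite forms in `elemSet p k` with a given diagonal. -/
def elemExponent (d : Fin 3 → Fin 2) : ℕ :=
  (d 1 : ℕ) * (1 - d 0) + (d 2 : ℕ) * (1 - d 0) + (d 2 : ℕ) * (1 - d 1)

theorem sum_elemIndex {R : Type*} [CommRing R] (k : ℕ) (f : (Fin 3 → Fin 2) → R) :
    ∑ i : ElemIndex p k, f i.1.1 =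
      ∑ d : Fin 3 → Fin 2 with (d 0 : ℕ) + d 1 + d 2 = k, (p : R) ^ elemExponent d * f d := by
  have h : ∑ i : ElemIndex p k, f i.1.1 =
      ∑ d : {d : Fin 3 → Fin 2 // (d 0 : ℕ) + d 1 + d 2 = k},
        (p : R) ^ elemExponent d.1 * f d.1 := by
    refine (Fintype.sum_sigma _).trans (Finset.sum_congr rfl fun d _ => ?_)
    refine (Finset.sum_const (f d.1)).trans ?_
    rw [Finset.card_univ, nsmul_eq_mul]
    simp only [Fintype.card_prod, Fintype.card_fin, Nat.cast_mul, Nat.cast_pow, elemExponent,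
      pow_add, mul_assoc]
  rw [h, Finset.sum_subtype (p := fun d : Fin 3 → Fin 2 => (d 0 : ℕ) + d 1 + d 2 = k)]
  simp

/-- The sum runs over `p⁻¹ h` with `h` a Hermite form in the complementary set. Multiplied by a
diagonal matrix with increasing exponents, `h` becomes diagonal up to a unimodular factor on the
right, so only its diagonal `d` matters, with multiplicity `p ^ elemExponent d`. -/
theorem coeffHom_elemHecke_mul {k l : ℕ} (hkl : k + l = 3) (s : HeckeRing (GLZ 3))
    {a : Fin 3 → ℤ} (ha : Monotone a) :
    coeffHom (glDiag p a) (elemHecke p k * s) =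
      ∑ d : Fin 3 → Fin 2 with (d 0 : ℕ) + d 1 + d 2 = l,
        (p : ℤ) ^ elemExponent d * coeffHom (glDiag p fun i => (d i : ℤ) + (a i - 1)) s := by
  rw [← sum_elemIndex (p := p) l fun d => coeffHom (glDiag p fun i => (d i : ℤ) + (a i - 1)) s,
    elemHecke, coeffHom_ofBiinvariant_mul (k := fun i : ElemIndex p l =>
      glDiag p (fun _ => -1) * elemRep i)]
  · refine Finset.sum_congr rfl fun i _ => ?_
    obtain ⟨e1, e2, e3, -⟩ := i.entries
    rw [glDiag_const_comm, mul_assoc, glDiag_mul]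
    have h : (fun _ => -1) + a = fun i => a i - 1 := by
      ext i; simp [sub_eq_neg_add]
    rw [h, elemRep, coeffHom_herm_mul_glDiag]
    · exact e1.imp_left fun h => by rw [h, Nat.cast_zero]
    · exact e2.imp_left fun h => by rw [h, Nat.cast_zero]
    · exact e3.imp_left fun h => by rw [h, Nat.cast_zero]
    · exact fun i j hij => sub_le_sub_right (ha hij) 1
  · intro i j e
    apply coset_elemRep_injective
    simp only [Function.comp_apply] at e ⊢
    rw [glDiag_const_comm, glDiag_const_comm, ← translate_coset, ← translate_coset] at e
    exact translate_injective _ e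
  · intro i
    have := mul_inv_mem_elemSet (p := p) (k := l) (l := k) (by omega) (elemRep_mem i)
    rwa [_root_.mul_inv_rev, glDiag_inv, Pi.neg_def, neg_neg, ← glDiag_const_comm]
  · intro g hg
    have h1 := mul_inv_mem_elemSet (p := p) hkl hg
    rw [inv_inv] at h1
    obtain ⟨i, e⟩ := exists_elemRep h1
    refine ⟨i, ?_⟩
    rw [glDiag_const_comm, ← translate_coset, ← e, translate_coset, glDiag_const_comm, mul_assoc,
      glDiag_mul]
    have h : ((fun _ => 1) + fun _ => -1 : Fin 3 → ℤ) = 0 := by ext; simp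
    rw [h, glDiag_zero, mul_one]

theorem weightSum_elemHecke (k : ℕ) :
    weightSum (glWeight p) (elemHecke p k).toCosets =
      ∑ d : Fin 3 → Fin 2 with (d 0 : ℕ) + d 1 + d 2 = k,
        (p : MvPolynomial (Fin 4) ℚ) ^ elemExponent d *
          ∏ i : Fin 3, (MvPolynomial.C (((p : ℚ) ^ ((i : ℕ) + 1))⁻¹) * MvPolynomial.X i.succ) ^
            (d i : ℕ) := by
  rw [elemHecke, weightSum_ofBiinvariant _ (coset_elemRep_injective k) (range_elemRep k),
    ← sum_elemIndex]
  refine Finset.sum_congr rfl fun i _ => ?_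
  rw [elemRep, glWeight_coset (isTri_herm _ _ _ _)]

end Pieri

/-! ### The Pieri rule and the spherical images made explicit. -/

section PieriRank

variable {p : ℕ} [hp : Fact p.Prime]

/-- The coefficient of `diag(p ^ x, p ^ y, p ^ z)`. -/
def diagCoeff (p : ℕ) [Fact p.Prime] (s : HeckeRing (GLZ 3)) (x y z : ℤ) : ℤ :=
  coeffHom (glDiag p ![x, y, z]) s

variable {x y z : ℤ} (s : HeckeRing (GLZ 3))

theorem diagCoeff_swap (x y z : ℤ) : diagCoeff p s y x z = diagCoeff p s x y z := by
  rw [diagCoeff, diagCoeff, ← coeffHom_glDiag_perm s ![x, y, z] (Equiv.swap 0 1)]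
  congr 2
  ext i
  fin_cases i <;> rfl

theorem diagCoeff_swap' (x y z : ℤ) : diagCoeff p s x z y = diagCoeff p s x y z := by
  rw [diagCoeff, diagCoeff, ← coeffHom_glDiag_perm s ![x, y, z] (Equiv.swap 1 2)]
  congr 2
  ext i
  fin_cases i <;> rfl

theorem monotone_vec (h1 : x ≤ y) (h2 : y ≤ z) : Monotone ![x, y, z] := by
  rw [Fin.monotone_iff_le_succ]
  intro i
  fin_cases i
  · exact h1
  · exact h2

theorem diagCoeff_elemHecke_mul {k l : ℕ} (hkl : k + l = 3) (h1 : x ≤ y) (h2 : y ≤ z) :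
    diagCoeff p (elemHecke p k * s) x y z =
      ∑ d : Fin 3 → Fin 2 with (d 0 : ℕ) + d 1 + d 2 = l,
        (p : ℤ) ^ elemExponent d *
          diagCoeff p s (d 0 + (x - 1)) (d 1 + (y - 1)) (d 2 + (z - 1)) := by
  rw [diagCoeff, coeffHom_elemHecke_mul hkl s (monotone_vec h1 h2)]
  refine Finset.sum_congr rfl fun d _ => ?_
  rw [diagCoeff]
  congr 3
  ext i
  fin_cases i <;> rfl

theorem filter_sum_eq_one : (Finset.univ.filter fun d : Fin 3 → Fin 2 =>
    (d 0 : ℕ) + d 1 + d 2 = 1) = {![1, 0, 0], ![0, 1, 0], ![0, 0, 1]} := by decide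

theorem filter_sum_eq_two : (Finset.univ.filter fun d : Fin 3 → Fin 2 =>
    (d 0 : ℕ) + d 1 + d 2 = 2) = {![1, 1, 0], ![1, 0, 1], ![0, 1, 1]} := by decide

theorem diagCoeff_elemHecke_one_mul (h1 : x ≤ y) (h2 : y ≤ z) :
    diagCoeff p (elemHecke p 1 * s) x y z = diagCoeff p s x y (z - 1) +
      p * diagCoeff p s x (y - 1) z + p ^ 2 * diagCoeff p s (x - 1) y z := by
  rw [diagCoeff_elemHecke_mul (l := 2) s (by norm_num) h1 h2, filter_sum_eq_two,
    Finset.sum_insert (by decide), Finset.sum_insert (by decide), Finset.sum_singleton]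
  simp [elemExponent]
  ring

theorem diagCoeff_elemHecke_two_mul (h1 : x ≤ y) (h2 : y ≤ z) :
    diagCoeff p (elemHecke p 2 * s) x y z = diagCoeff p s x (y - 1) (z - 1) +
      p * diagCoeff p s (x - 1) y (z - 1) + p ^ 2 * diagCoeff p s (x - 1) (y - 1) z := by
  rw [diagCoeff_elemHecke_mul (l := 1) s (by norm_num) h1 h2, filter_sum_eq_one,
    Finset.sum_insert (by decide), Finset.sum_insert (by decide), Finset.sum_singleton]
  simp [elemExponent]
  ring

theorem diagCoeff_elemHecke_three_mul (h1 : x ≤ y) (h2 : y ≤ z) :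
    diagCoeff p (elemHecke p 3 * s) x y z = diagCoeff p s (x - 1) (y - 1) (z - 1) := by
  have h : (Finset.univ.filter fun d : Fin 3 → Fin 2 => (d 0 : ℕ) + d 1 + d 2 = 0) =
    {![0, 0, 0]} := by decide
  rw [diagCoeff_elemHecke_mul (l := 0) s (by norm_num) h1 h2, h, Finset.sum_singleton]
  simp [elemExponent]

theorem C_inv_pow {σ : Type*} (k : ℕ) :
    (MvPolynomial.C (((p : ℚ) ^ k)⁻¹) : MvPolynomial σ ℚ) =
    MvPolynomial.C ((p : ℚ)⁻¹) ^ k := by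
  rw [← map_pow, inv_pow]

theorem natCast_mul_C_inv :
    (p : MvPolynomial (Fin 4) ℚ) * MvPolynomial.C ((p : ℚ)⁻¹) = 1 := by
  rw [← map_natCast (MvPolynomial.C (σ := Fin 4) (R := ℚ)), ← map_mul,
    mul_inv_cancel₀ ratCast_prime_ne_zero, map_one]

/-- There are `p ^ (i - 1)` Hermite forms with `p` at the place `i`. They offset the weight `p ^
(-i)` up to a common `p⁻¹`, and this makes the result symmetric. -/
theorem weightSum_elemHecke_one : weightSum (glWeight p) (elemHecke p 1).toCosets =
    MvPolynomial.C ((p : ℚ)⁻¹) *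
      (MvPolynomial.X 1 + MvPolynomial.X 2 + MvPolynomial.X 3 : MvPolynomial (Fin 4) ℚ) := by
  rw [weightSum_elemHecke, filter_sum_eq_one,
    Finset.sum_insert (by decide), Finset.sum_insert (by decide), Finset.sum_singleton]
  simp only [C_inv_pow, elemExponent, Fin.prod_univ_three]
  simp [-map_inv₀]
  linear_combination (MvPolynomial.C ((p : ℚ)⁻¹) * MvPolynomial.X 2 +
    ((p : MvPolynomial (Fin 4) ℚ) * MvPolynomial.C ((p : ℚ)⁻¹) + 1) *
      MvPolynomial.C ((p : ℚ)⁻¹) * MvPolynomial.X 3) * natCast_mul_C_inv (p := p)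

theorem weightSum_elemHecke_two : weightSum (glWeight p) (elemHecke p 2).toCosets =
    MvPolynomial.C ((p : ℚ)⁻¹) ^ 3 *
      (MvPolynomial.X 1 * MvPolynomial.X 2 + MvPolynomial.X 1 * MvPolynomial.X 3 +
        MvPolynomial.X 2 * MvPolynomial.X 3 : MvPolynomial (Fin 4) ℚ) := by
  rw [weightSum_elemHecke, filter_sum_eq_two,
    Finset.sum_insert (by decide), Finset.sum_insert (by decide), Finset.sum_singleton]
  simp only [C_inv_pow, elemExponent, Fin.prod_univ_three]
  simp [-map_inv₀]
  linear_combination (MvPolynomial.C ((p : ℚ)⁻¹) ^ 3 * MvPolynomial.X 1 * MvPolynomial.X 3 +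
    ((p : MvPolynomial (Fin 4) ℚ) * MvPolynomial.C ((p : ℚ)⁻¹) + 1) *
      MvPolynomial.C ((p : ℚ)⁻¹) ^ 3 * MvPolynomial.X 2 * MvPolynomial.X 3) *
    natCast_mul_C_inv (p := p)

theorem weightSum_elemHecke_three : weightSum (glWeight p) (elemHecke p 3).toCosets =
    MvPolynomial.C ((p : ℚ)⁻¹) ^ 6 *
      (MvPolynomial.X 1 * MvPolynomial.X 2 * MvPolynomial.X 3 : MvPolynomial (Fin 4) ℚ) := by
  have h : (Finset.univ.filter fun d : Fin 3 → Fin 2 => (d 0 : ℕ) + d 1 + d 2 = 3) =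
    {![1, 1, 1]} := by decide
  rw [weightSum_elemHecke, h, Finset.sum_singleton]
  simp only [C_inv_pow, elemExponent, Fin.prod_univ_three]
  simp [-map_inv₀]
  ring

end PieriRank

end

noncomputable section

/-! ### The integral Hecke rings, their spherical homomorphisms, and the image of `T(p ^ δ)`. -/

section SupportedSubring

variable {G : Type*} [Group G] {Γ : Subgroup G}

/-- The elements of the Hecke ring which are supported on a submonoid. -/
def supportedSubring (Γ : Subgroup G) (B : Set G) (h1 : 1 ∈ B)
    (hmul : ∀ g ∈ B, ∀ h ∈ B, g * h ∈ B) : Subring (HeckeRing Γ) where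
  carrier := {t | SupportedOn B t.toCosets}
  mul_mem' := fun ht hs => ht.mul hmul hs
  one_mem' := by
    intro c hc
    rw [toCosets_one, Finsupp.single_apply_ne_zero] at hc
    exact ⟨1, h1, hc.1.symm⟩
  add_mem' := fun ht hs => ht.add hs
  zero_mem' := fun c hc => absurd rfl hc
  neg_mem' := fun ht => ht.neg

end SupportedSubring

variable {p : ℕ} [hp : Fact p.Prime]

variable (p) in
/-- The integral part of the Hecke ring of `GL₃`. -/
def glRing : Subring (HeckeRing (GLZ 3)) :=
  supportedSubring (GLZ 3) (glIntegral 3 p) (glIntegral_of_mem_GLZ (one_mem _))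
    fun _ hg _ hh => glIntegral_mul hg hh

variable (p) in
/-- The spherical map on the integral part of the Hecke ring of `GL₃`. -/
def glOmega : glRing p →+* MvPolynomial (Fin 4) ℚ where
  toFun t := weightSum (glWeight p) t.1.toCosets
  map_one' := weightSum_one _ (by rw [glWeight_coset isTri_one]; simp)
  map_mul' t s := weightSum_glWeight_mul t.2 s.2
  map_zero' := map_zero _
  map_add' _ _ := map_add _ _ _

theorem glOmega_apply (t : glRing p) :
    glOmega p t = weightSum (glWeight p) t.1.toCosets := rfl

variable (p) in
/-- The integral part of the Hecke ring of `GSp₃`. -/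
def spRing : Subring (HeckeRing (Sp 3)) :=
  supportedSubring (Sp 3) (integralUnion 3 p) ⟨0, mem_integralSet_zero.2 (one_mem _)⟩ (by
    rintro g ⟨δ, hg⟩ h ⟨ε, hh⟩
    exact ⟨_, integralSet_mul hg hh⟩)

variable (p) in
/-- The spherical map on the integral part of the Hecke ring of `GSp₃`. -/
def spOmega : spRing p →+* MvPolynomial (Fin 4) ℚ where
  toFun t := omegaLin p t.1.toCosets
  map_one' := omegaLin_one
  map_mul' t s := omegaLin_mul t.2 s.2
  map_zero' := map_zero _
  map_add' _ _ := map_add _ _ _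

theorem spOmega_apply (t : spRing p) : spOmega p t = omegaLin p t.1.toCosets := rfl

theorem spOmega_injective : Function.Injective (spOmega p) := by
  rw [injective_iff_map_eq_zero]
  intro t ht
  exact Subtype.ext (eq_zero_of_omegaLin_eq_zero t.2 ht)

theorem supportedOn_heckeT (δ : ℕ) (h0 : p ^ δ ≠ 0) :
    SupportedOn (integralSet 3 p δ) (heckeT 3 (p ^ δ) h0).toCosets := by
  classical
  intro c hc
  obtain ⟨M, rfl⟩ := coset_surjective c
  rw [← coeffHom_apply, coeffHom_heckeT] at hc
  exact ⟨M, by by_contra h; exact hc (if_neg h), rfl⟩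

theorem integralSet_subset (δ : ℕ) : integralSet 3 p δ ⊆ integralUnion 3 p := fun _ h => ⟨δ, h⟩

theorem supportedOn_integralUnion_heckeT (δ : ℕ) (h0 : p ^ δ ≠ 0) :
    SupportedOn (integralUnion 3 p) (heckeT 3 (p ^ δ) h0).toCosets :=
  (supportedOn_heckeT δ h0).mono (integralSet_subset δ)

variable (p) in
/-- `T(p ^ δ)` as an element of the integral part of the Hecke ring. -/
def heckeTInt (δ : ℕ) : spRing p :=
  ⟨heckeT 3 (p ^ δ) (pow_ne_zero δ hp.out.ne_zero), supportedOn_integralUnion_heckeT δ _⟩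

variable (p) in
/-- The image of `T(p ^ δ)` in the Hecke ring of `GL₃`, for `δ ≥ 0`. -/
def pushT (δ : ℤ) : glRing p :=
  if 0 ≤ δ then ⟨pushGL p (heckeTInt p δ.toNat).1 (heckeTInt p δ.toNat).2, supportedOn_pushGL _ _⟩
  else 0

theorem pushT_of_neg {δ : ℤ} (h : δ < 0) : pushT p δ = 0 := if_neg (by omega)

theorem coe_pushT (δ : ℕ) : (pushT p δ).1 =
    pushGL p (heckeT 3 (p ^ δ) (pow_ne_zero δ hp.out.ne_zero))
      (supportedOn_integralUnion_heckeT δ _) := by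
  rw [pushT, if_pos (Int.natCast_nonneg δ)]
  rfl

theorem spOmega_heckeTInt (δ : ℕ) :
    spOmega p (heckeTInt p δ) = MvPolynomial.X 0 ^ δ * glOmega p (pushT p δ) := by
  rw [spOmega_apply, omegaLin_eq (heckeTInt p δ).2 (supportedOn_heckeT δ _), glOmega_apply,
    coe_pushT]
  rfl

/-- All integral matrices with multiplier `p ^ δ` occur in `T(p ^ δ)`, so the coefficient is the
full number of blocks `B` modulo `D`. Integer arguments, with zero outside the range, keep later
shifts free of truncated subtraction. -/
theorem diagCoeff_pushT {δ x y z : ℤ} (h1 : x ≤ y) (h2 : y ≤ z) :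
    (diagCoeff p (pushT p δ).1 x y z : ℚ) =
      if 0 ≤ x ∧ z ≤ δ then (p : ℚ) ^ (3 * x + 2 * y + z) else 0 := by
  classical
  by_cases hδ : 0 ≤ δ
  swap
  · rw [pushT_of_neg (by omega), if_neg (by omega), ZeroMemClass.coe_zero, diagCoeff, map_zero,
      Int.cast_zero]
  by_cases hx : 0 ≤ x
  swap
  · rw [if_neg (by omega), diagCoeff, coeffHom_glDiag_of_neg (pushT p δ).2 (i := 0) (not_le.1 hx),
      Int.cast_zero]
  lift δ to ℕ using hδ
  lift x to ℕ using hx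
  lift y to ℕ using by omega
  lift z to ℕ using by omega
  rw [coe_pushT, diagCoeff]
  have hv : ![(x : ℤ), y, z] = fun i => ((![x, y, z] i : ℕ) : ℤ) := by
    ext i; fin_cases i <;> rfl
  have ma : Monotone ![x, y, z] := by
    rw [Fin.monotone_iff_le_succ]
    intro i
    fin_cases i
    · change x ≤ y; omega
    · change y ≤ z; omega
  rw [hv]
  split_ifs with h
  · have hle (i) : ![x, y, z] i ≤ δ := by
      fin_cases i
      · change x ≤ δ; omega
      · change y ≤ δ; omega
      · change z ≤ δ; omega
    rw [coeffHom_pushGL_glDiag (𝒮 := integralSet 3 p δ) subset_rfl (coeffHom_heckeT δ _)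
      _ hle ma, Finset.filter_true_of_mem fun s _ => fiberMatrix_mem s, card_box]
    have : (3 * (x : ℤ) + 2 * y + z) = ((3 * x + 2 * y + z : ℕ) : ℤ) := by push_cast; ring
    rw [this, zpow_natCast]
    simp
  · rw [coeffHom_pushGL_glDiag_eq_zero (supportedOn_heckeT δ _), Int.cast_zero]
    intro hle
    have : z ≤ δ := hle 2
    omega

/-! ### Normalized coefficients and the Pieri rule for the elementary symmetric elements. -/

section NormalizedCoefficients

variable {x y z : ℤ}

variable (p) in
/-- The coefficient of `diag(p ^ x, p ^ y, p ^ z)`, multiplied by `p ^ (δ - 2 (x + y + z))`. -/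
def normCoeff (δ : ℤ) (s : glRing p) (x y z : ℤ) : ℚ :=
  (p : ℚ) ^ (δ - 2 * (x + y + z)) * diagCoeff p s.1 x y z

theorem normCoeff_add (δ : ℤ) (s t : glRing p) :
    normCoeff p δ (s + t) x y z = normCoeff p δ s x y z + normCoeff p δ t x y z := by
  simp only [normCoeff, diagCoeff, Subring.coe_add, map_add, Int.cast_add, mul_add]

theorem normCoeff_sub (δ : ℤ) (s t : glRing p) :
    normCoeff p δ (s - t) x y z = normCoeff p δ s x y z - normCoeff p δ t x y z := by
  simp only [normCoeff, diagCoeff, AddSubgroupClass.coe_sub, map_sub, Int.cast_sub, mul_sub]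

theorem normCoeff_natCast_mul (δ : ℤ) (m : ℕ) (s : glRing p) :
    normCoeff p δ ((m : glRing p) * s) x y z = m * normCoeff p δ s x y z := by
  rw [← nsmul_eq_mul]
  simp only [normCoeff, diagCoeff, AddSubmonoidClass.coe_nsmul, map_nsmul]
  rw [nsmul_eq_mul]
  push_cast
  ring

theorem normCoeff_shift (δ : ℤ) (s : glRing p) :
    normCoeff p δ s x y z = p * normCoeff p (δ - 1) s x y z := by
  have : δ - 2 * (x + y + z) = 1 + (δ - 1 - 2 * (x + y + z)) := by ring
  rw [normCoeff, normCoeff, this, zpow_add₀ ratCast_prime_ne_zero, zpow_one]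
  ring

theorem normCoeff_shift_two (δ : ℤ) (s : glRing p) :
    normCoeff p δ s x y z = p ^ 2 * normCoeff p (δ - 2) s x y z := by
  rw [normCoeff_shift, normCoeff_shift, show δ - 1 - 1 = δ - 2 by ring]
  ring

variable (p) in
/-- The elements of the Hecke ring of `GL₃` which correspond to the elementary symmetric
polynomials. -/
def elemGL (k : ℕ) : glRing p :=
  ((p ^ (k * (k + 1) / 2) : ℕ) : glRing p) * ⟨elemHecke p k, supportedOn_elemHecke k⟩

/-- The factor `p` in `elemGL p 1` is exactly the change of normalization: with `S = x + y + z`, `p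
· p ^ (δ - 2S) = p ^ ((δ - 1) - 2(S - 1))`. The Pieri coefficients `1, p, p²` remain, and `δ` drops
by one, as it should for a factor `e₁ y`. -/
theorem normCoeff_elemGL_one_mul (δ : ℤ) (s : glRing p) (h1 : x ≤ y) (h2 : y ≤ z) :
    normCoeff p δ (elemGL p 1 * s) x y z = normCoeff p (δ - 1) s x y (z - 1) +
      p * normCoeff p (δ - 1) s x (y - 1) z + p ^ 2 * normCoeff p (δ - 1) s (x - 1) y z := by
  have hp0 := ratCast_prime_ne_zero (p := p)
  rw [elemGL, mul_assoc, normCoeff_natCast_mul, normCoeff, Subring.coe_mul,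
    diagCoeff_elemHecke_one_mul s.1 h1 h2]
  have e : (p : ℚ) ^ (δ - 2 * (x + y + z)) * p = p ^ (δ - 1 - 2 * (x + y + z - 1)) := by
    rw [← zpow_add_one₀ hp0]; congr 1; ring
  simp only [normCoeff]
  rw [show x + y + (z - 1) = x + y + z - 1 by ring, show x + (y - 1) + z = x + y + z - 1 by ring,
    show x - 1 + y + z = x + y + z - 1 by ring, ← e]
  push_cast
  ring

theorem normCoeff_elemGL_two_mul (δ : ℤ) (s : glRing p) (h1 : x ≤ y) (h2 : y ≤ z) :
    normCoeff p δ (elemGL p 2 * s) x y z = normCoeff p (δ - 1) s x (y - 1) (z - 1) +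
      p * normCoeff p (δ - 1) s (x - 1) y (z - 1) +
        p ^ 2 * normCoeff p (δ - 1) s (x - 1) (y - 1) z := by
  have hp0 := ratCast_prime_ne_zero (p := p)
  rw [elemGL, mul_assoc, normCoeff_natCast_mul, normCoeff, Subring.coe_mul,
    diagCoeff_elemHecke_two_mul s.1 h1 h2]
  have e : (p : ℚ) ^ (δ - 2 * (x + y + z)) * p ^ 3 = p ^ (δ - 1 - 2 * (x + y + z - 2)) := by
    rw [← zpow_natCast, ← zpow_add₀ hp0]; congr 1; push_cast; ring
  simp only [normCoeff]
  rw [show x + (y - 1) + (z - 1) = x + y + z - 2 by ring,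
    show x - 1 + y + (z - 1) = x + y + z - 2 by ring,
    show x - 1 + (y - 1) + z = x + y + z - 2 by ring, ← e]
  push_cast
  ring

/-- The normalization uses up `p ^ 5` of the factor `p ^ 6` in `elemGL p 3`, so one `p` is left. -/
theorem normCoeff_elemGL_three_mul (δ : ℤ) (s : glRing p) (h1 : x ≤ y) (h2 : y ≤ z) :
    normCoeff p δ (elemGL p 3 * s) x y z =
      p * normCoeff p (δ - 1) s (x - 1) (y - 1) (z - 1) := by
  have hp0 := ratCast_prime_ne_zero (p := p)
  rw [elemGL, mul_assoc, normCoeff_natCast_mul, normCoeff, Subring.coe_mul,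
    diagCoeff_elemHecke_three_mul s.1 h1 h2]
  have e : (p : ℚ) ^ (δ - 2 * (x + y + z)) * p ^ 5 = p ^ (δ - 1 - 2 * (x + y + z - 3)) := by
    rw [← zpow_natCast, ← zpow_add₀ hp0]; congr 1; push_cast; ring
  simp only [normCoeff]
  rw [show x - 1 + (y - 1) + (z - 1) = x + y + z - 3 by ring, ← e]
  push_cast
  ring

theorem normCoeff_swap (δ : ℤ) (s : glRing p) (x y z : ℤ) :
    normCoeff p δ s y x z = normCoeff p δ s x y z := by
  rw [normCoeff, normCoeff, diagCoeff_swap, add_comm y x]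

theorem normCoeff_swap' (δ : ℤ) (s : glRing p) (x y z : ℤ) :
    normCoeff p δ s x z y = normCoeff p δ s x y z := by
  rw [normCoeff, normCoeff, diagCoeff_swap', add_right_comm]

/-- An element is determined by its coefficients at the diagonal matrices with increasing
exponents. -/
theorem eq_of_normCoeff {δ : ℤ} {s t : glRing p}
    (h : ∀ x y z, x ≤ y → y ≤ z → normCoeff p δ s x y z = normCoeff p δ t x y z) : s = t := by
  refine Subtype.ext (eq_of_coeffHom_glDiag s.2 t.2 fun a ma => ?_)
  have h' := h (a 0) (a 1) (a 2) (by exact_mod_cast ma (show (0 : Fin 3) ≤ 1 by decide))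
    (by exact_mod_cast ma (show (1 : Fin 3) ≤ 2 by decide))
  rw [normCoeff, normCoeff] at h'
  have h2 := mul_left_cancel₀ (zpow_ne_zero _ ratCast_prime_ne_zero) h'
  have e : (fun i => (a i : ℤ)) = ![(a 0 : ℤ), a 1, a 2] := by
    ext i; fin_cases i <;> rfl
  rw [e]
  exact_mod_cast h2

/-- The normalization is chosen so that the middle exponent drops out and the values are geometric
in `x` and in `δ - z`. -/
theorem normCoeff_pushT (δ : ℤ) (h1 : x ≤ y) (h2 : y ≤ z) :
    normCoeff p δ (pushT p δ) x y z = if 0 ≤ x ∧ z ≤ δ then (p : ℚ) ^ (x + δ - z) else 0 := by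
  rw [normCoeff, diagCoeff_pushT h1 h2]
  split_ifs
  · rw [← zpow_add₀ ratCast_prime_ne_zero]
    congr 1
    ring
  · rw [mul_zero]

theorem normCoeff_one (δ : ℤ) (x y z : ℤ) :
    normCoeff p δ 1 x y z = if x = 0 ∧ y = 0 ∧ z = 0 then (p : ℚ) ^ δ else 0 := by
  classical
  rw [normCoeff, diagCoeff, Subring.coe_one, coeffHom_one]
  split_ifs with h h' h'
  · obtain ⟨rfl, rfl, rfl⟩ := h'
    simp
  · exfalso
    have hp1 : (1 : ℚ) < p := by exact_mod_cast hp.out.one_lt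
    have key (c : Fin 3 → ℤ) (hc : IsInt (glDiag p c).val) (i : Fin 3) : 0 ≤ c i := by
      by_contra hi
      obtain ⟨m, hm⟩ := isInt_iff.1 hc i i
      rw [glDiag_val, diagonal_apply_eq] at hm
      have h1 : (p : ℚ) ^ c i < 1 := zpow_lt_one_of_neg₀ hp1 (not_le.1 hi)
      have h0 : 0 < (p : ℚ) ^ c i := zpow_pos (by positivity) _
      rw [← hm] at h0 h1
      have h0' : 0 < m := by exact_mod_cast h0
      have h1' : m < 1 := by exact_mod_cast h1
      omega
    have k1 := key _ (mem_GLZ_iff.1 h).1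
    have k2 := (mem_GLZ_iff.1 h).2
    rw [glDiag_inv] at k2
    have k2 := key _ k2
    have a0 : 0 ≤ x := k1 0
    have a1 : 0 ≤ y := k1 1
    have a2 : 0 ≤ z := k1 2
    have b0 : 0 ≤ -x := k2 0
    have b1 : 0 ≤ -y := k2 1
    have b2 : 0 ≤ -z := k2 2
    omega
  · obtain ⟨rfl, rfl, rfl⟩ := h'
    refine absurd ?_ h
    have : ![(0 : ℤ), 0, 0] = 0 := by ext i; fin_cases i <;> rfl
    rw [this, glDiag_zero]
    exact one_mem _
  · simp

theorem glOmega_elemGL_one : glOmega p (elemGL p 1) =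
    MvPolynomial.X 1 + MvPolynomial.X 2 + MvPolynomial.X 3 := by
  rw [elemGL, map_mul, map_natCast, glOmega_apply, weightSum_elemHecke_one]
  have h := natCast_mul_C_inv (p := p)
  push_cast
  linear_combination (MvPolynomial.X 1 + MvPolynomial.X 2 + MvPolynomial.X 3) * h

theorem glOmega_elemGL_two : glOmega p (elemGL p 2) =
    MvPolynomial.X 1 * MvPolynomial.X 2 + MvPolynomial.X 1 * MvPolynomial.X 3 +
      MvPolynomial.X 2 * MvPolynomial.X 3 := by
  rw [elemGL, map_mul, map_natCast, glOmega_apply, weightSum_elemHecke_two]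
  have h : ((p : MvPolynomial (Fin 4) ℚ) * MvPolynomial.C ((p : ℚ)⁻¹)) ^ 3 = 1 := by
    rw [natCast_mul_C_inv, one_pow]
  push_cast
  linear_combination (MvPolynomial.X 1 * MvPolynomial.X 2 + MvPolynomial.X 1 * MvPolynomial.X 3 +
      MvPolynomial.X 2 * MvPolynomial.X 3) * h

theorem glOmega_elemGL_three : glOmega p (elemGL p 3) =
    MvPolynomial.X 1 * MvPolynomial.X 2 * MvPolynomial.X 3 := by
  rw [elemGL, map_mul, map_natCast, glOmega_apply, weightSum_elemHecke_three]
  have h : ((p : MvPolynomial (Fin 4) ℚ) * MvPolynomial.C ((p : ℚ)⁻¹)) ^ 6 = 1 := by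
    rw [natCast_mul_C_inv, one_pow]
  push_cast
  linear_combination (MvPolynomial.X 1 * MvPolynomial.X 2 * MvPolynomial.X 3) * h

end NormalizedCoefficients

end

noncomputable section

variable {p : ℕ} [hp : Fact p.Prime]

/-! ### Telescoping by `(1 - y)(1 - e₃ y)` and by `∏ (1 - xᵢ y)`. -/

section Reduction

variable (p)

/-- The coefficients of `(1 - y) (1 - e₃ y) ∑ F_δ y ^ δ`. -/
def reducedLinear (δ : ℤ) : glRing p :=
  pushT p δ - pushT p (δ - 1) - elemGL p 3 * (pushT p (δ - 1) - pushT p (δ - 2))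

/-- The coefficients of the product of the previous series with `1 - e₁ y + e₂ y ^ 2 - e₃ y ^ 3`. -/
def reducedCubic (δ : ℤ) : glRing p :=
  reducedLinear p δ - elemGL p 1 * reducedLinear p (δ - 1) + elemGL p 2 * reducedLinear p (δ - 2) -
    elemGL p 3 * reducedLinear p (δ - 3)

/-- The coefficients of the product of the previous series with
`1 - e₂ y + e₁ e₃ y ^ 2 - e₃ ^ 2 y ^ 3`. -/
def reducedTotal (δ : ℤ) : glRing p :=
  reducedCubic p δ - elemGL p 2 * reducedCubic p (δ - 1) +
    elemGL p 3 * (elemGL p 1 * reducedCubic p (δ - 2)) -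
    elemGL p 3 * (elemGL p 3 * reducedCubic p (δ - 3))

variable {p}

theorem reducedLinear_of_neg {δ : ℤ} (h : δ < 0) : reducedLinear p δ = 0 := by
  rw [reducedLinear, pushT_of_neg h, pushT_of_neg (by omega), pushT_of_neg (by omega)]
  simp

theorem reducedCubic_of_neg {δ : ℤ} (h : δ < 0) : reducedCubic p δ = 0 := by
  rw [reducedCubic, reducedLinear_of_neg h, reducedLinear_of_neg (by omega),
    reducedLinear_of_neg (by omega), reducedLinear_of_neg (by omega)]
  simp

variable {x y z : ℤ}

/-- The Pieri rule leads from sorted to unsorted triples. Coefficients are symmetric, so a formula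
in the minimum and the maximum covers all of them. -/
theorem eq_of_sorted {δ : ℤ} {s : glRing p} {Ψ : ℤ → ℤ → ℚ}
    (h : ∀ x y z, x ≤ y → y ≤ z → normCoeff p δ s x y z = Ψ x z) (x y z : ℤ) :
    normCoeff p δ s x y z = Ψ (min x (min y z)) (max x (max y z)) := by
  rcases le_total x y with h1 | h1 <;> rcases le_total y z with h2 | h2 <;>
    rcases le_total x z with h3 | h3
  · rw [h _ _ _ h1 h2]; congr 1 <;> omega
  · rw [h _ _ _ h1 h2]; congr 1 <;> omega
  · rw [normCoeff_swap', h _ _ _ h3 h2]; congr 1 <;> omega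
  · rw [normCoeff_swap', normCoeff_swap, h _ _ _ h3 h1]; congr 1 <;> omega
  · rw [normCoeff_swap, h _ _ _ h1 h3]; congr 1 <;> omega
  · rw [normCoeff_swap, normCoeff_swap', h _ _ _ h2 h3]; congr 1 <;> omega
  · rw [normCoeff_swap, normCoeff_swap', normCoeff_swap, h _ _ _ h2 h1]; congr 1 <;> omega
  · rw [normCoeff_swap, normCoeff_swap', normCoeff_swap, h _ _ _ h2 h1]; congr 1 <;> omega

/-- In `p ^ (x + δ - z)` the factor `1 - y` telescopes over `δ` and leaves `z = δ`; the factor `1 -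
e₃ y` telescopes over `x` and leaves `x = 0`. -/
theorem normCoeff_reducedLinear_of_sorted (δ : ℤ) (h1 : x ≤ y) (h2 : y ≤ z) :
    normCoeff p δ (reducedLinear p δ) x y z = if x = 0 ∧ z = δ then 1 else 0 := by
  have hp0 := ratCast_prime_ne_zero (p := p)
  have h1' : x - 1 ≤ y - 1 := by omega
  have h2' : y - 1 ≤ z - 1 := by omega
  rw [reducedLinear, normCoeff_sub, normCoeff_sub, normCoeff_elemGL_three_mul _ _ h1 h2,
    normCoeff_sub, normCoeff_shift δ (pushT p (δ - 1)),
    normCoeff_shift (δ - 1) (pushT p (δ - 2)), show δ - 1 - 1 = δ - 2 by ring,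
    normCoeff_pushT _ h1 h2, normCoeff_pushT _ h1 h2, normCoeff_pushT _ h1' h2',
    normCoeff_pushT _ h1' h2']
  have e1 : (p : ℚ) * p ^ (x + (δ - 1) - z) = p ^ (x + δ - z) := by
    rw [← zpow_one_add₀ hp0]; congr 1; ring
  have e2 : (p : ℚ) * p ^ (x - 1 + (δ - 1) - (z - 1)) = p ^ (x + δ - z) := by
    rw [← zpow_one_add₀ hp0]; congr 1; ring
  have e3 : (p : ℚ) * (p * p ^ (x - 1 + (δ - 2) - (z - 1))) = p ^ (x + δ - z) := by
    rw [← zpow_one_add₀ hp0, ← zpow_one_add₀ hp0]; congr 1; ring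
  rw [mul_sub, mul_ite, mul_ite, mul_ite, mul_ite, e1, e2, e3, mul_zero, mul_zero]
  rcases (by omega : x < 0 ∨ x = 0 ∨ 1 ≤ x) with hx | hx | hx <;>
    rcases (by omega : z < δ ∨ z = δ ∨ δ < z) with hz | hz | hz <;>
    simp (disch := omega) only [if_pos, if_neg] <;> try ring1
  rw [hx, hz]
  simp

theorem normCoeff_reducedLinear (δ x y z : ℤ) : normCoeff p δ (reducedLinear p δ) x y z =
    if min x (min y z) = 0 ∧ max x (max y z) = δ then 1 else 0 :=
  eq_of_sorted (Ψ := fun m M => if m = 0 ∧ M = δ then 1 else 0)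
    (fun _ _ _ => normCoeff_reducedLinear_of_sorted δ) x y z

/-- The normalized coefficients of `reducedCubic` at `(x, t, t)`, where `x ≤ t`. -/
def cubicCoeff (p : ℕ) (δ x t : ℤ) : ℚ :=
  if x = 0 then (if t = δ then 1 else if t = δ - 1 ∧ 1 ≤ t then -1 else 0)
  else if x = 1 then
    (if t = δ - 1 then (if t = 1 then -((p : ℚ) ^ 2 + p + 1) else -(p : ℚ) ^ 2)
    else if t = δ - 2 then (if t = 1 then ((p : ℚ) + 1) * p else (p : ℚ) ^ 2) else 0)
  else 0

/-- The shifts are by at most one in each exponent and three in `δ`, and the input is an indicator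
function. Both sides therefore depend only on the position of `x` near `0`, on coincidences among
the exponents and on `z - δ`, which leaves finitely many cases. -/
theorem normCoeff_reducedCubic_of_sorted (δ : ℤ) (h1 : x ≤ y) (h2 : y ≤ z) :
    normCoeff p δ (reducedCubic p δ) x y z = if y = z then cubicCoeff p δ x z else 0 := by
  rw [reducedCubic, normCoeff_sub, normCoeff_add, normCoeff_sub,
    normCoeff_elemGL_one_mul _ _ h1 h2, normCoeff_elemGL_two_mul _ _ h1 h2,
    normCoeff_elemGL_three_mul _ _ h1 h2]
  simp only [normCoeff_shift (δ - 1) (reducedLinear p (δ - 2)),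
    normCoeff_shift_two (δ - 1) (reducedLinear p (δ - 3)), show δ - 1 - 1 = δ - 2 by ring,
    show δ - 1 - 2 = δ - 3 by ring, normCoeff_reducedLinear, cubicCoeff]
  rcases (by omega : x < 0 ∨ x = 0 ∨ x = 1 ∨ 2 ≤ x) with hx | hx | hx | hx <;>
    rcases (by omega : y = x ∨ x < y) with hy | hy <;>
    rcases (by omega : z = y ∨ y < z) with hz | hz <;>
    rcases (by omega : z = δ ∨ z = δ - 1 ∨ z = δ - 2 ∨ (z ≠ δ ∧ z ≠ δ - 1 ∧ z ≠ δ - 2))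
      with hd | hd | hd | hd <;>
    simp (disch := omega) only [if_pos, if_neg] <;> ring1

end Reduction

end

noncomputable section

variable {p : ℕ} [hp : Fact p.Prime]

/-! ### Multiplication by `∏ (1 - xᵢ xⱼ y)` and the finite support of the result. -/

section Total

variable {x y z t : ℤ}

/-- On the support of `reducedCubic` the largest exponent occurs at least twice. This and its
variants dispose of most terms of the next product. -/
theorem normCoeff_reducedCubic_zero₃ (δ : ℤ) (h1 : x < z) (h2 : y < z) :
    normCoeff p δ (reducedCubic p δ) x y z = 0 := by
  rcases le_total x y with h | h
  · rw [normCoeff_reducedCubic_of_sorted δ h h2.le, if_neg h2.ne]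
  · rw [normCoeff_swap, normCoeff_reducedCubic_of_sorted δ h h1.le, if_neg h1.ne]

theorem normCoeff_reducedCubic_zero₂ (δ : ℤ) (h1 : x < y) (h2 : z < y) :
    normCoeff p δ (reducedCubic p δ) x y z = 0 := by
  rw [normCoeff_swap', normCoeff_reducedCubic_zero₃ δ h1 h2]

theorem normCoeff_reducedCubic_eq₁ (δ : ℤ) (h : x ≤ t) :
    normCoeff p δ (reducedCubic p δ) x t t = cubicCoeff p δ x t := by
  rw [normCoeff_reducedCubic_of_sorted δ h le_rfl, if_pos rfl]

theorem normCoeff_reducedCubic_eq₂ (δ : ℤ) (h : x ≤ t) :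
    normCoeff p δ (reducedCubic p δ) t x t = cubicCoeff p δ x t := by
  rw [normCoeff_swap, normCoeff_reducedCubic_eq₁ δ h]

theorem normCoeff_reducedCubic_eq₃ (δ : ℤ) (h : x ≤ t) :
    normCoeff p δ (reducedCubic p δ) t t x = cubicCoeff p δ x t := by
  rw [normCoeff_swap', normCoeff_reducedCubic_eq₂ δ h]

theorem normCoeff_reducedCubic_zero₁ (δ : ℤ) (h1 : y < x) (h2 : z < x) :
    normCoeff p δ (reducedCubic p δ) x y z = 0 := by
  rw [normCoeff_swap, normCoeff_reducedCubic_zero₂ δ h1 h2]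

theorem normCoeff_reducedTotal_expand (δ : ℤ) (h1 : x ≤ y) (h2 : y ≤ z) :
    normCoeff p δ (reducedTotal p δ) x y z =
      normCoeff p δ (reducedCubic p δ) x y z -
      (normCoeff p (δ - 1) (reducedCubic p (δ - 1)) x (y - 1) (z - 1) +
        p * normCoeff p (δ - 1) (reducedCubic p (δ - 1)) (x - 1) y (z - 1) +
        p ^ 2 * normCoeff p (δ - 1) (reducedCubic p (δ - 1)) (x - 1) (y - 1) z) +
      p * (normCoeff p (δ - 2) (reducedCubic p (δ - 2)) (x - 1) (y - 1) (z - 2) +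
        p * normCoeff p (δ - 2) (reducedCubic p (δ - 2)) (x - 1) (y - 2) (z - 1) +
        p ^ 2 * normCoeff p (δ - 2) (reducedCubic p (δ - 2)) (x - 2) (y - 1) (z - 1)) -
      p ^ 3 * normCoeff p (δ - 3) (reducedCubic p (δ - 3)) (x - 2) (y - 2) (z - 2) := by
  have h1' : x - 1 ≤ y - 1 := by omega
  have h2' : y - 1 ≤ z - 1 := by omega
  rw [reducedTotal, normCoeff_sub, normCoeff_add, normCoeff_sub,
    normCoeff_elemGL_two_mul _ _ h1 h2, normCoeff_elemGL_three_mul _ _ h1 h2,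
    normCoeff_elemGL_three_mul _ _ h1 h2, normCoeff_elemGL_one_mul _ _ h1' h2',
    normCoeff_elemGL_three_mul _ _ h1' h2', show δ - 1 - 1 = δ - 2 by ring,
    normCoeff_shift (δ - 2) (reducedCubic p (δ - 3)), show δ - 2 - 1 = δ - 3 by ring,
    show x - 1 - 1 = x - 2 by ring, show y - 1 - 1 = y - 2 by ring,
    show z - 1 - 1 = z - 2 by ring]
  ring

/-- A gap of two survives all the shifts: each shifted triple still has a single largest exponent.
-/
theorem normCoeff_reducedTotal_of_lt (δ : ℤ) (h1 : x ≤ y) (h2 : y + 1 < z) :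
    normCoeff p δ (reducedTotal p δ) x y z = 0 := by
  rw [normCoeff_reducedTotal_expand δ h1 (by omega)]
  simp (disch := omega) only [normCoeff_reducedCubic_zero₃]
  ring

theorem normCoeff_reducedTotal_succ (δ : ℤ) (h : x ≤ y) :
    normCoeff p δ (reducedTotal p δ) x y (y + 1) =
      p * cubicCoeff p (δ - 2) (x - 1) (y - 1) -
        (p + if x = y then 1 else 0) * cubicCoeff p (δ - 1) (x - 1) y := by
  rw [normCoeff_reducedTotal_expand δ h (by omega), add_sub_cancel_right,
    show y + 1 - 2 = y - 1 by ring, normCoeff_reducedCubic_eq₁ (δ - 1) (show x - 1 ≤ y by omega),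
    normCoeff_reducedCubic_eq₁ (δ - 2) (show x - 1 ≤ y - 1 by omega)]
  simp (disch := omega) only [normCoeff_reducedCubic_zero₃]
  split_ifs with hxy
  · rw [hxy, normCoeff_reducedCubic_eq₂ (δ - 1) (show y - 1 ≤ y by omega)]
    ring
  · simp (disch := omega) only [normCoeff_reducedCubic_zero₃]
    ring

theorem normCoeff_reducedTotal_self (δ : ℤ) (h : x ≤ y) :
    normCoeff p δ (reducedTotal p δ) x y y =
      cubicCoeff p δ x y - (if x = y then 0 else cubicCoeff p (δ - 1) x (y - 1)) +
        (p ^ 3 + if x = y then (p : ℚ) ^ 2 + p else 0) * cubicCoeff p (δ - 2) (x - 2) (y - 1) -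
        p ^ 3 * cubicCoeff p (δ - 3) (x - 2) (y - 2) := by
  rw [normCoeff_reducedTotal_expand δ h le_rfl, normCoeff_reducedCubic_eq₁ δ h,
    normCoeff_reducedCubic_eq₁ (δ - 2) (show x - 2 ≤ y - 1 by omega),
    normCoeff_reducedCubic_eq₁ (δ - 3) (show x - 2 ≤ y - 2 by omega)]
  split_ifs with hxy
  · rw [hxy, normCoeff_reducedCubic_eq₃ (δ - 2) (show y - 2 ≤ y - 1 by omega),
      normCoeff_reducedCubic_eq₂ (δ - 2) (show y - 2 ≤ y - 1 by omega)]
    simp (disch := omega) only [normCoeff_reducedCubic_zero₃, normCoeff_reducedCubic_zero₂,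
      normCoeff_reducedCubic_zero₁]
    ring
  · rw [normCoeff_reducedCubic_eq₁ (δ - 1) (show x ≤ y - 1 by omega)]
    simp (disch := omega) only [normCoeff_reducedCubic_zero₃, normCoeff_reducedCubic_zero₂]
    ring

/-- The normalized coefficients of `reducedTotal`. -/
def totalCoeff (p : ℕ) (δ x y z : ℤ) : ℚ :=
  if δ = 0 then (if x = 0 ∧ y = 0 ∧ z = 0 then 1 else 0)
  else if δ = 2 then
    (if x = 0 ∧ y = 1 ∧ z = 1 then -1 else if x = 1 ∧ y = 1 ∧ z = 1 then -((p : ℚ) ^ 2 + p + 1)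
    else if x = 1 ∧ y = 1 ∧ z = 2 then -1 else 0)
  else if δ = 3 then
    (if x = 1 ∧ y = 1 ∧ z = 1 then ((p : ℚ) + 1) * p else if x = 1 ∧ y = 1 ∧ z = 2 then (p : ℚ) + 1
    else if x = 1 ∧ y = 2 ∧ z = 2 then (p : ℚ) + 1
    else if x = 2 ∧ y = 2 ∧ z = 2 then ((p : ℚ) + 1) * p else 0)
  else if δ = 4 then
    (if x = 1 ∧ y = 2 ∧ z = 2 then -(p : ℚ)
    else if x = 2 ∧ y = 2 ∧ z = 2 then -(((p : ℚ) ^ 2 + p + 1) * p)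
    else if x = 2 ∧ y = 2 ∧ z = 3 then -(p : ℚ) else 0)
  else if δ = 6 then (if x = 3 ∧ y = 3 ∧ z = 3 then (p : ℚ) ^ 3 else 0)
  else 0

set_option maxHeartbeats 2000000 in
theorem normCoeff_reducedTotal_self_eq (δ : ℤ) (h1 : x ≤ y) :
    normCoeff p δ (reducedTotal p δ) x y y = totalCoeff p δ x y y := by
  rw [normCoeff_reducedTotal_self δ h1]
  simp only [cubicCoeff, totalCoeff]
  -- Outside `0 ≤ x ≤ 3` and `y ≤ δ ≤ y + 3` both sides vanish. Inside, only whether `y - x` is `0`,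
  -- `1` or larger matters, although `y` itself is unbounded.
  by_cases hx : x < 0 ∨ 3 < x
  · simp (disch := omega) only [if_neg, ite_self]
    ring
  by_cases hd : δ < y ∨ y + 3 < δ
  · simp (disch := omega) only [if_neg, ite_self]
    ring
  rcases (by omega : x = 0 ∨ x = 1 ∨ x = 2 ∨ x = 3) with hx | hx | hx | hx <;>
  rcases (by omega : y = x ∨ y = x + 1 ∨ x + 1 < y) with hy | hy | hy <;>
  rcases (by omega : δ = y ∨ δ = y + 1 ∨ δ = y + 2 ∨ δ = y + 3) with hd | hd | hd | hd <;>
  simp (disch := omega) only [if_pos, if_neg, ite_self] <;> ring1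

set_option maxHeartbeats 1000000 in
theorem normCoeff_reducedTotal_succ_eq (δ : ℤ) (h1 : x ≤ y) :
    normCoeff p δ (reducedTotal p δ) x y (y + 1) = totalCoeff p δ x y (y + 1) := by
  rw [normCoeff_reducedTotal_succ δ h1]
  simp only [cubicCoeff, totalCoeff]
  by_cases hx : x < 1 ∨ 2 < x
  · simp (disch := omega) only [if_neg, ite_self]
    ring
  by_cases hd : δ < y + 1 ∨ y + 3 < δ
  · simp (disch := omega) only [if_neg, ite_self]
    ring
  rcases (by omega : x = 1 ∨ x = 2) with hx | hx <;>
  rcases (by omega : y = x ∨ x < y) with hy | hy <;>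
  rcases (by omega : δ = y + 1 ∨ δ = y + 2 ∨ δ = y + 3) with hd | hd | hd <;>
  simp (disch := omega) only [if_pos, if_neg, ite_self] <;> ring1

theorem normCoeff_reducedTotal (δ : ℤ) (h1 : x ≤ y) (h2 : y ≤ z) :
    normCoeff p δ (reducedTotal p δ) x y z = totalCoeff p δ x y z := by
  rcases (by omega : z = y ∨ z = y + 1 ∨ y + 1 < z) with rfl | rfl | hz
  · exact normCoeff_reducedTotal_self_eq δ h1
  · exact normCoeff_reducedTotal_succ_eq δ h1
  · rw [normCoeff_reducedTotal_of_lt δ h1 hz, totalCoeff]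
    simp (disch := omega) only [if_neg, ite_self]

end Total

end

noncomputable section

variable {p : ℕ} [hp : Fact p.Prime]

/-! ### The nonzero coefficients in terms of the elementary symmetric elements. -/

section TotalValues

variable {x y z : ℤ}

theorem normCoeff_zero (δ : ℤ) : normCoeff p δ 0 x y z = 0 := by
  simp [normCoeff, diagCoeff]

theorem normCoeff_elemGL_one (δ : ℤ) (h1 : x ≤ y) (h2 : y ≤ z) :
    normCoeff p δ (elemGL p 1) x y z =
      if x = 0 ∧ y = 0 ∧ z = 1 then (p : ℚ) ^ (δ - 1) else 0 := by
  rw [← mul_one (elemGL p 1), normCoeff_elemGL_one_mul δ 1 h1 h2]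
  simp only [normCoeff_one]
  by_cases h : x = 0 ∧ y = 0 ∧ z = 1 <;> simp (disch := omega) only [if_pos, if_neg] <;> ring

theorem normCoeff_elemGL_two (δ : ℤ) (h1 : x ≤ y) (h2 : y ≤ z) :
    normCoeff p δ (elemGL p 2) x y z =
      if x = 0 ∧ y = 1 ∧ z = 1 then (p : ℚ) ^ (δ - 1) else 0 := by
  rw [← mul_one (elemGL p 2), normCoeff_elemGL_two_mul δ 1 h1 h2]
  simp only [normCoeff_one]
  by_cases h : x = 0 ∧ y = 1 ∧ z = 1 <;> simp (disch := omega) only [if_pos, if_neg] <;> ring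

theorem normCoeff_elemGL_three (δ : ℤ) (h1 : x ≤ y) (h2 : y ≤ z) :
    normCoeff p δ (elemGL p 3) x y z =
      if x = 1 ∧ y = 1 ∧ z = 1 then (p : ℚ) * p ^ (δ - 1) else 0 := by
  rw [← mul_one (elemGL p 3), normCoeff_elemGL_three_mul δ 1 h1 h2]
  simp only [normCoeff_one]
  by_cases h : x = 1 ∧ y = 1 ∧ z = 1 <;> simp (disch := omega) only [if_pos, if_neg] <;> ring

theorem reducedTotal_zero : reducedTotal p 0 = 1 := by
  refine eq_of_normCoeff (δ := 0) fun x y z h1 h2 => ?_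
  rw [normCoeff_reducedTotal 0 h1 h2, normCoeff_one, totalCoeff]
  simp

theorem reducedTotal_eq_zero {δ : ℤ} (h0 : δ ≠ 0) (h2 : δ ≠ 2) (h3 : δ ≠ 3) (h4 : δ ≠ 4)
    (h6 : δ ≠ 6) : reducedTotal p δ = 0 := by
  refine eq_of_normCoeff (δ := δ) fun x y z h1 h2 => ?_
  rw [normCoeff_reducedTotal δ h1 h2, normCoeff_zero, totalCoeff]
  simp only [if_neg, *, not_false_eq_true]

/-- The triples `(0, 1, 1)`, `(1, 1, 1)`, `(1, 1, 2)` of `totalCoeff` belong to `e₂`, `e₃`, `e₃ e₁`.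
The factor `p²` keeps the identity inside the integral Hecke ring. -/
theorem reducedTotal_two : ((p ^ 2 : ℕ) : glRing p) * reducedTotal p 2 =
    0 - ((p : ℕ) * elemGL p 2 + ((p ^ 2 + p + 1 : ℕ) : glRing p) * elemGL p 3 +
      (p : ℕ) * (elemGL p 3 * elemGL p 1)) := by
  refine eq_of_normCoeff (δ := 2) fun x y z h1 h2 => ?_
  have h1' : x - 1 ≤ y - 1 := by omega
  have h2' : y - 1 ≤ z - 1 := by omega
  simp only [normCoeff_natCast_mul, normCoeff_sub, normCoeff_zero, normCoeff_add,
    normCoeff_reducedTotal 2 h1 h2, normCoeff_elemGL_three_mul _ _ h1 h2,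
    normCoeff_elemGL_two _ h1 h2, normCoeff_elemGL_three _ h1 h2, normCoeff_elemGL_one _ h1' h2',
    totalCoeff]
  by_cases c1 : x = 0 ∧ y = 1 ∧ z = 1
  · simp (disch := omega) only [if_pos, if_neg]; norm_num; ring
  by_cases c2 : x = 1 ∧ y = 1 ∧ z = 1
  · simp (disch := omega) only [if_pos, if_neg]; norm_num; ring
  by_cases c3 : x = 1 ∧ y = 1 ∧ z = 2
  · simp (disch := omega) only [if_pos, if_neg]; norm_num; ring
  simp (disch := omega) only [if_neg, ite_self]
  ring

theorem reducedTotal_three : ((p ^ 2 : ℕ) : glRing p) * reducedTotal p 3 =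
    ((p + 1 : ℕ) : glRing p) * (elemGL p 3 + elemGL p 3 * elemGL p 1 + elemGL p 3 * elemGL p 2 +
      elemGL p 3 * elemGL p 3) := by
  refine eq_of_normCoeff (δ := 3) fun x y z h1 h2 => ?_
  have h1' : x - 1 ≤ y - 1 := by omega
  have h2' : y - 1 ≤ z - 1 := by omega
  simp only [normCoeff_natCast_mul, normCoeff_add,
    normCoeff_reducedTotal 3 h1 h2, normCoeff_elemGL_three_mul _ _ h1 h2,
    normCoeff_elemGL_three _ h1 h2, normCoeff_elemGL_two _ h1' h2', normCoeff_elemGL_one _ h1' h2',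
    normCoeff_elemGL_three _ h1' h2', totalCoeff]
  by_cases c1 : x = 1 ∧ y = 1 ∧ z = 1
  · simp (disch := omega) only [if_pos, if_neg]; norm_num; ring
  by_cases c2 : x = 1 ∧ y = 1 ∧ z = 2
  · simp (disch := omega) only [if_pos, if_neg]; norm_num; ring
  by_cases c3 : x = 1 ∧ y = 2 ∧ z = 2
  · simp (disch := omega) only [if_pos, if_neg]; norm_num; ring
  by_cases c4 : x = 2 ∧ y = 2 ∧ z = 2
  · simp (disch := omega) only [if_pos, if_neg]; norm_num; ring
  simp (disch := omega) only [if_neg, ite_self]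
  ring

theorem reducedTotal_four : ((p ^ 3 : ℕ) : glRing p) * reducedTotal p 4 =
    0 - ((p : ℕ) * (elemGL p 3 * elemGL p 2) +
      ((p ^ 2 + p + 1 : ℕ) : glRing p) * (elemGL p 3 * elemGL p 3) +
      (p : ℕ) * (elemGL p 3 * (elemGL p 3 * elemGL p 1))) := by
  refine eq_of_normCoeff (δ := 4) fun x y z h1 h2 => ?_
  have h1' : x - 1 ≤ y - 1 := by omega
  have h2' : y - 1 ≤ z - 1 := by omega
  have h1'' : x - 1 - 1 ≤ y - 1 - 1 := by omega
  have h2'' : y - 1 - 1 ≤ z - 1 - 1 := by omega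
  simp only [normCoeff_natCast_mul, normCoeff_sub, normCoeff_zero, normCoeff_add,
    normCoeff_reducedTotal 4 h1 h2, normCoeff_elemGL_three_mul _ _ h1 h2,
    normCoeff_elemGL_three_mul _ _ h1' h2', normCoeff_elemGL_two _ h1' h2',
    normCoeff_elemGL_three _ h1' h2', normCoeff_elemGL_one _ h1'' h2'', totalCoeff]
  by_cases c1 : x = 1 ∧ y = 2 ∧ z = 2
  · simp (disch := omega) only [if_pos, if_neg]; norm_num; ring
  by_cases c2 : x = 2 ∧ y = 2 ∧ z = 2
  · simp (disch := omega) only [if_pos, if_neg]; norm_num; ring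
  by_cases c3 : x = 2 ∧ y = 2 ∧ z = 3
  · simp (disch := omega) only [if_pos, if_neg]; norm_num; ring
  simp (disch := omega) only [if_neg, ite_self]
  ring

theorem reducedTotal_six : ((p ^ 3 : ℕ) : glRing p) * reducedTotal p 6 =
    elemGL p 3 * (elemGL p 3 * elemGL p 3) := by
  refine eq_of_normCoeff (δ := 6) fun x y z h1 h2 => ?_
  have h1' : x - 1 ≤ y - 1 := by omega
  have h2' : y - 1 ≤ z - 1 := by omega
  have h1'' : x - 1 - 1 ≤ y - 1 - 1 := by omega
  have h2'' : y - 1 - 1 ≤ z - 1 - 1 := by omega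
  simp only [normCoeff_natCast_mul, normCoeff_reducedTotal 6 h1 h2,
    normCoeff_elemGL_three_mul _ _ h1 h2, normCoeff_elemGL_three_mul _ _ h1' h2',
    normCoeff_elemGL_three _ h1'' h2'', totalCoeff]
  by_cases c1 : x = 3 ∧ y = 3 ∧ z = 3
  · simp (disch := omega) only [if_pos, if_neg]; norm_num; ring
  simp (disch := omega) only [if_pos, if_neg]
  norm_num

end TotalValues

/-! ### The generating series over the polynomial ring. -/

section Series

/-- The power series `∑ u_n (x₀ v) ^ n`. -/
def homogSeries (u : ℤ → MvPolynomial (Fin 4) ℚ) : PowerSeries (MvPolynomial (Fin 4) ℚ) :=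
  PowerSeries.mk fun n => MvPolynomial.X 0 ^ n * u n

/-- Multiplication by `a (x₀ v) ^ k` is a shift of the index; the vanishing at negative indices lets
the shifted series be written without a case distinction. -/
theorem homogSeries_mul {u : ℤ → MvPolynomial (Fin 4) ℚ} (hu : ∀ n < 0, u n = 0)
    (a : MvPolynomial (Fin 4) ℚ) (k : ℕ) :
    homogSeries u * (PowerSeries.C (MvPolynomial.X 0 ^ k * a) * PowerSeries.X ^ k) =
      homogSeries fun n => a * u (n - k) := by
  ext1 n
  rw [← mul_assoc, mul_comm (homogSeries u), mul_assoc, PowerSeries.coeff_C_mul,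
    PowerSeries.coeff_mul_X_pow', homogSeries, homogSeries, PowerSeries.coeff_mk,
    PowerSeries.coeff_mk]
  split_ifs with h
  · obtain ⟨m, rfl⟩ := Nat.exists_eq_add_of_le h
    rw [Nat.add_sub_cancel_left, show ((k + m : ℕ) : ℤ) - k = m by push_cast; ring, pow_add]
    ring
  · rw [hu _ (by omega)]
    ring

theorem homogSeries_add (u v : ℤ → MvPolynomial (Fin 4) ℚ) :
    homogSeries u + homogSeries v = homogSeries fun n => u n + v n := by
  ext1 n
  simp [homogSeries, mul_add]

theorem homogSeries_sub (u v : ℤ → MvPolynomial (Fin 4) ℚ) :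
    homogSeries u - homogSeries v = homogSeries fun n => u n - v n := by
  ext1 n
  simp [homogSeries, mul_sub]

/-- The elementary symmetric polynomials in `x₁, x₂, x₃`. -/
def elemSym (k : ℕ) : MvPolynomial (Fin 4) ℚ :=
  match k with
  | 1 => MvPolynomial.X 1 + MvPolynomial.X 2 + MvPolynomial.X 3
  | 2 => MvPolynomial.X 1 * MvPolynomial.X 2 + MvPolynomial.X 1 * MvPolynomial.X 3 +
      MvPolynomial.X 2 * MvPolynomial.X 3
  | _ => MvPolynomial.X 1 * MvPolynomial.X 2 * MvPolynomial.X 3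

theorem univ_finset_fin_three : (Finset.univ : Finset (Finset (Fin 3))) =
    {∅, {0}, {1}, {2}, {0, 1}, {0, 2}, {1, 2}, {0, 1, 2}} := by decide

/-- The eight factors are grouped by the size of the subset: empty, full, singletons, pairs. -/
theorem spinor_eq : spinor 3 = (1 - C (MvPolynomial.X 0 ^ 1 * 1) * X ^ 1) *
    (1 - C (MvPolynomial.X 0 ^ 1 * elemSym 3) * X ^ 1) *
    (1 - C (MvPolynomial.X 0 ^ 1 * elemSym 1) * X ^ 1 +
      C (MvPolynomial.X 0 ^ 2 * elemSym 2) * X ^ 2 -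
      C (MvPolynomial.X 0 ^ 3 * elemSym 3) * X ^ 3) *
    (1 - C (MvPolynomial.X 0 ^ 1 * elemSym 2) * X ^ 1 +
      C (MvPolynomial.X 0 ^ 2 * (elemSym 3 * elemSym 1)) * X ^ 2 -
      C (MvPolynomial.X 0 ^ 3 * (elemSym 3 * elemSym 3)) * X ^ 3) := by
  rw [spinor, univ_finset_fin_three]
  repeat rw [Finset.prod_insert (by decide)]
  rw [Finset.prod_singleton]
  have h (f : Fin 3 → MvPolynomial (Fin 4) ℚ) : ∏ i ∈ ({0, 1, 2} : Finset (Fin 3)), f i =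
      f 0 * (f 1 * f 2) := by
    rw [Finset.prod_insert (by decide), Finset.prod_insert (by decide), Finset.prod_singleton]
  simp only [h, Finset.prod_empty, Finset.prod_singleton, elemSym,
    show Fin.succ (0 : Fin 3) = 1 from rfl, show Fin.succ (1 : Fin 3) = 2 from rfl,
    show Fin.succ (2 : Fin 3) = 3 from rfl, map_mul, map_add, map_pow, map_one]
  ring

theorem homogSeries_mul_linear {u : ℤ → MvPolynomial (Fin 4) ℚ} (hu : ∀ n < 0, u n = 0)
    (a : MvPolynomial (Fin 4) ℚ) :
    homogSeries u * (1 - C (MvPolynomial.X 0 ^ 1 * a) * X ^ 1 :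
      (MvPolynomial (Fin 4) ℚ)[X]).toPowerSeries =
      homogSeries fun n => u n - a * u (n - 1) := by
  rw [Polynomial.coe_sub, Polynomial.coe_one, Polynomial.coe_mul, Polynomial.coe_C,
    Polynomial.coe_pow, Polynomial.coe_X, mul_sub, mul_one, homogSeries_mul hu, homogSeries_sub,
    Nat.cast_one]

theorem homogSeries_mul_cubic {u : ℤ → MvPolynomial (Fin 4) ℚ} (hu : ∀ n < 0, u n = 0)
    (a b c : MvPolynomial (Fin 4) ℚ) :
    homogSeries u * (1 - C (MvPolynomial.X 0 ^ 1 * a) * X ^ 1 +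
      C (MvPolynomial.X 0 ^ 2 * b) * X ^ 2 - C (MvPolynomial.X 0 ^ 3 * c) * X ^ 3 :
      (MvPolynomial (Fin 4) ℚ)[X]).toPowerSeries =
      homogSeries fun n => u n - a * u (n - 1) + b * u (n - 2) - c * u (n - 3) := by
  simp only [Polynomial.coe_mul, Polynomial.coe_sub, Polynomial.coe_add, Polynomial.coe_one,
    Polynomial.coe_C, Polynomial.coe_X, Polynomial.coe_pow]
  rw [mul_sub, mul_add, mul_sub, mul_one, homogSeries_mul hu, homogSeries_mul hu,
    homogSeries_mul hu, homogSeries_sub, homogSeries_add, homogSeries_sub]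
  rfl

/-- Each group of factors in `spinor_eq` is one of the stages `reducedLinear`, `reducedCubic`,
`reducedTotal`, with `y = x₀ v`. -/
theorem homogSeries_mul_spinor : homogSeries (fun n => glOmega p (pushT p n)) *
    (spinor 3 : (MvPolynomial (Fin 4) ℚ)[X]).toPowerSeries =
      homogSeries fun n => glOmega p (reducedTotal p n) := by
  have e1 : elemSym 1 = glOmega p (elemGL p 1) := glOmega_elemGL_one.symm
  have e2 : elemSym 2 = glOmega p (elemGL p 2) := glOmega_elemGL_two.symm
  have e3 : elemSym 3 = glOmega p (elemGL p 3) := glOmega_elemGL_three.symm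
  have hF (n : ℤ) (h : n < 0) : glOmega p (pushT p n) = 0 := by rw [pushT_of_neg h, map_zero]
  have hG (n : ℤ) (h : n < 0) : glOmega p (reducedLinear p n) = 0 := by
    rw [reducedLinear_of_neg h, map_zero]
  have hH (n : ℤ) (h : n < 0) : glOmega p (reducedCubic p n) = 0 := by
    rw [reducedCubic_of_neg h, map_zero]
  have hF' (n : ℤ) (h : n < 0) : glOmega p (pushT p n) - 1 * glOmega p (pushT p (n - 1)) = 0 := by
    rw [hF n h, hF (n - 1) (by omega), mul_zero, sub_zero]
  have s1 (n : ℤ) : glOmega p (pushT p n) - 1 * glOmega p (pushT p (n - 1)) -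
      elemSym 3 * (glOmega p (pushT p (n - 1)) - 1 * glOmega p (pushT p (n - 1 - 1))) =
      glOmega p (reducedLinear p n) := by
    rw [reducedLinear, e3, show n - 1 - 1 = n - 2 by ring]
    simp only [map_sub, map_mul, one_mul]
  have s2 (n : ℤ) : glOmega p (reducedLinear p n) -
      elemSym 1 * glOmega p (reducedLinear p (n - 1)) +
      elemSym 2 * glOmega p (reducedLinear p (n - 2)) -
      elemSym 3 * glOmega p (reducedLinear p (n - 3)) = glOmega p (reducedCubic p n) := by
    rw [reducedCubic, e1, e2, e3]
    simp only [map_sub, map_add, map_mul]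
  have s3 (n : ℤ) : glOmega p (reducedCubic p n) -
      elemSym 2 * glOmega p (reducedCubic p (n - 1)) +
      elemSym 3 * elemSym 1 * glOmega p (reducedCubic p (n - 2)) -
      elemSym 3 * elemSym 3 * glOmega p (reducedCubic p (n - 3)) =
        glOmega p (reducedTotal p n) := by
    rw [reducedTotal, e1, e2, e3]
    simp only [map_sub, map_add, map_mul, mul_assoc]
  rw [spinor_eq, Polynomial.coe_mul, Polynomial.coe_mul, Polynomial.coe_mul, ← mul_assoc,
    ← mul_assoc, ← mul_assoc, homogSeries_mul_linear hF, homogSeries_mul_linear hF']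
  simp only [s1]
  rw [homogSeries_mul_cubic hG]
  simp only [s2]
  rw [homogSeries_mul_cubic hH]
  simp only [s3]

theorem sym_one_one_zero : sym 1 1 0 = elemSym 2 := by
  have h : Finset.univ.image (fun σ : Equiv.Perm (Fin 3) => ![1, 1, 0] ∘ σ) =
    {![1, 1, 0], ![1, 0, 1], ![0, 1, 1]} := by decide
  rw [sym, h, Finset.sum_insert (by decide), Finset.sum_insert (by decide), Finset.sum_singleton]
  simp [Fin.prod_univ_three, elemSym]
  ring

theorem sym_two_one_one : sym 2 1 1 = elemSym 3 * elemSym 1 := by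
  have h : Finset.univ.image (fun σ : Equiv.Perm (Fin 3) => ![2, 1, 1] ∘ σ) =
    {![2, 1, 1], ![1, 2, 1], ![1, 1, 2]} := by decide
  rw [sym, h, Finset.sum_insert (by decide), Finset.sum_insert (by decide), Finset.sum_singleton]
  simp [Fin.prod_univ_three, elemSym]
  ring

theorem sym_two_two_one : sym 2 2 1 = elemSym 3 * elemSym 2 := by
  have h : Finset.univ.image (fun σ : Equiv.Perm (Fin 3) => ![2, 2, 1] ∘ σ) =
    {![2, 2, 1], ![2, 1, 2], ![1, 2, 2]} := by decide
  rw [sym, h, Finset.sum_insert (by decide), Finset.sum_insert (by decide), Finset.sum_singleton]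
  simp [Fin.prod_univ_three, elemSym]
  ring

theorem sym_three_two_two : sym 3 2 2 = elemSym 3 ^ 2 * elemSym 1 := by
  have h : Finset.univ.image (fun σ : Equiv.Perm (Fin 3) => ![3, 2, 2] ∘ σ) =
    {![3, 2, 2], ![2, 3, 2], ![2, 2, 3]} := by decide
  rw [sym, h, Finset.sum_insert (by decide), Finset.sum_insert (by decide), Finset.sum_singleton]
  simp [Fin.prod_univ_three, elemSym]
  ring

theorem sym_self (i : ℕ) : sym i i i = elemSym 3 ^ i := by
  have h : Finset.univ.image (fun σ : Equiv.Perm (Fin 3) => ![i, i, i] ∘ σ) = {![i, i, i]} := by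
    have e : ![i, i, i] = fun _ => i := by
      ext j; fin_cases j <;> rfl
    rw [e]
    exact Finset.image_const Finset.univ_nonempty _
  rw [sym, h, Finset.sum_singleton, Fin.prod_univ_three, elemSym, mul_pow, mul_pow]
  · rfl
  all_goals simp

theorem C_inv_mul {c : ℕ} (hc : c ≠ 0) {a b : MvPolynomial (Fin 4) ℚ}
    (h : (c : MvPolynomial (Fin 4) ℚ) * a = b) : a = MvPolynomial.C ((c : ℚ)⁻¹) * b := by
  rw [← h, ← mul_assoc, ← map_natCast (MvPolynomial.C (σ := Fin 4) (R := ℚ)), ← map_mul,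
    inv_mul_cancel₀ (by exact_mod_cast hc), map_one, one_mul]

theorem homogSeries_reducedTotal :
    homogSeries (fun n => glOmega p (reducedTotal p n)) = (sphericalP₃ p).toPowerSeries := by
  have hp0 := ratCast_prime_ne_zero (p := p)
  have e1 : glOmega p (elemGL p 1) = elemSym 1 := glOmega_elemGL_one
  have e2 : glOmega p (elemGL p 2) = elemSym 2 := glOmega_elemGL_two
  have e3 : glOmega p (elemGL p 3) = elemSym 3 := glOmega_elemGL_three
  have k2 := congrArg (glOmega p) (reducedTotal_two (p := p))
  have k3 := congrArg (glOmega p) (reducedTotal_three (p := p))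
  have k4 := congrArg (glOmega p) (reducedTotal_four (p := p))
  have k6 := congrArg (glOmega p) (reducedTotal_six (p := p))
  simp only [map_mul, map_add, map_sub, map_zero, map_natCast, e1, e2, e3] at k2 k3 k4 k6
  replace k2 := C_inv_mul (pow_ne_zero 2 hp.out.ne_zero) k2
  replace k3 := C_inv_mul (pow_ne_zero 2 hp.out.ne_zero) k3
  replace k4 := C_inv_mul (pow_ne_zero 3 hp.out.ne_zero) k4
  replace k6 := C_inv_mul (pow_ne_zero 3 hp.out.ne_zero) k6
  push_cast [C_inv_pow] at k2 k3 k4 k6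
  have hu := natCast_mul_C_inv (p := p)
  have d (a : ℚ) (k : ℕ) : (MvPolynomial.C (a / (p : ℚ) ^ k) : MvPolynomial (Fin 4) ℚ) =
      MvPolynomial.C a * MvPolynomial.C ((p : ℚ)⁻¹) ^ k := by
    rw [div_eq_mul_inv, map_mul, C_inv_pow]
  have d1 : (MvPolynomial.C (1 / (p : ℚ)) : MvPolynomial (Fin 4) ℚ) =
      MvPolynomial.C ((p : ℚ)⁻¹) := by rw [one_div]
  rw [sphericalP₃]
  simp only [sym_one_one_zero, sym_two_one_one, sym_two_two_one, sym_three_two_two, sym_self,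
    MvPolynomial.smul_eq_C_mul, d, d1, map_add, map_one, map_pow, map_natCast]
  ext1 n
  rw [homogSeries, PowerSeries.coeff_mk, Polynomial.coeff_coe]
  simp only [Polynomial.coeff_add, Polynomial.coeff_sub, Polynomial.coeff_C_mul,
    Polynomial.coeff_X_pow, Polynomial.coeff_one]
  by_cases h0 : n = 0
  · subst h0
    rw [Nat.cast_zero, reducedTotal_zero, map_one]
    simp
  by_cases h2 : n = 2
  · subst h2
    rw [Nat.cast_ofNat, k2]
    norm_num [-map_inv₀]
    linear_combination -(MvPolynomial.X 0 ^ 2 * MvPolynomial.C ((p : ℚ)⁻¹) *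
      (elemSym 2 + elemSym 3 * elemSym 1)) * hu
  by_cases h3 : n = 3
  · subst h3
    rw [Nat.cast_ofNat, k3]
    norm_num [-map_inv₀]
    ring
  by_cases h4 : n = 4
  · subst h4
    rw [Nat.cast_ofNat, k4]
    norm_num [-map_inv₀]
    linear_combination -(MvPolynomial.X 0 ^ 4 * MvPolynomial.C ((p : ℚ)⁻¹) ^ 2 *
      (elemSym 3 * elemSym 2 + elemSym 3 ^ 2 * elemSym 1)) * hu
  by_cases h6 : n = 6
  · subst h6
    rw [Nat.cast_ofNat, k6]
    norm_num [-map_inv₀]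
    ring
  rw [reducedTotal_eq_zero (by omega) (by omega) (by omega) (by omega) (by omega), map_zero]
  simp [h0, h2, h3, h4, h6]

end Series

end

noncomputable section

variable {p : ℕ} [hp : Fact p.Prime]

/-! ### Operators with multiplier `p²` and the rank modulo `p`. -/

section RankOne

variable (p) in
/-- All minors of size `k` are divisible by `p`. -/
def DvdMinors {m : Type*} (k : ℕ) (N : Matrix m m ℤ) : Prop :=
  ∀ f g : Fin k → m, (p : ℤ) ∣ (N.submatrix f g).det

theorem DvdMinors.dvd {m : Type*} {N : Matrix m m ℤ} (h : DvdMinors p 2 N) (i i' j j' : m) :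
    (p : ℤ) ∣ N i j * N i' j' - N i j' * N i' j := by
  have := h ![i, i'] ![j, j']
  rw [det_fin_two] at this
  simpa using this

theorem dvdMinors_one_iff {m : Type*} {N : Matrix m m ℤ} :
    DvdMinors p 1 N ↔ ∀ i j, (p : ℤ) ∣ N i j := by
  constructor
  · intro h i j
    have := h (fun _ => i) fun _ => j
    rwa [det_fin_one] at this
  · intro h f g
    rw [det_fin_one]
    exact h _ _

theorem dvdMinors_of_eq_mul {m : Type*} {N : Matrix m m ℤ} (u v : m → ZMod p)
    (h : ∀ i j, (N i j : ZMod p) = u i * v j) : DvdMinors p 2 N := by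
  intro f g
  rw [← ZMod.intCast_zmod_eq_zero_iff_dvd, det_fin_two]
  simp only [submatrix_apply, Int.cast_sub, Int.cast_mul, h]
  ring

variable (p) in
/-- The integral elements of `GSp₃` with multiplier `p ^ 2` whose reduction modulo `p` has rank
less than `k`. -/
def minorSet (k : ℕ) : Set (GSp 3) :=
  {M | M ∈ integralSet 3 p 2 ∧ ∀ N, N.map (Int.castRingHom ℚ) = mat M → DvdMinors p k N}

theorem minorSet_subset (k : ℕ) : minorSet p k ⊆ integralSet 3 p 2 := fun _ h => h.1

/-- Here each exponent `aᵢ` is `0` or `1`, and the entries `p ^ (2 - aᵢ)` vanish modulo `p`. So the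
rank of the reduction is the number of zeros among the `aᵢ`, which come first. -/
theorem mem_minorSet_iff {γ γ' M : GSp 3} {a : Fin 3 → ℕ} {h : ∀ i, a i ≤ 2} (ha : Monotone a)
    (h2 : ∀ i, 2 * a i ≤ 2) (hγ : γ ∈ Sp 3) (hγ' : γ' ∈ Sp 3)
    (e : M = γ * powDiag p 2 a h * γ') (i : Fin 3) : M ∈ minorSet p (i + 1) ↔ a i = 1 := by
  have hi : (i : ℕ) + 1 ≤ 3 := i.2
  have hmem : M ∈ integralSet 3 p 2 := by
    rw [e]
    exact integralSet_mul_mem hγ' (mul_mem_integralSet hγ (powDiag_mem 2 a h))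
  constructor
  · rintro ⟨-, hM⟩
    obtain ⟨N, hN⟩ := hmem.2
    obtain ⟨A, hA⟩ := isInt_of_mem_Sp (inv_mem hγ)
    obtain ⟨B, hB⟩ := isInt_of_mem_Sp (inv_mem hγ')
    have e' : powDiag p 2 a h = γ⁻¹ * M * γ'⁻¹ := by rw [e]; group
    have hD : diagonal (Sum.elim (fun i => (p : ℤ) ^ a i) fun i => (p : ℤ) ^ (2 - a i)) =
        A * N * B := map_intCast_injective (by
      rw [← mat_powDiag 2 a h, e', mat_mul, mat_mul, Matrix.map_mul, Matrix.map_mul, hA, hB, hN])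
    have hdvd := dvd_minor_mul_right (dvd_minor_mul_left (hM N hN) A) B
      (Sum.inl ∘ Fin.castLE hi) (Sum.inl ∘ Fin.castLE hi)
    rw [← hD, submatrix_diagonal _ _ (Sum.inl_injective.comp (Fin.castLE_injective hi)),
      det_diagonal] at hdvd
    by_contra h1
    have hzero (j : Fin (i + 1)) : a (Fin.castLE hi j) = 0 := by
      have h3 : a (Fin.castLE hi j) ≤ a i := ha (Nat.le_of_lt_succ j.2)
      have h4 := h2 i
      omega
    simp only [Function.comp_apply, Sum.elim_inl, hzero, pow_zero, Finset.prod_const_one] at hdvd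
    exact (Nat.prime_iff_prime_int.1 hp.out).not_dvd_one hdvd
  · intro h1
    refine ⟨hmem, fun N hN f g => ?_⟩
    refine dvd_trans ?_ (pow_dvd_minor ha h2 hi hγ hγ' e hN f g)
    refine dvd_pow_self _ ?_
    rw [Fin.sum_univ_castSucc]
    have : Fin.castLE hi (Fin.last i) = i := rfl
    rw [this, h1]
    omega

theorem heckeDiag_congr {n : ℕ} {d d' e e' : Fin n → ℕ} {a : ℕ} {ha : a ≠ 0}
    {h : ∀ i, d i * e i = a} {h' : ∀ i, d' i * e' i = a} (hd : d = d') (he : e = e') :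
    heckeDiag d e a ha h = heckeDiag d' e' a ha h' := by
  subst hd he
  rfl

theorem vec_le_two (k : ℕ) : ∀ i, (fun j : Fin 3 => if (j : ℕ) < 3 - k then 0 else 1) i ≤ 2 := by
  intro i
  dsimp only
  split_ifs <;> norm_num

theorem heckeTi_eq (k : ℕ) :
    heckeTi 3 p k = heckePow p 2 (fun j => if (j : ℕ) < 3 - k then 0 else 1) (vec_le_two k) :=
  heckeDiag_congr (by ext j; by_cases h : (j : ℕ) < 3 - k <;> simp [h])
    (by ext j; by_cases h : (j : ℕ) < 3 - k <;> simp [h])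

theorem coeffHom_heckeTi_powDiag (k : ℕ) {a : Fin 3 → ℕ} {h : ∀ i, a i ≤ 2} (ha : Monotone a)
    (h2 : ∀ i, 2 * a i ≤ 2) : coeffHom (powDiag p 2 a h) (heckeTi 3 p k) =
      if a = (fun j : Fin 3 => if (j : ℕ) < 3 - k then 0 else 1) then 1 else 0 := by
  rw [heckeTi_eq, coeffHom_heckePow _ ha _ h2]
  · intro i j hij
    have : (i : ℕ) ≤ j := hij
    beta_reduce
    split_ifs <;> omega
  · intro i
    split_ifs <;> norm_num

theorem supportedOn_heckeTi (k : ℕ) :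
    SupportedOn (integralSet 3 p 2) (heckeTi 3 p k).toCosets := by
  intro c hc
  obtain ⟨M, rfl⟩ := coset_surjective c
  refine ⟨M, ?_, rfl⟩
  by_contra hM
  exact hc (coeffHom_doubleCoset_of_notMem (diag_mem_integralSet _ _ _ _) hM)

theorem coeffHom_heckeTi_of_notMem (k : ℕ) {M : GSp 3} (hM : M ∉ integralSet 3 p 2) :
    coeffHom M (heckeTi 3 p k) = 0 :=
  coeffHom_doubleCoset_of_notMem (diag_mem_integralSet _ _ _ _) hM

variable (p) in
/-- `T_{3 - i}(p²) + ⋯ + T₃(p²)`. -/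
def tailSum : Fin 3 → HeckeRing (Sp 3) :=
  ![heckeTi 3 p 3, heckeTi 3 p 2 + heckeTi 3 p 3,
    heckeTi 3 p 1 + (heckeTi 3 p 2 + heckeTi 3 p 3)]

theorem coeffHom_tailSum_powDiag {a : Fin 3 → ℕ} {h : ∀ i, a i ≤ 2} (ha : Monotone a)
    (h2 : ∀ i, 2 * a i ≤ 2) (i : Fin 3) :
    coeffHom (powDiag p 2 a h) (tailSum p i) = if a i = 1 then 1 else 0 := by
  have a0 := h2 0
  have a1 := h2 1
  have a2 := h2 2
  have h01 := ha (show (0 : Fin 3) ≤ 1 by decide)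
  have h12 := ha (show (1 : Fin 3) ≤ 2 by decide)
  have key (k : ℕ) : coeffHom (powDiag p 2 a h) (heckeTi 3 p k) =
      if a 0 = (if 0 < 3 - k then 0 else 1) ∧ a 1 = (if 1 < 3 - k then 0 else 1) ∧
        a 2 = (if 2 < 3 - k then 0 else 1) then 1 else 0 := by
    rw [coeffHom_heckeTi_powDiag _ ha h2]
    refine if_congr ?_ rfl rfl
    simp [funext_iff, Fin.forall_fin_succ]
  fin_cases i
  · change coeffHom _ (heckeTi 3 p 3) = if a 0 = 1 then 1 else 0
    rw [key]
    norm_num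
    split_ifs <;> omega
  · change coeffHom _ (heckeTi 3 p 2 + heckeTi 3 p 3) = if a 1 = 1 then 1 else 0
    rw [map_add, key, key]
    norm_num
    split_ifs <;> omega
  · change coeffHom _ (heckeTi 3 p 1 + (heckeTi 3 p 2 + heckeTi 3 p 3)) = if a 2 = 1 then 1 else 0
    rw [map_add, map_add, key, key, key]
    norm_num
    split_ifs <;> omega

open Classical in
/-- `T_{3 - i}(p²) + ⋯ + T₃(p²)` is the sum of the integral cosets with multiplier `p ^ 2` whose
reduction modulo `p` has rank at most `i`. -/
theorem coeffHom_tailSum (i : Fin 3) (M : GSp 3) :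
    coeffHom M (tailSum p i) = if M ∈ minorSet p (i + 1) then 1 else 0 := by
  by_cases hM : M ∈ integralSet 3 p 2
  · obtain ⟨γ, hγ, γ', hγ', a, ha, ma, a2, e⟩ := exists_eq_mul_powDiag_mul hM
    rw [e, coeffHom_mul_right _ _ hγ', coeffHom_mul_left _ _ hγ,
      if_congr (mem_minorSet_iff ma a2 hγ hγ' rfl i) rfl rfl, coeffHom_tailSum_powDiag ma a2]
  · rw [if_neg fun h => hM (minorSet_subset _ h), tailSum]
    fin_cases i <;> simp [coeffHom_heckeTi_of_notMem _ hM]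

end RankOne

/-! ### Counting the blocks `B` for which the reduction modulo `p` has rank at most one. -/

section Counting

variable {a : Fin 3 → ℕ} {h : ∀ i, a i ≤ 2} {ma : Monotone a} {s : Fin 6 → ℕ}

theorem fiberMatrix_mem_minorSet {k : ℕ} :
    fiberMatrix p 2 a h ma s ∈ minorSet p k ↔ DvdMinors p k (fiberIntMatrix p 2 a s) := by
  constructor
  · exact fun H => H.2 _ rfl
  · refine fun H => ⟨fiberMatrix_mem s, fun N hN => ?_⟩
    rw [mat_fiberMatrix] at hN
    rw [map_intCast_injective hN]
    exact H

/-- Two diagonal entries equal to `1` give a minor equal to `1`: the matrix is block triangular with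
diagonal blocks `A` and `D`, so the product of the two off-diagonal entries is zero. -/
theorem not_dvdMinors_fiber {i j : Fin 3 ⊕ Fin 3} (hij : i ≠ j)
    (hi : fiberIntMatrix p 2 a s i i = 1) (hj : fiberIntMatrix p 2 a s j j = 1) :
    ¬ DvdMinors p 2 (fiberIntMatrix p 2 a s) := by
  intro H
  have h0 : fiberIntMatrix p 2 a s i j * fiberIntMatrix p 2 a s j i = 0 := by
    rcases i with i | i <;> rcases j with j | j
    · have : i ≠ j := fun e => hij (congrArg _ e)
      simp [fiberIntMatrix, this]
    · simp [fiberIntMatrix]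
    · simp [fiberIntMatrix]
    · have : i ≠ j := fun e => hij (congrArg _ e)
      simp [fiberIntMatrix, this]
  have := H.dvd i j i j
  rw [hi, hj, h0, sub_zero, one_mul] at this
  exact (Nat.prime_iff_prime_int.1 hp.out).not_dvd_one this

theorem fiberIntMatrix_inl (i : Fin 3) :
    fiberIntMatrix p 2 a s (Sum.inl i) (Sum.inl i) = (p : ℤ) ^ (2 - a i) := by
  simp [fiberIntMatrix]

theorem fiberIntMatrix_inr (i : Fin 3) :
    fiberIntMatrix p 2 a s (Sum.inr i) (Sum.inr i) = (p : ℤ) ^ a i := by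
  simp [fiberIntMatrix]

theorem lt_of_mem_box (hs : s ∈ box p a) (k : Fin 6) : s k < p ^ boxExponent a k :=
  Finset.mem_range.1 (Fintype.mem_piFinset.1 hs k)

theorem eq_zero_of_natCast_dvd {x : ℕ} (hx : x < p) (hd : (p : ℤ) ∣ x) : x = 0 :=
  Nat.eq_zero_of_dvd_of_lt (by exact_mod_cast hd) hx

open Classical in
-- The entry `1` of `D` already gives rank one, so the remaining entries of `B`, which are reduced
-- modulo `p`, must vanish.
theorem card_filter_zero_one_one {h : ∀ i, ![0, 1, 1] i ≤ 2} {ma : Monotone ![0, 1, 1]} :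
    ((box p ![0, 1, 1]).filter fun s => fiberMatrix p 2 ![0, 1, 1] h ma s ∈ minorSet p 2).card =
      1 := by
  rw [Finset.card_eq_one]
  refine ⟨0, ?_⟩
  ext s
  rw [Finset.mem_filter, fiberMatrix_mem_minorSet, Finset.mem_singleton]
  constructor
  · rintro ⟨hs, H⟩
    have hlt := lt_of_mem_box hs
    have b0 : s 0 < 1 := by simpa [boxExponent] using hlt 0
    have b1 : s 1 < 1 := by simpa [boxExponent] using hlt 1
    have b2 : s 2 < 1 := by simpa [boxExponent] using hlt 2
    have b3 : s 3 < p := by simpa [boxExponent] using hlt 3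
    have b4 : s 4 < p := by simpa [boxExponent] using hlt 4
    have b5 : s 5 < p := by simpa [boxExponent] using hlt 5
    have c3 := H.dvd (Sum.inl 1) (Sum.inr 0) (Sum.inr 1) (Sum.inr 0)
    have c4 := H.dvd (Sum.inl 2) (Sum.inr 0) (Sum.inr 1) (Sum.inr 0)
    have c5 := H.dvd (Sum.inl 2) (Sum.inr 0) (Sum.inr 2) (Sum.inr 0)
    simp [fiberIntMatrix, boxMatrix] at c3 c4 c5
    have c3 := eq_zero_of_natCast_dvd b3 (by exact_mod_cast c3)
    have c4 := eq_zero_of_natCast_dvd b4 (by exact_mod_cast c4)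
    have c5 := eq_zero_of_natCast_dvd b5 (by exact_mod_cast c5)
    ext k
    fin_cases k <;> simp <;> omega
  · rintro rfl
    refine ⟨?_, ?_⟩
    · rw [box, Fintype.mem_piFinset]
      exact fun k => Finset.mem_range.2 (pow_pos hp.out.pos _)
    · refine dvdMinors_of_eq_mul (Pi.single (Sum.inr 0) 1) (Pi.single (Sum.inr 0) 1) ?_
      rintro (i | i) (j | j) <;> fin_cases i <;> fin_cases j <;>
        simp [fiberIntMatrix, boxMatrix]

open Classical in
-- The entry `p ^ (2 - 2) = 1` of `A` is the pivot. The entries of `B` outside its row and column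
-- vanish, and the last row is free: two entries modulo `p`, one modulo `p²`.
theorem card_filter_one_one_two {h : ∀ i, ![1, 1, 2] i ≤ 2} {ma : Monotone ![1, 1, 2]} :
    ((box p ![1, 1, 2]).filter fun s => fiberMatrix p 2 ![1, 1, 2] h ma s ∈ minorSet p 2).card =
      p ^ 4 := by
  have e : ((box p ![1, 1, 2]).filter fun s => fiberMatrix p 2 ![1, 1, 2] h ma s ∈ minorSet p 2) =
      Fintype.piFinset fun k => Finset.range (![1, 1, p, 1, p, p ^ 2] k) := by
    ext s
    rw [Finset.mem_filter, fiberMatrix_mem_minorSet, Fintype.mem_piFinset, box,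
      Fintype.mem_piFinset]
    simp only [Finset.mem_range]
    have hb (P : Fin 6 → Prop) : (∀ k, P k) ↔ P 0 ∧ P 1 ∧ P 2 ∧ P 3 ∧ P 4 ∧ P 5 := by
      simp [Fin.forall_fin_succ]
    rw [hb, hb]
    simp only [boxExponent]
    simp
    constructor
    · rintro ⟨⟨b0, b1, b2, b3, b4, b5⟩, H⟩
      have c0 := H.dvd (Sum.inl 0) (Sum.inl 2) (Sum.inr 0) (Sum.inl 2)
      have c1 := H.dvd (Sum.inl 0) (Sum.inl 2) (Sum.inr 1) (Sum.inl 2)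
      have c3 := H.dvd (Sum.inl 1) (Sum.inl 2) (Sum.inr 1) (Sum.inl 2)
      simp [fiberIntMatrix, boxMatrix] at c0 c1 c3
      exact ⟨eq_zero_of_natCast_dvd b0 (by exact_mod_cast c0),
        eq_zero_of_natCast_dvd b1 (by exact_mod_cast c1), b2,
        eq_zero_of_natCast_dvd b3 (by exact_mod_cast c3), b4, b5⟩
    · rintro ⟨b0, b1, b2, b3, b4, b5⟩
      have := hp.out.pos
      refine ⟨⟨by omega, by omega, b2, by omega, b4, b5⟩, ?_⟩
      refine dvdMinors_of_eq_mul (Pi.single (Sum.inl 2) 1)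
        (Sum.elim ![0, 0, 1] ![(s 2 : ZMod p), s 4, s 5]) ?_
      rintro (i | i) (j | j) <;> fin_cases i <;> fin_cases j <;>
        simp [fiberIntMatrix, boxMatrix, b0, b1, b3]
  rw [e, Fintype.card_piFinset, Fin.prod_univ_six]
  simp only [Finset.card_range]
  simp
  ring

/-- The relations satisfied by the entries of a symmetric matrix of rank at most `1`. -/
def IsRankOne {F : Type*} [Field F] (c : Fin 6 → F) : Prop :=
  c 0 * c 3 = c 1 ^ 2 ∧ c 0 * c 4 = c 1 * c 2 ∧ c 0 * c 5 = c 2 ^ 2 ∧ c 1 * c 4 = c 2 * c 3 ∧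
    c 1 * c 5 = c 2 * c 4 ∧ c 3 * c 5 = c 4 ^ 2

/-- For `D = p` the blocks `A` and `D` vanish modulo `p`, and what remains is the rank of the
symmetric matrix `B`. -/
theorem dvdMinors_fiber_iff : DvdMinors p 2 (fiberIntMatrix p 2 ![1, 1, 1] s) ↔
    IsRankOne fun k => (s k : ZMod p) := by
  constructor
  · intro H
    have key (i i' j j') := (ZMod.intCast_zmod_eq_zero_iff_dvd _ p).2
      (H.dvd (Sum.inl i) (Sum.inl i') (Sum.inr j) (Sum.inr j'))
    have k1 := key 0 1 0 1
    have k2 := key 0 1 0 2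
    have k3 := key 0 2 0 2
    have k4 := key 0 1 1 2
    have k5 := key 0 2 1 2
    have k6 := key 1 2 1 2
    simp [fiberIntMatrix, boxMatrix] at k1 k2 k3 k4 k5 k6
    refine ⟨?_, ?_, ?_, ?_, ?_, ?_⟩
    · linear_combination k1
    · linear_combination k2
    · linear_combination k3
    · linear_combination k4
    · linear_combination k5
    · linear_combination k6
  · rintro ⟨k1, k2, k3, -, -, k6⟩
    beta_reduce at k1 k2 k3 k6
    -- The first nonzero diagonal entry serves as pivot and exhibits `B` as a column times a row; if
    -- the first two vanish, only the last entry can survive.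
    by_cases h0 : (s 0 : ZMod p) = 0
    · rw [h0, zero_mul] at k1 k2 k3
      have h1 : (s 1 : ZMod p) = 0 := by simpa using k1.symm
      have h2 : (s 2 : ZMod p) = 0 := by simpa using k3.symm
      by_cases h3 : (s 3 : ZMod p) = 0
      · rw [h3, zero_mul] at k6
        have h4 : (s 4 : ZMod p) = 0 := by simpa using k6.symm
        refine dvdMinors_of_eq_mul (Sum.elim ![0, 0, 1] 0) (Sum.elim 0 ![0, 0, (s 5 : ZMod p)]) ?_
        rintro (i | i) (j | j) <;> fin_cases i <;> fin_cases j <;>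
          simp [fiberIntMatrix, boxMatrix, h0, h1, h2, h3, h4]
      · refine dvdMinors_of_eq_mul (Sum.elim ![0, (s 3 : ZMod p), s 4] 0)
          (Sum.elim 0 ![0, 1, (s 4 : ZMod p) / s 3]) ?_
        rintro (i | i) (j | j) <;> fin_cases i <;> fin_cases j <;>
          simp [fiberIntMatrix, boxMatrix, h0, h1, h2]
        · field_simp
        · field_simp
          linear_combination k6
    · refine dvdMinors_of_eq_mul (Sum.elim ![(s 0 : ZMod p), s 1, s 2] 0)
        (Sum.elim 0 ![1, (s 1 : ZMod p) / s 0, (s 2 : ZMod p) / s 0]) ?_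
      rintro (i | i) (j | j) <;> fin_cases i <;> fin_cases j <;>
        simp [fiberIntMatrix, boxMatrix]
      · field_simp
      · field_simp
      · field_simp
        linear_combination k1
      · field_simp
        linear_combination k2
      · field_simp
        linear_combination k2
      · field_simp
        linear_combination k3

open Classical in
/-- Coordinates on the set of the symmetric matrices of rank at most `1`. -/
def rankOneCoord {F : Type*} [Field F] (c : Fin 6 → F) : F × F × F :=
  if c 0 ≠ 0 then (c 0, c 1, c 2) else if c 3 ≠ 0 then (0, c 3, c 4) else (0, 0, c 5)

/-- A symmetric matrix of rank at most one is determined by the row of a nonzero diagonal entry. The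
strata given by the first such entry fit together to all of `F³`, by `exists_rankOneCoord`. -/
theorem rankOneCoord_injOn {F : Type*} [Field F] {c c' : Fin 6 → F} (hc : IsRankOne c)
    (hc' : IsRankOne c') (e : rankOneCoord c = rankOneCoord c') : c = c' := by
  have ext6 (h0 : c 0 = c' 0) (h1 : c 1 = c' 1) (h2 : c 2 = c' 2) (h3 : c 3 = c' 3)
      (h4 : c 4 = c' 4) (h5 : c 5 = c' 5) : c = c' := by
    ext k; fin_cases k <;> assumption
  obtain ⟨k1, k2, k3, -, -, k6⟩ := hc
  obtain ⟨l1, l2, l3, -, -, l6⟩ := hc'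
  unfold rankOneCoord at e
  by_cases h0 : c 0 = 0 <;> by_cases h0' : c' 0 = 0
  · simp only [h0, h0', ne_eq, not_true_eq_false, if_false] at e
    rw [h0, zero_mul] at k1 k2 k3
    rw [h0', zero_mul] at l1 l2 l3
    have h1 : c 1 = 0 := by simpa using k1.symm
    have h2 : c 2 = 0 := by simpa using k3.symm
    have h1' : c' 1 = 0 := by simpa using l1.symm
    have h2' : c' 2 = 0 := by simpa using l3.symm
    by_cases h3 : c 3 = 0 <;> by_cases h3' : c' 3 = 0
    · simp [h3, h3'] at e
      rw [h3, zero_mul] at k6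
      rw [h3', zero_mul] at l6
      have h4 : c 4 = 0 := by simpa using k6.symm
      have h4' : c' 4 = 0 := by simpa using l6.symm
      exact ext6 (by rw [h0, h0']) (by rw [h1, h1']) (by rw [h2, h2']) (by rw [h3, h3'])
        (by rw [h4, h4']) e
    · simp [h3, h3'] at e
      exact absurd e.1.symm h3'
    · simp [h3, h3'] at e
    · simp [h3, h3'] at e
      refine ext6 (by rw [h0, h0']) (by rw [h1, h1']) (by rw [h2, h2']) e.1 e.2 ?_
      refine mul_left_cancel₀ h3 ?_
      rw [k6, e.1, e.2, l6]
  · simp [h0, h0'] at e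
    by_cases h3 : c 3 = 0 <;> simp [h3] at e <;> exact absurd e.1.symm h0'
  · simp [h0, h0'] at e
    by_cases h3 : c' 3 = 0 <;> simp [h3] at e <;> exact absurd e.1 h0
  · simp [h0, h0'] at e
    obtain ⟨e0, e1, e2⟩ := e
    refine ext6 e0 e1 e2 ?_ ?_ ?_ <;> refine mul_left_cancel₀ h0 ?_
    · rw [k1, e0, e1, l1]
    · rw [k2, e0, e1, e2, l2]
    · rw [k3, e0, e2, l3]

theorem exists_rankOneCoord {F : Type*} [Field F] (t : F × F × F) :
    ∃ c : Fin 6 → F, IsRankOne c ∧ rankOneCoord c = t := by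
  obtain ⟨a, b, d⟩ := t
  by_cases h0 : a = 0
  · by_cases h1 : b = 0
    · exact ⟨![0, 0, 0, 0, 0, d], by simp [IsRankOne], by simp [rankOneCoord, h0, h1]⟩
    · refine ⟨![0, 0, 0, b, d, d ^ 2 / b], ?_, by simp [rankOneCoord, h0, h1]⟩
      simp [IsRankOne]
      field_simp
  · refine ⟨![a, b, d, b ^ 2 / a, b * d / a, d ^ 2 / a], ?_, by simp [rankOneCoord, h0]⟩
    simp only [IsRankOne]
    simp
    refine ⟨?_, ?_, ?_, ?_, ?_, ?_⟩ <;> field_simp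

open Classical in
theorem card_filter_one_one_one {h : ∀ i, ![1, 1, 1] i ≤ 2} {ma : Monotone ![1, 1, 1]} :
    ((box p ![1, 1, 1]).filter fun s => fiberMatrix p 2 ![1, 1, 1] h ma s ∈ minorSet p 2).card =
      p ^ 3 := by
  have hcard : (Finset.univ : Finset (ZMod p × ZMod p × ZMod p)).card = p ^ 3 := by
    rw [Finset.card_univ, Fintype.card_prod, Fintype.card_prod, ZMod.card]
    ring
  have hexp (k) : boxExponent ![1, 1, 1] k = 1 := by fin_cases k <;> rfl
  rw [← hcard]
  refine Finset.card_bij (fun s _ => rankOneCoord fun k => (s k : ZMod p)) (by simp) ?_ ?_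
  · intro s hs s' hs' e
    rw [Finset.mem_filter, fiberMatrix_mem_minorSet, dvdMinors_fiber_iff] at hs hs'
    have := rankOneCoord_injOn hs.2 hs'.2 e
    ext k
    have hk := congrFun this k
    have b := lt_of_mem_box hs.1 k
    have b' := lt_of_mem_box hs'.1 k
    rw [hexp, pow_one] at b b'
    rw [ZMod.natCast_eq_natCast_iff] at hk
    exact Nat.ModEq.eq_of_lt_of_lt hk b b'
  · intro t _
    obtain ⟨c, hc, e⟩ := exists_rankOneCoord t
    refine ⟨fun k => (c k).val, ?_, ?_⟩
    · rw [Finset.mem_filter, fiberMatrix_mem_minorSet, dvdMinors_fiber_iff, box,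
        Fintype.mem_piFinset]
      refine ⟨fun k => ?_, ?_⟩
      · rw [hexp, pow_one, Finset.mem_range]
        exact ZMod.val_lt _
      · simpa using hc
    · simpa using e

end Counting

end

noncomputable section

variable {p : ℕ} [hp : Fact p.Prime]

/-! ### The images of the operators with multiplier `p²` in the Hecke ring of `GL₃`. -/

section PushTail

theorem supportedOn_tailSum (i : Fin 3) :
    SupportedOn (integralSet 3 p 2) (tailSum p i).toCosets := by
  classical
  intro c hc
  obtain ⟨M, rfl⟩ := coset_surjective c
  rw [← coeffHom_apply, coeffHom_tailSum] at hc
  exact ⟨M, by by_contra h; exact hc (if_neg fun h' => h (minorSet_subset _ h')), rfl⟩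

variable (p) in
/-- `T_{3 - i}(p²) + ⋯ + T₃(p²)` as an element of the integral part of the Hecke ring. -/
def tailInt (i : Fin 3) : spRing p :=
  ⟨tailSum p i, (supportedOn_tailSum i).mono (integralSet_subset 2)⟩

variable (p) in
/-- The image of `tailSum` in the Hecke ring of `GL₃`. -/
def pushTail (i : Fin 3) : glRing p :=
  ⟨pushGL p (tailSum p i) (tailInt p i).2, supportedOn_pushGL _ _⟩

theorem spOmega_tailInt (i : Fin 3) :
    spOmega p (tailInt p i) = MvPolynomial.X 0 ^ 2 * glOmega p (pushTail p i) := by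
  rw [spOmega_apply, omegaLin_eq (tailInt p i).2 (supportedOn_tailSum i), glOmega_apply]
  rfl

theorem vec_natCast (x y z : ℕ) : ![(x : ℤ), y, z] = fun i => ((![x, y, z] i : ℕ) : ℤ) := by
  ext i; fin_cases i <;> rfl

open Classical in
theorem diagCoeff_pushTail (i : Fin 3) {x y z : ℕ} (h : ∀ j, ![x, y, z] j ≤ 2)
    (ma : Monotone ![x, y, z]) : diagCoeff p (pushTail p i).1 x y z =
      ((box p ![x, y, z]).filter fun s =>
        fiberMatrix p 2 ![x, y, z] h ma s ∈ minorSet p (i + 1)).card := by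
  rw [diagCoeff, vec_natCast]
  exact coeffHom_pushGL_glDiag (minorSet_subset _) (coeffHom_tailSum i) (tailInt p i).2 h ma

theorem normCoeff_of_neg (δ : ℤ) (s : glRing p) {x y z : ℤ} (h : x < 0 ∨ y < 0 ∨ z < 0) :
    normCoeff p δ s x y z = 0 := by
  rw [normCoeff, diagCoeff]
  rcases h with h | h | h
  · rw [coeffHom_glDiag_of_neg s.2 (i := 0) h, Int.cast_zero, mul_zero]
  · rw [coeffHom_glDiag_of_neg s.2 (i := 1) h, Int.cast_zero, mul_zero]
  · rw [coeffHom_glDiag_of_neg s.2 (i := 2) h, Int.cast_zero, mul_zero]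

theorem diagCoeff_pushTail_of_lt (i : Fin 3) {x y z : ℕ} (hz : 2 < z) :
    diagCoeff p (pushTail p i).1 x y z = 0 := by
  rw [diagCoeff, vec_natCast]
  refine coeffHom_pushGL_glDiag_eq_zero (supportedOn_tailSum i) (tailInt p i).2 fun h => ?_
  have : z ≤ 2 := h 2
  omega

theorem monotone_vec_nat {x y z : ℕ} (h1 : x ≤ y) (h2 : y ≤ z) : Monotone ![x, y, z] := by
  rw [Fin.monotone_iff_le_succ]
  intro i
  fin_cases i
  · exact h1
  · exact h2

theorem vec_le {x y z k : ℕ} (hx : x ≤ k) (hy : y ≤ k) (hz : z ≤ k) :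
    ∀ j, ![x, y, z] j ≤ k := by
  intro j
  fin_cases j
  · exact hx
  · exact hy
  · exact hz

/-- For every other `D` with exponents at most two, the diagonal `(p ^ (2 - a); p ^ a)` contains two
ones, which excludes rank one. -/
theorem diagCoeff_pushTail_one {x y z : ℕ} (h1 : x ≤ y) (h2 : y ≤ z) :
    diagCoeff p (pushTail p 1).1 x y z =
      if x = 0 ∧ y = 1 ∧ z = 1 then 1 else if x = 1 ∧ y = 1 ∧ z = 1 then (p : ℤ) ^ 3
      else if x = 1 ∧ y = 1 ∧ z = 2 then (p : ℤ) ^ 4 else 0 := by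
  classical
  by_cases hz : 2 < z
  · rw [diagCoeff_pushTail_of_lt 1 hz]
    simp (disch := omega) only [if_neg]
  have hle : ∀ j, ![x, y, z] j ≤ 2 := vec_le (by omega) (by omega) (by omega)
  have ma := monotone_vec_nat h1 h2
  rw [diagCoeff_pushTail 1 hle ma]
  by_cases c1 : x = 0 ∧ y = 1 ∧ z = 1
  · rw [if_pos c1]
    obtain ⟨rfl, rfl, rfl⟩ := c1
    exact_mod_cast card_filter_zero_one_one
  by_cases c2 : x = 1 ∧ y = 1 ∧ z = 1
  · rw [if_neg c1, if_pos c2]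
    obtain ⟨rfl, rfl, rfl⟩ := c2
    exact_mod_cast card_filter_one_one_one
  by_cases c3 : x = 1 ∧ y = 1 ∧ z = 2
  · rw [if_neg c1, if_neg c2, if_pos c3]
    obtain ⟨rfl, rfl, rfl⟩ := c3
    exact_mod_cast card_filter_one_one_two
  rw [if_neg c1, if_neg c2, if_neg c3, Finset.filter_eq_empty_iff.2, Finset.card_empty,
    Nat.cast_zero]
  intro s _ hs
  have hs : DvdMinors p 2 (fiberIntMatrix p 2 ![x, y, z] s) := fiberMatrix_mem_minorSet.1 hs
  rcases (by omega : (x = 0 ∧ y = 0) ∨ (y = 2 ∧ z = 2) ∨ (x = 0 ∧ z = 2)) with ⟨e, e'⟩ | ⟨e, e'⟩ |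
    ⟨e, e'⟩
  · refine not_dvdMinors_fiber (i := Sum.inr 0) (j := Sum.inr 1) (by simp) ?_ ?_ hs
    · rw [fiberIntMatrix_inr]; simp [e]
    · rw [fiberIntMatrix_inr]; simp [e']
  · refine not_dvdMinors_fiber (i := Sum.inl 1) (j := Sum.inl 2) (by simp) ?_ ?_ hs
    · rw [fiberIntMatrix_inl]; simp [e]
    · rw [fiberIntMatrix_inl]; simp [e']
  · refine not_dvdMinors_fiber (i := Sum.inr 0) (j := Sum.inl 2) (by simp) ?_ ?_ hs
    · rw [fiberIntMatrix_inr]; simp [e]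
    · rw [fiberIntMatrix_inl]; simp [e']

theorem diagCoeff_pushTail_zero {x y z : ℕ} (h1 : x ≤ y) (h2 : y ≤ z) :
    diagCoeff p (pushTail p 0).1 x y z = if x = 1 ∧ y = 1 ∧ z = 1 then 1 else 0 := by
  classical
  by_cases hz : 2 < z
  · rw [diagCoeff_pushTail_of_lt 0 hz, if_neg (by omega)]
  have hle : ∀ j, ![x, y, z] j ≤ 2 := vec_le (by omega) (by omega) (by omega)
  have ma := monotone_vec_nat h1 h2
  rw [diagCoeff_pushTail 0 hle ma]
  have hunit : ¬ (p : ℤ) ∣ 1 := (Nat.prime_iff_prime_int.1 hp.out).not_dvd_one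
  by_cases c : x = 1 ∧ y = 1 ∧ z = 1
  · rw [if_pos c]
    obtain ⟨rfl, rfl, rfl⟩ := c
    have hexp (k) : boxExponent ![1, 1, 1] k = 1 := by fin_cases k <;> rfl
    norm_cast
    rw [Finset.card_eq_one]
    refine ⟨0, ?_⟩
    ext s
    rw [Finset.mem_filter, fiberMatrix_mem_minorSet, Finset.mem_singleton]
    constructor
    · rintro ⟨hs, H⟩
      have H := dvdMinors_one_iff.1 (show DvdMinors p 1 _ from H)
      have hlt (k) : s k < p := by
        have := lt_of_mem_box hs k
        rwa [hexp, pow_one] at this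
      have key (i j) := H (Sum.inl i) (Sum.inr j)
      have e (k) (i j) (hk : fiberIntMatrix p 2 ![1, 1, 1] s (Sum.inl i) (Sum.inr j) = s k) :
          s k = 0 := eq_zero_of_natCast_dvd (hlt k) (hk ▸ key i j)
      ext k
      fin_cases k
      · exact e 0 0 0 rfl
      · exact e 1 1 0 rfl
      · exact e 2 2 0 rfl
      · exact e 3 1 1 rfl
      · exact e 4 2 1 rfl
      · exact e 5 2 2 rfl
    · rintro rfl
      refine ⟨?_, ?_⟩
      · rw [box, Fintype.mem_piFinset]
        exact fun k => Finset.mem_range.2 (pow_pos hp.out.pos _)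
      · refine (dvdMinors_one_iff (p := p)).2 ?_
        rintro (i | i) (j | j) <;> fin_cases i <;> fin_cases j <;>
          simp [fiberIntMatrix, boxMatrix]
  · rw [if_neg c, Finset.filter_eq_empty_iff.2, Finset.card_empty, Nat.cast_zero]
    intro s _ hs
    have hs := dvdMinors_one_iff.1 (show DvdMinors p 1 _ from fiberMatrix_mem_minorSet.1 hs)
    rcases (by omega : x = 0 ∨ z = 2 ∨ (y = 0 ∧ x = 0)) with e | e | e
    · have := hs (Sum.inr 0) (Sum.inr 0)
      rw [fiberIntMatrix_inr] at this
      simp [e] at this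
      exact hunit (by exact_mod_cast this)
    · have := hs (Sum.inl 2) (Sum.inl 2)
      rw [fiberIntMatrix_inl] at this
      simp [e] at this
      exact hunit (by exact_mod_cast this)
    · have := hs (Sum.inr 0) (Sum.inr 0)
      rw [fiberIntMatrix_inr] at this
      simp [e.2] at this
      exact hunit (by exact_mod_cast this)

theorem diagCoeff_pushTail_two_zero : diagCoeff p (pushTail p 2).1 0 0 0 = 0 := by
  classical
  have := diagCoeff_pushTail (p := p) 2 (vec_le (Nat.zero_le 2) (Nat.zero_le 2) (Nat.zero_le 2))
    (monotone_vec_nat (le_refl 0) (le_refl 0))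
  rw [Nat.cast_zero] at this
  rw [this, Finset.filter_eq_empty_iff.2, Finset.card_empty, Nat.cast_zero]
  intro s _ hs
  have hs : DvdMinors p 3 (fiberIntMatrix p 2 ![0, 0, 0] s) := fiberMatrix_mem_minorSet.1 hs
  have := hs Sum.inr Sum.inr
  have e : (fiberIntMatrix p 2 ![0, 0, 0] s).submatrix Sum.inr Sum.inr = 1 := by
    ext i j
    fin_cases i <;> fin_cases j <;> simp [fiberIntMatrix]
  rw [e, det_one] at this
  exact (Nat.prime_iff_prime_int.1 hp.out).not_dvd_one this

/-- Two entries of `D` equal to `1` give rank two already, so the only free entry of `B` must vanish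
modulo `p`. This value and the previous one are all that is needed of `pushTail p 2`. -/
theorem diagCoeff_pushTail_two_one : diagCoeff p (pushTail p 2).1 0 0 1 = 1 := by
  classical
  have := diagCoeff_pushTail (p := p) 2 (vec_le (Nat.zero_le 2) (Nat.zero_le 2) one_le_two)
    (monotone_vec_nat (le_refl 0) zero_le_one)
  rw [Nat.cast_zero, Nat.cast_one] at this
  rw [this]
  norm_cast
  rw [Finset.card_eq_one]
  refine ⟨0, ?_⟩
  ext s
  rw [Finset.mem_filter, fiberMatrix_mem_minorSet, Finset.mem_singleton]
  constructor
  · rintro ⟨hs, H⟩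
    have hlt := lt_of_mem_box hs
    have b0 : s 0 < 1 := by simpa [boxExponent] using hlt 0
    have b1 : s 1 < 1 := by simpa [boxExponent] using hlt 1
    have b2 : s 2 < 1 := by simpa [boxExponent] using hlt 2
    have b3 : s 3 < 1 := by simpa [boxExponent] using hlt 3
    have b4 : s 4 < 1 := by simpa [boxExponent] using hlt 4
    have b5 : s 5 < p := by simpa [boxExponent] using hlt 5
    have H := (show DvdMinors p 3 _ from H) ![Sum.inl 2, Sum.inr 0, Sum.inr 1]
      ![Sum.inr 2, Sum.inr 0, Sum.inr 1]
    rw [det_fin_three] at H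
    simp [fiberIntMatrix, boxMatrix] at H
    have c5 := eq_zero_of_natCast_dvd b5 (by exact_mod_cast H)
    ext k
    fin_cases k <;> simp <;> omega
  · rintro rfl
    refine ⟨?_, ?_⟩
    · rw [box, Fintype.mem_piFinset]
      exact fun k => Finset.mem_range.2 (pow_pos hp.out.pos _)
    · have e : fiberIntMatrix p 2 ![0, 0, 1] 0 = diagonal (Sum.elim
          ![(p : ℤ) ^ 2, (p : ℤ) ^ 2, p] ![1, 1, (p : ℤ)]) := by
        ext i j
        rcases i with i | i <;> rcases j with j | j <;> fin_cases i <;> fin_cases j <;>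
          simp [fiberIntMatrix, boxMatrix]
      rw [e]
      refine dvd_minor_diagonal fun f hf => ?_
      by_contra hnd
      have hf' (j : Fin 3) : f j = Sum.inr 0 ∨ f j = Sum.inr 1 := by
        by_contra hj
        refine hnd (dvd_trans ?_ (Finset.dvd_prod_of_mem _ (Finset.mem_univ j)))
        rcases hfj : f j with i | i <;> fin_cases i <;> simp [hfj] at hj ⊢
      have h01 : f 0 ≠ f 1 := fun e => absurd (hf e) (by decide)
      have h02 : f 0 ≠ f 2 := fun e => absurd (hf e) (by decide)
      have h12 : f 1 ≠ f 2 := fun e => absurd (hf e) (by decide)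
      rcases hf' 0 with a | a <;> rcases hf' 1 with b | b <;> rcases hf' 2 with c | c <;>
        simp_all

end PushTail

end

noncomputable section

variable {p : ℕ} [hp : Fact p.Prime]

/-! ### `T(p)` and the rank operators in terms of the elementary symmetric elements. -/

section SmallOperators

theorem pushT_one : pushT p 1 = 1 + elemGL p 1 + elemGL p 2 + elemGL p 3 := by
  refine eq_of_normCoeff (δ := 1) fun x y z h1 h2 => ?_
  simp only [normCoeff_add, normCoeff_pushT 1 h1 h2, normCoeff_one, normCoeff_elemGL_one 1 h1 h2,
    normCoeff_elemGL_two 1 h1 h2, normCoeff_elemGL_three 1 h1 h2]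
  by_cases c0 : x = 0 ∧ y = 0 ∧ z = 0
  · simp (disch := omega) only [if_pos, if_neg]; simp [c0]
  by_cases c1 : x = 0 ∧ y = 0 ∧ z = 1
  · simp (disch := omega) only [if_pos, if_neg]; simp [c1]
  by_cases c2 : x = 0 ∧ y = 1 ∧ z = 1
  · simp (disch := omega) only [if_pos, if_neg]; simp [c2]
  by_cases c3 : x = 1 ∧ y = 1 ∧ z = 1
  · simp (disch := omega) only [if_pos, if_neg]; simp [c3]
  simp (disch := omega) only [if_neg]
  ring

theorem pushTail_zero : ((p ^ 6 : ℕ) : glRing p) * pushTail p 0 = elemGL p 3 := by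
  have hp0 := ratCast_prime_ne_zero (p := p)
  refine eq_of_normCoeff (δ := 6) fun x y z h1 h2 => ?_
  rw [normCoeff_natCast_mul, normCoeff_elemGL_three 6 h1 h2]
  by_cases hx : x < 0
  · rw [normCoeff_of_neg _ _ (Or.inl hx), if_neg (by omega), mul_zero]
  lift x to ℕ using by omega
  lift y to ℕ using by omega
  lift z to ℕ using by omega
  rw [normCoeff, diagCoeff_pushTail_zero (by omega) (by omega)]
  by_cases c : x = 1 ∧ y = 1 ∧ z = 1
  · rw [if_pos c, if_pos (by omega)]
    obtain ⟨rfl, rfl, rfl⟩ := c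
    norm_num
    norm_cast
    ring
  · rw [if_neg c, if_neg (by omega)]
    simp

theorem pushTail_one : ((p ^ 3 : ℕ) : glRing p) * pushTail p 1 =
    elemGL p 2 + elemGL p 3 + elemGL p 3 * elemGL p 1 := by
  have hp0 := ratCast_prime_ne_zero (p := p)
  -- The normalizing exponent is arbitrary; `8` is twice the largest degree `x + y + z` that occurs,
  -- so no negative power of `p` appears.
  refine eq_of_normCoeff (δ := 8) fun x y z h1 h2 => ?_
  have h1' : x - 1 ≤ y - 1 := by omega
  have h2' : y - 1 ≤ z - 1 := by omega
  simp only [normCoeff_natCast_mul, normCoeff_add, normCoeff_elemGL_three_mul _ _ h1 h2,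
    normCoeff_elemGL_two _ h1 h2, normCoeff_elemGL_three _ h1 h2, normCoeff_elemGL_one _ h1' h2']
  by_cases hx : x < 0
  · rw [normCoeff_of_neg _ _ (Or.inl hx)]
    simp (disch := omega) only [if_neg]
    ring
  lift x to ℕ using by omega
  lift y to ℕ using by omega
  lift z to ℕ using by omega
  rw [normCoeff, diagCoeff_pushTail_one (by omega) (by omega)]
  by_cases c1 : x = 0 ∧ y = 1 ∧ z = 1
  · simp (disch := omega) only [if_pos, if_neg]
    obtain ⟨rfl, rfl, rfl⟩ := c1
    norm_num; norm_cast; ring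
  by_cases c2 : x = 1 ∧ y = 1 ∧ z = 1
  · simp (disch := omega) only [if_pos, if_neg]
    obtain ⟨rfl, rfl, rfl⟩ := c2
    norm_num; norm_cast; ring
  by_cases c3 : x = 1 ∧ y = 1 ∧ z = 2
  · simp (disch := omega) only [if_pos, if_neg]
    obtain ⟨rfl, rfl, rfl⟩ := c3
    norm_num; norm_cast; ring
  simp (disch := omega) only [if_neg]
  simp

theorem glWeight_eq_monomial {g : GL (Fin 3) ℚ} {d : Fin 3 → ℕ} (h : IsTri p g d) :
    glWeight p (coset (GLZ 3) g) =
      MvPolynomial.monomial (Finsupp.equivFunOnFinite.symm (Fin.cons 0 d))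
        (∏ i : Fin 3, (((p : ℚ) ^ ((i : ℕ) + 1))⁻¹) ^ d i) := by
  rw [glWeight_coset h, MvPolynomial.monomial_eq, Finsupp.prod_fintype _ _ (by simp)]
  simp only [mul_pow, Finset.prod_mul_distrib, ← map_pow, ← map_prod,
    Finsupp.equivFunOnFinite_symm_apply_apply]
  rw [Fin.prod_univ_succ (n := 3)]
  simp only [Fin.cons_zero, Fin.cons_succ]
  ring

/-- Only one coset contributes to the power `x₁ ^ k` in the spherical image. -/
theorem coeff_glOmega (s : glRing p) (k : ℕ) :
    MvPolynomial.coeff (Finsupp.equivFunOnFinite.symm (Fin.cons 0 ![k, 0, 0])) (glOmega p s) =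
      ((p : ℚ) ^ k)⁻¹ * diagCoeff p s.1 0 0 k := by
  classical
  have hperm : diagCoeff p s.1 0 0 k = coeffHom (herm p ![k, 0, 0] 0 0 0) s.1 := by
    rw [diagCoeff_swap', diagCoeff_swap, diagCoeff]
    congr 2
    apply Units.ext
    rw [glDiag_val, herm_val]
    ext i j
    fin_cases i <;> fin_cases j <;> simp [hermMatrix]
  rw [hperm, glOmega_apply, weightSum, Finsupp.linearCombination_apply, Finsupp.sum,
    MvPolynomial.coeff_sum, Finset.sum_eq_single (coset (GLZ 3) (herm p ![k, 0, 0] 0 0 0))]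
  · rw [MvPolynomial.coeff_smul, glWeight_eq_monomial (isTri_herm _ _ _ _),
      MvPolynomial.coeff_monomial, if_pos rfl, coeffHom_apply]
    simp [Fin.prod_univ_three, mul_comm]
  · intro c hc hne
    obtain ⟨g, hg, rfl⟩ := s.2 c (Finsupp.mem_support_iff.1 hc)
    obtain ⟨d, x, y, z, hx, hy, hz, e⟩ := exists_herm hg
    rw [e, MvPolynomial.coeff_smul, glWeight_eq_monomial (isTri_herm _ _ _ _),
      MvPolynomial.coeff_monomial, if_neg, smul_zero]
    intro h
    have hd : d = ![k, 0, 0] := by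
      have := Finsupp.equivFunOnFinite.symm.injective h
      exact (Fin.cons_inj.1 this).2
    subst hd
    -- For the diagonal `(p ^ k, 1, 1)` the entries above the diagonal are reduced modulo `1`, so
    -- there is a single Hermite form.
    have ex : x = 0 := by simpa using hx
    have ey : y = 0 := by simpa using hy
    have ez : z = 0 := by simpa using hz
    subst ex ey ez
    exact hne e
  · intro hc
    rw [Finsupp.notMem_support_iff.1 hc, zero_smul, MvPolynomial.coeff_zero]

/-- This replaces injectivity on the `GL₃` side: relations between spherical images may be tested at
the matrices `diag(1, 1, p ^ k)`. -/
theorem normCoeff_eq_zero_of_glOmega (δ : ℤ) {s : glRing p} (hs : glOmega p s = 0) (k : ℕ) :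
    normCoeff p δ s 0 0 k = 0 := by
  have h := coeff_glOmega s k
  rw [hs, MvPolynomial.coeff_zero] at h
  have h' := (mul_eq_zero.1 h.symm).resolve_left
    (inv_ne_zero (pow_ne_zero k ratCast_prime_ne_zero))
  rw [normCoeff, h', mul_zero]

theorem normCoeff_intCast_mul (δ : ℤ) (m : ℤ) (s : glRing p) (x y z : ℤ) :
    normCoeff p δ ((m : glRing p) * s) x y z = m * normCoeff p δ s x y z := by
  rw [← zsmul_eq_mul]
  simp only [normCoeff, diagCoeff, AddSubgroupClass.coe_zsmul, map_zsmul]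
  rw [zsmul_eq_mul]
  push_cast
  ring

theorem normCoeff_pushT_one_sq :
    normCoeff p 2 (pushT p 1 * pushT p 1) 0 0 0 = p ^ 2 ∧
      normCoeff p 2 (pushT p 1 * pushT p 1) 0 0 1 = 2 * p := by
  nth_rw 1 [pushT_one]
  nth_rw 2 [pushT_one]
  simp only [add_mul, one_mul, normCoeff_add, normCoeff_elemGL_one_mul 2 _ (le_refl (0 : ℤ)) le_rfl,
    normCoeff_elemGL_two_mul 2 _ (le_refl (0 : ℤ)) le_rfl,
    normCoeff_elemGL_three_mul 2 _ (le_refl (0 : ℤ)) le_rfl,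
    normCoeff_elemGL_one_mul 2 _ (le_refl (0 : ℤ)) zero_le_one,
    normCoeff_elemGL_two_mul 2 _ (le_refl (0 : ℤ)) zero_le_one,
    normCoeff_elemGL_three_mul 2 _ (le_refl (0 : ℤ)) zero_le_one]
  have hneg (a b c : ℤ) (h : a < 0 ∨ b < 0 ∨ c < 0) : normCoeff p 1 (pushT p 1) a b c = 0 :=
    normCoeff_of_neg 1 _ h
  have v0 : normCoeff p 1 (pushT p 1) 0 0 0 = p := by
    rw [normCoeff_pushT 1 le_rfl le_rfl]; simp
  have v1 : normCoeff p 1 (pushT p 1) 0 0 1 = 1 := by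
    rw [normCoeff_pushT 1 le_rfl zero_le_one]; simp
  rw [normCoeff_shift 2 (pushT p 1) (z := 0), normCoeff_shift 2 (pushT p 1) (z := 1)]
  norm_num [hneg, v0, v1]
  constructor <;> ring

end SmallOperators

/-! ### The decomposition of `T(p)²`. -/

section Square

/-- An element supported on the integral matrices with multiplier `p²` is a combination of
`T(p²)`, `T₁(p²)`, `T₂(p²)`, `T₃(p²)`. -/
theorem exists_eq_of_supportedOn_two {t : spRing p}
    (ht : SupportedOn (integralSet 3 p 2) t.1.toCosets) :
    ∃ a b c d : ℤ, t = (a : spRing p) * heckeTInt p 2 + (b : spRing p) * tailInt p 2 +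
      (c : spRing p) * tailInt p 1 + (d : spRing p) * tailInt p 0 := by
  classical
  let v (b : Fin 3 → ℕ) (h : ∀ i, b i ≤ 2) : ℤ := coeffHom (powDiag p 2 b h) t.1
  let z0 := v ![0, 0, 0] (by decide)
  let z1 := v ![0, 0, 1] (by decide)
  let z2 := v ![0, 1, 1] (by decide)
  let z3 := v ![1, 1, 1] (by decide)
  -- `tailSum p i` is the indicator of `aᵢ = 1` on the four diagonal representatives, so the
  -- multiplicities are successive differences of the values of `t`.
  refine ⟨z0, z1 - z0, z2 - z1, z3 - z2, ?_⟩
  rw [← sub_eq_zero]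
  simp only [← zsmul_eq_mul]
  refine Subtype.ext (eq_zero_of_coeffHom_powDiag (p := p)
    (SetLike.coe_mem (p := spRing p) _) fun δ a ha ma a2 => ?_)
  simp only [AddSubgroupClass.coe_sub, Subring.coe_add, AddSubgroupClass.coe_zsmul, map_sub,
    map_add, map_zsmul]
  change coeffHom _ t.1 - (z0 • coeffHom _ (heckeT 3 (p ^ 2) _) +
    (z1 - z0) • coeffHom _ (tailSum p 2) + (z2 - z1) • coeffHom _ (tailSum p 1) +
    (z3 - z2) • coeffHom _ (tailSum p 0)) = 0
  by_cases hδ : δ = 2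
  · subst hδ
    rw [coeffHom_heckeT, if_pos (powDiag_mem _ _ _), coeffHom_tailSum_powDiag ma a2,
      coeffHom_tailSum_powDiag ma a2, coeffHom_tailSum_powDiag ma a2]
    have a0 := a2 0
    have a1 := a2 1
    have a2 := a2 2
    have h01 := ma (show (0 : Fin 3) ≤ 1 by decide)
    have h12 := ma (show (1 : Fin 3) ≤ 2 by decide)
    have ea : a = ![a 0, a 1, a 2] := by ext i; fin_cases i <;> rfl
    have hv : coeffHom (powDiag p 2 a ha) t.1 = v ![a 0, a 1, a 2] (ea ▸ ha) := by
      congr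
    rw [hv]
    rcases (by omega : (a 0 = 0 ∧ a 1 = 0 ∧ a 2 = 0) ∨ (a 0 = 0 ∧ a 1 = 0 ∧ a 2 = 1) ∨
      (a 0 = 0 ∧ a 1 = 1 ∧ a 2 = 1) ∨ (a 0 = 1 ∧ a 1 = 1 ∧ a 2 = 1)) with h | h | h | h <;>
    · simp only [h, smul_eq_mul]
      simp [z0, z1, z2, z3]
  · have key {u : HeckeRing (Sp 3)} (hu : SupportedOn (integralSet 3 p 2) u.toCosets) :
        coeffHom (powDiag p δ a ha) u = 0 := by
      by_contra hne
      obtain ⟨M, hM, e⟩ := hu _ hne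
      obtain ⟨γ, hγ, e⟩ := coset_eq_coset_iff_exists.1 e
      refine hδ (integralSet_unique (powDiag_mem (p := p) δ a ha) (e ▸ mul_mem_integralSet hγ hM))
    rw [key ht, key (supportedOn_heckeT 2 _), key (supportedOn_tailSum 2),
      key (supportedOn_tailSum 1), key (supportedOn_tailSum 0)]
    simp

/-- `T(p)²` is an integral combination of `T(p²)` and the rank operators. At `diag(1, 1, 1)` and
`diag(1, 1, p)` the operators of rank at most one do not occur, and comparison there gives the
multiplicities `1` and `p`. That of `T(p²)` being `1` is the point; `c` and `d` are not needed. -/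
theorem exists_heckeTInt_two : ∃ c d : ℤ, heckeTInt p 2 = heckeTInt p 1 * heckeTInt p 1 -
    (p : spRing p) * tailInt p 2 - (c : spRing p) * tailInt p 1 - (d : spRing p) * tailInt p 0 := by
  have hsupp : SupportedOn (integralSet 3 p 2) (heckeTInt p 1 * heckeTInt p 1).1.toCosets :=
    (supportedOn_heckeT 1 _).mul (fun g hg h hh => integralSet_mul hg hh) (supportedOn_heckeT 1 _)
  obtain ⟨a, b, c, d, e⟩ := exists_eq_of_supportedOn_two hsupp
  have hΩ := congrArg (spOmega p) e
  have hX : (MvPolynomial.X 0 ^ 2 : MvPolynomial (Fin 4) ℚ) ≠ 0 :=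
    pow_ne_zero 2 (MvPolynomial.X_ne_zero 0)
  have hG : glOmega p (pushT p 1 * pushT p 1 - ((a : glRing p) * pushT p 2 +
      (b : glRing p) * pushTail p 2 + (c : glRing p) * pushTail p 1 +
      (d : glRing p) * pushTail p 0)) = 0 := by
    refine mul_left_cancel₀ hX ?_
    simp only [map_mul, map_add, map_intCast, spOmega_heckeTInt, spOmega_tailInt,
      Nat.cast_one, Nat.cast_ofNat] at hΩ
    simp only [map_sub, map_mul, map_add, map_intCast]
    linear_combination hΩ
  have h0 := normCoeff_eq_zero_of_glOmega 2 hG 0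
  have h1 := normCoeff_eq_zero_of_glOmega 2 hG 1
  rw [Nat.cast_zero] at h0
  rw [Nat.cast_one] at h1
  simp only [normCoeff_sub, normCoeff_add, normCoeff_intCast_mul,
    normCoeff_pushT_one_sq.1, normCoeff_pushT_one_sq.2] at h0 h1
  have t1 (z : ℕ) : normCoeff p 2 (pushTail p 1) 0 0 z = 0 := by
    have := diagCoeff_pushTail_one (p := p) (le_refl 0) (Nat.zero_le z)
    rw [Nat.cast_zero] at this
    rw [normCoeff, this]
    simp
  have t0 (z : ℕ) : normCoeff p 2 (pushTail p 0) 0 0 z = 0 := by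
    have := diagCoeff_pushTail_zero (p := p) (le_refl 0) (Nat.zero_le z)
    rw [Nat.cast_zero] at this
    rw [normCoeff, this]
    simp
  have t10 := t1 0
  have t11 := t1 1
  have t00 := t0 0
  have t01 := t0 1
  rw [Nat.cast_zero] at t10 t00
  rw [Nat.cast_one] at t11 t01
  have t20 : normCoeff p 2 (pushTail p 2) 0 0 0 = 0 := by
    rw [normCoeff, diagCoeff_pushTail_two_zero, Int.cast_zero, mul_zero]
  have t21 : normCoeff p 2 (pushTail p 2) 0 0 1 = 1 := by
    rw [normCoeff, diagCoeff_pushTail_two_one]; simp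
  have s0 : normCoeff p 2 (pushT p 2) 0 0 0 = p ^ 2 := by
    rw [normCoeff_pushT 2 le_rfl le_rfl]; norm_num
  have s1 : normCoeff p 2 (pushT p 2) 0 0 1 = p := by
    rw [normCoeff_pushT 2 le_rfl zero_le_one]; norm_num
  rw [t10, t00, t20, s0] at h0
  rw [t11, t01, t21, s1] at h1
  have hp0 := ratCast_prime_ne_zero (p := p)
  have ha : (a : ℚ) = 1 := mul_right_cancel₀ (pow_ne_zero 2 hp0) (by linear_combination -h0)
  have hb : (b : ℚ) = p := by rw [ha] at h1; linear_combination -h1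
  have ha' : a = 1 := by exact_mod_cast ha
  have hb' : b = p := by exact_mod_cast hb
  refine ⟨c, d, ?_⟩
  rw [e, ha', hb', Int.cast_one, Int.cast_natCast, one_mul]
  abel

end Square

end

noncomputable section

variable {p : ℕ} [hp : Fact p.Prime]

/-! ### The spherical map on `L_ℤ` and the image of the numerator. -/

section SphericalMap

theorem LZ_le_spRing : LZ 3 p ≤ spRing p := by
  rw [LZ, Subring.closure_le]
  rintro t (rfl | ⟨i, -, -, rfl⟩)
  · have h := (heckeTInt p 1).2
    simp only [heckeTInt, pow_one] at h
    exact h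
  · exact (supportedOn_heckeTi i).mono (integralSet_subset 2)

variable (p) in
/-- The inclusion of `L_ℤ` in the integral part of the Hecke ring. -/
def lzInclusion : LZ 3 p →+* spRing p := Subring.inclusion LZ_le_spRing

variable (p) in
/-- The spherical map as a ring homomorphism. -/
def lzOmega : LZ 3 p →+* MvPolynomial (Fin 4) ℚ := (spOmega p).comp (lzInclusion p)

theorem lzOmega_injective : Function.Injective (lzOmega p) :=
  spOmega_injective.comp (Subring.inclusion_injective LZ_le_spRing)

theorem OmegaPoly_eq_map (F : (LZ 3 p)[X]) : OmegaPoly F = F.map (lzOmega p) := by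
  rw [OmegaPoly, Polynomial.map, Polynomial.eval₂_eq_sum]
  refine Finset.sum_congr rfl fun j _ => ?_
  beta_reduce
  rw [Omega_eq, ← Polynomial.C_mul_X_pow_eq_monomial]
  rfl

theorem OmegaPoly_injective : Function.Injective (OmegaPoly (n := 3) (p := p)) := by
  intro F G h
  rw [OmegaPoly_eq_map, OmegaPoly_eq_map] at h
  exact Polynomial.map_injective _ lzOmega_injective h

theorem lzInclusion_T₀ : lzInclusion p (T₀ p) = heckeTInt p 1 := by
  apply Subtype.ext
  change heckeT 3 p _ = heckeT 3 (p ^ 1) _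
  simp only [pow_one]

theorem lzInclusion_scalar₃ : lzInclusion p (scalar₃ p) = tailInt p 0 :=
  Subtype.ext (heckeTi_self 3 p).symm

theorem lzInclusion_T₂_add_scalar₃ : lzInclusion p (T₂ p + scalar₃ p) = tailInt p 1 := by
  apply Subtype.ext
  change heckeTi 3 p 2 + heckeScalar 3 p = heckeTi 3 p 2 + heckeTi 3 p 3
  rw [heckeTi_self]

theorem lzOmega_T₀ : lzOmega p (T₀ p) =
    MvPolynomial.X 0 * (1 + elemSym 1 + elemSym 2 + elemSym 3) := by
  rw [lzOmega, RingHom.comp_apply, lzInclusion_T₀, spOmega_heckeTInt, Nat.cast_one, pushT_one,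
    map_add, map_add, map_add, map_one, glOmega_elemGL_one, glOmega_elemGL_two,
    glOmega_elemGL_three, pow_one]
  rfl

theorem pow_six_mul_lzOmega_scalar₃ :
    (p : MvPolynomial (Fin 4) ℚ) ^ 6 * lzOmega p (scalar₃ p) =
      MvPolynomial.X 0 ^ 2 * elemSym 3 := by
  have h := congrArg (glOmega p) (pushTail_zero (p := p))
  rw [map_mul, map_natCast, glOmega_elemGL_three] at h
  rw [lzOmega, RingHom.comp_apply, lzInclusion_scalar₃, spOmega_tailInt]
  push_cast at h
  rw [elemSym]
  · linear_combination MvPolynomial.X 0 ^ 2 * h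
  all_goals simp

theorem pow_three_mul_lzOmega :
    (p : MvPolynomial (Fin 4) ℚ) ^ 3 * (lzOmega p (T₂ p) + lzOmega p (scalar₃ p)) =
      MvPolynomial.X 0 ^ 2 * (elemSym 2 + elemSym 3 + elemSym 3 * elemSym 1) := by
  have h := congrArg (glOmega p) (pushTail_one (p := p))
  have e1 : glOmega p (elemGL p 1) = elemSym 1 := glOmega_elemGL_one
  have e2 : glOmega p (elemGL p 2) = elemSym 2 := glOmega_elemGL_two
  have e3 : glOmega p (elemGL p 3) = elemSym 3 := glOmega_elemGL_three
  simp only [map_mul, map_add, map_natCast, e1, e2, e3] at h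
  rw [← map_add, lzOmega, RingHom.comp_apply, lzInclusion_T₂_add_scalar₃, spOmega_tailInt]
  push_cast at h
  linear_combination MvPolynomial.X 0 ^ 2 * h

theorem lzOmega_scalar₃ : lzOmega p (scalar₃ p) =
    MvPolynomial.C ((p : ℚ)⁻¹) ^ 6 * (MvPolynomial.X 0 ^ 2 * elemSym 3) := by
  rw [← C_inv_pow]
  exact_mod_cast C_inv_mul (pow_ne_zero 6 hp.out.ne_zero)
    (by exact_mod_cast pow_six_mul_lzOmega_scalar₃)

theorem lzOmega_T₂ : lzOmega p (T₂ p) = MvPolynomial.C ((p : ℚ)⁻¹) ^ 3 *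
    (MvPolynomial.X 0 ^ 2 * (elemSym 2 + elemSym 3 + elemSym 3 * elemSym 1)) -
    MvPolynomial.C ((p : ℚ)⁻¹) ^ 6 * (MvPolynomial.X 0 ^ 2 * elemSym 3) := by
  rw [← lzOmega_scalar₃, eq_sub_iff_add_eq, ← C_inv_pow]
  exact_mod_cast C_inv_mul (pow_ne_zero 3 hp.out.ne_zero)
    (by exact_mod_cast pow_three_mul_lzOmega)

theorem natCast_pow_mul_C_inv_pow (a b : ℕ) :
    (p : MvPolynomial (Fin 4) ℚ) ^ a * MvPolynomial.C ((p : ℚ)⁻¹) ^ (a + b) =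
      MvPolynomial.C ((p : ℚ)⁻¹) ^ b := by
  rw [pow_add, ← mul_assoc, ← mul_pow, natCast_mul_C_inv, one_pow, one_mul]

/-- Since `(p² - p + 1)(p² + p + 1) = p⁴ + p² + 1`, the bracket is `(T₂ + [p]) + (p⁴ + p²)[p]`. The
three parts contribute `p⁻¹`, `1` and `p⁻²` to the coefficient of `e₃`, whose sum is `(p² + p + 1) /
p²`. -/
theorem lzOmega_coeff_two : lzOmega p ((p : LZ 3 p) ^ 2 *
      (T₂ p + ((p : LZ 3 p) ^ 2 - p + 1) * ((p : LZ 3 p) ^ 2 + p + 1) * scalar₃ p)) =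
    (MvPolynomial.C ((p : ℚ)⁻¹) * (elemSym 3 * elemSym 1) + ((p : MvPolynomial (Fin 4) ℚ) ^ 2 +
      (p : MvPolynomial (Fin 4) ℚ) + 1) * MvPolynomial.C ((p : ℚ)⁻¹) ^ 2 * elemSym 3 +
      MvPolynomial.C ((p : ℚ)⁻¹) * elemSym 2) * MvPolynomial.X 0 ^ 2 := by
  have k21 := natCast_pow_mul_C_inv_pow (p := p) 2 1
  have k60 := natCast_pow_mul_C_inv_pow (p := p) 6 0
  have k42 := natCast_pow_mul_C_inv_pow (p := p) 4 2
  have k20 := natCast_pow_mul_C_inv_pow (p := p) 2 0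
  have k11 := natCast_pow_mul_C_inv_pow (p := p) 1 1
  simp only [map_add, map_sub, map_mul, map_pow, map_one, map_natCast, lzOmega_scalar₃,
    lzOmega_T₂]
  generalize (MvPolynomial.X 0 : MvPolynomial (Fin 4) ℚ) = w at *
  generalize (MvPolynomial.C ((p : ℚ)⁻¹) : MvPolynomial (Fin 4) ℚ) = u at *
  generalize elemSym 1 = e1, elemSym 2 = e2, elemSym 3 = e3
  linear_combination w ^ 2 * (e2 + e3 + e3 * e1) * k21 + w ^ 2 * e3 * (k60 + k42 - k20 - k11)

theorem lzOmega_coeff_three :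
    lzOmega p (((p : LZ 3 p) + 1) * (p : LZ 3 p) ^ 4 * T₀ p * scalar₃ p) =
    ((p : MvPolynomial (Fin 4) ℚ) + 1) * MvPolynomial.C ((p : ℚ)⁻¹) ^ 2 *
      (elemSym 3 ^ 2 + elemSym 3 * elemSym 2 + elemSym 3 * elemSym 1 + elemSym 3) *
      MvPolynomial.X 0 ^ 3 := by
  have k42 := natCast_pow_mul_C_inv_pow (p := p) 4 2
  simp only [map_add, map_mul, map_pow, map_one, map_natCast, lzOmega_scalar₃, lzOmega_T₀]
  generalize (MvPolynomial.X 0 : MvPolynomial (Fin 4) ℚ) = w at *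
  generalize (MvPolynomial.C ((p : ℚ)⁻¹) : MvPolynomial (Fin 4) ℚ) = u at *
  generalize elemSym 1 = e1, elemSym 2 = e2, elemSym 3 = e3
  linear_combination (p + 1) * w ^ 3 * e3 * (1 + e1 + e2 + e3) * k42

theorem lzOmega_coeff_four : lzOmega p ((p : LZ 3 p) ^ 7 * scalar₃ p *
      (T₂ p + ((p : LZ 3 p) ^ 2 - p + 1) * ((p : LZ 3 p) ^ 2 + p + 1) * scalar₃ p)) =
    (MvPolynomial.C ((p : ℚ)⁻¹) ^ 2 * (elemSym 3 ^ 2 * elemSym 1) +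
      ((p : MvPolynomial (Fin 4) ℚ) ^ 2 + (p : MvPolynomial (Fin 4) ℚ) + 1) *
        MvPolynomial.C ((p : ℚ)⁻¹) ^ 3 * elemSym 3 ^ 2 +
      MvPolynomial.C ((p : ℚ)⁻¹) ^ 2 * (elemSym 3 * elemSym 2)) * MvPolynomial.X 0 ^ 4 := by
  -- This coefficient is `p ^ 5 [p]` times that of `v²`, so the previous computation is reused.
  have h : (p : LZ 3 p) ^ 7 * scalar₃ p = (p : LZ 3 p) ^ 5 * (scalar₃ p * (p : LZ 3 p) ^ 2) := by
    rw [← Nat.cast_pow, ← Nat.cast_pow, ← Nat.cast_pow, (Nat.cast_commute (p ^ 2) (scalar₃ p)).symm,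
      ← mul_assoc, ← Nat.cast_mul, ← pow_add]
  rw [h, mul_assoc, mul_assoc, map_mul, map_mul, lzOmega_coeff_two, map_pow, map_natCast,
    lzOmega_scalar₃]
  have k51 := natCast_pow_mul_C_inv_pow (p := p) 5 1
  generalize (MvPolynomial.X 0 : MvPolynomial (Fin 4) ℚ) = w at *
  generalize (MvPolynomial.C ((p : ℚ)⁻¹) : MvPolynomial (Fin 4) ℚ) = u at *
  generalize elemSym 1 = e1, elemSym 2 = e2, elemSym 3 = e3
  linear_combination w ^ 4 * e3 * (u * (e3 * e1) + ((p : MvPolynomial (Fin 4) ℚ) ^ 2 +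
    (p : MvPolynomial (Fin 4) ℚ) + 1) * u ^ 2 * e3 + u * e2) * k51

theorem lzOmega_coeff_six : lzOmega p ((p : LZ 3 p) ^ 15 * scalar₃ p ^ 3) =
    MvPolynomial.C ((p : ℚ)⁻¹) ^ 3 * elemSym 3 ^ 3 * MvPolynomial.X 0 ^ 6 := by
  simp only [map_mul, map_pow, map_natCast, lzOmega_scalar₃]
  linear_combination MvPolynomial.X 0 ^ 6 * elemSym 3 ^ 3 *
    natCast_pow_mul_C_inv_pow (p := p) 15 3

/-- The spherical image of the numerator. -/
theorem OmegaPoly_P₃ : OmegaPoly (P₃ p) = sphericalP₃ p := by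
  have d (a : ℚ) (k : ℕ) : (MvPolynomial.C (a / (p : ℚ) ^ k) : MvPolynomial (Fin 4) ℚ) =
      MvPolynomial.C a * MvPolynomial.C ((p : ℚ)⁻¹) ^ k := by
    rw [div_eq_mul_inv, map_mul, C_inv_pow]
  have d1 : (MvPolynomial.C (1 / (p : ℚ)) : MvPolynomial (Fin 4) ℚ) =
      MvPolynomial.C ((p : ℚ)⁻¹) := by rw [one_div]
  rw [OmegaPoly_eq_map, P₃, sphericalP₃]
  simp only [sym_one_one_zero, sym_two_one_one, sym_two_two_one, sym_three_two_two, sym_self,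
    MvPolynomial.smul_eq_C_mul, d, d1, map_add (MvPolynomial.C (σ := Fin 4) (R := ℚ)), map_one,
    map_pow (MvPolynomial.C (σ := Fin 4) (R := ℚ)),
    map_natCast (MvPolynomial.C (σ := Fin 4) (R := ℚ)), pow_one, one_mul]
  simp only [Polynomial.map_add, Polynomial.map_sub, Polynomial.map_one, Polynomial.map_mul,
    Polynomial.map_pow, Polynomial.map_X, Polynomial.map_C]
  rw [lzOmega_coeff_two, lzOmega_coeff_three, lzOmega_coeff_four, lzOmega_coeff_six]

theorem natDegree_P₃ : (P₃ p).natDegree = 6 := by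
  -- The leading coefficient is nonzero because its image is a nonzero monomial.
  have h0 : ((p ^ 15 : ℕ) : LZ 3 p) * scalar₃ p ^ 3 ≠ 0 := by
    intro h
    have h' := congrArg (lzOmega p) h
    rw [map_zero, map_mul, map_natCast, map_pow, lzOmega_scalar₃] at h'
    have hX (i : Fin 4) : (MvPolynomial.X i : MvPolynomial (Fin 4) ℚ) ≠ 0 :=
      MvPolynomial.X_ne_zero i
    have hC : (MvPolynomial.C ((p : ℚ)⁻¹) : MvPolynomial (Fin 4) ℚ) ≠ 0 := by
      rw [Ne, MvPolynomial.C_eq_zero]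
      exact inv_ne_zero ratCast_prime_ne_zero
    have he : elemSym 3 ≠ 0 := mul_ne_zero (mul_ne_zero (hX 1) (hX 2)) (hX 3)
    refine mul_ne_zero ?_ (pow_ne_zero 3 (mul_ne_zero (pow_ne_zero 6 hC)
      (mul_ne_zero (pow_ne_zero 2 (hX 0)) he))) h'
    exact Nat.cast_ne_zero.2 (pow_ne_zero 15 hp.out.ne_zero)
  rw [P₃]
  compute_degree!

end SphericalMap

/-! ### The lift of the spinor polynomial and the rationality of the Hecke series. -/

section Denominator

theorem exists_T_sq : ∃ t : LZ 3 p, lzInclusion p t = heckeTInt p 2 := by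
  obtain ⟨c, d, e⟩ := exists_heckeTInt_two (p := p)
  let T₁ : LZ 3 p :=
    ⟨heckeTi 3 p 1, Subring.subset_closure (Or.inr ⟨1, by norm_num, by norm_num, rfl⟩)⟩
  have h2 : lzInclusion p (T₁ + (T₂ p + scalar₃ p)) = tailInt p 2 := by
    apply Subtype.ext
    change heckeTi 3 p 1 + (heckeTi 3 p 2 + heckeScalar 3 p) =
      heckeTi 3 p 1 + (heckeTi 3 p 2 + heckeTi 3 p 3)
    rw [heckeTi_self]
  refine ⟨T₀ p * T₀ p - p * (T₁ + (T₂ p + scalar₃ p)) - c * (T₂ p + scalar₃ p) - d * scalar₃ p, ?_⟩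
  simp only [map_sub, map_mul, map_natCast, map_intCast, h2, lzInclusion_T₀,
    lzInclusion_T₂_add_scalar₃, lzInclusion_scalar₃]
  rw [e]

theorem homogSeries_mul_spinor_eq : homogSeries (fun n => glOmega p (pushT p n)) *
    (spinor 3 : (MvPolynomial (Fin 4) ℚ)[X]).toPowerSeries = (sphericalP₃ p).toPowerSeries :=
  homogSeries_mul_spinor.trans homogSeries_reducedTotal

variable (p) in
/-- The Hecke series over the integral part of the Hecke ring. -/
def heckeSeriesInt : PowerSeries (spRing p) := PowerSeries.mk (heckeTInt p)

theorem map_heckeSeriesInt : PowerSeries.map (spOmega p) (heckeSeriesInt p) =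
    homogSeries fun n => glOmega p (pushT p n) := by
  ext1 n
  rw [PowerSeries.coeff_map, heckeSeriesInt, PowerSeries.coeff_mk, spOmega_heckeTInt, homogSeries,
    PowerSeries.coeff_mk]

theorem map_subtype_heckeSeriesInt :
    PowerSeries.map (spRing p).subtype (heckeSeriesInt p) = heckeSeries 3 p := by
  ext1 n
  rw [PowerSeries.coeff_map, heckeSeriesInt, PowerSeries.coeff_mk, heckeSeries,
    PowerSeries.coeff_mk]
  rfl

theorem powerSeries_map_injective {R S : Type*} [Semiring R] [Semiring S] {f : R →+* S}
    (hf : Function.Injective f) : Function.Injective (PowerSeries.map f) := by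
  intro a b h
  ext1 n
  have := congrArg (PowerSeries.coeff n) h
  rw [PowerSeries.coeff_map, PowerSeries.coeff_map] at this
  exact hf this

theorem toPowerSeries_map {R S : Type*} [Semiring R] [Semiring S] (f : R →+* S) (F : R[X]) :
    (F.map f).toPowerSeries = PowerSeries.map f F.toPowerSeries := by
  ext1 n
  rw [PowerSeries.coeff_map, Polynomial.coeff_coe, Polynomial.coeff_coe, Polynomial.coeff_map]

theorem coe_map_subtype (F : (LZ 3 p)[X]) : (F.map (LZ 3 p).subtype).toPowerSeries =
    PowerSeries.map (spRing p).subtype (F.map (lzInclusion p)).toPowerSeries := by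
  rw [← toPowerSeries_map, Polynomial.map_map]
  rfl

theorem map_spOmega_coe (F : (LZ 3 p)[X]) :
    PowerSeries.map (spOmega p) (F.map (lzInclusion p)).toPowerSeries =
      (OmegaPoly F).toPowerSeries := by
  rw [← toPowerSeries_map, Polynomial.map_map, OmegaPoly_eq_map]
  rfl

/-- All coefficients lie in the integral Hecke ring, where the spherical map is an injective
homomorphism, so the identity may be checked after applying it. Commutativity is used only in the
target, and the reversed product is obtained in the same way. -/
theorem heckeSeries_mul {Q : (LZ 3 p)[X]} (hQ : OmegaPoly Q = spinor 3) :
    heckeSeries 3 p * (Q.map (LZ 3 p).subtype).toPowerSeries =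
      ((P₃ p).map (LZ 3 p).subtype).toPowerSeries := by
  rw [coe_map_subtype, coe_map_subtype, ← map_subtype_heckeSeriesInt, ← map_mul]
  congr 1
  refine powerSeries_map_injective (spOmega_injective (p := p)) ?_
  rw [map_mul, map_spOmega_coe, map_spOmega_coe, hQ, OmegaPoly_P₃, map_heckeSeriesInt,
    homogSeries_mul_spinor_eq]

theorem mul_heckeSeries {Q : (LZ 3 p)[X]} (hQ : OmegaPoly Q = spinor 3) :
    (Q.map (LZ 3 p).subtype).toPowerSeries * heckeSeries 3 p =
      ((P₃ p).map (LZ 3 p).subtype).toPowerSeries := by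
  rw [coe_map_subtype, coe_map_subtype, ← map_subtype_heckeSeriesInt, ← map_mul]
  congr 1
  refine powerSeries_map_injective (spOmega_injective (p := p)) ?_
  rw [map_mul, map_spOmega_coe, map_spOmega_coe, hQ, OmegaPoly_P₃, map_heckeSeriesInt, mul_comm,
    homogSeries_mul_spinor_eq]

theorem coeff_zero_eq_one {Q : (LZ 3 p)[X]} (hQ : OmegaPoly Q = spinor 3) : Q.coeff 0 = 1 := by
  apply lzOmega_injective
  rw [← Polynomial.coeff_map, ← OmegaPoly_eq_map, hQ, map_one, spinor,
    Polynomial.coeff_zero_eq_eval_zero, Polynomial.eval_prod]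
  simp

/-- As `Q` has constant term `1`, the coefficient of `v ^ δ` in `R Q = P` expresses `T(p ^ δ)` by
the earlier `T(p ^ i)` and coefficients in `L_ℤ`. -/
theorem coeff_heckeSeries_mem {Q : (LZ 3 p)[X]} (hQ : OmegaPoly Q = spinor 3) (δ : ℕ) :
    (heckeSeries 3 p).coeff δ ∈ LZ 3 p := by
  induction δ using Nat.strong_induction_on with
  | _ δ ih =>
    have h := congrArg (PowerSeries.coeff δ) (heckeSeries_mul hQ)
    rw [PowerSeries.coeff_mul, Finset.Nat.sum_antidiagonal_eq_sum_range_succ_mk,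
      Finset.sum_range_succ, Nat.sub_self, Polynomial.coeff_coe, Polynomial.coeff_coe,
      Polynomial.coeff_map, Polynomial.coeff_map, coeff_zero_eq_one hQ, map_one, mul_one,
      ← eq_sub_iff_add_eq'] at h
    rw [h]
    refine sub_mem (Subtype.property _)
      (sum_mem fun i hi => mul_mem (ih i (Finset.mem_range.1 hi)) ?_)
    rw [Polynomial.coeff_coe, Polynomial.coeff_map]
    exact Subtype.property _

/-- The coefficients of the spinor polynomial, in terms of three of them. -/
theorem spinor_expand {a b e f : MvPolynomial (Fin 4) ℚ}
    (ha : a = MvPolynomial.X 0 * (1 + elemSym 1 + elemSym 2 + elemSym 3))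
    (hb : b = MvPolynomial.X 0 ^ 2 * (elemSym 3 + elemSym 1 + 2 * elemSym 2 +
      2 * (elemSym 3 * elemSym 1) + elemSym 3 * elemSym 2 + elemSym 1 * elemSym 2))
    (he : e = MvPolynomial.X 0 ^ 2 * elemSym 3)
    (hf : f = MvPolynomial.X 0 ^ 2 * (elemSym 2 + elemSym 3 + elemSym 3 * elemSym 1)) :
    spinor 3 = 1 - C a * X + C b * X ^ 2 - C (f * a) * X ^ 3 +
      C (f ^ 2 + e * a ^ 2 - e ^ 2 - 2 * (e * b) + 2 * (e * f)) * X ^ 4 -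
      C (e * (f * a)) * X ^ 5 + C (e ^ 2 * b) * X ^ 6 - C (e ^ 3 * a) * X ^ 7 +
      C (e ^ 4) * X ^ 8 := by
  -- Complementary subsets pair the eight roots with product `e`, so the coefficient of `v ^ (8 -
  -- k)` is `e ^ (4 - k)` times that of `v ^ k`. Only the coefficients up to `v⁴` carry information.
  rw [spinor_eq, ha, hb, he, hf]
  simp only [map_add, map_sub, map_mul, map_pow, map_one, map_ofNat]
  ring

/-- In `spinor_expand` the elements `a`, `e`, `f` are the images of `T(p)`, `p⁶ [p]₃` and `p³
(T₂(p²) + [p]₃)`. The coefficient of `v²` in `Ω(R) · spinor = Ω(P)` shows that `b` is the image of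
`P₂ + T(p)² - T(p²)`, where `P₂` is the coefficient of `v²` in the numerator. -/
theorem exists_denominator : ∃ Q : (LZ 3 p)[X], OmegaPoly Q = spinor 3 := by
  obtain ⟨t, ht⟩ := exists_T_sq (p := p)
  obtain ⟨b, hb⟩ : ∃ b, b = MvPolynomial.X 0 ^ 2 * (elemSym 3 + elemSym 1 + 2 * elemSym 2 +
      2 * (elemSym 3 * elemSym 1) + elemSym 3 * elemSym 2 + elemSym 1 * elemSym 2) := ⟨_, rfl⟩
  obtain ⟨E, hE⟩ : ∃ E, lzOmega p E = MvPolynomial.X 0 ^ 2 * elemSym 3 :=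
    ⟨(p : LZ 3 p) ^ 6 * scalar₃ p, by
      rw [map_mul, map_pow, map_natCast, pow_six_mul_lzOmega_scalar₃]⟩
  obtain ⟨F, hF⟩ : ∃ F, lzOmega p F =
      MvPolynomial.X 0 ^ 2 * (elemSym 2 + elemSym 3 + elemSym 3 * elemSym 1) :=
    ⟨(p : LZ 3 p) ^ 3 * (T₂ p + scalar₃ p), by
      rw [map_mul, map_pow, map_natCast, map_add, pow_three_mul_lzOmega]⟩
  have hsp := spinor_expand (lzOmega_T₀ (p := p)) hb hE hF
  have hR (n : ℕ) : (homogSeries fun n => glOmega p (pushT p n)).coeff n =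
      MvPolynomial.X 0 ^ n * glOmega p (pushT p n) := PowerSeries.coeff_mk _ _
  have h0 := congrArg (PowerSeries.coeff 0) (homogSeries_mul_spinor_eq (p := p))
  have h2 := congrArg (PowerSeries.coeff 2) (homogSeries_mul_spinor_eq (p := p))
  rw [← OmegaPoly_P₃, OmegaPoly_eq_map, PowerSeries.coeff_mul, Polynomial.coeff_coe,
    Polynomial.coeff_map] at h0 h2
  have p0 : (P₃ p).coeff 0 = 1 := by
    simp only [P₃, Polynomial.coeff_add, Polynomial.coeff_sub, Polynomial.coeff_C_mul,
      Polynomial.coeff_X_pow, Polynomial.coeff_one]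
    simp
  rw [p0, map_one] at h0
  have h1 : lzOmega p (T₀ p) = MvPolynomial.X 0 ^ 1 * glOmega p (pushT p (1 : ℕ)) := by
    rw [← spOmega_heckeTInt, ← lzInclusion_T₀]; rfl
  have ht' : lzOmega p t = MvPolynomial.X 0 ^ 2 * glOmega p (pushT p (2 : ℕ)) := by
    rw [← spOmega_heckeTInt, ← ht]; rfl
  have c0 : (spinor 3).coeff 0 = 1 := by
    rw [hsp]
    simp only [Polynomial.coeff_add, Polynomial.coeff_sub, Polynomial.coeff_C_mul,
      Polynomial.coeff_X_pow, Polynomial.coeff_one, Polynomial.coeff_X]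
    simp
  have c1 : (spinor 3).coeff 1 = -lzOmega p (T₀ p) := by
    rw [hsp]
    simp only [Polynomial.coeff_add, Polynomial.coeff_sub, Polynomial.coeff_C_mul,
      Polynomial.coeff_X_pow, Polynomial.coeff_one, Polynomial.coeff_X]
    simp
  have c2 : (spinor 3).coeff 2 = b := by
    rw [hsp]
    simp only [Polynomial.coeff_add, Polynomial.coeff_sub, Polynomial.coeff_C_mul,
      Polynomial.coeff_X_pow, Polynomial.coeff_one, Polynomial.coeff_X]
    simp
  rw [Finset.Nat.sum_antidiagonal_eq_sum_range_succ_mk] at h0 h2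
  simp only [Finset.sum_range_succ, Finset.sum_range_zero, Nat.reduceSub, Nat.sub_self,
    Polynomial.coeff_coe, hR, c0, c1, c2, ← h1, ← ht', mul_one, pow_zero, one_mul,
    zero_add] at h0 h2
  rw [h0] at h2
  obtain ⟨B, hB⟩ : ∃ B, lzOmega p B = b := ⟨(P₃ p).coeff 2 + T₀ p ^ 2 - t, by
    rw [map_sub, map_add, map_pow]
    linear_combination -h2⟩
  refine ⟨1 - C (T₀ p) * X + C B * X ^ 2 - C (F * T₀ p) * X ^ 3 +
      C (F ^ 2 + E * T₀ p ^ 2 - E ^ 2 - 2 * (E * B) + 2 * (E * F)) * X ^ 4 -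
      C (E * (F * T₀ p)) * X ^ 5 + C (E ^ 2 * B) * X ^ 6 - C (E ^ 3 * T₀ p) * X ^ 7 +
      C (E ^ 4) * X ^ 8, ?_⟩
  rw [OmegaPoly_eq_map, hsp, ← hB]
  simp only [Polynomial.map_add, Polynomial.map_sub, Polynomial.map_one, Polynomial.map_mul,
    Polynomial.map_pow, Polynomial.map_X, Polynomial.map_C, map_add (lzOmega p),
    map_sub (lzOmega p), map_mul (lzOmega p), map_pow (lzOmega p), map_ofNat (lzOmega p)]

end Denominator

end

end SymplecticHecke

theorem theorem1 (p : ℕ) [Fact p.Prime] :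
    (∀ δ : ℕ, (heckeSeries 3 p).coeff δ ∈ LZ 3 p) ∧
    (∃! Q : (LZ 3 p)[X], OmegaPoly Q = spinor 3) ∧
    (∀ Q : (LZ 3 p)[X], OmegaPoly Q = spinor 3 →
      Q.coeff 0 = 1 ∧
      heckeSeries 3 p * (Q.map (LZ 3 p).subtype).toPowerSeries =
        ((P₃ p).map (LZ 3 p).subtype).toPowerSeries ∧
      (Q.map (LZ 3 p).subtype).toPowerSeries * heckeSeries 3 p =
        ((P₃ p).map (LZ 3 p).subtype).toPowerSeries) ∧
    (P₃ p).natDegree = 6 ∧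
    OmegaPoly (P₃ p) = sphericalP₃ p := by
  obtain ⟨Q, hQ⟩ := exists_denominator (p := p)
  exact ⟨coeff_heckeSeries_mem hQ,
    ⟨Q, hQ, fun Q' hQ' => OmegaPoly_injective (hQ'.trans hQ.symm)⟩,
    fun Q' hQ' => ⟨coeff_zero_eq_one hQ', heckeSeries_mul hQ', mul_heckeSeries hQ'⟩,
    natDegree_P₃, OmegaPoly_P₃⟩
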